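/- **Setting.** Fix $0<\alpha<1/2$, $0<\beta<1$. For $x\in\mathbb R^n$ ($n\ge 3$) put $\rho=\sqrt{x_1^2+\dots+x_{n-1}^2}$, $z=x_n$; a function is axially symmetric if it depends on $(\rho,z)$ only, and an axially symmetric function on $\mathbb R^3$ is also viewed as a function on every $\mathbb R^n$ through $(\rho,z)$. Let $\phi,\psi$ satisfy: * $\phi\in C^1(\mathbb R)$, and for some $E_0>0$, $\phi(\eta)=0$ for $\eta\ge E_0$ and $\phi(\eta)>0$ for $\eta<E_0$. * There are $U_N\in C^2(\mathbb R^3)$, spherically symmetric, and $R_N$ with $\Delta U_N=4\pi\rho_N$, $\rho_N=\int_{\mathbb R^3}\phi(\frac12|v|^2+U_N)\,dv\in C_c^2(\mathbb R^3)$, $U_N(0)=0$, $\operatorname{supp}\rho_N=\overline B_{R_N}(0)$, $U_N(R_N)=E_0$, $U_N(r)<E_0$ for $r<R_N$ and $U_N(r)>E_0$ for $r>R_N$. Write $U_N(\infty)=\lim_{|x|\to\infty}U_N(x)$ and $f_N(x,v)=\phi(\frac12|v|^2+U_N(x))$. * $6+4\pi r^2\int_{\mathbb R^3}\phi'(\frac12|v|^2+U_N(r))\,dv>0$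 for all $r\ge0$. * $\psi\in C_c^\infty(\mathbb R^2)$, $\psi\ge0$, $\partial_L\psi(\lambda,0)=0$ for all $\lambda$, and $\psi(0,L)=1$ on an open neighbourhood of $\{x_1v_2-x_2v_1\mid (x,v)\in\operatorname{supp}f_N\}$. Fix $R>R_N$ with $U_N(r)>(E_0+U_N(\infty))/2$ for all $r>R$, and let $Z_R=\{x\in\mathbb R^3\mid\rho<R\}$. Let $\mathcal X$ be the space of axially symmetric $(\nu,b,\xi,\omega)\in C^{2,\alpha}(\mathbb R^3)\times C^{3,\alpha}(\mathbb R^3)\times C^{1,\alpha}(Z_R)\times C^{2,\alpha}(\mathbb R^3)$ for which the norm $$\|\nu\|_{C^{2,\alpha}}+\|(1+|x|)^{1+\beta}\nabla\nu\|_\infty+\|b\|_{C^{3,\alpha}}+\|(1+|x|)^3\nabla b\|_\infty+\|\xi\|_{C^{1,\alpha}(Z_R)}+\|\omega\|_{C^{2,\alpha}}+\|(1+|x|)^4\nabla\omega\|_\infty$$ is finite. For $\delta_0>0$ let $\mathcal U_{\delta_0}$ be the set of $(\nu,b,\xi,\omega;\gamma,\lambda)\in\mathcal X\times[0,\delta_0[\,\times\,]-\delta_0,\delta_0[$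 with $\|(\nu,b,\xi,\omega)-(U_N,0,0,0)\|_{\mathcal X}<\delta_0$. **Matter terms.** Put $B=1+b$, $m=Be^{-\gamma\nu}\sqrt{(e^{-2\gamma\nu}(1+\gamma\eta)^2-1)/\gamma}$ and $$\langle w\rangle=\int_{(e^{\gamma\nu}-1)/\gamma}^\infty\int_{-m}^m w(\eta,s)\,\phi(\eta+\rho s\omega)\,\psi(\lambda,\rho s)\,ds\,d\eta ,$$ where for $\gamma=0$ the quotients by $\gamma$ are replaced by their limits $\nu$ and $2(\eta-\nu)$. Define $$\Phi_{00}=\tfrac{2\pi}{B}e^{2\xi-4\gamma\nu}\langle(1+\gamma\eta+\gamma\rho s\omega)^2\rangle,\quad \Phi_{11}=\tfrac{2\pi}{B^3}e^{2\xi}\langle m^2-s^2\rangle,$$ $$\Phi_{33}=\tfrac{2\pi\rho^2}{B}e^{2\xi}\langle s^2\rangle,\quad \Phi_{03}=-\tfrac{2\pi\rho}{B}e^{2\xi}\langle s(1+\gamma\eta+\gamma\rho s\omega)\rangle,$$ $$M_1=\Phi_{00}+\gamma\Phi_{11}+2\gamma\omega e^{-4\gamma\nu}\Phi_{03}+\Big(\tfrac{\gamma}{\rho^2B^2}+\gamma^2\omega^2e^{-4\gamma\nu}\Big)\Phi_{33},$$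 $$M_2=\gamma^2B\,\Phi_{11},\qquad M_3=\tfrac{16\pi}{\rho^2B^2}(\gamma\Phi_{03}+\gamma^2\omega\Phi_{33}).$$ **Solution operators.** Define $$G_1(x)=-\int_{\mathbb R^3}\Big(\tfrac1{|x-y|}-\tfrac1{|y|}\Big)M_1(y)\,dy+\tfrac1{4\pi}\int_{\mathbb R^3}\Big[\tfrac{\nabla b\cdot\nabla\nu}{B}-\tfrac12\rho^2B^2e^{-4\gamma\nu}|\nabla\omega|^2\Big](y)\tfrac{dy}{|x-y|},\quad x\in\mathbb R^3,$$ $$G_2(x)=-\tfrac2\pi\int_{\mathbb R^4}M_2(y)\tfrac{dy}{|x-y|^2},\quad x\in\mathbb R^4,\qquad G_3(\rho,z)=\ln(1+b(0,z))+\int_0^\rho g(s,z)\,ds,\quad \rho\ge 0,$$ $$G_4(x)=\tfrac1{8\pi^2}\int_{\mathbb R^5}\Big[\tfrac{3\nabla b}{B}\cdot\nabla\omega-4\gamma\nabla\nu\cdot\nabla\omega-M_3\Big](y)\tfrac{dy}{|x-y|^3},\quad x\in\mathbb R^5,$$ where $$\begin{aligned}g={}&\big((B+\rho\partial_\rho b)^2+(\rho\partial_zb)^2\big)^{-1}\Big[\rho\partial_zb\big(\partial_zb+\rho\partial_{z\rho}b+2\gamma^2\rho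 B\,\partial_\rho\nu\,\partial_z\nu-\tfrac12\gamma\rho^3B^3e^{-4\gamma\nu}\partial_\rho\omega\,\partial_z\omega\big)\\&+(B+\rho\partial_\rho b)\big(\tfrac\rho2(\partial_{\rho\rho}b+\tfrac2\rho\partial_\rho b-\partial_{zz}b)+\gamma^2\rho B((\partial_\rho\nu)^2-(\partial_z\nu)^2)-\tfrac14\gamma\rho^3B^3e^{-4\gamma\nu}((\partial_\rho\omega)^2-(\partial_z\omega)^2)\big)\Big],\end{aligned}$$ and $\mathcal F(\nu,b,\xi,\omega;\gamma,\lambda)=(\nu,b,\xi,\omega)-(G_1,G_2,G_3,G_4)$, the third component being considered on $Z_R$. (Zeros of $\mathcal F$ solve the reduced Einstein-Vlasov system with $\gamma=1/c^2$.) **Proposition 3.2.** There is $\delta_0>0$ such that the following holds for every zero $(\nu,b,\xi,\omega;\gamma,\lambda)\in\mathcal U_{\delta_0}$ of $\mathcal F$, in particular for the members $(\nu,b,\xi,\omega)=S(\gamma,\lambda)$ of every family of solutions of $\mathcal F(S(\gamma,\lambda);\gamma,\lambda)=0$ that stays in $\mathcal U_{\delta_0}$. Extend $\xi$ to $\mathbb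 R^3$ by $\xi:=G_3(\nu,b,\xi,\omega;\gamma,\lambda)$ for all $\rho\ge 0$, and put $\mu:=\xi-\gamma\nu$, $B:=1+b$. Then $\xi\in C^{2,\alpha}(\mathbb R^3)$, the limit $\nu_\infty:=\lim_{|x|\to\infty}\nu(x)$ exists, and there is a constant $C$ such that for all $\sigma\in\mathbb N_0^3$ with $|\sigma|\le2$ and all $x\in\mathbb R^3$ $$|D^\sigma(\nu-\nu_\infty)(x)|\le C(1+|x|)^{-(1+|\sigma|)},\qquad |D^\sigma(B-1)(x)|\le C(1+|x|)^{-(2+|\sigma|)},$$ $$|D^\sigma\xi(x)|\le C(1+|x|)^{-(2+|\sigma|)},\qquad |D^\sigma\omega(x)|\le C(1+|x|)^{-(3+|\sigma|)}.$$ In particular the spacetime is asymptotically flat: $\nu\to\nu_\infty$ and $\mu\to-\gamma\nu_\infty$ as $|x|\to\infty$. Moreover, with $c_1=e^{\gamma\nu_\infty}$, $c_2=e^{-\gamma\nu_\infty}$, the functions $$\nu'(x)=\nu(x/c_2)-\nu_\infty,\quad B'(x)=B(x/c_2),\quad \mu'(x)=\mu(x/c_2)+\gamma\nu_\infty,\quad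 \omega'(x)=e^{-\gamma\nu_\infty}\omega(x/c_2)$$ satisfy $|\nu'|+|\mu'|+|\omega'|+|B'-1|\to0$ as $|x|\to\infty$, and if $\gamma=1/c^2>0$, then the change of coordinates $(t,\rho,z,\varphi)\mapsto(c_1t,c_2\rho,c_2z,\varphi)$ turns the metric $$-c^2e^{2\nu/c^2}dt^2+e^{2\mu}(d\rho^2+dz^2)+\rho^2B^2e^{-2\nu/c^2}(d\varphi-\omega\,dt)^2$$ into the metric of the same form with $(\nu',B',\mu',\omega')$ in place of $(\nu,B,\mu,\omega)$. -/

import Mathlib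

open MeasureTheory Filter Topology Set
open scoped ENNReal

noncomputable section

namespace RotatingEV

/-! ## Axial coordinates and derivatives -/

/-- Euclidean space `ℝⁿ`. -/
abbrev E (n : ℕ) : Type := EuclideanSpace ℝ (Fin n)

/-- Distance `ρ` to the axis of symmetry, which is the last coordinate axis. -/
def axialRadius {n : ℕ} (x : E (n + 1)) : ℝ := √(∑ i : Fin n, x i.castSucc ^ 2)

/-- The coordinate `z` along the axis of symmetry. -/
def axialHeight {n : ℕ} (x : E (n + 1)) : ℝ := x (Fin.last n)

/-- The point of `ℝ³` with axial coordinates `(ρ, z)` in the half plane `x₁ ≥ 0, x₂ = 0`. -/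
def meridian (ρ z : ℝ) : E 3 := !₂[ρ, 0, z]

/-- A function on `ℝ³` is axially symmetric on `Ω` if there it depends on `(ρ, z)` only. -/
def AxiallySymmetricOn (Ω : Set (E 3)) (u : E 3 → ℝ) : Prop :=
  ∀ x ∈ Ω, ∀ y ∈ Ω, axialRadius x = axialRadius y → axialHeight x = axialHeight y → u x = u y

/-- An axially symmetric function on `ℝ³`, viewed as an axially symmetric function on
`ℝⁿ⁺¹` through `(ρ, z)`. -/
def lift (n : ℕ) (q : E 3 → ℝ) (y : E (n + 1)) : ℝ := q (meridian (axialRadius y) (axialHeight y))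

/-- Cartesian partial derivative `∂_{x_i}` on `ℝ³`. -/
def pd (i : Fin 3) (f : E 3 → ℝ) (x : E 3) : ℝ := fderiv ℝ f x (EuclideanSpace.single i 1)

/-- `D^σ f` for a multi-index `σ ∈ ℕ₀³`. -/
def mpd (σ : Fin 3 → ℕ) (f : E 3 → ℝ) : E 3 → ℝ :=
  (pd 0)^[σ 0] ((pd 1)^[σ 1] ((pd 2)^[σ 2] f))

/-- `∇f · ∇h` on `ℝ³`. -/
def gradDot (f h : E 3 → ℝ) (x : E 3) : ℝ := ∑ i : Fin 3, pd i f x * pd i h x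

/-! ## Function spaces. All norms take values in `[0, ∞]`. -/

/-- Supremum norm of `f` on `Ω`. -/
def supNorm (Ω : Set (E 3)) (f : E 3 → ℝ) : ℝ≥0∞ := ⨆ x ∈ Ω, ‖f x‖ₑ

/-- Hölder seminorm of `f` on `Ω` with exponent `α`. -/
def holderSeminorm (α : ℝ) (Ω : Set (E 3)) (f : E 3 → ℝ) : ℝ≥0∞ :=
  ⨆ x ∈ Ω, ⨆ y ∈ Ω, ⨆ _ : x ≠ y, ‖f x - f y‖ₑ / ENNReal.ofReal (‖x - y‖ ^ α)

/-- The multi-indices `σ ∈ ℕ₀³` with `|σ| = j`. -/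
def multiIndices (j : ℕ) : Finset (Fin 3 → ℕ) := Finset.Nat.antidiagonalTuple 3 j

/-- The norm of `C^{k,α}(Ω)`. -/
def holderNorm (k : ℕ) (α : ℝ) (Ω : Set (E 3)) (f : E 3 → ℝ) : ℝ≥0∞ :=
  (∑ j ∈ Finset.range (k + 1), ∑ σ ∈ multiIndices j, supNorm Ω (mpd σ f)) +
    ∑ σ ∈ multiIndices k, holderSeminorm α Ω (mpd σ f)

/-- `f ∈ C^{k,α}(Ω)` for an open set `Ω`. -/
def MemHolder (k : ℕ) (α : ℝ) (Ω : Set (E 3)) (f : E 3 → ℝ) : Prop :=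
  ContDiffOn ℝ k f Ω ∧ holderNorm k α Ω f < ∞

/-- The open cylinder `Z_R = {ρ < R}`. -/
def cylinder (R : ℝ) : Set (E 3) := {x | axialRadius x < R}

/-- The unknowns `(ν, b, ξ, ω)`, as functions of the Cartesian variable in `ℝ³`. -/
structure Fields where
  ν : E 3 → ℝ
  b : E 3 → ℝ
  ξ : E 3 → ℝ
  ω : E 3 → ℝ

/-- The norm of `𝒳₁`. -/
def normX1 (α β : ℝ) (ν : E 3 → ℝ) : ℝ≥0∞ :=
  holderNorm 2 α univ ν + supNorm univ (fun x => (1 + ‖x‖) ^ (1 + β) * ‖fderiv ℝ ν x‖)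

/-- The norm of `𝒳₂`. -/
def normX2 (α : ℝ) (b : E 3 → ℝ) : ℝ≥0∞ :=
  holderNorm 3 α univ b + supNorm univ (fun x => (1 + ‖x‖) ^ 3 * ‖fderiv ℝ b x‖)

/-- The norm of `𝒳₃`. -/
def normX3 (α R : ℝ) (ξ : E 3 → ℝ) : ℝ≥0∞ := holderNorm 1 α (cylinder R) ξ

/-- The norm of `𝒳₄`. -/
def normX4 (α : ℝ) (ω : E 3 → ℝ) : ℝ≥0∞ :=
  holderNorm 2 α univ ω + supNorm univ (fun x => (1 + ‖x‖) ^ 4 * ‖fderiv ℝ ω x‖)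

/-- The norm of `𝒳 = 𝒳₁ × 𝒳₂ × 𝒳₃ × 𝒳₄`. -/
def normX (α β R : ℝ) (u : Fields) : ℝ≥0∞ :=
  normX1 α β u.ν + normX2 α u.b + normX3 α R u.ξ + normX4 α u.ω

/-- `u ∈ 𝒳`. Only the values of `ξ` on `Z_R` matter. -/
structure MemX (α β R : ℝ) (u : Fields) : Prop where
  contDiff_ν : ContDiff ℝ 2 u.ν
  contDiff_b : ContDiff ℝ 3 u.b
  contDiffOn_ξ : ContDiffOn ℝ 1 u.ξ (cylinder R)
  contDiff_ω : ContDiff ℝ 2 u.ω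
  axial_ν : AxiallySymmetricOn univ u.ν
  axial_b : AxiallySymmetricOn univ u.b
  axial_ξ : AxiallySymmetricOn (cylinder R) u.ξ
  axial_ω : AxiallySymmetricOn univ u.ω
  norm_lt_top : normX α β R u < ∞

/-- The set `𝒰` of all `(ν, b, ξ, ω; γ, λ)` with `0 ≤ γ < δ₀`, `|λ| < δ₀`, and
`‖(ν, b, ξ, ω) - (U_N, 0, 0, 0)‖_𝒳 < δ₀`. -/
def MemU (α β R : ℝ) (UN : E 3 → ℝ) (δ₀ : ℝ) (u : Fields) (γ lam : ℝ) : Prop :=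
  MemX α β R u ∧ γ ∈ Ico 0 δ₀ ∧ lam ∈ Ioo (-δ₀) δ₀ ∧
    normX α β R ⟨fun x => u.ν x - UN x, u.b, u.ξ, u.ω⟩ < ENNReal.ofReal δ₀

/-! ## The ansatz functions and the Newtonian steady state -/

/-- `φ ∈ C¹` is positive below the cut-off energy `E₀ > 0` and vanishes above it. -/
structure CondPhi1 (φ : ℝ → ℝ) (E₀ : ℝ) : Prop where
  contDiff : ContDiff ℝ 1 φ
  pos_cutoff : 0 < E₀
  eq_zero : ∀ η, E₀ ≤ η → φ η = 0
  pos : ∀ η, η < E₀ → 0 < φ η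

/-- The spatial density `∫ φ(|v|²/2 + U(x)) dv`. -/
def newtonDensity (φ : ℝ → ℝ) (U : E 3 → ℝ) (x : E 3) : ℝ := ∫ v : E 3, φ (‖v‖ ^ 2 / 2 + U x)

/-- `U` is the potential of a compactly supported, spherically symmetric steady
state of the Vlasov-Poisson system, normalized by `U(0) = 0`, with matter in the ball of
radius `RN`. -/
structure CondPhi2 (φ : ℝ → ℝ) (E₀ : ℝ) (U : E 3 → ℝ) (RN : ℝ) : Prop where
  contDiff : ContDiff ℝ 2 U
  radial : ∀ x y, ‖x‖ = ‖y‖ → U x = U y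
  normalized : U 0 = 0
  poisson : ∀ x, Laplacian.laplacian U x = 4 * Real.pi * newtonDensity φ U x
  contDiff_density : ContDiff ℝ 2 (newtonDensity φ U)
  tsupport_density : tsupport (newtonDensity φ U) = Metric.closedBall 0 RN
  eq_at : ∀ x, ‖x‖ = RN → U x = E₀
  lt_inside : ∀ x, ‖x‖ < RN → U x < E₀
  gt_outside : ∀ x, RN < ‖x‖ → E₀ < U x

/-- The non-degeneracy condition `6 + 4π r² a_N(r) > 0`, where
`a_N(r) = ∫ φ'(|v|²/2 + U(r)) dv`. -/
def CondPhi3 (φ : ℝ → ℝ) (U : E 3 → ℝ) : Prop :=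
  ∀ x : E 3, 0 < 6 + 4 * Real.pi * ‖x‖ ^ 2 * ∫ v : E 3, deriv φ (‖v‖ ^ 2 / 2 + U x)

/-- The values of the angular momentum `L(x, v) = x₁v₂ - x₂v₁` on the support of the Newtonian
phase space density `f_N(x, v) = φ(|v|²/2 + U(x))`. -/
def newtonAngularMomenta (φ : ℝ → ℝ) (U : E 3 → ℝ) : Set ℝ :=
  (fun p : E 3 × E 3 => p.1 0 * p.2 1 - p.1 1 * p.2 0) ''
    tsupport (fun p : E 3 × E 3 => φ (‖p.2‖ ^ 2 / 2 + U p.1))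

/-- The conditions on the angular momentum factor `ψ`; its arguments are `(λ, L)`. -/
structure CondPsi (φ : ℝ → ℝ) (U : E 3 → ℝ) (ψ : ℝ × ℝ → ℝ) : Prop where
  contDiff : ContDiff ℝ (⊤ : ℕ∞) ψ
  compact : HasCompactSupport ψ
  nonneg : ∀ p, 0 ≤ ψ p
  deriv_zero : ∀ lam, deriv (fun L => ψ (lam, L)) 0 = 0
  eq_one : ∃ O : Set ℝ, IsOpen O ∧ newtonAngularMomenta φ U ⊆ O ∧ ∀ L ∈ O, ψ (0, L) = 1

/-! ## Matter terms. Here `ν B ξ ω ρ` are the values of the fields and of the axial radius at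
a point. The values at `γ = 0` are the limits as `γ → 0`. -/

/-- Lower limit `(e^{γν} - 1)/γ` of the energy integration. -/
def etaMin (γ ν : ℝ) : ℝ := if γ = 0 then ν else (Real.exp (γ * ν) - 1) / γ

/-- The bound `m(η, B, ν, γ)` of the angular momentum integration. -/
def mBound (γ η B ν : ℝ) : ℝ :=
  B * Real.exp (-γ * ν) *
    √(if γ = 0 then 2 * (η - ν) else (Real.exp (-2 * γ * ν) * (1 + γ * η) ^ 2 - 1) / γ)

/-- `∫_{(e^{γν}-1)/γ}^∞ ∫_{-m}^m w(η, s) φ(η + ρsω) ψ(λ, ρs) ds dη`. -/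
def matterIntegral (φ : ℝ → ℝ) (ψ : ℝ × ℝ → ℝ) (γ lam ν B ω ρ : ℝ) (w : ℝ → ℝ → ℝ) : ℝ :=
  ∫ η in Ioi (etaMin γ ν), ∫ s in (-mBound γ η B ν)..(mBound γ η B ν),
    w η s * φ (η + ρ * s * ω) * ψ (lam, ρ * s)

/-- `Φ₀₀ = γ² e^{2ξ - 4γν} T₀₀`. -/
def Phi00 (φ : ℝ → ℝ) (ψ : ℝ × ℝ → ℝ) (γ lam ν B ξ ω ρ : ℝ) : ℝ :=
  2 * Real.pi / B * Real.exp (2 * ξ - 4 * γ * ν) *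
    matterIntegral φ ψ γ lam ν B ω ρ (fun η s => (1 + γ * η + γ * ρ * s * ω) ^ 2)

/-- `Φ₁₁ = T₁₁ + T₂₂`. -/
def Phi11 (φ : ℝ → ℝ) (ψ : ℝ × ℝ → ℝ) (γ lam ν B ξ ω ρ : ℝ) : ℝ :=
  2 * Real.pi / B ^ 3 * Real.exp (2 * ξ) *
    matterIntegral φ ψ γ lam ν B ω ρ (fun η s => mBound γ η B ν ^ 2 - s ^ 2)

/-- `Φ₃₃ = e^{2ξ} T₃₃`. -/
def Phi33 (φ : ℝ → ℝ) (ψ : ℝ × ℝ → ℝ) (γ lam ν B ξ ω ρ : ℝ) : ℝ :=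
  2 * Real.pi * ρ ^ 2 / B * Real.exp (2 * ξ) *
    matterIntegral φ ψ γ lam ν B ω ρ (fun _ s => s ^ 2)

/-- `Φ₀₃ = γ e^{2ξ} T₀₃`. -/
def Phi03 (φ : ℝ → ℝ) (ψ : ℝ × ℝ → ℝ) (γ lam ν B ξ ω ρ : ℝ) : ℝ :=
  -(2 * Real.pi * ρ / B) * Real.exp (2 * ξ) *
    matterIntegral φ ψ γ lam ν B ω ρ (fun η s => s * (1 + γ * η + γ * ρ * s * ω))

/-- The source term `M₁`. -/
def M1 (φ : ℝ → ℝ) (ψ : ℝ × ℝ → ℝ) (γ lam : ℝ) (u : Fields) (x : E 3) : ℝ :=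
  let ν := u.ν x
  let B := 1 + u.b x
  let ξ := u.ξ x
  let ω := u.ω x
  let ρ := axialRadius x
  Phi00 φ ψ γ lam ν B ξ ω ρ + γ * Phi11 φ ψ γ lam ν B ξ ω ρ
    + 2 * γ * ω * Real.exp (-4 * γ * ν) * Phi03 φ ψ γ lam ν B ξ ω ρ
    + (γ / (ρ ^ 2 * B ^ 2) + γ ^ 2 * ω ^ 2 * Real.exp (-4 * γ * ν)) * Phi33 φ ψ γ lam ν B ξ ω ρ

/-- The source term `M₂`. -/
def M2 (φ : ℝ → ℝ) (ψ : ℝ × ℝ → ℝ) (γ lam : ℝ) (u : Fields) (x : E 3) : ℝ :=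
  γ ^ 2 * (1 + u.b x) * Phi11 φ ψ γ lam (u.ν x) (1 + u.b x) (u.ξ x) (u.ω x) (axialRadius x)

/-- The source term `M₃`. -/
def M3 (φ : ℝ → ℝ) (ψ : ℝ × ℝ → ℝ) (γ lam : ℝ) (u : Fields) (x : E 3) : ℝ :=
  let ν := u.ν x
  let B := 1 + u.b x
  let ξ := u.ξ x
  let ω := u.ω x
  let ρ := axialRadius x
  16 * Real.pi / (ρ ^ 2 * B ^ 2) *
    (γ * Phi03 φ ψ γ lam ν B ξ ω ρ + γ ^ 2 * ω * Phi33 φ ψ γ lam ν B ξ ω ρ)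

/-! ## The solution operators -/

/-- `G₁`, the solution operator of
`Δν = 4π M₁ - ∇b·∇ν/B + ρ² B² e^{-4γν} |∇ω|²/2` on `ℝ³`. -/
def G1 (φ : ℝ → ℝ) (ψ : ℝ × ℝ → ℝ) (γ lam : ℝ) (u : Fields) (x : E 3) : ℝ :=
  -(∫ y : E 3, (1 / ‖x - y‖ - 1 / ‖y‖) * M1 φ ψ γ lam u y)
    + 1 / (4 * Real.pi) * ∫ y : E 3,
      (gradDot u.b u.ν y / (1 + u.b y)
        - 1 / 2 * axialRadius y ^ 2 * (1 + u.b y) ^ 2 * Real.exp (-4 * γ * u.ν y)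
          * gradDot u.ω u.ω y) / ‖x - y‖

/-- `G₂`, the solution operator of `Δb + ∇ρ·∇b/ρ = 8π M₂`, a Poisson equation on `ℝ⁴`. -/
def G2 (φ : ℝ → ℝ) (ψ : ℝ × ℝ → ℝ) (γ lam : ℝ) (u : Fields) (x : E 3) : ℝ :=
  -(2 / Real.pi) * ∫ y : E 4,
    lift 3 (M2 φ ψ γ lam u) y / ‖!₂[axialRadius x, 0, 0, axialHeight x] - y‖ ^ 2

/-- The right hand side `g` of `∂_ρ ξ = g` at `(ρ, z)`. On the half plane `x₁ ≥ 0, x₂ = 0` the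
derivatives `∂_ρ` and `∂_z` are `∂_{x₁}` and `∂_{x₃}`. -/
def gRhs (γ : ℝ) (u : Fields) (ρ z : ℝ) : ℝ :=
  let p := meridian ρ z
  let B := 1 + u.b p
  let b_ρ := pd 0 u.b p
  let b_z := pd 2 u.b p
  let b_ρρ := pd 0 (pd 0 u.b) p
  let b_zρ := pd 2 (pd 0 u.b) p
  let b_zz := pd 2 (pd 2 u.b) p
  let ν_ρ := pd 0 u.ν p
  let ν_z := pd 2 u.ν p
  let ω_ρ := pd 0 u.ω p
  let ω_z := pd 2 u.ω p
  let e := Real.exp (-4 * γ * u.ν p)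
  ((B + ρ * b_ρ) ^ 2 + (ρ * b_z) ^ 2)⁻¹ *
    (ρ * b_z * (b_z + ρ * b_zρ + 2 * γ ^ 2 * ρ * B * ν_ρ * ν_z
        - 1 / 2 * γ * ρ ^ 3 * B ^ 3 * e * ω_ρ * ω_z)
      + (B + ρ * b_ρ) * (ρ / 2 * (b_ρρ + 2 / ρ * b_ρ - b_zz)
        + γ ^ 2 * ρ * B * (ν_ρ ^ 2 - ν_z ^ 2)
        - 1 / 4 * γ * ρ ^ 3 * B ^ 3 * e * (ω_ρ ^ 2 - ω_z ^ 2)))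

/-- `G₃`, the integration of `∂_ρ ξ = g` with `ξ = ln(1 + b)` on the axis, for all `ρ ≥ 0`. -/
def G3 (γ : ℝ) (u : Fields) (x : E 3) : ℝ :=
  Real.log (1 + u.b (meridian 0 (axialHeight x)))
    + ∫ s in (0 : ℝ)..(axialRadius x), gRhs γ u s (axialHeight x)

/-- `G₄`, the solution operator of
`Δω + 2∇ρ·∇ω/ρ = M₃ - (3∇b/B - 4γ∇ν)·∇ω`, a Poisson equation on `ℝ⁵`. -/
def G4 (φ : ℝ → ℝ) (ψ : ℝ × ℝ → ℝ) (γ lam : ℝ) (u : Fields) (x : E 3) : ℝ :=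
  1 / (8 * Real.pi ^ 2) * ∫ y : E 5,
    lift 4 (fun p => 3 * gradDot u.b u.ω p / (1 + u.b p) - 4 * γ * gradDot u.ν u.ω p
      - M3 φ ψ γ lam u p) y / ‖!₂[axialRadius x, 0, 0, 0, axialHeight x] - y‖ ^ 3

/-- The map `ℱ(u; γ, λ) = u - (G₁, G₂, G₃, G₄)(u; γ, λ)`. -/
def mapF (φ : ℝ → ℝ) (ψ : ℝ × ℝ → ℝ) (u : Fields) (γ lam : ℝ) : Fields where
  ν x := u.ν x - G1 φ ψ γ lam u x
  b x := u.b x - G2 φ ψ γ lam u x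
  ξ x := u.ξ x - G3 γ u x
  ω x := u.ω x - G4 φ ψ γ lam u x

/-- `v = 0` in `𝒳`, whose third component consists of functions on `Z_R`. -/
def IsZeroX (R : ℝ) (v : Fields) : Prop :=
  (∀ x, v.ν x = 0) ∧ (∀ x, v.b x = 0) ∧ (∀ x ∈ cylinder R, v.ξ x = 0) ∧ (∀ x, v.ω x = 0)

/-! ## The spacetime metric -/

/-- Components with respect to `(t, ρ, z, ϕ)` of the metric
`-c² e^{2ν/c²} dt² + e^{2μ} (dρ² + dz²) + ρ² B² e^{-2ν/c²} (dϕ - ω dt)²` with `γ = 1/c² > 0`. -/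
def metric (γ : ℝ) (ν B μ ω : E 3 → ℝ) (x : E 3) : Matrix (Fin 4) (Fin 4) ℝ :=
  let h := axialRadius x ^ 2 * B x ^ 2 * Real.exp (-2 * γ * ν x)
  let m := Real.exp (2 * μ x)
  !![-(1 / γ) * Real.exp (2 * γ * ν x) + h * ω x ^ 2, 0, 0, -h * ω x;
     0, m, 0, 0;
     0, 0, m, 0;
     -h * ω x, 0, 0, h]

/-- The boundary condition at spatial infinity: `|ν| + |μ| + |ω| + |B - 1| → 0`. -/
def VanishAtInfinity (ν B μ ω : E 3 → ℝ) : Prop :=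
  Tendsto (fun x => |ν x| + |μ x| + |ω x| + |B x - 1|) (cocompact (E 3)) (𝓝 0)

end RotatingEV

end

/-!
The equation `𝓕 = 0` says that `ν`, `b`, `ω` are, up to a constant, Newtonian potentials of axially
symmetric sources lifted to `ℝ³`, `ℝ⁴` and `ℝ⁵`, where `|x|⁻¹`, `|x|⁻²`, `|x|⁻³` are harmonic off the
origin, while `ξ` is obtained from `b`, `ν`, `ω` by integration from the axis of rotation.

**Compact support of the matter.** A spherically symmetric Newtonian potential outside its matter is
`a - c / r` with `c > 0`, so `E₀ < U_N(∞)` (`CondPhi2.lt_limit`). If the fields are close to the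
Newtonian state, then `E₀ + L₀ |ω| ≤ ν` outside a ball, where `L₀` bounds the angular momenta
admitted by `ψ`, and there all matter terms vanish (`matter_eq_zero`, `isSolution_of_memU`).

**Decay of `ν`, `b`, `ω`.** The source of `b` consists of a matter term only, so `b` and its
derivatives decay like those of the fundamental solution (`b_decay`). The sources of `ν` and `ω`
contain products of gradients, for which finiteness of the norm gives a first decay. The potential and
its gradient are then estimated by splitting the integral (`exists_abs_rieszPot_le`,
`exists_norm_fderiv_rieszPot_le`); a pure second derivative is estimated with the Lipschitz constant
of the source near the point and with the size of the source elsewhere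
(`exists_abs_snd_fderiv_rieszPot_le`). As the Lipschitz constants involve the second derivatives to be
estimated, the optimal order is reached in three rounds: a first bound for `ω`, then `ν`, then `ω`
again (`ν_decay`, `ω_decay`).

**The gradient of `ξ`.** The integral operator prescribes only `∂_ρ ξ`, and integrating it from the
axis gives no decay in directions in which `ρ` is large. The reduced field equations contain a second
equation, which prescribes `∂_z ξ`, and the solution satisfies it as well. Indeed, Poisson's equation
for the potentials (`lap_rieszPot_eq`, `axial_poisson`) gives the equations for `ν`, `b`, `ω` in
differential form (`field_equations`), and their matter terms are derivatives of a single potential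
(`hasDerivAt_matJ`, `exists_source_identity`). Differentiating the two equations for the gradient of
`ξ` crosswise then shows (`integrability_algebra`, `transport`) that the defect in the equation for
`∂_z ξ` satisfies a linear homogeneous ordinary differential equation in `ρ`. It vanishes on the axis,
hence everywhere (`hasDerivAt_ξ_vertical`). So the gradient of `ξ` is an explicit expression in the
derivatives of `b`, `ν`, `ω`; in Cartesian coordinates it is regular up to the axis, and it is of order
`-3` together with the corresponding bounds for its derivatives and their Hölder constants
(`reg_grad`). Integrating along vertical lines from infinity shows that `ξ` is of order `-2`
(`decays_two_of_vertical`, `decays_ξ`).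

The limits at infinity follow from the decay, and the behaviour of the metric under the change of units
is a computation with its coefficients (`metric_rescale`).
-/

open MeasureTheory Filter Topology Set
open scoped ENNReal

noncomputable section

namespace RotatingEV

/-! ### Weighted integrals of the Newton kernel -/

theorem inv_pow_mul_inv_pow_le {a c : ℝ} (ha : 0 < a) (hc : 0 < c) (i j : ℕ) :
    (a ^ i)⁻¹ * (c ^ j)⁻¹ ≤ (a ^ (i + j))⁻¹ + (c ^ (i + j))⁻¹ := by
  rcases le_total a c with h | h
  · calc (a ^ i)⁻¹ * (c ^ j)⁻¹ ≤ (a ^ i)⁻¹ * (a ^ j)⁻¹ := by gcongr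
      _ = (a ^ (i + j))⁻¹ := by rw [pow_add, mul_inv]
      _ ≤ _ := le_add_of_nonneg_right (by positivity)
  · calc (a ^ i)⁻¹ * (c ^ j)⁻¹ ≤ (c ^ i)⁻¹ * (c ^ j)⁻¹ := by gcongr
      _ = (c ^ (i + j))⁻¹ := by rw [pow_add, mul_inv]
      _ ≤ _ := le_add_of_nonneg_left (by positivity)

/-- `1 + |x| ≤ |x - y| + (1 + |y|)`, so a power of `1 + |x|` is absorbed either by the kernel or by
the weight. -/
theorem weight_mul_kernel_le {n : ℕ} {k N : ℕ} (hk : k ≤ N) (x y : E n) (hxy : x ≠ y) :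
    (1 + ‖x‖) ^ k * (((1 + ‖y‖) ^ N)⁻¹ * (‖x - y‖ ^ k)⁻¹) ≤
      2 ^ k * (((1 + ‖y‖) ^ N)⁻¹ + ((1 + ‖y‖) ^ (N - k))⁻¹ * (‖x - y‖ ^ k)⁻¹) := by
  have hz : 0 < ‖x - y‖ := norm_pos_iff.2 (sub_ne_zero.2 hxy)
  have ha : 0 < 1 + ‖y‖ := by positivity
  have h1 : (1 + ‖x‖) ^ k ≤ 2 ^ k * (‖x - y‖ ^ k + (1 + ‖y‖) ^ k) := by
    have h2 : 1 + ‖x‖ ≤ ‖x - y‖ + (1 + ‖y‖) := by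
      have := norm_add_le (x - y) y
      simp only [sub_add_cancel] at this
      linarith
    have h3 : 1 + ‖x‖ ≤ 2 * max ‖x - y‖ (1 + ‖y‖) := by
      have := le_max_left ‖x - y‖ (1 + ‖y‖)
      have := le_max_right ‖x - y‖ (1 + ‖y‖)
      linarith
    calc (1 + ‖x‖) ^ k ≤ (2 * max ‖x - y‖ (1 + ‖y‖)) ^ k := by gcongr
      _ = 2 ^ k * (max ‖x - y‖ (1 + ‖y‖)) ^ k := mul_pow _ _ _
      _ ≤ _ := by
        gcongr
        rcases max_choice ‖x - y‖ (1 + ‖y‖) with h | h <;> rw [h]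
        · exact le_add_of_nonneg_right (by positivity)
        · exact le_add_of_nonneg_left (by positivity)
  calc _ ≤ 2 ^ k * (‖x - y‖ ^ k + (1 + ‖y‖) ^ k) * (((1 + ‖y‖) ^ N)⁻¹ * (‖x - y‖ ^ k)⁻¹) := by
        gcongr
    _ = _ := by
        have : (1 + ‖y‖) ^ N = (1 + ‖y‖) ^ (N - k) * (1 + ‖y‖) ^ k := by
          rw [← pow_add, Nat.sub_add_cancel hk]
        rw [this]
        field_simp

theorem integrableOn_ball_inv_norm_pow {n k : ℕ} (hk : k < n) (r : ℝ) :
    IntegrableOn (fun z : E n => (‖z‖ ^ k)⁻¹) (Metric.ball 0 r) := by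
  have : Nonempty (Fin n) := ⟨⟨0, by omega⟩⟩
  have : Nontrivial (E n) := inferInstance
  rw [integrableOn_fun_norm_addHaar (μ := (volume : Measure (E n))) (f := fun t => (t ^ k)⁻¹)]
  have h : IntegrableOn (fun y : ℝ => y ^ (n - 1 - k)) (Ioo 0 r) :=
    ((continuous_pow _).integrableOn_Icc (a := 0) (b := r)).mono_set Ioo_subset_Icc_self
  refine h.congr_fun (fun y hy => ?_) measurableSet_Ioo
  have hy0 : y ≠ 0 := hy.1.ne'
  have : y ^ (n - 1) = y ^ (n - 1 - k) * y ^ k := by rw [← pow_add]; congr 1; omega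
  simp only [finrank_euclideanSpace, Fintype.card_fin, smul_eq_mul]
  rw [this]
  field_simp

theorem integrable_truncated_inv_norm_pow {n : ℕ} (hn : 0 < n) {r : ℝ} (hr : 0 < r) :
    Integrable (fun z : E n => (Ici r).indicator (fun t => (t ^ (n + 1))⁻¹) ‖z‖) ∧
    ∫ z : E n, (Ici r).indicator (fun t => (t ^ (n + 1))⁻¹) ‖z‖ =
      n * volume.real (Metric.ball (0 : E n) 1) * r⁻¹ := by
  have : Nonempty (Fin n) := ⟨⟨0, by omega⟩⟩
  have : Nontrivial (E n) := inferInstance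
  have key : ∀ y ∈ Ioi (0 : ℝ), y ^ (n - 1) • (Ici r).indicator (fun t => (t ^ (n + 1))⁻¹) y =
      (Ici r).indicator (fun t => t ^ (-2 : ℝ)) y := by
    intro y hy
    by_cases h : y ∈ Ici r
    · have hy0 : y ≠ 0 := (show 0 < y from hy).ne'
      rw [indicator_of_mem h, indicator_of_mem h, Real.rpow_neg (le_of_lt hy), smul_eq_mul]
      have : y ^ (n + 1) = y ^ (n - 1) * y ^ 2 := by rw [← pow_add]; congr 1; omega
      rw [this]
      norm_cast
      field_simp
    · rw [indicator_of_notMem h, indicator_of_notMem h, smul_zero]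
  have hs : Ioi 0 ∩ Ici r = Ici r := inter_eq_right.2 fun t ht => lt_of_lt_of_le hr ht
  constructor
  · rw [integrable_fun_norm_addHaar (μ := (volume : Measure (E n)))
      (f := (Ici r).indicator (fun t => (t ^ (n + 1))⁻¹))]
    simp only [finrank_euclideanSpace, Fintype.card_fin]
    rw [integrableOn_congr_fun key measurableSet_Ioi, IntegrableOn,
      integrable_indicator_iff measurableSet_Ici, IntegrableOn,
      Measure.restrict_restrict measurableSet_Ici, inter_comm, hs, ← IntegrableOn,
      integrableOn_Ici_iff_integrableOn_Ioi]
    exact integrableOn_Ioi_rpow_of_lt (by norm_num) hr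
  · rw [integral_fun_norm_addHaar (volume : Measure (E n))]
    simp only [finrank_euclideanSpace, Fintype.card_fin]
    rw [setIntegral_congr_fun measurableSet_Ioi key, setIntegral_indicator measurableSet_Ici, hs,
      integral_Ici_eq_integral_Ioi, integral_Ioi_rpow_of_lt (by norm_num) hr]
    rw [show (-2 : ℝ) + 1 = -1 by norm_num, Real.rpow_neg_one]
    simp only [nsmul_eq_mul, smul_eq_mul]
    ring

theorem integrable_weight (n : ℕ) : Integrable (fun y : E n => ((1 + ‖y‖) ^ (n + 1))⁻¹) := by
  have h := integrable_one_add_norm (E := E n) (μ := volume) (r := n + 1) (by simp)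
  refine h.congr (ae_of_all _ fun y => ?_)
  simp only
  rw [Real.rpow_neg (by positivity), ← Real.rpow_natCast]
  push_cast
  rfl

theorem measurable_kernel {n : ℕ} (k : ℕ) (x : E n) :
    Measurable (fun y : E n => (‖x - y‖ ^ k)⁻¹) := by fun_prop

/-- `∫ ⟨y⟩^{-(n+1)} |x-y|^{-k} dy = O(⟨x⟩^{-k})` for `k < n`. -/
theorem exists_integral_weight_mul_kernel_le {n k : ℕ} (hk : k < n) :
    ∃ C, 0 < C ∧ ∀ x : E n,
      Integrable (fun y : E n => ((1 + ‖y‖) ^ (n + 1))⁻¹ * (‖x - y‖ ^ k)⁻¹) ∧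
      ∫ y : E n, ((1 + ‖y‖) ^ (n + 1))⁻¹ * (‖x - y‖ ^ k)⁻¹ ≤ C * ((1 + ‖x‖) ^ k)⁻¹ := by
  have hn : 0 < n := by omega
  have : Nonempty (Fin n) := ⟨⟨0, hn⟩⟩
  have : Nontrivial (E n) := inferInstance
  -- Integrable majorant of the translated factor: the kernel itself near its pole, and
  -- `|z|^{-(n+1)}` away from it, where weight and kernel are combined by Young's inequality.
  set h : E n → ℝ := fun z => (Metric.ball 0 1).indicator (fun z => (‖z‖ ^ k)⁻¹) z +
    (Ici 1).indicator (fun t => (t ^ (n + 1))⁻¹) ‖z‖ with hh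
  have hint : Integrable h :=
    ((integrable_indicator_iff measurableSet_ball).2 (integrableOn_ball_inv_norm_pow hk 1)).add
      (integrable_truncated_inv_norm_pow hn one_pos).1
  have hpos : ∀ z, 0 ≤ h z := fun z => add_nonneg (indicator_nonneg (fun _ _ => by positivity) _)
    (indicator_nonneg (fun t ht => by
      have : (0 : ℝ) ≤ t := zero_le_one.trans ht
      positivity) _)
  set w : E n → ℝ := fun y => ((1 + ‖y‖) ^ (n + 1))⁻¹ with hw
  have hwint : Integrable w := integrable_weight n
  have hwpos : ∀ y, 0 ≤ w y := fun y => by positivity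
  refine ⟨2 ^ k * (2 * (∫ y, w y) + ∫ z, h z) + 1, by
    have h1 := integral_nonneg (μ := volume) (f := w) hwpos
    have h2 := integral_nonneg (μ := volume) (f := h) hpos
    positivity, fun x => ?_⟩
  have hae : ∀ᵐ y : E n, y ≠ x := by
    rw [ae_iff]; simp
  have hbd : ∀ y, y ≠ x → (1 + ‖x‖) ^ k * (w y * (‖x - y‖ ^ k)⁻¹) ≤
      2 ^ k * (2 * w y + h (x - y)) := by
    intro y hy
    refine (weight_mul_kernel_le (N := n + 1) (by omega) x y (Ne.symm hy)).trans ?_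
    refine mul_le_mul_of_nonneg_left ?_ (by positivity)
    rw [two_mul, add_assoc]
    refine add_le_add le_rfl ?_
    have hz : 0 < ‖x - y‖ := norm_pos_iff.2 (sub_ne_zero.2 (Ne.symm hy))
    have ha : 0 < 1 + ‖y‖ := by positivity
    rcases lt_or_ge ‖x - y‖ 1 with h1 | h1
    · have : h (x - y) = (‖x - y‖ ^ k)⁻¹ := by
        simp only [hh]
        rw [indicator_of_mem (by simpa using h1), indicator_of_notMem (by simpa using h1), add_zero]
      rw [this]
      have : ((1 + ‖y‖) ^ (n + 1 - k))⁻¹ ≤ 1 :=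
        inv_le_one_of_one_le₀ (one_le_pow₀ (by linarith [norm_nonneg y]))
      calc _ ≤ 1 * (‖x - y‖ ^ k)⁻¹ := by gcongr
        _ ≤ _ := by rw [one_mul]; exact le_add_of_nonneg_left (hwpos y)
    · have : h (x - y) = (‖x - y‖ ^ (n + 1))⁻¹ := by
        simp only [hh]
        rw [indicator_of_notMem (by simpa using h1), indicator_of_mem (by simpa using h1), zero_add]
      rw [this]
      have := inv_pow_mul_inv_pow_le ha hz (n + 1 - k) k
      rwa [Nat.sub_add_cancel (by omega)] at this
  have hdom : Integrable (fun y => 2 ^ k * (2 * w y + h (x - y))) :=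
    ((hwint.const_mul 2).add (hint.comp_sub_left x)).const_mul _
  have hmeas : AEStronglyMeasurable (fun y => (1 + ‖x‖) ^ k * (w y * (‖x - y‖ ^ k)⁻¹)) :=
    (by fun_prop : Measurable _).aestronglyMeasurable
  have hI : Integrable (fun y => (1 + ‖x‖) ^ k * (w y * (‖x - y‖ ^ k)⁻¹)) := by
    refine hdom.mono' hmeas ?_
    filter_upwards [hae] with y hy
    rw [Real.norm_of_nonneg (mul_nonneg (by positivity) (mul_nonneg (hwpos y) (by positivity)))]
    exact hbd y hy
  have hx : 0 < (1 + ‖x‖) ^ k := by positivity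
  have hI' : Integrable (fun y => w y * (‖x - y‖ ^ k)⁻¹) := by
    refine (hI.const_mul ((1 + ‖x‖) ^ k)⁻¹).congr (ae_of_all _ fun y => ?_)
    simp only
    field_simp
  refine ⟨hI', ?_⟩
  rw [← div_eq_mul_inv, le_div_iff₀ hx, mul_comm, ← integral_const_mul]
  calc _ ≤ ∫ y, 2 ^ k * (2 * w y + h (x - y)) := integral_mono_ae hI hdom (hae.mono hbd)
    _ = 2 ^ k * (2 * (∫ y, w y) + ∫ z, h z) := by
      rw [integral_const_mul, integral_add (hwint.const_mul 2) (hint.comp_sub_left x),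
        integral_const_mul, integral_sub_left_eq_self]
    _ ≤ _ := by linarith

/-- `∫_{|x-y| ≥ r} ⟨y⟩^{-(n+1)} |x-y|^{-n} dy = O(⟨x⟩^{-n} / r)`: allowing a factor `1 / r` avoids
the logarithm. -/
theorem exists_integral_weight_mul_truncated_kernel_le {n : ℕ} (hn : 0 < n) :
    ∃ C, 0 < C ∧ ∀ (x : E n) (r : ℝ), 0 < r → r ≤ 1 →
      Integrable (fun y : E n => (Ici r).indicator
        (fun t => ((1 + ‖y‖) ^ (n + 1))⁻¹ * (t ^ n)⁻¹) ‖x - y‖) ∧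
      ∫ y : E n, (Ici r).indicator (fun t => ((1 + ‖y‖) ^ (n + 1))⁻¹ * (t ^ n)⁻¹) ‖x - y‖ ≤
        C * r⁻¹ * ((1 + ‖x‖) ^ n)⁻¹ := by
  have : Nonempty (Fin n) := ⟨⟨0, hn⟩⟩
  have : Nontrivial (E n) := inferInstance
  set w : E n → ℝ := fun y => ((1 + ‖y‖) ^ (n + 1))⁻¹ with hw
  have hwint : Integrable w := integrable_weight n
  have hwpos : ∀ y, 0 ≤ w y := fun y => by positivity
  set v : ℝ := n * volume.real (Metric.ball (0 : E n) 1) with hv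
  have hv0 : 0 ≤ v := by positivity
  refine ⟨2 ^ n * (2 * (∫ y, w y) + v) + 1, by
    have h1 := integral_nonneg (μ := volume) (f := w) hwpos
    positivity, fun x r hr hr1 => ?_⟩
  obtain ⟨hint, hval⟩ := integrable_truncated_inv_norm_pow hn hr
  set h : E n → ℝ := fun z => (Ici r).indicator (fun t => (t ^ (n + 1))⁻¹) ‖z‖ with hh
  have hbd : ∀ y, (1 + ‖x‖) ^ n * ((Ici r).indicator (fun t => w y * (t ^ n)⁻¹) ‖x - y‖) ≤
      2 ^ n * (2 * w y + h (x - y)) := by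
    intro y
    have ha : 0 < 1 + ‖y‖ := by positivity
    by_cases h1 : r ≤ ‖x - y‖
    · have hz : 0 < ‖x - y‖ := hr.trans_le h1
      have hxy : x ≠ y := sub_ne_zero.1 (norm_pos_iff.1 hz)
      simp only [hh]
      rw [indicator_of_mem (show ‖x - y‖ ∈ Ici r from h1),
        indicator_of_mem (show ‖x - y‖ ∈ Ici r from h1)]
      refine (weight_mul_kernel_le (N := n + 1) (by omega) x y hxy).trans ?_
      refine mul_le_mul_of_nonneg_left ?_ (by positivity)
      rw [two_mul, add_assoc]
      refine add_le_add le_rfl ?_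
      have := inv_pow_mul_inv_pow_le ha hz (n + 1 - n) n
      rwa [Nat.sub_add_cancel (by omega)] at this
    · simp only [hh]
      rw [indicator_of_notMem (show ‖x - y‖ ∉ Ici r from h1),
        indicator_of_notMem (show ‖x - y‖ ∉ Ici r from h1)]
      have := hwpos y
      rw [mul_zero]
      positivity
  have hdom : Integrable (fun y => 2 ^ n * (2 * w y + h (x - y))) :=
    ((hwint.const_mul 2).add (hint.comp_sub_left x)).const_mul _
  have hset : MeasurableSet {y : E n | r ≤ ‖x - y‖} :=
    (isClosed_le continuous_const (by fun_prop)).measurableSet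
  have hmeas : Measurable (fun y => (Ici r).indicator (fun t => w y * (t ^ n)⁻¹) ‖x - y‖) := by
    have : (fun y => (Ici r).indicator (fun t => w y * (t ^ n)⁻¹) ‖x - y‖) =
      {y : E n | r ≤ ‖x - y‖}.indicator (fun y => w y * (‖x - y‖ ^ n)⁻¹) := by
      ext y; by_cases h1 : r ≤ ‖x - y‖ <;> simp [indicator, h1]
    rw [this]
    exact Measurable.indicator (by fun_prop) hset
  have hp : ∀ y, 0 ≤ (Ici r).indicator (fun t => w y * (t ^ n)⁻¹) ‖x - y‖ := fun y =>
    indicator_nonneg (fun t ht => by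
      have : (0 : ℝ) ≤ t := hr.le.trans ht
      have := hwpos y
      positivity) _
  have hI : Integrable
      (fun y => (1 + ‖x‖) ^ n * ((Ici r).indicator (fun t => w y * (t ^ n)⁻¹) ‖x - y‖)) := by
    refine hdom.mono' (hmeas.const_mul _).aestronglyMeasurable (ae_of_all _ fun y => ?_)
    rw [Real.norm_of_nonneg (mul_nonneg (by positivity) (hp y))]
    exact hbd y
  have hx : 0 < (1 + ‖x‖) ^ n := by positivity
  have hI' : Integrable (fun y => (Ici r).indicator (fun t => w y * (t ^ n)⁻¹) ‖x - y‖) := by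
    refine (hI.const_mul ((1 + ‖x‖) ^ n)⁻¹).congr (ae_of_all _ fun y => ?_)
    simp only
    field_simp
  refine ⟨hI', ?_⟩
  rw [← div_eq_mul_inv, le_div_iff₀ hx, mul_comm, ← integral_const_mul]
  have h1r : 1 ≤ r⁻¹ := (one_le_inv₀ hr).2 hr1
  have hw0 := integral_nonneg (μ := volume) (f := w) hwpos
  calc _ ≤ ∫ y, 2 ^ n * (2 * w y + h (x - y)) := integral_mono hI hdom hbd
    _ = 2 ^ n * (2 * (∫ y, w y) + v * r⁻¹) := by
      rw [integral_const_mul, integral_add (hwint.const_mul 2) (hint.comp_sub_left x),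
        integral_const_mul, integral_sub_left_eq_self, hval]
    _ ≤ 2 ^ n * (2 * (∫ y, w y) * r⁻¹ + v * r⁻¹) := by
      have : 2 * (∫ y, w y) ≤ 2 * (∫ y, w y) * r⁻¹ :=
        le_mul_of_one_le_right (by positivity) h1r
      exact mul_le_mul_of_nonneg_left (add_le_add this le_rfl) (by positivity)
    _ ≤ _ := by
      have : 0 ≤ r⁻¹ := by positivity
      nlinarith

/-! ### Homogeneous kernels and difference quotients -/

/-- A kernel on `ℝⁿ`, smooth away from the origin and homogeneous of degree `-p`. -/
structure IsKernel {n : ℕ} (p : ℕ) (Φ : E n → ℝ) : Prop where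
  contDiffOn : ContDiffOn ℝ (⊤ : ℕ∞) Φ {0}ᶜ
  hom : ∀ c : ℝ, 0 < c → ∀ a : E n, a ≠ 0 → Φ (c • a) = (c ^ p)⁻¹ * Φ a

theorem isKernel_inv_norm_pow {n : ℕ} (m : ℕ) : IsKernel m (fun a : E n => (‖a‖ ^ m)⁻¹) where
  contDiffOn := fun a ha => by
    have ha' : a ≠ 0 := ha
    refine ContDiffAt.contDiffWithinAt (ContDiffAt.inv ?_ (pow_ne_zero _ (norm_ne_zero_iff.2 ha')))
    exact (contDiffAt_norm ℝ ha').pow m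
  hom := fun c hc a _ => by
    rw [norm_smul, Real.norm_of_nonneg hc.le, mul_pow, mul_inv]

namespace IsKernel

variable {n p : ℕ} {Φ : E n → ℝ}

theorem contDiffAt (h : IsKernel p Φ) {a : E n} (ha : a ≠ 0) : ContDiffAt ℝ (⊤ : ℕ∞) Φ a :=
  h.contDiffOn.contDiffAt (isOpen_compl_singleton.mem_nhds ha)

theorem differentiableAt (h : IsKernel p Φ) {a : E n} (ha : a ≠ 0) : DifferentiableAt ℝ Φ a :=
  (h.contDiffAt ha).differentiableAt (by simp)

theorem dir (h : IsKernel p Φ) (v : E n) : IsKernel (p + 1) (fun a => fderiv ℝ Φ a v) where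
  contDiffOn := fun a ha => by
    have h1 : ContDiffAt ℝ (⊤ : ℕ∞) (fderiv ℝ Φ) a := (h.contDiffAt ha).fderiv_right (by simp)
    exact (h1.clm_apply contDiffAt_const).contDiffWithinAt
  hom := fun c hc a ha => by
    have hca : c • a ≠ 0 := smul_ne_zero hc.ne' ha
    have h1 : HasFDerivAt (fun x : E n => Φ (c • x))
        ((fderiv ℝ Φ (c • a)).comp (c • ContinuousLinearMap.id ℝ (E n))) a := by
      refine HasFDerivAt.comp a (h.differentiableAt hca).hasFDerivAt ?_
      exact (hasFDerivAt_id a).const_smul c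
    have h2 : HasFDerivAt (fun x : E n => (c ^ p)⁻¹ * Φ x) ((c ^ p)⁻¹ • fderiv ℝ Φ a) a :=
      (h.differentiableAt ha).hasFDerivAt.const_mul _
    have h3 : (fun x : E n => Φ (c • x)) =ᶠ[𝓝 a] fun x => (c ^ p)⁻¹ * Φ x := by
      filter_upwards [isOpen_compl_singleton.mem_nhds ha] with x hx using h.hom c hc x hx
    have h4 := congrArg (fun L => L v) (h1.unique (h2.congr_of_eventuallyEq h3))
    simp only [ContinuousLinearMap.comp_apply, smul_apply,
      ContinuousLinearMap.id_apply, map_smul, smul_eq_mul] at h4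
    rw [pow_succ, mul_inv, mul_right_comm, ← h4]
    field_simp

theorem exists_abs_le (h : IsKernel p Φ) : ∃ C, 0 < C ∧ ∀ a, a ≠ 0 → |Φ a| ≤ C * (‖a‖ ^ p)⁻¹ := by
  have hc : ContinuousOn Φ (Metric.sphere 0 1) :=
    h.contDiffOn.continuousOn.mono fun a ha => by
      rintro rfl
      simp at ha
  obtain ⟨C, hC⟩ := (isCompact_sphere (0 : E n) 1).exists_bound_of_continuousOn hc
  refine ⟨|C| + 1, by positivity, fun a ha => ?_⟩
  have hna : 0 < ‖a‖ := norm_pos_iff.2 ha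
  have h1 := h.hom ‖a‖ hna (‖a‖⁻¹ • a) (smul_ne_zero (inv_ne_zero hna.ne') ha)
  rw [smul_inv_smul₀ hna.ne'] at h1
  rw [h1, abs_mul, abs_of_pos (by positivity : 0 < (‖a‖ ^ p)⁻¹), mul_comm]
  gcongr
  have h2 := hC (‖a‖⁻¹ • a) (by simp [norm_smul, hna.ne'])
  rw [Real.norm_eq_abs] at h2
  linarith [le_abs_self C]

theorem measurable (h : IsKernel p Φ) : Measurable Φ :=
  measurable_of_continuousOn_compl_singleton 0 h.contDiffOn.continuousOn

end IsKernel

/-- Mean value theorem for second differences. -/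
theorem exists_second_difference_eq {g g' g'' : ℝ → ℝ} {t : ℝ} (ht : 0 < t)
    (h1 : ∀ s ∈ Icc 0 (2 * t), HasDerivAt g (g' s) s)
    (h2 : ∀ s ∈ Icc 0 (2 * t), HasDerivAt g' (g'' s) s) :
    ∃ θ ∈ Ioo 0 (2 * t), g (2 * t) - 2 * g t + g 0 = t ^ 2 * g'' θ := by
  have hd : ∀ s ∈ Icc 0 t, HasDerivAt (fun s => g (s + t) - g s) (g' (s + t) - g' s) s := by
    intro s hs
    refine HasDerivAt.sub ?_ (h1 s ⟨hs.1, by linarith [hs.2]⟩)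
    exact (h1 (s + t) ⟨by linarith [hs.1], by linarith [hs.2]⟩).comp_add_const s t
  obtain ⟨c, hc, hc'⟩ := exists_hasDerivAt_eq_slope (fun s => g (s + t) - g s)
    (fun s => g' (s + t) - g' s) ht (fun s hs => (hd s hs).continuousAt.continuousWithinAt)
    (fun s hs => hd s (Ioo_subset_Icc_self hs))
  have hsub : Icc c (c + t) ⊆ Icc 0 (2 * t) := Icc_subset_Icc hc.1.le (by linarith [hc.2])
  obtain ⟨θ, hθ, hθ'⟩ := exists_hasDerivAt_eq_slope g' g'' (by linarith : c < c + t)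
    (fun s hs => (h2 s (hsub hs)).continuousAt.continuousWithinAt)
    (fun s hs => h2 s (hsub (Ioo_subset_Icc_self hs)))
  refine ⟨θ, ⟨hc.1.trans hθ.1, by linarith [hθ.2, hc.2]⟩, ?_⟩
  rw [eq_div_iff (by linarith)] at hc' hθ'
  simp only [zero_add, sub_zero, add_sub_cancel_left] at hc' hθ'
  rw [← two_mul] at hc'
  linear_combination -hc' - t * hθ'

theorem abs_le_of_second_difference_le {g g' g'' : ℝ → ℝ} {M ε : ℝ} (hε : 0 < ε)
    (h1 : ∀ s, HasDerivAt g (g' s) s) (h2 : ∀ s, HasDerivAt g' (g'' s) s)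
    (hc : ContinuousAt g'' 0)
    (hM : ∀ t, 0 < t → t < ε → |g (2 * t) - 2 * g t + g 0| ≤ M * t ^ 2) : |g'' 0| ≤ M := by
  by_contra! hlt
  have hev : ∀ᶠ s in 𝓝 (0 : ℝ), M < |g'' s| := hc.abs.eventually (lt_mem_nhds hlt)
  obtain ⟨δ, hδ, hball⟩ := Metric.eventually_nhds_iff.1 hev
  set t := min δ ε / 3 with ht
  have hmin : 0 < min δ ε := lt_min hδ hε
  have ht0 : 0 < t := by positivity
  obtain ⟨θ, hθ, hθ'⟩ := exists_second_difference_eq ht0 (fun s _ => h1 s) (fun s _ => h2 s)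
  have h3 := hM t ht0 (by linarith [min_le_right δ ε])
  have h4 := hball (y := θ) (by
    rw [Real.dist_eq, sub_zero, abs_of_pos hθ.1]
    linarith [hθ.2, min_le_left δ ε])
  rw [hθ', abs_mul, abs_of_pos (by positivity : 0 < t ^ 2), mul_comm] at h3
  have := le_of_mul_le_mul_right h3 (by positivity)
  linarith

/-- The convention `0⁻¹ = 0` keeps the estimate valid when `a` or `b` vanishes, so that no null set
has to be removed under the integral. -/
theorem abs_inv_norm_pow_sub_le {V : Type*} [NormedAddCommGroup V] {m : ℕ} (hm : 0 < m) (a b : V) :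
    |(‖a‖ ^ m)⁻¹ - (‖b‖ ^ m)⁻¹| ≤
      m * ‖a - b‖ * ((‖a‖ ^ (m + 1))⁻¹ + (‖b‖ ^ (m + 1))⁻¹) := by
  have key : ∀ s t d : ℝ, 0 ≤ s → s ≤ t → t - s ≤ d →
      |(s ^ m)⁻¹ - (t ^ m)⁻¹| ≤ m * d * ((s ^ (m + 1))⁻¹ + (t ^ (m + 1))⁻¹) := by
    intro s t d hs hst hd
    have hd0 : 0 ≤ d := (sub_nonneg.2 hst).trans hd
    have hm1 : (1 : ℝ) ≤ m := by exact_mod_cast hm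
    rcases hs.eq_or_lt with rfl | hs
    · rcases hst.eq_or_lt with rfl | ht
      · simp only [sub_self, abs_zero]
        positivity
      · rw [zero_pow hm.ne', zero_pow (by omega), inv_zero, zero_sub, zero_add, abs_neg,
          abs_of_pos (by positivity), pow_succ, mul_inv]
        have h1 : 1 ≤ m * d * t⁻¹ := by
          rw [← div_eq_mul_inv, one_le_div ht]
          nlinarith
        calc (t ^ m)⁻¹ = 1 * (t ^ m)⁻¹ := (one_mul _).symm
          _ ≤ (m * d * t⁻¹) * (t ^ m)⁻¹ := by gcongr
          _ = _ := by ring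
    -- Bernoulli: `(s / t) ^ m ≥ 1 - m (1 - s / t)`.
    · have ht : 0 < t := hs.trans_le hst
      have h0 : (t ^ m)⁻¹ ≤ (s ^ m)⁻¹ := by gcongr
      rw [abs_of_nonneg (sub_nonneg.2 h0)]
      have h1 := one_add_mul_le_pow (a := s / t - 1) (by
        have : 0 ≤ s / t := by positivity
        linarith) m
      rw [add_sub_cancel, div_pow] at h1
      have h2 : (s ^ m)⁻¹ - (t ^ m)⁻¹ = (s ^ m)⁻¹ * (1 - s ^ m / t ^ m) := by
        field_simp
      have h3 : 1 - s ^ m / t ^ m ≤ m * d * s⁻¹ := by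
        have h4 : 1 - s / t ≤ d * s⁻¹ := by
          rw [one_sub_div ht.ne', ← div_eq_mul_inv]
          gcongr
        nlinarith
      calc _ = (s ^ m)⁻¹ * (1 - s ^ m / t ^ m) := h2
        _ ≤ (s ^ m)⁻¹ * (m * d * s⁻¹) := by gcongr
        _ = m * d * (s ^ (m + 1))⁻¹ := by rw [pow_succ, mul_inv]; ring
        _ ≤ _ := by
          refine mul_le_mul_of_nonneg_left (le_add_of_nonneg_right (by positivity)) (by positivity)
  have hab : |‖a‖ - ‖b‖| ≤ ‖a - b‖ := abs_norm_sub_norm_le a b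
  rcases le_total ‖a‖ ‖b‖ with h | h
  · exact key _ _ _ (norm_nonneg _) h (by linarith [neg_abs_le (‖a‖ - ‖b‖)])
  · rw [abs_sub_comm, add_comm]
    exact key _ _ _ (norm_nonneg _) h (by linarith [le_abs_self (‖a‖ - ‖b‖)])

theorem hasDerivAt_comp_line {V : Type*} [NormedAddCommGroup V] [NormedSpace ℝ V] {f : V → ℝ}
    (x e : V) {s : ℝ} (hf : DifferentiableAt ℝ f (x + s • e)) :
    HasDerivAt (fun s : ℝ => f (x + s • e)) (fderiv ℝ f (x + s • e) e) s := by
  have h : HasDerivAt (fun s : ℝ => x + s • e) e s := by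
    simpa using ((hasDerivAt_id s).smul_const e).const_add x
  exact hf.hasFDerivAt.comp_hasDerivAt s h

/-- The condition `4 t ‖e‖ ≤ ‖a‖` keeps the segment from `a` to `a + 2 t e` away from the singularity
at distance `‖a‖ / 2`. -/
theorem IsKernel.exists_second_difference_le {n p : ℕ} {Φ : E n → ℝ} (h : IsKernel p Φ) (e : E n) :
    ∃ C, 0 < C ∧ ∀ (a : E n) (t : ℝ), 0 < t → 4 * t * ‖e‖ ≤ ‖a‖ → a ≠ 0 →
      |Φ (a + (2 * t) • e) - 2 * Φ (a + t • e) + Φ a| ≤ C * t ^ 2 * (‖a‖ ^ (p + 2))⁻¹ := by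
  obtain ⟨C, hC0, hC⟩ := ((h.dir e).dir e).exists_abs_le
  refine ⟨C * 2 ^ (p + 2), by positivity, fun a t ht hat ha => ?_⟩
  have hna : 0 < ‖a‖ := norm_pos_iff.2 ha
  have hnorm : ∀ s ∈ Icc 0 (2 * t), ‖a‖ / 2 ≤ ‖a + s • e‖ := by
    intro s hs
    have h1 : ‖a‖ ≤ ‖a + s • e‖ + ‖s • e‖ := by
      have := norm_sub_le (a + s • e) (s • e)
      simpa using this
    have h2 : ‖s • e‖ ≤ 2 * t * ‖e‖ := by
      rw [norm_smul, Real.norm_of_nonneg hs.1]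
      exact mul_le_mul_of_nonneg_right hs.2 (norm_nonneg _)
    linarith
  have hne : ∀ s ∈ Icc 0 (2 * t), a + s • e ≠ 0 := fun s hs h0 => by
    have := hnorm s hs
    rw [h0, norm_zero] at this
    linarith
  obtain ⟨θ, hθ, hθ'⟩ := exists_second_difference_eq (g := fun s => Φ (a + s • e))
    (g' := fun s => fderiv ℝ Φ (a + s • e) e)
    (g'' := fun s => fderiv ℝ (fun x => fderiv ℝ Φ x e) (a + s • e) e) ht
    (fun s hs => hasDerivAt_comp_line a e (h.differentiableAt (hne s hs)))
    (fun s hs => hasDerivAt_comp_line (f := fun x => fderiv ℝ Φ x e) a e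
      ((h.dir e).differentiableAt (hne s hs)))
  have hθI := Ioo_subset_Icc_self hθ
  rw [zero_smul, add_zero] at hθ'
  rw [hθ', abs_mul, abs_of_pos (by positivity : 0 < t ^ 2)]
  have h5 := hC _ (hne θ hθI)
  have h6 : (‖a + θ • e‖ ^ (p + 1 + 1))⁻¹ ≤ 2 ^ (p + 2) * (‖a‖ ^ (p + 2))⁻¹ := by
    calc (‖a + θ • e‖ ^ (p + 1 + 1))⁻¹ ≤ ((‖a‖ / 2) ^ (p + 2))⁻¹ := by
          have := hnorm θ hθI
          gcongr
      _ = _ := by rw [div_pow, inv_div, div_eq_mul_inv]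
  calc _ ≤ t ^ 2 * (C * (2 ^ (p + 2) * (‖a‖ ^ (p + 2))⁻¹)) := by
        gcongr
        exact h5.trans (by gcongr)
    _ = _ := by ring

/-! ### Decay of Newton potentials -/

/-- The potential `∫ f(y) |x - y|^{-m} dy` on `ℝⁿ`; it is Newtonian for `m = n - 2`. -/
def rieszPot {n : ℕ} (m : ℕ) (f : E n → ℝ) (x : E n) : ℝ := ∫ y, f y * (‖x - y‖ ^ m)⁻¹

/-- A measurable source on `ℝⁿ` which is bounded by `A ⟨y⟩^{-(n+1)}`. -/
structure SourceBound {n : ℕ} (A : ℝ) (f : E n → ℝ) : Prop where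
  meas : AEStronglyMeasurable f volume
  bound : ∀ y, |f y| ≤ A * ((1 + ‖y‖) ^ (n + 1))⁻¹

namespace SourceBound

variable {n k : ℕ} {A : ℝ} {f : E n → ℝ}

theorem nonneg (h : SourceBound A f) : 0 ≤ A := by
  have := (abs_nonneg _).trans (h.bound 0)
  simpa using this

theorem mul_of_abs_le_one (h : SourceBound A f) {χ : E n → ℝ} (hχ : Continuous χ)
    (h1 : ∀ y, |χ y| ≤ 1) : SourceBound A (fun y => χ y * f y) where
  meas := hχ.aestronglyMeasurable.mul h.meas
  bound y := by
    rw [abs_mul]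
    calc _ ≤ 1 * |f y| := by gcongr; exact h1 y
      _ ≤ _ := by rw [one_mul]; exact h.bound y

theorem integrable (h : SourceBound A f) : Integrable f :=
  ((integrable_weight n).const_mul A).mono' h.meas (ae_of_all _ fun y => h.bound y)

theorem abs_mul_kernel_le (h : SourceBound A f) (k : ℕ) (x y : E n) :
    |f y * (‖x - y‖ ^ k)⁻¹| ≤ A * (((1 + ‖y‖) ^ (n + 1))⁻¹ * (‖x - y‖ ^ k)⁻¹) := by
  rw [abs_mul, abs_of_nonneg (by positivity : 0 ≤ (‖x - y‖ ^ k)⁻¹), ← mul_assoc]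
  gcongr
  exact h.bound y

theorem integrable_mul_kernel (h : SourceBound A f) (hk : k < n) (x : E n) :
    Integrable (fun y => f y * (‖x - y‖ ^ k)⁻¹) := by
  obtain ⟨C, -, hC⟩ := exists_integral_weight_mul_kernel_le hk
  exact ((hC x).1.const_mul A).mono' (h.meas.mul (measurable_kernel k x).aestronglyMeasurable)
    (ae_of_all _ fun y => h.abs_mul_kernel_le k x y)

end SourceBound

theorem exists_integral_abs_mul_kernel_le {n k : ℕ} (hk : k < n) :
    ∃ C, 0 < C ∧ ∀ (A : ℝ) (f : E n → ℝ), SourceBound A f → ∀ x : E n,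
      ∫ y, |f y| * (‖x - y‖ ^ k)⁻¹ ≤ C * A * ((1 + ‖x‖) ^ k)⁻¹ := by
  obtain ⟨C, hC0, hC⟩ := exists_integral_weight_mul_kernel_le hk
  refine ⟨C, hC0, fun A f h x => ?_⟩
  have h1 : ∀ y, |f y| * (‖x - y‖ ^ k)⁻¹ = |f y * (‖x - y‖ ^ k)⁻¹| := fun y => by
    rw [abs_mul, abs_of_nonneg (by positivity : 0 ≤ (‖x - y‖ ^ k)⁻¹)]
  simp only [h1]
  calc _ ≤ ∫ y : E n, A * (((1 + ‖y‖) ^ (n + 1))⁻¹ * (‖x - y‖ ^ k)⁻¹) :=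
        integral_mono (h.integrable_mul_kernel hk x).abs ((hC x).1.const_mul A)
          fun y => h.abs_mul_kernel_le k x y
    _ = A * ∫ y : E n, (((1 + ‖y‖) ^ (n + 1))⁻¹ * (‖x - y‖ ^ k)⁻¹) := integral_const_mul _ _
    _ ≤ A * (C * ((1 + ‖x‖) ^ k)⁻¹) := mul_le_mul_of_nonneg_left (hC x).2 h.nonneg
    _ = _ := by ring

theorem exists_abs_rieszPot_le {n m : ℕ} (hm : m < n) :
    ∃ C, 0 < C ∧ ∀ (A : ℝ) (f : E n → ℝ), SourceBound A f → ∀ x : E n,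
      |rieszPot m f x| ≤ C * A * ((1 + ‖x‖) ^ m)⁻¹ := by
  obtain ⟨C, hC0, hC⟩ := exists_integral_abs_mul_kernel_le hm
  refine ⟨C, hC0, fun A f h x => le_trans ?_ (hC A f h x)⟩
  refine (abs_integral_le_integral_abs).trans (le_of_eq ?_)
  congr 1; ext y
  rw [abs_mul, abs_of_nonneg (by positivity : 0 ≤ (‖x - y‖ ^ m)⁻¹)]

/-- The source need not be continuous: the gradient is bounded through the Lipschitz quotients of the
kernel, and differentiability of the potential is a hypothesis. -/
theorem exists_norm_fderiv_rieszPot_le {n m : ℕ} (hm0 : 0 < m) (hm : m + 1 < n) :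
    ∃ C, 0 < C ∧ ∀ (A : ℝ) (f : E n → ℝ), SourceBound A f → ∀ (ι : E 3 →ₗᵢ[ℝ] E n) (w : E 3 → ℝ),
      (∀ x, w x = rieszPot m f (ι x)) → ∀ x, DifferentiableAt ℝ w x →
        ‖fderiv ℝ w x‖ ≤ C * A * ((1 + ‖x‖) ^ (m + 1))⁻¹ := by
  obtain ⟨C, hC0, hC⟩ := exists_integral_abs_mul_kernel_le hm
  refine ⟨m * (1 + 2 ^ (m + 1)) * C, by positivity, fun A f h ι w hw x hx => ?_⟩
  have hA := h.nonneg
  refine HasFDerivAt.le_of_lip' hx.hasFDerivAt (by positivity) ?_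
  filter_upwards [Metric.ball_mem_nhds x (by norm_num : (0 : ℝ) < 1 / 2)] with z hz
  rw [Metric.mem_ball, dist_eq_norm] at hz
  have hInt := fun u => h.integrable_mul_kernel (show m < n by omega) u
  have hInt' : ∀ u, Integrable (fun y => |f y| * (‖u - y‖ ^ (m + 1))⁻¹) := fun u => by
    refine (h.integrable_mul_kernel hm u).abs.congr (ae_of_all _ fun y => ?_)
    simp only
    rw [abs_mul, abs_of_nonneg (by positivity : 0 ≤ (‖u - y‖ ^ (m + 1))⁻¹)]
  rw [hw, hw, rieszPot, rieszPot, ← integral_sub (hInt _) (hInt _)]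
  have hb : ∀ y, ‖f y * (‖ι z - y‖ ^ m)⁻¹ - f y * (‖ι x - y‖ ^ m)⁻¹‖ ≤
      (m * ‖z - x‖) * (|f y| * (‖ι z - y‖ ^ (m + 1))⁻¹ + |f y| * (‖ι x - y‖ ^ (m + 1))⁻¹) := by
    intro y
    rw [← mul_sub, Real.norm_eq_abs, abs_mul]
    have h1 := abs_inv_norm_pow_sub_le hm0 (ι z - y) (ι x - y)
    rw [sub_sub_sub_cancel_right, ← map_sub, ι.norm_map] at h1
    calc _ ≤ |f y| * (m * ‖z - x‖ * ((‖ι z - y‖ ^ (m + 1))⁻¹ + (‖ι x - y‖ ^ (m + 1))⁻¹)) := by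
          gcongr
      _ = _ := by ring
  refine (norm_integral_le_of_norm_le (((hInt' _).add (hInt' _)).const_mul _)
    (ae_of_all _ hb)).trans ?_
  simp only [Pi.add_apply]
  rw [integral_const_mul, integral_add (hInt' _) (hInt' _)]
  have h2 := hC A f h (ι z)
  have h3 := hC A f h (ι x)
  rw [ι.norm_map] at h2 h3
  have h4 : ((1 + ‖z‖) ^ (m + 1))⁻¹ ≤ 2 ^ (m + 1) * ((1 + ‖x‖) ^ (m + 1))⁻¹ := by
    have h5 : (1 + ‖x‖) / 2 ≤ 1 + ‖z‖ := by
      have := norm_sub_norm_le x z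
      rw [norm_sub_rev] at this
      linarith [norm_nonneg z]
    calc ((1 + ‖z‖) ^ (m + 1))⁻¹ ≤ (((1 + ‖x‖) / 2) ^ (m + 1))⁻¹ := by gcongr
      _ = _ := by rw [div_pow, inv_div, div_eq_mul_inv]
  calc _ ≤ m * ‖z - x‖ * (C * A * (2 ^ (m + 1) * ((1 + ‖x‖) ^ (m + 1))⁻¹) +
        C * A * ((1 + ‖x‖) ^ (m + 1))⁻¹) := by
        gcongr
        exact h2.trans (by gcongr)
    _ = _ := by ring

theorem integral_ball_inv_norm_pow {n : ℕ} (hn : 0 < n) {r : ℝ} (hr : 0 < r) :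
    ∫ z in Metric.ball (0 : E n) r, (‖z‖ ^ (n - 1))⁻¹ =
      n * volume.real (Metric.ball (0 : E n) 1) * r := by
  have : Nonempty (Fin n) := ⟨⟨0, by omega⟩⟩
  have : Nontrivial (E n) := inferInstance
  have h1 : ∫ z in Metric.ball (0 : E n) r, (‖z‖ ^ (n - 1))⁻¹ =
      ∫ z : E n, (Iio r).indicator (fun t => (t ^ (n - 1))⁻¹) ‖z‖ := by
    rw [← integral_indicator measurableSet_ball]
    congr 1; ext z
    by_cases h : ‖z‖ < r <;> simp [indicator, h]
  have key : ∀ y ∈ Ioi (0 : ℝ), y ^ (n - 1) • (Iio r).indicator (fun t => (t ^ (n - 1))⁻¹) y =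
      (Iio r).indicator (fun _ => 1) y := by
    intro y hy
    have hy0 : y ≠ 0 := (show 0 < y from hy).ne'
    by_cases h : y < r
    · simp [indicator, h, hy0]
    · simp [indicator, h]
  rw [h1, integral_fun_norm_addHaar (volume : Measure (E n))]
  simp only [finrank_euclideanSpace, Fintype.card_fin]
  rw [setIntegral_congr_fun measurableSet_Ioi key, setIntegral_indicator measurableSet_Iio,
    Ioi_inter_Iio]
  simp [hr.le, mul_assoc]

theorem integral_ball_kernel {n : ℕ} (hn : 0 < n) {r : ℝ} (hr : 0 < r) (x : E n) :
    Integrable (fun y => (Metric.ball x r).indicator (fun y => (‖x - y‖ ^ (n - 1))⁻¹) y) ∧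
    ∫ y, (Metric.ball x r).indicator (fun y => (‖x - y‖ ^ (n - 1))⁻¹) y =
      n * volume.real (Metric.ball (0 : E n) 1) * r := by
  have h : (fun y => (Metric.ball x r).indicator (fun y => (‖x - y‖ ^ (n - 1))⁻¹) y) =
      fun y => (Metric.ball (0 : E n) r).indicator (fun z => (‖z‖ ^ (n - 1))⁻¹) (x - y) := by
    ext y
    by_cases h : ‖x - y‖ < r
    · rw [indicator_of_mem (by rwa [Metric.mem_ball, dist_comm, dist_eq_norm]),
        indicator_of_mem (by simpa using h)]
    · rw [indicator_of_notMem (by rwa [Metric.mem_ball, dist_comm, dist_eq_norm]),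
        indicator_of_notMem (by simpa using h)]
  rw [h]
  refine ⟨Integrable.comp_sub_left ((integrable_indicator_iff measurableSet_ball).2
    (integrableOn_ball_inv_norm_pow (by omega) r)) x, ?_⟩
  rw [integral_sub_left_eq_self (fun z => (Metric.ball (0 : E n) r).indicator
    (fun z => (‖z‖ ^ (n - 1))⁻¹) z), integral_indicator measurableSet_ball,
    integral_ball_inv_norm_pow hn hr]

/-- A Lipschitz cut-off: `1` on the ball of radius `r` about `X`, `0` off the ball of radius `2r`. -/
def radialCutoff {n : ℕ} (X : E n) (r : ℝ) (y : E n) : ℝ := max 0 (min 1 (2 - ‖y - X‖ / r))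

section radialCutoff

variable {n : ℕ} {X : E n} {r : ℝ}

theorem continuous_radialCutoff : Continuous (radialCutoff X r) := by
  unfold radialCutoff
  fun_prop

theorem radialCutoff_nonneg (y : E n) : 0 ≤ radialCutoff X r y := le_max_left _ _

theorem radialCutoff_le_one (y : E n) : radialCutoff X r y ≤ 1 :=
  max_le zero_le_one (min_le_left _ _)

theorem radialCutoff_eq_one (hr : 0 < r) {y : E n} (hy : ‖y - X‖ ≤ r) : radialCutoff X r y = 1 := by
  have : ‖y - X‖ / r ≤ 1 := (div_le_one hr).2 hy
  rw [radialCutoff, min_eq_left (by linarith), max_eq_right zero_le_one]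

theorem radialCutoff_eq_zero (hr : 0 < r) {y : E n} (hy : 2 * r ≤ ‖y - X‖) :
    radialCutoff X r y = 0 := by
  have : 2 ≤ ‖y - X‖ / r := (le_div_iff₀ hr).2 hy
  rw [radialCutoff, max_eq_left]
  exact (min_le_right _ _).trans (by linarith)

theorem abs_radialCutoff_sub_le (hr : 0 < r) (y y' : E n) :
    |radialCutoff X r y - radialCutoff X r y'| ≤ ‖y - y'‖ / r := by
  unfold radialCutoff
  refine (abs_max_sub_max_le_max _ _ _ _).trans (max_le (by simp; positivity) ?_)
  refine (abs_min_sub_min_le_max _ _ _ _).trans (max_le (by simp; positivity) ?_)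
  rw [sub_sub_sub_cancel_left, ← sub_div, abs_div, abs_of_pos hr]
  gcongr
  refine (abs_norm_sub_norm_le _ _).trans (le_of_eq ?_)
  rw [sub_sub_sub_cancel_right, norm_sub_rev]

end radialCutoff

theorem integral_sub_two_mul_add {V : Type*} [MeasurableSpace V] {μ : Measure V} {f g h : V → ℝ}
    (hf : Integrable f μ) (hg : Integrable g μ) (hh : Integrable h μ) :
    ∫ x, (f x - 2 * g x + h x) ∂μ = ∫ x, f x ∂μ - 2 * ∫ x, g x ∂μ + ∫ x, h x ∂μ := by
  rw [integral_add (f := fun x => f x - 2 * g x) (hf.sub (hg.const_mul 2)) hh,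
    integral_sub hf (hg.const_mul 2), integral_const_mul]

theorem integral_sub_sub_sub {V : Type*} [MeasurableSpace V] {μ : Measure V} {f g h k : V → ℝ}
    (hf : Integrable f μ) (hg : Integrable g μ) (hh : Integrable h μ) (hk : Integrable k μ) :
    ∫ x, (f x - g x - (h x - k x)) ∂μ =
      ∫ x, f x ∂μ - ∫ x, g x ∂μ - (∫ x, h x ∂μ - ∫ x, k x ∂μ) := by
  rw [integral_sub (f := fun x => f x - g x) (g := fun x => h x - k x) (hf.sub hg) (hh.sub hk),
    integral_sub hf hg, integral_sub hh hk]

/-- Second derivatives of a potential by second differences. The part of the source in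
the ball of radius `2r` is shifted, so that only its Lipschitz constant `L` enters. -/
theorem exists_abs_snd_fderiv_rieszPot_le {n m : ℕ} (hmn : m + 2 = n) (hm : 0 < m)
    (ι : E 3 →ₗᵢ[ℝ] E n) (e : E 3) :
    ∃ C, 0 < C ∧ ∀ (A : ℝ) (f : E n → ℝ), SourceBound A f → ∀ w : E 3 → ℝ,
      (∀ x, w x = rieszPot m f (ι x)) → ContDiff ℝ 2 w → ∀ (x : E 3) (L r : ℝ), 0 < r → r ≤ 1 →
      0 ≤ L → (∀ y y', ‖y - ι x‖ ≤ 3 → ‖y - y'‖ ≤ 1 → |f y - f y'| ≤ L * ‖y - y'‖) →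
      |fderiv ℝ (fun z => fderiv ℝ w z e) x e| ≤ C * (r * L + A * r⁻¹ * ((1 + ‖x‖) ^ n)⁻¹) := by
  have hn : 0 < n := by omega
  obtain ⟨C₁, hC₁, hfar⟩ := exists_integral_weight_mul_truncated_kernel_le hn
  set v := ι e with hv
  obtain ⟨C₂, hC₂, hker⟩ := (isKernel_inv_norm_pow (n := n) m).exists_second_difference_le v
  set c : ℝ := n * volume.real (Metric.ball (0 : E n) 1) with hc
  have hc0 : 0 ≤ c := by positivity
  refine ⟨8 * m * c * ‖v‖ ^ 2 * (1 + 4 ^ (n + 1)) + C₂ * C₁, by positivity,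
    fun A f hf w hw hw2 x L r hr hr1 hL hLip => ?_⟩
  have hA := hf.nonneg
  set X := ι x with hX
  set K : E n → ℝ := fun a => (‖a‖ ^ m)⁻¹ with hK
  set f₁ : E n → ℝ := fun y => radialCutoff X r y * f y with hf₁
  set f₂ : E n → ℝ := fun y => (1 - radialCutoff X r y) * f y with hf₂
  have hs₁ : SourceBound A f₁ := hf.mul_of_abs_le_one continuous_radialCutoff fun y => by
    rw [abs_of_nonneg (radialCutoff_nonneg y)]; exact radialCutoff_le_one y
  have hs₂ : SourceBound A f₂ := hf.mul_of_abs_le_one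
    (continuous_const.sub continuous_radialCutoff) fun y => by
      rw [abs_of_nonneg (sub_nonneg.2 (radialCutoff_le_one y))]
      linarith [radialCutoff_nonneg (X := X) (r := r) y]
  have hi₁ := fun u => hs₁.integrable_mul_kernel (show m < n by omega) u
  have hi₂ := fun u => hs₂.integrable_mul_kernel (show m < n by omega) u
  have hsplit : ∀ s : ℝ, w (x + s • e) = rieszPot m f₁ (X + s • v) + rieszPot m f₂ (X + s • v) := by
    intro s
    rw [hw, rieszPot, rieszPot, rieszPot, ← integral_add (hi₁ _) (hi₂ _), map_add, map_smul]
    congr 1; ext y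
    simp only [hf₁, hf₂]
    ring
  set wx : ℝ := ((1 + ‖x‖) ^ n)⁻¹ with hwx
  have hwx0 : 0 < wx := by positivity
  -- The source `f₂` vanishes near `X`, so the second difference may fall on the kernel, which
  -- becomes `|X - y|^{-n}`; cutting at distance `r` costs only the factor `1 / r`.
  have hF : ∀ t, 0 < t → 4 * t * ‖v‖ ≤ r →
      |rieszPot m f₂ (X + (2 * t) • v) - 2 * rieszPot m f₂ (X + t • v) + rieszPot m f₂ X| ≤
        (C₂ * C₁ * (A * r⁻¹ * wx)) * t ^ 2 := by
    intro t ht htr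
    have h1 : rieszPot m f₂ (X + (2 * t) • v) - 2 * rieszPot m f₂ (X + t • v) + rieszPot m f₂ X =
        ∫ y, f₂ y * (K (X - y + (2 * t) • v) - 2 * K (X - y + t • v) + K (X - y)) := by
      rw [rieszPot, rieszPot, rieszPot, ← integral_sub_two_mul_add (hi₂ _) (hi₂ _) (hi₂ _)]
      congr 1; ext y
      simp only [hK, add_sub_right_comm]
      ring
    obtain ⟨hint, hval⟩ := hfar X r hr hr1
    rw [h1, ← Real.norm_eq_abs]
    refine (norm_integral_le_of_norm_le (hint.const_mul (A * (C₂ * t ^ 2)))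
      (ae_of_all _ fun y => ?_)).trans ?_
    · rw [Real.norm_eq_abs, abs_mul]
      by_cases hy : r ≤ ‖X - y‖
      · rw [indicator_of_mem (show ‖X - y‖ ∈ Ici r from hy)]
        have h2 := hker (X - y) t ht (htr.trans hy) (norm_pos_iff.1 (hr.trans_le hy))
        rw [hmn] at h2
        calc _ ≤ (A * ((1 + ‖y‖) ^ (n + 1))⁻¹) * (C₂ * t ^ 2 * (‖X - y‖ ^ n)⁻¹) := by
              have := hs₂.bound y
              gcongr
          _ = _ := by ring
      · rw [indicator_of_notMem (show ‖X - y‖ ∉ Ici r from hy)]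
        have : f₂ y = 0 := by
          simp only [hf₂]
          rw [radialCutoff_eq_one hr (by rw [norm_sub_rev]; exact (not_le.1 hy).le)]
          ring
        rw [this, abs_zero, zero_mul, mul_zero]
    · rw [integral_const_mul]
      have hnX : ‖X‖ = ‖x‖ := ι.norm_map x
      rw [hnX] at hval
      calc _ ≤ A * (C₂ * t ^ 2) * (C₁ * r⁻¹ * wx) := by gcongr
        _ = _ := by ring
  -- On the ball of radius `3` about `X` the weights at `x` and at `y` are comparable.
  set A' : ℝ := A * (4 ^ (n + 1) * wx) with hA'
  have hA'0 : 0 ≤ A' := by positivity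
  have hbdA' : ∀ y, ‖y - X‖ ≤ 3 → |f y| ≤ A' := by
    intro y hy
    refine (hf.bound y).trans ?_
    rw [hA']
    gcongr
    have h1 : (1 + ‖x‖) / 4 ≤ 1 + ‖y‖ := by
      have h2 : ‖X‖ ≤ ‖y‖ + ‖y - X‖ := by
        have := norm_sub_le y (y - X)
        rwa [sub_sub_cancel] at this
      rw [show ‖X‖ = ‖x‖ from ι.norm_map x] at h2
      linarith [norm_nonneg y]
    calc ((1 + ‖y‖) ^ (n + 1))⁻¹ ≤ (((1 + ‖x‖) / 4) ^ (n + 1))⁻¹ := by gcongr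
      _ = 4 ^ (n + 1) * ((1 + ‖x‖) ^ (n + 1))⁻¹ := by rw [div_pow, inv_div, div_eq_mul_inv]
      _ ≤ _ := by
        rw [hwx]
        gcongr
        · linarith [norm_nonneg x]
        · omega
  -- For `f₁` a second difference of the kernel would not be integrable. A translation of the
  -- variable of integration moves one of the two differences to the source.
  have hN : ∀ t, 0 < t → 4 * t * ‖v‖ ≤ r →
      |rieszPot m f₁ (X + (2 * t) • v) - 2 * rieszPot m f₁ (X + t • v) + rieszPot m f₁ X| ≤
        (8 * m * c * ‖v‖ ^ 2 * (r * L + A')) * t ^ 2 := by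
    intro t ht htr
    have hshift : ∀ u, rieszPot m f₁ (u + t • v) = ∫ y, f₁ (y + t • v) * K (u - y) := by
      intro u
      rw [rieszPot, ← integral_add_right_eq_self _ (t • v)]
      congr 1; ext y
      simp only [hK, add_sub_add_right_eq_sub]
    have hish : ∀ u, Integrable (fun y => f₁ (y + t • v) * K (u - y)) := by
      intro u
      refine ((hi₁ (u + t • v)).comp_add_right (t • v)).congr (ae_of_all _ fun y => ?_)
      simp only [hK, add_sub_add_right_eq_sub]
    have h1 : rieszPot m f₁ (X + (2 * t) • v) - 2 * rieszPot m f₁ (X + t • v) + rieszPot m f₁ X =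
        ∫ y, (f₁ (y + t • v) - f₁ y) * (K (X + t • v - y) - K (X - y)) := by
      have h2 : X + (2 * t) • v = X + t • v + t • v := by rw [two_mul, add_smul, add_assoc]
      have h3 : (fun y => (f₁ (y + t • v) - f₁ y) * (K (X + t • v - y) - K (X - y))) =
          fun y => (f₁ (y + t • v) * K (X + t • v - y) - f₁ y * K (X + t • v - y)) -
            (f₁ (y + t • v) * K (X - y) - f₁ y * K (X - y)) := by
        ext y; ring
      have e1 : rieszPot m f₁ (X + t • v) = ∫ y, f₁ y * K (X + t • v - y) := rfl
      have e2 : rieszPot m f₁ X = ∫ y, f₁ y * K (X - y) := rfl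
      rw [h3, integral_sub_sub_sub (hish _) (hi₁ _) (hish _) (hi₁ _), h2, hshift (X + t • v),
        ← hshift X, ← e1, ← e2]
      ring
    have hb1 := integral_ball_kernel hn (show 0 < 4 * r by positivity) (X + t • v)
    have hb2 := integral_ball_kernel hn (show 0 < 4 * r by positivity) X
    have htv : ‖t • v‖ = t * ‖v‖ := by rw [norm_smul, Real.norm_of_nonneg ht.le]
    rw [h1, ← Real.norm_eq_abs]
    refine (norm_integral_le_of_norm_le ((hb1.1.add hb2.1).const_mul
      ((L + A' / r) * (t * ‖v‖) * (m * (t * ‖v‖)))) (ae_of_all _ fun y => ?_)).trans ?_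
    · simp only [Pi.add_apply]
      have hp1 : 0 ≤ (Metric.ball (X + t • v) (4 * r)).indicator
          (fun y => (‖X + t • v - y‖ ^ (n - 1))⁻¹) y := indicator_nonneg (fun _ _ => by positivity) _
      have hp2 : 0 ≤ (Metric.ball X (4 * r)).indicator
          (fun y => (‖X - y‖ ^ (n - 1))⁻¹) y := indicator_nonneg (fun _ _ => by positivity) _
      by_cases hy : ‖y - X‖ ≤ 3 * r
      · have hd : |f₁ (y + t • v) - f₁ y| ≤ (L + A' / r) * (t * ‖v‖) := by
          have e1 : f₁ (y + t • v) - f₁ y =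
              -(radialCutoff X r (y + t • v) * (f y - f (y + t • v))) +
              (radialCutoff X r (y + t • v) - radialCutoff X r y) * f y := by
            simp only [hf₁]; ring
          have hyy : ‖y - (y + t • v)‖ = t * ‖v‖ := by
            rw [sub_add_cancel_left, norm_neg, htv]
          have e2 := hLip y (y + t • v) (by linarith) (by rw [hyy]; linarith)
          have e3 := abs_radialCutoff_sub_le (X := X) hr (y + t • v) y
          rw [add_sub_cancel_left, htv] at e3
          rw [hyy] at e2
          rw [e1]
          refine (abs_add_le _ _).trans ?_
          rw [abs_neg, abs_mul, abs_mul, abs_of_nonneg (radialCutoff_nonneg (y + t • v))]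
          calc _ ≤ 1 * (L * (t * ‖v‖)) + (t * ‖v‖ / r) * A' := by
                have := radialCutoff_le_one (X := X) (r := r) (y + t • v)
                have := hbdA' y (by linarith)
                gcongr
            _ = _ := by ring
        have hk := abs_inv_norm_pow_sub_le hm (X + t • v - y) (X - y)
        rw [sub_sub_sub_cancel_right, add_sub_cancel_left, htv,
          show m + 1 = n - 1 by omega] at hk
        have hm1 : y ∈ Metric.ball (X + t • v) (4 * r) := by
          rw [Metric.mem_ball, dist_eq_norm, ← sub_sub]
          refine (norm_sub_le _ _).trans_lt ?_
          rw [htv]; linarith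
        have hm2 : y ∈ Metric.ball X (4 * r) := by
          rw [Metric.mem_ball, dist_eq_norm]; linarith
        rw [indicator_of_mem hm1, indicator_of_mem hm2, norm_mul, Real.norm_eq_abs,
          Real.norm_eq_abs]
        calc _ ≤ ((L + A' / r) * (t * ‖v‖)) * (m * (t * ‖v‖) *
              ((‖X + t • v - y‖ ^ (n - 1))⁻¹ + (‖X - y‖ ^ (n - 1))⁻¹)) := by gcongr
          _ = _ := by ring
      · have z1 : radialCutoff X r y = 0 := radialCutoff_eq_zero hr (by linarith)
        have z2 : radialCutoff X r (y + t • v) = 0 := by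
          refine radialCutoff_eq_zero hr ?_
          have : ‖y - X‖ ≤ ‖y + t • v - X‖ + ‖t • v‖ := by
            have := norm_sub_le (y + t • v - X) (t • v)
            rwa [show y + t • v - X - t • v = y - X by abel] at this
          rw [htv] at this
          linarith
        simp only [hf₁, z1, z2, zero_mul, sub_zero, norm_zero]
        positivity
    · rw [integral_const_mul]
      simp only [Pi.add_apply]
      rw [integral_add hb1.1 hb2.1, hb1.2, hb2.2]
      refine le_of_eq ?_
      field_simp
      ring
  -- Second differences of the `C²` function `w` over `t²` converge to its second derivative.
  have hd1 : ∀ s : ℝ, HasDerivAt (fun s : ℝ => w (x + s • e)) (fderiv ℝ w (x + s • e) e) s :=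
    fun s => hasDerivAt_comp_line x e (hw2.differentiable (by norm_num) _)
  have hw1 : ContDiff ℝ 1 (fun z => fderiv ℝ w z e) :=
    (hw2.fderiv_right (by norm_num)).clm_apply contDiff_const
  have hd2 : ∀ s : ℝ, HasDerivAt (fun s : ℝ => fderiv ℝ w (x + s • e) e)
      (fderiv ℝ (fun z => fderiv ℝ w z e) (x + s • e) e) s :=
    fun s => hasDerivAt_comp_line (f := fun z => fderiv ℝ w z e) x e
      (hw1.differentiable (by norm_num) _)
  have hcont : Continuous (fun s : ℝ => fderiv ℝ (fun z => fderiv ℝ w z e) (x + s • e) e) := by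
    have h1 : Continuous (fderiv ℝ (fun z => fderiv ℝ w z e)) := hw1.continuous_fderiv (by norm_num)
    exact (h1.comp (by fun_prop : Continuous fun s : ℝ => x + s • e)).clm_apply continuous_const
  have hε : 0 < r / (4 * (‖v‖ + 1)) := by positivity
  have hfin := abs_le_of_second_difference_le (M := 8 * m * c * ‖v‖ ^ 2 * (r * L + A') +
    C₂ * C₁ * (A * r⁻¹ * wx)) hε hd1 hd2 hcont.continuousAt (fun t ht htε => by
      have htr : 4 * t * ‖v‖ ≤ r := by
        rw [lt_div_iff₀ (by positivity)] at htε
        nlinarith [norm_nonneg v]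
      have h1 := hN t ht htr
      have h2 := hF t ht htr
      have h0 := hsplit 0
      rw [zero_smul, zero_smul, add_zero, add_zero] at h0
      simp only [zero_smul, add_zero]
      rw [hsplit, hsplit, h0]
      calc _ = |(rieszPot m f₁ (X + (2 * t) • v) - 2 * rieszPot m f₁ (X + t • v) +
            rieszPot m f₁ X) + (rieszPot m f₂ (X + (2 * t) • v) - 2 * rieszPot m f₂ (X + t • v) +
            rieszPot m f₂ X)| := by congr 1; ring
        _ ≤ _ := (abs_add_le _ _).trans (by linarith))
  simp only [zero_smul, add_zero] at hfin
  refine hfin.trans ?_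
  have hr1' : 1 ≤ r⁻¹ := (one_le_inv₀ hr).2 hr1
  have hAw : A' ≤ 4 ^ (n + 1) * (A * r⁻¹ * wx) := by
    rw [hA']
    have : A * wx ≤ A * r⁻¹ * wx := by
      gcongr
      exact le_mul_of_one_le_right hA hr1'
    calc A * (4 ^ (n + 1) * wx) = 4 ^ (n + 1) * (A * wx) := by ring
      _ ≤ _ := by gcongr
  have hP : 0 ≤ A * r⁻¹ * wx := by positivity
  have hrL : 0 ≤ r * L := by positivity
  have hQ : r * L + A' ≤ (1 + 4 ^ (n + 1)) * (r * L + A * r⁻¹ * wx) := by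
    have h4 : (0 : ℝ) ≤ 4 ^ (n + 1) := by positivity
    nlinarith [mul_nonneg h4 hrL]
  calc _ ≤ 8 * m * c * ‖v‖ ^ 2 * ((1 + 4 ^ (n + 1)) * (r * L + A * r⁻¹ * wx)) +
        C₂ * C₁ * (r * L + A * r⁻¹ * wx) := by
        gcongr
        linarith
    _ = _ := by ring

/-! ### Potentials of compactly supported sources -/

/-- `x ↦ ∫ f(y) Φ(ιx - y) dy`. -/
def kernelPot {n : ℕ} (ι : E 3 →ₗᵢ[ℝ] E n) (Φ f : E n → ℝ) (x : E 3) : ℝ := ∫ y, f y * Φ (ι x - y)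

section exterior

variable {n p : ℕ} {ι : E 3 →ₗᵢ[ℝ] E n} {Φ f : E n → ℝ} {A R₀ : ℝ}

theorem half_norm_le_norm_sub {x : E 3} {y : E n} (hx : 2 * R₀ < ‖x‖) (hy : ‖y‖ ≤ R₀) :
    ‖x‖ / 2 ≤ ‖ι x - y‖ := by
  have := norm_sub_norm_le (ι x) y
  rw [ι.norm_map] at this
  linarith

theorem kernelPot_differentiableAt_and_pd (hR₀ : 0 < R₀) (hf : SourceBound A f)
    (hsupp : ∀ y, R₀ < ‖y‖ → f y = 0) (hΦ : IsKernel p Φ) {x : E 3} (hx : 2 * R₀ < ‖x‖) :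
    DifferentiableAt ℝ (kernelPot ι Φ f) x ∧ ∀ i, pd i (kernelPot ι Φ f) x =
      kernelPot ι (fun a => fderiv ℝ Φ a (ι (EuclideanSpace.single i 1))) f x := by
  set ε := (‖x‖ - 2 * R₀) / 2 with hε
  have hε0 : 0 < ε := by rw [hε]; linarith
  have hball : ∀ z ∈ Metric.ball x ε, 2 * R₀ < ‖z‖ ∧ ‖z‖ ≤ ‖x‖ + ε := by
    intro z hz
    rw [Metric.mem_ball, dist_eq_norm] at hz
    have h1 := norm_sub_norm_le x z
    have h2 := norm_sub_norm_le z x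
    rw [norm_sub_rev] at h1
    constructor <;> linarith
  -- For `z` near `x` and `y` in the support, `ι z - y` stays in a compact set without the origin.
  set S : Set (E n) := {a | R₀ ≤ ‖a‖ ∧ ‖a‖ ≤ ‖x‖ + ε + R₀} with hS
  have hScomp : IsCompact S := by
    refine (isCompact_closedBall (0 : E n) (‖x‖ + ε + R₀)).of_isClosed_subset ?_ ?_
    · exact (isClosed_le continuous_const continuous_norm).inter
        (isClosed_le continuous_norm continuous_const)
    · intro a ha
      simpa using ha.2
  have hmem : ∀ z ∈ Metric.ball x ε, ∀ y : E n, ‖y‖ ≤ R₀ → ι z - y ∈ S := by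
    intro z hz y hy
    have h1 := half_norm_le_norm_sub (ι := ι) (hball z hz).1 hy
    have h2 := norm_sub_le (ι z) y
    rw [ι.norm_map] at h2
    exact ⟨by linarith [(hball z hz).1], by linarith [(hball z hz).2]⟩
  have hne : ∀ a ∈ S, a ≠ 0 := by
    rintro a ha rfl
    have := ha.1
    rw [norm_zero] at this
    linarith
  have hdc : ContinuousOn (fderiv ℝ Φ) S := fun a ha =>
    (((hΦ.contDiffAt (hne a ha)).fderiv_right (m := 0) (by simp)).continuousAt).continuousWithinAt
  obtain ⟨M, hM⟩ := hScomp.exists_bound_of_continuousOn hdc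
  obtain ⟨M₀, hM₀⟩ := hScomp.exists_bound_of_continuousOn
    (fun a ha => (hΦ.contDiffAt (hne a ha)).continuousAt.continuousWithinAt : ContinuousOn Φ S)
  have hmeasF : ∀ z, AEStronglyMeasurable (fun y => f y * Φ (ι z - y)) volume := fun z =>
    hf.meas.mul (hΦ.measurable.comp (by fun_prop : Measurable fun y => ι z - y)).aestronglyMeasurable
  have hfbound : ∀ y, f y ≠ 0 → ‖y‖ ≤ R₀ := fun y hy => by
    by_contra! h
    exact hy (hsupp y h)
  have hd : HasFDerivAt (kernelPot ι Φ f)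
      (∫ y, f y • (fderiv ℝ Φ (ι x - y)).comp ι.toContinuousLinearMap) x := by
    refine hasFDerivAt_integral_of_dominated_of_fderiv_le (𝕜 := ℝ)
      (F := fun x y => f y * Φ (ι x - y))
      (F' := fun x y => f y • (fderiv ℝ Φ (ι x - y)).comp ι.toContinuousLinearMap)
      (bound := fun y => M * |f y|) (Metric.ball_mem_nhds x hε0)
      (Eventually.of_forall hmeasF) ?_ ?_ ?_ (hf.integrable.abs.const_mul M) ?_
    · refine (hf.integrable.abs.const_mul M₀).mono' (hmeasF x) (ae_of_all _ fun y => ?_)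
      by_cases hy : f y = 0
      · simp [hy]
      · rw [norm_mul, mul_comm, Real.norm_eq_abs (f y)]
        gcongr
        exact hM₀ _ (hmem x (Metric.mem_ball_self hε0) y (hfbound y hy))
    · refine hf.meas.smul (Measurable.aestronglyMeasurable ?_)
      have h1 : Measurable fun y => fderiv ℝ Φ (ι x - y) :=
        (measurable_fderiv ℝ Φ).comp (by fun_prop : Measurable fun y => ι x - y)
      have h2 : Continuous fun L : E n →L[ℝ] ℝ => L.comp ι.toContinuousLinearMap := by fun_prop
      exact h2.measurable.comp h1
    · refine ae_of_all _ fun y z hz => ?_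
      by_cases hy : f y = 0
      · simp [hy]
      · rw [norm_smul, mul_comm, Real.norm_eq_abs]
        gcongr
        refine (ContinuousLinearMap.opNorm_comp_le _ _).trans ?_
        calc _ ≤ M * 1 := by
              have h0 := hM _ (hmem z hz y (hfbound y hy))
              have := ι.norm_toContinuousLinearMap_le
              have h3 := (norm_nonneg _).trans h0
              gcongr
          _ = M := mul_one M
    · refine ae_of_all _ fun y z hz => ?_
      by_cases hy : f y = 0
      · simpa [hy] using hasFDerivAt_const (0 : ℝ) z
      · have h1 := (hΦ.differentiableAt (hne _ (hmem z hz y (hfbound y hy)))).hasFDerivAt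
        have h2 : HasFDerivAt (fun z => ι z - y) ι.toContinuousLinearMap z :=
          ι.toContinuousLinearMap.hasFDerivAt.sub_const y
        exact (h1.comp z h2).const_mul (f y)
  refine ⟨hd.differentiableAt, fun i => ?_⟩
  rw [pd, hd.fderiv]
  rw [kernelPot]
  have hint : Integrable fun y => f y • (fderiv ℝ Φ (ι x - y)).comp ι.toContinuousLinearMap := by
    refine (hf.integrable.abs.const_mul M).mono' (hf.meas.smul (Measurable.aestronglyMeasurable ?_))
      (ae_of_all _ fun y => ?_)
    · have h1 : Measurable fun y => fderiv ℝ Φ (ι x - y) :=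
        (measurable_fderiv ℝ Φ).comp (by fun_prop : Measurable fun y => ι x - y)
      have h2 : Continuous fun L : E n →L[ℝ] ℝ => L.comp ι.toContinuousLinearMap := by fun_prop
      exact h2.measurable.comp h1
    · by_cases hy : f y = 0
      · simp [hy]
      · rw [norm_smul, mul_comm, Real.norm_eq_abs]
        gcongr
        refine (ContinuousLinearMap.opNorm_comp_le _ _).trans ?_
        calc _ ≤ M * 1 := by
              have h0 := hM _ (hmem x (Metric.mem_ball_self hε0) y (hfbound y hy))
              have := ι.norm_toContinuousLinearMap_le
              have h3 := (norm_nonneg _).trans h0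
              gcongr
          _ = M := mul_one M
  rw [ContinuousLinearMap.integral_apply hint]
  rfl

theorem exists_abs_kernelPot_le (hR₀ : 1 ≤ R₀) (hf : SourceBound A f)
    (hsupp : ∀ y, R₀ < ‖y‖ → f y = 0) (hΦ : IsKernel p Φ) :
    ∃ C, 0 < C ∧ ∀ x : E 3, 2 * R₀ < ‖x‖ → |kernelPot ι Φ f x| ≤ C * ((1 + ‖x‖) ^ p)⁻¹ := by
  obtain ⟨C, hC0, hC⟩ := hΦ.exists_abs_le
  refine ⟨C * 4 ^ p * (∫ y, |f y|) + 1, by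
    have := integral_nonneg (μ := volume) (f := fun y => |f y|) fun y => abs_nonneg _
    positivity, fun x hx => ?_⟩
  have hb : ∀ y, ‖f y * Φ (ι x - y)‖ ≤ |f y| * (C * 4 ^ p * ((1 + ‖x‖) ^ p)⁻¹) := by
    intro y
    rw [norm_mul, Real.norm_eq_abs, Real.norm_eq_abs]
    by_cases hy : R₀ < ‖y‖
    · simp [hsupp y hy]
    · gcongr
      have h1 := half_norm_le_norm_sub (ι := ι) hx (not_lt.1 hy)
      have h2 : (1 + ‖x‖) / 4 ≤ ‖ι x - y‖ := by linarith
      have h3 : 0 < ‖ι x - y‖ := lt_of_lt_of_le (by positivity) h2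
      refine (hC _ (norm_pos_iff.1 h3)).trans ?_
      rw [mul_assoc]
      gcongr
      calc (‖ι x - y‖ ^ p)⁻¹ ≤ (((1 + ‖x‖) / 4) ^ p)⁻¹ := by gcongr
        _ = _ := by rw [div_pow, inv_div, div_eq_mul_inv]
  refine (norm_integral_le_of_norm_le (hf.integrable.abs.mul_const _) (ae_of_all _ hb)).trans ?_
  rw [integral_mul_const]
  have : 0 ≤ ((1 + ‖x‖) ^ p)⁻¹ := by positivity
  nlinarith

/-- A function which agrees, outside a ball, with the potential of a compactly supported source
for a kernel of degree `-p`. -/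
def IsExterior (ι : E 3 →ₗᵢ[ℝ] E n) (f : E n → ℝ) (R₀ : ℝ) (p : ℕ) (w : E 3 → ℝ) : Prop :=
  ∃ Φ : E n → ℝ, IsKernel p Φ ∧ ∀ x : E 3, 2 * R₀ < ‖x‖ → w x = kernelPot ι Φ f x

theorem IsExterior.differentiableAt {w : E 3 → ℝ} (h : IsExterior ι f R₀ p w) (hR₀ : 0 < R₀)
    (hf : SourceBound A f) (hsupp : ∀ y, R₀ < ‖y‖ → f y = 0) {x : E 3} (hx : 2 * R₀ < ‖x‖) :
    DifferentiableAt ℝ w x := by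
  obtain ⟨Φ, hΦ, hw⟩ := h
  refine (kernelPot_differentiableAt_and_pd (ι := ι) hR₀ hf hsupp hΦ hx).1.congr_of_eventuallyEq ?_
  filter_upwards [(isOpen_lt continuous_const continuous_norm).mem_nhds hx] with z hz using hw z hz

theorem IsExterior.pd {w : E 3 → ℝ} (h : IsExterior ι f R₀ p w) (hR₀ : 0 < R₀)
    (hf : SourceBound A f) (hsupp : ∀ y, R₀ < ‖y‖ → f y = 0) (i : Fin 3) :
    IsExterior ι f R₀ (p + 1) (pd i w) := by
  obtain ⟨Φ, hΦ, hw⟩ := h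
  refine ⟨_, hΦ.dir (ι (EuclideanSpace.single i 1)), fun x hx => ?_⟩
  rw [← (kernelPot_differentiableAt_and_pd hR₀ hf hsupp hΦ hx).2 i, RotatingEV.pd, RotatingEV.pd]
  congr 1
  refine Filter.EventuallyEq.fderiv_eq ?_
  filter_upwards [(isOpen_lt continuous_const continuous_norm).mem_nhds hx] with z hz using hw z hz

theorem IsExterior.exists_abs_le {w : E 3 → ℝ} (h : IsExterior ι f R₀ p w) (hR₀ : 1 ≤ R₀)
    (hf : SourceBound A f) (hsupp : ∀ y, R₀ < ‖y‖ → f y = 0) :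
    ∃ C, 0 < C ∧ ∀ x : E 3, 2 * R₀ < ‖x‖ → |w x| ≤ C * ((1 + ‖x‖) ^ p)⁻¹ := by
  obtain ⟨Φ, hΦ, hw⟩ := h
  obtain ⟨C, hC0, hC⟩ := exists_abs_kernelPot_le (ι := ι) hR₀ hf hsupp hΦ
  exact ⟨C, hC0, fun x hx => by rw [hw x hx]; exact hC x hx⟩

end exterior

/-! ### Poisson's equation for Newton potentials -/

/-- The Laplacian on `ℝⁿ` as the sum of the pure second partial derivatives. -/
def lap {n : ℕ} (f : E n → ℝ) (x : E n) : ℝ :=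
  ∑ i : Fin n, fderiv ℝ (fun z => fderiv ℝ f z (EuclideanSpace.single i 1)) x
    (EuclideanSpace.single i 1)

theorem integrable_mul_of_continuousOn {n : ℕ} {f g : E n → ℝ} {K : Set (E n)} (hK : IsCompact K)
    (hf : ContinuousOn f K) (hg : ContinuousOn g K) (hs : ∀ x, x ∉ K → g x = 0) :
    Integrable (fun x => f x * g x) := by
  refine (integrableOn_iff_integrable_of_support_subset (s := K) fun x hx => ?_).1
    ((hf.mul hg).integrableOn_compact hK)
  by_contra h
  exact hx (by simp [hs x h])

section parts

variable {n : ℕ} {W χ : E n → ℝ} {U : Set (E n)}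

theorem contDiffAt_dir {f : E n → ℝ} {x : E n} {j k : ℕ} (h : ContDiffAt ℝ k f x) (hjk : j + 1 ≤ k)
    (v : E n) : ContDiffAt ℝ j (fun z => fderiv ℝ f z v) x :=
  (h.fderiv_right (m := j) (by exact_mod_cast hjk)).clm_apply contDiffAt_const

theorem continuous_lap (hχ : ContDiff ℝ (2 : ℕ) χ) : Continuous (lap χ) := by
  refine continuous_finsetSum _ fun i _ => ?_
  exact (contDiff_iff_contDiffAt.2 fun x => contDiffAt_dir (j := 0)
    (contDiffAt_dir (j := 1) hχ.contDiffAt le_rfl (EuclideanSpace.single i 1)) le_rfl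
    (EuclideanSpace.single i 1) : ContDiff ℝ (0 : ℕ) _).continuous

theorem lap_eq_zero_of_notMem {x : E n} (hx : x ∉ tsupport χ) :
    lap χ x = 0 := by
  refine Finset.sum_eq_zero fun i _ => ?_
  refine image_eq_zero_of_notMem_tsupport
    (f := fun x => fderiv ℝ (fun z => fderiv ℝ χ z (EuclideanSpace.single i 1)) x
      (EuclideanSpace.single i 1)) fun h => hx ?_
  exact tsupport_fderiv_apply_subset ℝ _ (tsupport_fderiv_apply_subset ℝ _ h)

/-- `χ` is supported in the set where `W` is twice differentiable, so integrating by parts twice leaves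
no boundary terms, whatever `W` does elsewhere. -/
theorem integral_mul_lap_eq (hU : ∀ x ∈ U, ContDiffAt ℝ (2 : ℕ) W x) (hχ : ContDiff ℝ (2 : ℕ) χ)
    (hc : HasCompactSupport χ) (hs : tsupport χ ⊆ U) :
    ∫ x, W x * lap χ x = ∫ x, lap W x * χ x := by
  have hK : IsCompact (tsupport χ) := hc
  have hdχ : ∀ v : E n, ContDiff ℝ (1 : ℕ) (fun z => fderiv ℝ χ z v) := fun v =>
    contDiff_iff_contDiffAt.2 fun x => contDiffAt_dir hχ.contDiffAt le_rfl v
  have hddχ : ∀ v : E n, ContDiff ℝ (0 : ℕ) (fun x => fderiv ℝ (fun z => fderiv ℝ χ z v) x v) :=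
    fun v => contDiff_iff_contDiffAt.2 fun x => contDiffAt_dir (hdχ v).contDiffAt le_rfl v
  have hsub1 : ∀ v : E n, tsupport (fun z => fderiv ℝ χ z v) ⊆ tsupport χ := fun v =>
    tsupport_fderiv_apply_subset ℝ v
  have hsub2 : ∀ v : E n, tsupport (fun x => fderiv ℝ (fun z => fderiv ℝ χ z v) x v) ⊆ tsupport χ :=
    fun v => (tsupport_fderiv_apply_subset ℝ v).trans (hsub1 v)
  have hz : ∀ {g : E n → ℝ}, tsupport g ⊆ tsupport χ → ∀ x, x ∉ tsupport χ → g x = 0 :=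
    fun hg x hx => image_eq_zero_of_notMem_tsupport fun h => hx (hg h)
  have hW0 : ContinuousOn W (tsupport χ) := fun x hx =>
    (hU x (hs hx)).continuousAt.continuousWithinAt
  have hW1 : ∀ v : E n, ContinuousOn (fun z => fderiv ℝ W z v) (tsupport χ) := fun v x hx =>
    (contDiffAt_dir (j := 1) (hU x (hs hx)) le_rfl v).continuousAt.continuousWithinAt
  have hW2 : ∀ v : E n, ContinuousOn (fun x => fderiv ℝ (fun z => fderiv ℝ W z v) x v)
      (tsupport χ) := fun v x hx =>
    (contDiffAt_dir (j := 0) (contDiffAt_dir (j := 1) (hU x (hs hx)) le_rfl v) le_rfl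
      v).continuousAt.continuousWithinAt
  have hi0 : ∀ v : E n, Integrable
      (fun x => W x * fderiv ℝ (fun z => fderiv ℝ χ z v) x v) := fun v =>
    integrable_mul_of_continuousOn hK hW0 (hddχ v).continuous.continuousOn (hz (hsub2 v))
  have hi2 : ∀ v : E n, Integrable
      (fun x => fderiv ℝ (fun z => fderiv ℝ W z v) x v * χ x) := fun v =>
    integrable_mul_of_continuousOn hK (hW2 v) hχ.continuous.continuousOn (hz subset_rfl)
  have hi1 : ∀ v : E n, Integrable (fun x => fderiv ℝ W x v * fderiv ℝ χ x v) := fun v =>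
    integrable_mul_of_continuousOn hK (hW1 v) (hdχ v).continuous.continuousOn (hz (hsub1 v))
  have key : ∀ v : E n, ∫ x, W x * fderiv ℝ (fun z => fderiv ℝ χ z v) x v =
      ∫ x, fderiv ℝ (fun z => fderiv ℝ W z v) x v * χ x := by
    intro v
    have h1 := integral_mul_fderiv_eq_neg_fderiv_mul_of_integrable (μ := (volume : Measure (E n)))
      (f := W) (g := fun z => fderiv ℝ χ z v) (v := v) (hi1 v) (hi0 v)
      (integrable_mul_of_continuousOn hK hW0 (hdχ v).continuous.continuousOn (hz (hsub1 v)))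
      (fun x hx => (hU x (hs (hsub1 v hx))).differentiableAt (by norm_num))
      (fun x _ => (hdχ v).differentiable (by norm_num) x)
    have h2 := integral_mul_fderiv_eq_neg_fderiv_mul_of_integrable (μ := (volume : Measure (E n)))
      (f := fun z => fderiv ℝ W z v) (g := χ) (v := v) (hi2 v) (hi1 v)
      (integrable_mul_of_continuousOn hK (hW1 v) hχ.continuous.continuousOn (hz subset_rfl))
      (fun x hx => (contDiffAt_dir (j := 1) (hU x (hs hx)) le_rfl v).differentiableAt (by norm_num))
      (fun x _ => hχ.differentiable (by norm_num) x)
    rw [h1, h2, neg_neg]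
  simp only [lap, Finset.mul_sum, Finset.sum_mul]
  rw [integral_finsetSum _ fun i _ => hi0 _, integral_finsetSum _ fun i _ => hi2 _]
  exact Finset.sum_congr rfl fun i _ => key _

end parts

theorem sum_inner_single_sq {n : ℕ} (a : E n) :
    ∑ i : Fin n, (inner ℝ a (EuclideanSpace.single i (1 : ℝ))) ^ 2 = ‖a‖ ^ 2 := by
  rw [EuclideanSpace.norm_sq_eq]
  refine Finset.sum_congr rfl fun i _ => ?_
  simp [EuclideanSpace.inner_single_right]

/-- The Laplacian of `(‖x - y‖² + δ²)^s`. -/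
theorem lap_regularized {n : ℕ} (y : E n) {δ : ℝ} (hδ : 0 < δ) (s : ℝ) (x : E n) :
    lap (fun x => (‖x - y‖ ^ 2 + δ ^ 2) ^ s) x =
      4 * s * (s - 1) * (‖x - y‖ ^ 2 + δ ^ 2) ^ (s - 2) * ‖x - y‖ ^ 2 +
        2 * n * s * (‖x - y‖ ^ 2 + δ ^ 2) ^ (s - 1) := by
  have hq : ∀ x : E n, 0 < ‖x - y‖ ^ 2 + δ ^ 2 := fun x => by positivity
  have hdq : ∀ x : E n, HasFDerivAt (fun x => ‖x - y‖ ^ 2 + δ ^ 2)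
      (2 • (innerSL ℝ (x - y))) x := by
    intro x
    have h := ((hasFDerivAt_id x).sub_const y).norm_sq
    simpa using h.add_const (δ ^ 2)
  have hpow : ∀ (r : ℝ) (x : E n), HasFDerivAt (fun x => (‖x - y‖ ^ 2 + δ ^ 2) ^ r)
      ((r * (‖x - y‖ ^ 2 + δ ^ 2) ^ (r - 1)) • (2 • (innerSL ℝ (x - y)))) x := fun r x =>
    (hdq x).rpow_const (Or.inl (hq x).ne')
  have h1 : ∀ v : E n, (fun z => fderiv ℝ (fun x => (‖x - y‖ ^ 2 + δ ^ 2) ^ s) z v) =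
      fun z => (2 * s) * ((‖z - y‖ ^ 2 + δ ^ 2) ^ (s - 1) * inner ℝ (z - y) v) := by
    intro v; ext z
    rw [(hpow s z).fderiv]
    simp only [smul_apply, smul_eq_mul, nsmul_eq_mul, innerSL_apply_apply]
    push_cast
    ring
  have h2 : ∀ v : E n, fderiv ℝ (fun z => fderiv ℝ (fun x => (‖x - y‖ ^ 2 + δ ^ 2) ^ s) z v) x v =
      4 * s * (s - 1) * (‖x - y‖ ^ 2 + δ ^ 2) ^ (s - 2) * (inner ℝ (x - y) v) ^ 2 +
        2 * s * (‖x - y‖ ^ 2 + δ ^ 2) ^ (s - 1) * ‖v‖ ^ 2 := by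
    intro v
    rw [h1 v]
    have h3 : HasFDerivAt (fun z : E n => (inner ℝ (z - y) v : ℝ)) (innerSL ℝ v) x := by
      have h4 := (innerSL ℝ v).hasFDerivAt (x := x)
      have h5 : (fun z : E n => (inner ℝ (z - y) v : ℝ)) =
          fun z => innerSL ℝ v z - inner ℝ y v := by
        ext z
        rw [inner_sub_left, innerSL_apply_apply, real_inner_comm]
      rw [h5]
      exact h4.sub_const _
    have h6 : HasFDerivAt (fun z : E n => 2 * s * ((‖z - y‖ ^ 2 + δ ^ 2) ^ (s - 1) *
        inner ℝ (z - y) v)) _ x := ((hpow (s - 1) x).mul h3).const_mul (2 * s)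
    rw [h6.fderiv]
    simp only [smul_apply, add_apply, smul_eq_mul, nsmul_eq_mul, innerSL_apply_apply,
      real_inner_self_eq_norm_sq]
    rw [show s - 1 - 1 = s - 2 by ring]
    push_cast
    ring
  simp only [lap, h2, Finset.sum_add_distrib, ← Finset.mul_sum, sum_inner_single_sq]
  simp
  ring

theorem integral_one_add_sq_rpow {n : ℕ} (hn : 0 < n) :
    IntegrableOn (fun r : ℝ => r ^ (n - 1) * (1 + r ^ 2) ^ (-((n : ℝ) + 2) / 2)) (Ioi 0) ∧
    ∫ r in Ioi (0 : ℝ), r ^ (n - 1) * (1 + r ^ 2) ^ (-((n : ℝ) + 2) / 2) = (1 / n : ℝ) := by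
  have hn0 : (n : ℝ) ≠ 0 := by positivity
  -- An explicit primitive of the integrand.
  set G : ℝ → ℝ := fun r => r ^ n * (1 + r ^ 2) ^ (-(n : ℝ) / 2) / n with hG
  have hq : ∀ r : ℝ, 0 < 1 + r ^ 2 := fun r => by positivity
  have hd : ∀ r ∈ Ici (0 : ℝ),
      HasDerivAt G (r ^ (n - 1) * (1 + r ^ 2) ^ (-((n : ℝ) + 2) / 2)) r := by
    intro r _
    have h1 : HasDerivAt (fun r : ℝ => 1 + r ^ 2) (2 * r) r := by
      simpa using (hasDerivAt_pow 2 r).const_add 1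
    have h2 := h1.rpow_const (p := -(n : ℝ) / 2) (Or.inl (hq r).ne')
    have h3 : HasDerivAt G _ r := ((hasDerivAt_pow n r).mul h2).div_const (n : ℝ)
    refine h3.congr_deriv ?_
    have e1 : (1 + r ^ 2) ^ (-(n : ℝ) / 2) =
        (1 + r ^ 2) ^ (-((n : ℝ) + 2) / 2) * (1 + r ^ 2) := by
      rw [show -(n : ℝ) / 2 = -((n : ℝ) + 2) / 2 + 1 by ring, Real.rpow_add (hq r), Real.rpow_one]
    have e2 : -(n : ℝ) / 2 - 1 = -((n : ℝ) + 2) / 2 := by ring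
    have e3 : r ^ n = r ^ (n - 1) * r := by rw [← pow_succ, Nat.sub_add_cancel hn]
    rw [e1, e2, e3]
    field_simp
    ring
  have hlim : Tendsto G atTop (𝓝 (1 / n)) := by
    have h1 : Tendsto (fun r : ℝ => 1 - (1 + r ^ 2)⁻¹) atTop (𝓝 (1 - 0)) := by
      refine tendsto_const_nhds.sub (tendsto_inv_atTop_zero.comp ?_)
      exact tendsto_atTop_add_const_left _ _ (tendsto_pow_atTop (by norm_num))
    rw [sub_zero] at h1
    have h2 := (h1.rpow_const (p := (n : ℝ) / 2) (Or.inl one_ne_zero)).div_const (n : ℝ)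
    rw [Real.one_rpow] at h2
    refine h2.congr' ?_
    filter_upwards [eventually_ge_atTop 0] with r hr
    simp only [hG]
    congr 1
    have e1 : 1 - (1 + r ^ 2)⁻¹ = r ^ 2 / (1 + r ^ 2) := by
      have := hq r
      field_simp
      ring
    rw [e1, Real.div_rpow (by positivity) (hq r).le, neg_div, Real.rpow_neg (hq r).le,
      div_eq_mul_inv, ← Real.rpow_natCast r 2, ← Real.rpow_mul hr, ← Real.rpow_natCast r n]
    congr 2
    push_cast
    ring
  have hpos : ∀ r ∈ Ioi (0 : ℝ), 0 ≤ r ^ (n - 1) * (1 + r ^ 2) ^ (-((n : ℝ) + 2) / 2) :=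
    fun r hr => by
      have : (0 : ℝ) < r := hr
      positivity
  refine ⟨integrableOn_Ioi_deriv_of_nonneg' hd hpos hlim, ?_⟩
  rw [integral_Ioi_of_hasDerivAt_of_nonneg' hd hpos hlim]
  simp [hG, hn.ne']

theorem integral_poisson_profile {n : ℕ} (hn : 0 < n) :
    Integrable (fun u : E n => (1 + ‖u‖ ^ 2) ^ (-((n : ℝ) + 2) / 2)) ∧
    ∫ u : E n, (1 + ‖u‖ ^ 2) ^ (-((n : ℝ) + 2) / 2) = volume.real (Metric.ball (0 : E n) 1) := by
  have : Nonempty (Fin n) := ⟨⟨0, hn⟩⟩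
  have : Nontrivial (E n) := inferInstance
  obtain ⟨h1, h2⟩ := integral_one_add_sq_rpow hn
  constructor
  · rw [integrable_fun_norm_addHaar (μ := (volume : Measure (E n)))
      (f := fun r => (1 + r ^ 2) ^ (-((n : ℝ) + 2) / 2))]
    simpa using h1
  · rw [integral_fun_norm_addHaar (volume : Measure (E n))
      (fun r => (1 + r ^ 2) ^ (-((n : ℝ) + 2) / 2))]
    simp only [finrank_euclideanSpace, Fintype.card_fin, smul_eq_mul, nsmul_eq_mul]
    rw [h2]
    field_simp

/-- The substitution `x = y + δ u`. -/
theorem integral_poisson_kernel_mul {n : ℕ} (χ : E n → ℝ) (y : E n) {δ : ℝ} (hδ : 0 < δ) :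
    ∫ x, δ ^ 2 * (‖x - y‖ ^ 2 + δ ^ 2) ^ (-((n : ℝ) + 2) / 2) * χ x =
      ∫ u : E n, (1 + ‖u‖ ^ 2) ^ (-((n : ℝ) + 2) / 2) * χ (y + δ • u) := by
  set g : E n → ℝ := fun z => δ ^ n * (δ ^ 2 * (‖z‖ ^ 2 + δ ^ 2) ^ (-((n : ℝ) + 2) / 2) * χ (y + z))
    with hg
  have h1 : ∀ u : E n, (1 + ‖u‖ ^ 2) ^ (-((n : ℝ) + 2) / 2) * χ (y + δ • u) = g (δ • u) := by
    intro u
    simp only [hg]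
    rw [norm_smul, Real.norm_of_nonneg hδ.le, mul_pow,
      show δ ^ 2 * ‖u‖ ^ 2 + δ ^ 2 = δ ^ 2 * (1 + ‖u‖ ^ 2) by ring,
      Real.mul_rpow (by positivity) (by positivity)]
    have : (δ ^ 2) ^ (-((n : ℝ) + 2) / 2) = (δ ^ n * δ ^ 2)⁻¹ := by
      rw [← Real.rpow_natCast δ 2, ← Real.rpow_mul hδ.le, ← Real.rpow_natCast δ n,
        ← Real.rpow_add hδ, ← Real.rpow_neg hδ.le]
      congr 1
      push_cast
      ring
    rw [this]
    field_simp
  simp only [h1]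
  rw [Measure.integral_comp_smul]
  simp only [finrank_euclideanSpace, Fintype.card_fin, hg]
  rw [integral_const_mul, abs_of_pos (by positivity), smul_eq_mul, ← mul_assoc,
    inv_mul_cancel₀ (by positivity), one_mul,
    ← integral_sub_right_eq_self _ (-y)]
  congr 1; ext x
  rw [sub_neg_eq_add, add_sub_cancel_right, add_comm x y]

/-- Total mass `(n-2) |S^{n-1}|` of the Laplacian of the Newton kernel `|x|^{2-n}`. -/
def newtonConst (n m : ℕ) : ℝ := m * n * volume.real (Metric.ball (0 : E n) 1)

/-- The Newton kernel is the fundamental solution of the Laplacian. -/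
theorem integral_kernel_mul_lap {n m : ℕ} (hmn : m + 2 = n) (hm : 0 < m) {χ : E n → ℝ}
    (hχ : ContDiff ℝ (2 : ℕ) χ) (hc : HasCompactSupport χ) (y : E n) :
    ∫ x, (‖x - y‖ ^ m)⁻¹ * lap χ x = -newtonConst n m * χ y := by
  have hn : 0 < n := by omega
  have : Nonempty (Fin n) := ⟨⟨0, by omega⟩⟩
  have : Nontrivial (E n) := inferInstance
  set δ : ℕ → ℝ := fun k => 1 / ((k : ℝ) + 1) with hδdef
  have hδ : ∀ k, 0 < δ k := fun k => by positivity
  have hδ0 : Tendsto δ atTop (𝓝 0) := tendsto_one_div_add_atTop_nhds_zero_nat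
  -- With `|x - y|² + δ²` in place of `|x - y|²` the kernel is smooth, and its Laplacian is a multiple
  -- of the Poisson-type kernel `δ² (|x - y|² + δ²)^{-(n+2)/2}`, an approximate identity as `δ → 0`.
  have hreg : ∀ k, ∫ x, (‖x - y‖ ^ 2 + δ k ^ 2) ^ (-(m : ℝ) / 2) * lap χ x =
      -((m : ℝ) * n) * ∫ u : E n, (1 + ‖u‖ ^ 2) ^ (-((n : ℝ) + 2) / 2) * χ (y + δ k • u) := by
    intro k
    have hq : ∀ x : E n, 0 < ‖x - y‖ ^ 2 + δ k ^ 2 := fun x => by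
      have := hδ k
      positivity
    rw [integral_mul_lap_eq (U := univ) (W := fun x => (‖x - y‖ ^ 2 + δ k ^ 2) ^ (-(m : ℝ) / 2))
      (fun x _ => ContDiffAt.rpow_const_of_ne (ContDiffAt.add
        ((contDiff_id.sub contDiff_const).norm_sq ℝ).contDiffAt contDiffAt_const) (hq x).ne')
      hχ hc (subset_univ _), ← integral_poisson_kernel_mul χ y (hδ k), ← integral_const_mul]
    congr 1; ext x
    rw [lap_regularized y (hδ k)]
    have e1 : (‖x - y‖ ^ 2 + δ k ^ 2) ^ (-(m : ℝ) / 2 - 1) =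
        (‖x - y‖ ^ 2 + δ k ^ 2) ^ (-(m : ℝ) / 2 - 2) * (‖x - y‖ ^ 2 + δ k ^ 2) := by
      rw [show -(m : ℝ) / 2 - 1 = -(m : ℝ) / 2 - 2 + 1 by ring, Real.rpow_add (hq x), Real.rpow_one]
    have e2 : -((n : ℝ) + 2) / 2 = -(m : ℝ) / 2 - 2 := by
      rw [← hmn]; push_cast; ring
    have e3 : (n : ℝ) = m + 2 := by rw [← hmn]; push_cast; ring
    rw [e1, e2, e3]
    ring
  have hlim1 : Tendsto (fun k => ∫ x, (‖x - y‖ ^ 2 + δ k ^ 2) ^ (-(m : ℝ) / 2) * lap χ x) atTop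
      (𝓝 (∫ x, (‖x - y‖ ^ m)⁻¹ * lap χ x)) := by
    obtain ⟨A, hA0, hA⟩ : ∃ A, 0 ≤ A ∧ ∀ x ∈ tsupport χ, ‖lap χ x‖ ≤ A := by
      obtain ⟨A, hA⟩ := (show IsCompact (tsupport χ) from hc).exists_bound_of_continuousOn
        (continuous_lap hχ).continuousOn
      exact ⟨|A|, abs_nonneg A, fun x hx => (hA x hx).trans (le_abs_self A)⟩
    obtain ⟨ρ, hρ⟩ := (show IsCompact (tsupport χ) from hc).isBounded.subset_ball y
    have hne : ∀ᵐ x : E n, x ≠ y := by rw [ae_iff]; simp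
    have hK : ∀ x : E n, x ≠ y → (‖x - y‖ ^ m)⁻¹ = (‖x - y‖ ^ 2) ^ (-(m : ℝ) / 2) := by
      intro x hx
      rw [← Real.rpow_natCast _ 2, ← Real.rpow_mul (norm_nonneg _),
        show ((2 : ℕ) : ℝ) * (-(m : ℝ) / 2) = -m by push_cast; ring,
        Real.rpow_neg (norm_nonneg _), Real.rpow_natCast]
    -- The regularized kernels are dominated by the Newton kernel, which is locally integrable.
    refine tendsto_integral_of_dominated_convergence
      (fun x => (Metric.ball y ρ).indicator (fun x => A * (‖x - y‖ ^ m)⁻¹) x) ?_ ?_ ?_ ?_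
    · intro k
      refine (Continuous.mul ?_ (continuous_lap hχ)).aestronglyMeasurable
      refine Continuous.rpow_const (by fun_prop) fun x => Or.inl ?_
      have := hδ k
      positivity
    · rw [integrable_indicator_iff measurableSet_ball]
      have h1 := (integrable_indicator_iff measurableSet_ball).2
        (integrableOn_ball_inv_norm_pow (n := n) (show m < n by omega) ρ)
      have h2 := (h1.comp_sub_right y).const_mul A
      rw [← integrable_indicator_iff measurableSet_ball]
      refine h2.congr (ae_of_all _ fun x => ?_)
      by_cases hx : ‖x - y‖ < ρ <;> simp [indicator, dist_eq_norm, hx]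
    · intro k
      filter_upwards [hne] with x hx
      by_cases hxs : x ∈ tsupport χ
      · rw [indicator_of_mem (hρ hxs), norm_mul, Real.norm_of_nonneg (by positivity :
          0 ≤ (‖x - y‖ ^ 2 + δ k ^ 2) ^ (-(m : ℝ) / 2)), mul_comm]
        have h1 := hA x hxs
        have h2 : (‖x - y‖ ^ 2 + δ k ^ 2) ^ (-(m : ℝ) / 2) ≤ (‖x - y‖ ^ m)⁻¹ := by
          rw [hK x hx]
          have hz : 0 < ‖x - y‖ := norm_pos_iff.2 (sub_ne_zero.2 hx)
          refine Real.rpow_le_rpow_of_nonpos (by positivity) ?_ ?_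
          · exact le_add_of_nonneg_right (by positivity)
          · rw [neg_div]
            exact neg_nonpos.2 (by positivity)
        have h3 := (norm_nonneg _).trans h1
        gcongr
      · rw [lap_eq_zero_of_notMem hxs, mul_zero, norm_zero]
        refine indicator_nonneg (fun z _ => ?_) x
        positivity
    · filter_upwards [hne] with x hx
      refine Tendsto.mul_const _ ?_
      rw [hK x hx]
      have hz : 0 < ‖x - y‖ := norm_pos_iff.2 (sub_ne_zero.2 hx)
      refine Tendsto.rpow_const ?_ (Or.inl (by positivity))
      simpa using (hδ0.pow 2).const_add (‖x - y‖ ^ 2)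
  have hlim2 : Tendsto (fun k => ∫ u : E n, (1 + ‖u‖ ^ 2) ^ (-((n : ℝ) + 2) / 2) *
      χ (y + δ k • u)) atTop
      (𝓝 (∫ u : E n, (1 + ‖u‖ ^ 2) ^ (-((n : ℝ) + 2) / 2) * χ y)) := by
    obtain ⟨A, hA⟩ := hχ.continuous.bounded_above_of_compact_support hc
    refine tendsto_integral_of_dominated_convergence
      (fun u => (1 + ‖u‖ ^ 2) ^ (-((n : ℝ) + 2) / 2) * A) ?_
      ((integral_poisson_profile hn).1.mul_const A) ?_ ?_
    · intro k
      refine (Continuous.mul ?_ ?_).aestronglyMeasurable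
      · exact Continuous.rpow_const (by fun_prop) fun x => Or.inl (by positivity)
      · exact hχ.continuous.comp (by fun_prop)
    · intro k
      refine ae_of_all _ fun u => ?_
      rw [norm_mul, Real.norm_of_nonneg (by positivity)]
      gcongr
      exact hA _
    · refine ae_of_all _ fun u => Tendsto.const_mul _ ?_
      have h1 : Tendsto (fun k => y + δ k • u) atTop (𝓝 (y + (0 : ℝ) • u)) :=
        (hδ0.smul_const u).const_add y
      rw [zero_smul, add_zero] at h1
      exact (hχ.continuous.tendsto y).comp h1
  rw [integral_mul_const, (integral_poisson_profile hn).2] at hlim2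
  refine tendsto_nhds_unique hlim1 ?_
  simp only [hreg]
  have := hlim2.const_mul (-((m : ℝ) * n))
  convert this using 2
  rw [newtonConst]
  ring

theorem continuousAt_lap {n : ℕ} {χ : E n → ℝ} {x : E n} (hχ : ContDiffAt ℝ (2 : ℕ) χ x) :
    ContinuousAt (lap χ) x := by
  refine tendsto_finsetSum _ fun i _ => ?_
  exact (contDiffAt_dir (j := 0)
    (contDiffAt_dir (j := 1) hχ le_rfl (EuclideanSpace.single i 1)) le_rfl
    (EuclideanSpace.single i 1)).continuousAt

/-- The weak form of Poisson's equation. -/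
theorem integral_rieszPot_mul_lap {n m : ℕ} (hmn : m + 2 = n) (hm : 0 < m) {A : ℝ} {f : E n → ℝ}
    (hf : SourceBound A f) {χ : E n → ℝ} (hχ : ContDiff ℝ (2 : ℕ) χ) (hc : HasCompactSupport χ) :
    Integrable (fun x => rieszPot m f x * lap χ x) ∧
    ∫ x, rieszPot m f x * lap χ x = -newtonConst n m * ∫ y, f y * χ y := by
  have hmn' : m < n := by omega
  have hlc : HasCompactSupport (lap χ) :=
    HasCompactSupport.intro hc fun x hx => lap_eq_zero_of_notMem hx
  have hli : Integrable (lap χ) := (continuous_lap hχ).integrable_of_hasCompactSupport hlc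
  obtain ⟨C, hC0, hC⟩ := exists_integral_abs_mul_kernel_le hmn'
  -- Fubini's theorem reduces the claim to the fundamental solution.
  have hprod : Integrable (fun p : E n × E n => f p.2 * (‖p.1 - p.2‖ ^ m)⁻¹ * lap χ p.1)
      ((volume : Measure (E n)).prod volume) := by
    have hmeas : AEStronglyMeasurable
        (fun p : E n × E n => f p.2 * (‖p.1 - p.2‖ ^ m)⁻¹ * lap χ p.1)
        ((volume : Measure (E n)).prod volume) := by
      refine AEStronglyMeasurable.mul (AEStronglyMeasurable.mul hf.meas.comp_snd ?_) ?_
      · exact (by fun_prop : Measurable fun p : E n × E n =>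
          (‖p.1 - p.2‖ ^ m)⁻¹).aestronglyMeasurable
      · exact ((continuous_lap hχ).comp continuous_fst).aestronglyMeasurable
    rw [integrable_prod_iff hmeas]
    constructor
    · exact ae_of_all _ fun x => (hf.integrable_mul_kernel hmn' x).mul_const (lap χ x)
    · refine (hli.norm.const_mul (C * A)).mono' hmeas.norm.integral_prod_right'
        (ae_of_all _ fun x => ?_)
      rw [Real.norm_of_nonneg (integral_nonneg fun _ => norm_nonneg _)]
      have h1 : ∀ y, ‖f y * (‖x - y‖ ^ m)⁻¹ * lap χ x‖ =
          |f y| * (‖x - y‖ ^ m)⁻¹ * ‖lap χ x‖ := fun y => by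
        rw [norm_mul, norm_mul, Real.norm_eq_abs,
          Real.norm_of_nonneg (by positivity : 0 ≤ (‖x - y‖ ^ m)⁻¹)]
      simp only [h1]
      rw [integral_mul_const]
      gcongr
      refine (hC A f hf x).trans ?_
      have : ((1 + ‖x‖) ^ m)⁻¹ ≤ 1 :=
        inv_le_one_of_one_le₀ (one_le_pow₀ (by linarith [norm_nonneg x]))
      have hA := hf.nonneg
      exact mul_le_of_le_one_right (by positivity) this
  have e1 : ∀ x, rieszPot m f x * lap χ x = ∫ y, f y * (‖x - y‖ ^ m)⁻¹ * lap χ x := fun x => by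
    rw [rieszPot, integral_mul_const]
  constructor
  · refine hprod.integral_prod_left.congr (ae_of_all _ fun x => (e1 x).symm)
  · simp only [e1]
    rw [integral_integral_swap hprod, ← integral_const_mul]
    congr 1; ext y
    simp only [mul_assoc]
    rw [integral_const_mul, integral_kernel_mul_lap hmn hm hχ hc y]
    ring

/-- Poisson's equation at a point where the source is continuous, for a potential that is known
to be twice differentiable near that point. -/
theorem lap_rieszPot_eq {n m : ℕ} (hmn : m + 2 = n) (hm : 0 < m) {A c₀ : ℝ} {f W : E n → ℝ}
    (hf : SourceBound A f) (hW : ∀ x, W x = rieszPot m f x + c₀) {x₀ : E n}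
    (hcont : ContinuousAt f x₀) (hd : ∀ᶠ x in 𝓝 x₀, ContDiffAt ℝ (2 : ℕ) W x) :
    lap W x₀ = -newtonConst n m * f x₀ := by
  set g : E n → ℝ := fun x => lap W x + newtonConst n m * f x with hg
  -- If the equation fails at `x₀`, then `g x₀ * g` exceeds half its value there on a whole ball; testing
  -- with a bump function supported in that ball contradicts the weak form.
  by_contra hne
  have hg0 : g x₀ ≠ 0 := fun h => hne (by simp only [hg] at h; linarith)
  have hgc : ContinuousAt (fun x => g x₀ * g x) x₀ :=
    continuousAt_const.mul ((continuousAt_lap hd.self_of_nhds).add (continuousAt_const.mul hcont))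
  have hpos : 0 < g x₀ * g x₀ := mul_self_pos.2 hg0
  obtain ⟨r, hr, hball⟩ := Metric.eventually_nhds_iff_ball.1
    (hd.and (hgc.eventually (lt_mem_nhds (half_lt_self hpos))))
  let χ : ContDiffBump x₀ := ⟨r / 4, r / 2, by positivity, by linarith⟩
  have hχ : ContDiff ℝ (2 : ℕ) χ := χ.contDiff
  have hcs : HasCompactSupport χ := χ.hasCompactSupport
  have hts : tsupport χ ⊆ Metric.ball x₀ r := by
    rw [χ.tsupport_eq]
    exact Metric.closedBall_subset_ball (by simp only [χ]; linarith)
  have h1 := integral_mul_lap_eq (W := W) (U := Metric.ball x₀ r) (fun x hx => (hball x hx).1) hχ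
    hcs hts
  obtain ⟨hint, h2⟩ := integral_rieszPot_mul_lap hmn hm hf hχ hcs
  have h3 : ∫ x, c₀ * lap χ x = 0 := by
    rw [integral_mul_lap_eq (W := fun _ => c₀) (U := univ) (fun _ _ => contDiffAt_const) hχ hcs
      (subset_univ _)]
    simp [lap]
  have hli : Integrable (fun x => c₀ * lap χ x) :=
    ((continuous_lap hχ).integrable_of_hasCompactSupport (HasCompactSupport.intro hcs
      fun x hx => lap_eq_zero_of_notMem hx)).const_mul _
  have h4 : ∫ x, lap W x * χ x = -newtonConst n m * ∫ y, f y * χ y := by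
    rw [← h1, ← h2]
    simp only [hW, add_mul]
    rw [integral_add hint hli, h3, add_zero]
  have hi1 : Integrable (fun x => lap W x * χ x) :=
    integrable_mul_of_continuousOn hcs
      (fun x hx => (continuousAt_lap (hball x (hts hx)).1).continuousWithinAt)
      χ.continuous.continuousOn fun x hx => image_eq_zero_of_notMem_tsupport hx
  have hi2 : Integrable (fun x => f x * χ x) :=
    hf.integrable.abs.mono' (hf.meas.mul χ.continuous.aestronglyMeasurable)
      (ae_of_all _ fun x => by
        rw [norm_mul, Real.norm_of_nonneg χ.nonneg]
        exact mul_le_of_le_one_right (norm_nonneg _) χ.le_one)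
  have h5 : ∫ x, g x₀ * g x * χ x = 0 := by
    have e : ∀ x, g x₀ * g x * χ x =
        g x₀ * (lap W x * χ x + newtonConst n m * (f x * χ x)) := fun x => by
      simp only [hg]; ring
    simp only [e]
    rw [integral_const_mul, integral_add hi1 (hi2.const_mul _), integral_const_mul, h4]
    ring
  have h6 : ∫ x, g x₀ * g x₀ / 2 * χ x ≤ ∫ x, g x₀ * g x * χ x := by
    refine integral_mono (χ.integrable.const_mul _) ?_ fun x => ?_
    · have := (hi1.add (hi2.const_mul (newtonConst n m))).const_mul (g x₀)
      refine this.congr (ae_of_all _ fun x => ?_)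
      simp only [hg, Pi.add_apply]; ring
    · by_cases hx : x ∈ tsupport χ
      · exact mul_le_mul_of_nonneg_right (hball x (hts hx)).2.le χ.nonneg
      · simp [image_eq_zero_of_notMem_tsupport hx]
  rw [h5, integral_const_mul] at h6
  have h7 : 0 < ∫ x, χ x := χ.integral_pos
  have h8 : 0 < g x₀ * g x₀ / 2 * ∫ x, χ x := by positivity
  linarith

theorem volume_real_ball_three : volume.real (Metric.ball (0 : E 3) 1) = 4 / 3 * Real.pi := by
  rw [measureReal_def, EuclideanSpace.volume_ball_fin_three]
  simp
  rw [ENNReal.toReal_ofReal (by positivity)]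
  ring

theorem newtonConst_three : newtonConst 3 1 = 4 * Real.pi := by
  rw [newtonConst, volume_real_ball_three]
  push_cast
  ring

theorem newtonConst_four : newtonConst 4 2 = 4 * Real.pi ^ 2 := by
  have h : volume.real (Metric.ball (0 : E 4) 1) = Real.pi ^ 2 / 2 := by
    rw [measureReal_def, InnerProductSpace.volume_ball_of_dim_even (k := 2) (by simp)]
    simp [Nat.factorial]
    positivity
  rw [newtonConst, h]
  push_cast
  ring

theorem newtonConst_five : newtonConst 5 3 = 8 * Real.pi ^ 2 := by
  have h : volume.real (Metric.ball (0 : E 5) 1) = 8 / 15 * Real.pi ^ 2 := by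
    rw [measureReal_def, InnerProductSpace.volume_ball_of_dim_odd (k := 2) (by simp)]
    simp [Nat.doubleFactorial]
    rw [ENNReal.toReal_ofReal (by positivity)]
    ring
  rw [newtonConst, h]
  push_cast
  ring

/-! ### Axial coordinates and lifts to higher dimensions -/

section axial

variable {n : ℕ}

/-- The part of `x` orthogonal to the axis. -/
def axialPart (x : E (n + 1)) : E n := WithLp.toLp 2 fun i => x i.castSucc

theorem axialRadius_eq_norm (x : E (n + 1)) : axialRadius x = ‖axialPart x‖ := by
  simp [axialRadius, axialPart, EuclideanSpace.norm_eq]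

theorem axialRadius_nonneg (x : E (n + 1)) : 0 ≤ axialRadius x := Real.sqrt_nonneg _

theorem axialRadius_sq (x : E (n + 1)) : axialRadius x ^ 2 = ∑ i : Fin n, x i.castSucc ^ 2 :=
  Real.sq_sqrt (Finset.sum_nonneg fun _ _ => sq_nonneg _)

theorem norm_sq_eq_axial (x : E (n + 1)) : ‖x‖ ^ 2 = axialRadius x ^ 2 + axialHeight x ^ 2 := by
  rw [EuclideanSpace.real_norm_sq_eq, Fin.sum_univ_castSucc, axialRadius_sq, axialHeight]

theorem axialRadius_le_norm (x : E (n + 1)) : axialRadius x ≤ ‖x‖ := by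
  refine abs_le_of_sq_le_sq' ?_ (norm_nonneg _) |>.2
  rw [norm_sq_eq_axial]
  nlinarith [sq_nonneg (axialHeight x)]

theorem abs_axialHeight_le_norm (x : E (n + 1)) : |axialHeight x| ≤ ‖x‖ := by
  refine abs_le_of_sq_le_sq ?_ (norm_nonneg _)
  rw [norm_sq_eq_axial]
  nlinarith [sq_nonneg (axialRadius x)]

theorem continuous_axialHeight : Continuous (axialHeight : E (n + 1) → ℝ) := by
  unfold axialHeight; fun_prop

theorem continuous_axialRadius : Continuous (axialRadius : E (n + 1) → ℝ) := by
  unfold axialRadius; fun_prop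

theorem meridian_zero_coord (ρ z : ℝ) : meridian ρ z 0 = ρ := rfl
theorem meridian_one_coord (ρ z : ℝ) : meridian ρ z 1 = 0 := rfl
theorem meridian_two_coord (ρ z : ℝ) : meridian ρ z 2 = z := rfl

theorem axialRadius_three (x : E 3) : axialRadius x = √(x 0 ^ 2 + x 1 ^ 2) := by
  simp [axialRadius, Fin.sum_univ_two]

theorem axialRadius_sq_three (x : E 3) : axialRadius x ^ 2 = x 0 ^ 2 + x 1 ^ 2 := by
  rw [axialRadius_sq]
  simp [Fin.sum_univ_two]

theorem axialHeight_three (x : E 3) : axialHeight x = x 2 := rfl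

theorem axialRadius_meridian (ρ z : ℝ) : axialRadius (meridian ρ z) = |ρ| := by
  rw [axialRadius_three, meridian_zero_coord, meridian_one_coord, ← Real.sqrt_sq_eq_abs]
  norm_num

theorem axialHeight_meridian (ρ z : ℝ) : axialHeight (meridian ρ z) = z := rfl

theorem norm_sq_meridian (ρ z : ℝ) : ‖meridian ρ z‖ ^ 2 = ρ ^ 2 + z ^ 2 := by
  rw [norm_sq_eq_axial, axialRadius_meridian, axialHeight_meridian, sq_abs]

theorem norm_meridian_axial (y : E (n + 1)) :
    ‖meridian (axialRadius y) (axialHeight y)‖ = ‖y‖ := by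
  refine (sq_eq_sq₀ (norm_nonneg _) (norm_nonneg _)).1 ?_
  rw [norm_sq_meridian, norm_sq_eq_axial y]

theorem meridian_sub (ρ z ρ' z' : ℝ) :
    meridian ρ z - meridian ρ' z' = meridian (ρ - ρ') (z - z') := by
  ext i; fin_cases i <;> simp [meridian]

theorem norm_meridian_sub_le (y y' : E (n + 1)) :
    ‖meridian (axialRadius y) (axialHeight y) - meridian (axialRadius y') (axialHeight y')‖ ≤
      ‖y - y'‖ := by
  refine abs_le_of_sq_le_sq' ?_ (norm_nonneg _) |>.2
  rw [meridian_sub, norm_sq_meridian, norm_sq_eq_axial (y - y')]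
  have h1 : |axialRadius y - axialRadius y'| ≤ axialRadius (y - y') := by
    rw [axialRadius_eq_norm, axialRadius_eq_norm, axialRadius_eq_norm]
    exact abs_norm_sub_norm_le _ _
  have h2 : axialHeight y - axialHeight y' = axialHeight (y - y') := rfl
  rw [h2]
  nlinarith [sq_abs (axialRadius y - axialRadius y'), abs_nonneg (axialRadius y - axialRadius y')]

theorem contDiff_meridian : ContDiff ℝ (⊤ : ℕ∞) fun p : ℝ × ℝ => meridian p.1 p.2 := by
  rw [contDiff_euclidean]
  intro i
  fin_cases i
  · exact contDiff_fst
  · exact contDiff_const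
  · exact contDiff_snd

theorem continuous_meridian : Continuous fun p : ℝ × ℝ => meridian p.1 p.2 :=
  contDiff_meridian.continuous

theorem continuous_meridian_axial :
    Continuous fun y : E (n + 1) => meridian (axialRadius y) (axialHeight y) :=
  continuous_meridian.comp (continuous_axialRadius.prodMk continuous_axialHeight)

theorem contDiffAt_axialRadius {y : E (n + 1)} (hy : 0 < axialRadius y) :
    ContDiffAt ℝ (⊤ : ℕ∞) (axialRadius : E (n + 1) → ℝ) y := by
  unfold axialRadius
  refine ContDiffAt.sqrt ?_ ?_
  · fun_prop
  · rw [← axialRadius_sq]; positivity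

theorem contDiffAt_lift {k : ℕ} {w : E 3 → ℝ} {y : E (n + 1)} (hy : 0 < axialRadius y)
    (hw : ContDiffAt ℝ k w (meridian (axialRadius y) (axialHeight y))) :
    ContDiffAt ℝ k (lift n w) y := by
  have h1 : ContDiffAt ℝ k (fun y : E (n + 1) => (axialRadius y, axialHeight y)) y := by
    refine ContDiffAt.prodMk ?_ ?_
    · exact (contDiffAt_axialRadius hy).of_le (by exact_mod_cast le_top)
    · unfold axialHeight; fun_prop
  have h2 : ContDiffAt ℝ k (fun p : ℝ × ℝ => meridian p.1 p.2) (axialRadius y, axialHeight y) :=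
    (contDiff_meridian.of_le (by exact_mod_cast le_top)).contDiffAt
  have h3 : ContDiffAt ℝ k (w ∘ fun p : ℝ × ℝ => meridian p.1 p.2) (axialRadius y, axialHeight y) :=
    ContDiffAt.comp (axialRadius y, axialHeight y) hw h2
  exact ContDiffAt.comp (g := w ∘ fun p : ℝ × ℝ => meridian p.1 p.2) y h3 h1

theorem continuousAt_lift {q : E 3 → ℝ} {y : E (n + 1)}
    (hq : ContinuousAt q (meridian (axialRadius y) (axialHeight y))) :
    ContinuousAt (lift n q) y :=
  ContinuousAt.comp (f := fun y : E (n + 1) => meridian (axialRadius y) (axialHeight y)) hq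
    continuous_meridian_axial.continuousAt

/-- The axis is a null set. -/
theorem volume_axialRadius_eq_zero (n : ℕ) :
    volume {y : E (n + 1 + 1) | axialRadius y = 0} = 0 := by
  let p : E (n + 1 + 1) →ₗ[ℝ] ℝ := (EuclideanSpace.proj (0 : Fin (n + 1 + 1))).toLinearMap
  have h : LinearMap.ker p ≠ ⊤ := by
    intro h
    have : (EuclideanSpace.single 0 1 : E (n + 1 + 1)) ∈ LinearMap.ker p := by rw [h]; trivial
    simp [p] at this
  refine measure_mono_null ?_ (Measure.addHaar_submodule volume (LinearMap.ker p) h)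
  intro y hy
  have h1 := axialRadius_sq y
  rw [mem_ofPred_eq] at hy
  rw [hy] at h1
  have h2 := Finset.single_le_sum (f := fun i : Fin (n + 1) => y i.castSucc ^ 2)
    (fun _ _ => sq_nonneg _) (Finset.mem_univ 0)
  rw [← h1] at h2
  have : y 0 = 0 := by
    have h3 : y 0 ^ 2 ≤ 0 := by simpa using h2
    nlinarith [sq_nonneg (y 0)]
  simpa [p] using this

theorem aestronglyMeasurable_lift {q : E 3 → ℝ} (hq : ContinuousOn q {x | 0 < axialRadius x}) :
    AEStronglyMeasurable (lift (n + 1) q) volume := by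
  have hopen : IsOpen {y : E (n + 1 + 1) | 0 < axialRadius y} :=
    isOpen_lt continuous_const continuous_axialRadius
  have h1 : ContinuousOn (lift (n + 1) q) {y | 0 < axialRadius y} := by
    refine hq.comp continuous_meridian_axial.continuousOn ?_
    intro y hy
    rw [mem_ofPred_eq] at hy ⊢
    rw [axialRadius_meridian, abs_of_pos hy]
    exact hy
  have h2 := h1.aestronglyMeasurable hopen.measurableSet (μ := volume)
  rwa [Measure.restrict_eq_self_of_ae_mem] at h2
  have : ∀ᵐ y : E (n + 1 + 1), axialRadius y ≠ 0 := by
    rw [ae_iff]; simpa using volume_axialRadius_eq_zero n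
  filter_upwards [this] with y hy
  exact lt_of_le_of_ne (axialRadius_nonneg y) hy.symm

/-! ### Rotational invariance -/

theorem axialHeight_eq_inner (x : E (n + 1)) :
    axialHeight x = inner ℝ (EuclideanSpace.single (Fin.last n) 1) x := by
  rw [EuclideanSpace.inner_single_left]
  simp [axialHeight]

theorem axial_reflection {u : E (n + 1)} (hu : axialHeight u = 0) (x : E (n + 1)) :
    axialHeight ((ℝ ∙ u)ᗮ.reflection x) = axialHeight x ∧
      axialRadius ((ℝ ∙ u)ᗮ.reflection x) = axialRadius x := by
  set T := (ℝ ∙ u)ᗮ.reflection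
  have he : T (EuclideanSpace.single (Fin.last n) 1) = EuclideanSpace.single (Fin.last n) 1 := by
    refine Submodule.reflection_mem_subspace_eq_self ?_
    rw [Submodule.mem_orthogonal_singleton_iff_inner_left, ← axialHeight_eq_inner, hu]
  have h1 : axialHeight (T x) = axialHeight x := by
    rw [axialHeight_eq_inner, axialHeight_eq_inner]
    conv_lhs => rw [← he]
    exact T.inner_map_map _ _
  refine ⟨h1, ?_⟩
  have h2 := norm_sq_eq_axial (T x)
  rw [T.norm_map, norm_sq_eq_axial x, h1] at h2
  exact (sq_eq_sq₀ (axialRadius_nonneg _) (axialRadius_nonneg _)).1 (by linarith)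

/-- The isometry is the reflection that exchanges `x` and `y`; it fixes the axis because `x - y` is
orthogonal to it. -/
theorem exists_axial_isometry {x y : E (n + 1)} (hr : axialRadius x = axialRadius y)
    (hz : axialHeight x = axialHeight y) :
    ∃ T : E (n + 1) ≃ₗᵢ[ℝ] E (n + 1), T x = y ∧
      ∀ w, axialHeight (T w) = axialHeight w ∧ axialRadius (T w) = axialRadius w := by
  refine ⟨(ℝ ∙ (x - y))ᗮ.reflection, ?_, fun w => axial_reflection ?_ w⟩
  · refine Submodule.reflection_sub ?_
    refine (sq_eq_sq₀ (norm_nonneg _) (norm_nonneg _)).1 ?_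
    rw [norm_sq_eq_axial, norm_sq_eq_axial, hr, hz]
  · have : axialHeight (x - y) = axialHeight x - axialHeight y := rfl
    rw [this, hz, sub_self]

theorem rieszPot_lift_eq {k : ℕ} {q : E 3 → ℝ} {x y : E (n + 1)}
    (hr : axialRadius x = axialRadius y) (hz : axialHeight x = axialHeight y) :
    rieszPot k (lift n q) x = rieszPot k (lift n q) y := by
  obtain ⟨T, hT, hT'⟩ := exists_axial_isometry hr hz
  unfold rieszPot
  rw [← hT]
  rw [← T.measurePreserving.integral_comp' (f := T.toMeasurableEquiv)
    (g := fun w => lift n q w * (‖T x - w‖ ^ k)⁻¹)]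
  refine integral_congr_ae (Eventually.of_forall fun w => ?_)
  have h1 : lift n q (T w) = lift n q w := by
    unfold lift; rw [(hT' w).1, (hT' w).2]
  have h2 : ‖T x - T w‖ = ‖x - w‖ := by rw [← map_sub, T.norm_map]
  simp only [LinearIsometryEquiv.coe_toMeasurableEquiv, h1, h2]

/-- An isometric embedding of `ℝ³` into `ℝⁿ⁺¹` that preserves the axial coordinates. -/
def IsAxialEmbedding (ι : E 3 →ₗᵢ[ℝ] E (n + 1)) : Prop :=
  ∀ x, axialHeight (ι x) = axialHeight x

theorem IsAxialEmbedding.axialRadius {ι : E 3 →ₗᵢ[ℝ] E (n + 1)} (h : IsAxialEmbedding ι)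
    (x : E 3) : axialRadius (ι x) = axialRadius x := by
  have h2 := norm_sq_eq_axial (ι x)
  rw [ι.norm_map, norm_sq_eq_axial x, h] at h2
  exact (sq_eq_sq₀ (axialRadius_nonneg _) (axialRadius_nonneg _)).1 (by linarith)

theorem isAxialEmbedding_id : IsAxialEmbedding (n := 2) (LinearIsometry.id : E 3 →ₗᵢ[ℝ] E 3) :=
  fun _ => rfl

/-- The embedding `(x₁, x₂, x₃) ↦ (x₁, x₂, 0, x₃)`. -/
def embFour : E 3 →ₗᵢ[ℝ] E 4 where
  toFun x := !₂[x 0, x 1, 0, x 2]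
  map_add' x y := by ext i; fin_cases i <;> simp
  map_smul' c x := by ext i; fin_cases i <;> simp
  norm_map' x := by
    simp [EuclideanSpace.norm_eq, Fin.sum_univ_four, Fin.sum_univ_three]

theorem isAxialEmbedding_embFour : IsAxialEmbedding (n := 3) embFour := fun _ => rfl

/-- The embedding `(x₁, x₂, x₃) ↦ (x₁, x₂, 0, 0, x₃)`. -/
def embFive : E 3 →ₗᵢ[ℝ] E 5 where
  toFun x := !₂[x 0, x 1, 0, 0, x 2]
  map_add' x y := by ext i; fin_cases i <;> simp
  map_smul' c x := by ext i; fin_cases i <;> simp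
  norm_map' x := by
    simp [EuclideanSpace.norm_eq, Fin.sum_univ_five, Fin.sum_univ_three]

theorem isAxialEmbedding_embFive : IsAxialEmbedding (n := 4) embFive := fun _ => rfl

/-- A potential of a lifted source, restricted to `ℝ³` and lifted again, is the potential. -/
theorem lift_eq_of_rieszPot {k : ℕ} {q w : E 3 → ℝ} {c₀ : ℝ} {ι : E 3 →ₗᵢ[ℝ] E (n + 1)}
    (hι : IsAxialEmbedding ι) (hw : ∀ x, w x = rieszPot k (lift n q) (ι x) + c₀) (y : E (n + 1)) :
    lift n w y = rieszPot k (lift n q) y + c₀ := by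
  rw [lift, hw]
  congr 1
  refine rieszPot_lift_eq ?_ ?_
  · rw [hι.axialRadius, axialRadius_meridian, abs_of_nonneg (axialRadius_nonneg _)]
  · rw [hι, axialHeight_meridian]

end axial

/-! ### The Laplacian of a lift -/

section laplacian

theorem contDiff_pd {k : ℕ} {w : E 3 → ℝ} (hw : ContDiff ℝ (k + 1 : ℕ) w) (i : Fin 3) :
    ContDiff ℝ k (pd i w) := by
  unfold pd
  exact (hw.fderiv_right (m := k) (by norm_cast)).clm_apply contDiff_const

theorem meridian_add_smul_zero (ρ z s : ℝ) :
    meridian ρ z + s • EuclideanSpace.single 0 1 = meridian (ρ + s) z := by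
  ext i; fin_cases i <;> simp [meridian]

theorem meridian_add_smul_two (ρ z s : ℝ) :
    meridian ρ z + s • EuclideanSpace.single 2 1 = meridian ρ (z + s) := by
  ext i; fin_cases i <;> simp [meridian]

theorem hasDerivAt_meridian_radial {w : E 3 → ℝ} {ρ z : ℝ}
    (hw : DifferentiableAt ℝ w (meridian ρ z)) :
    HasDerivAt (fun s => w (meridian s z)) (pd 0 w (meridian ρ z)) ρ := by
  have h := hasDerivAt_comp_line (meridian 0 z) (EuclideanSpace.single 0 1) (f := w) (s := ρ)
    (by rwa [meridian_add_smul_zero, zero_add])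
  simpa only [pd, meridian_add_smul_zero, zero_add] using h

theorem hasDerivAt_meridian_vertical {w : E 3 → ℝ} {ρ z : ℝ}
    (hw : DifferentiableAt ℝ w (meridian ρ z)) :
    HasDerivAt (fun s => w (meridian ρ s)) (pd 2 w (meridian ρ z)) z := by
  have h := hasDerivAt_comp_line (meridian ρ 0) (EuclideanSpace.single 2 1) (f := w) (s := z)
    (by rwa [meridian_add_smul_two, zero_add])
  simpa only [pd, meridian_add_smul_two, zero_add] using h

/-- Second directional derivatives are second derivatives along lines. -/
theorem fderiv_fderiv_eq_of_line {n : ℕ} {W : E n → ℝ} {y e : E n} {g : ℝ → ℝ} {g' : ℝ}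
    (hW : ContDiffAt ℝ (2 : ℕ) W y)
    (h1 : ∀ᶠ s in 𝓝 (0 : ℝ), HasDerivAt (fun s => W (y + s • e)) (g s) s)
    (h2 : HasDerivAt g g' 0) : fderiv ℝ (fun z => fderiv ℝ W z e) y e = g' := by
  have hd : ∀ᶠ z in 𝓝 y, DifferentiableAt ℝ W z := by
    filter_upwards [hW.eventually (by simp)] with z hz
    exact hz.differentiableAt (by norm_num)
  have hline : Tendsto (fun s : ℝ => y + s • e) (𝓝 0) (𝓝 y) := by
    have : Continuous fun s : ℝ => y + s • e := by fun_prop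
    simpa using this.tendsto 0
  have h3 : ∀ᶠ s in 𝓝 (0 : ℝ), fderiv ℝ W (y + s • e) e = g s := by
    filter_upwards [h1, hline.eventually hd] with s hs hs'
    exact (hasDerivAt_comp_line y e hs').unique hs
  have hd2 : DifferentiableAt ℝ (fun z => fderiv ℝ W z e) (y + (0 : ℝ) • e) := by
    rw [zero_smul, add_zero]
    exact (contDiffAt_dir (j := 1) hW (by norm_num) e).differentiableAt (by norm_num)
  have h4 := hasDerivAt_comp_line y e (f := fun z => fderiv ℝ W z e) hd2
  rw [zero_smul, add_zero] at h4
  exact (h4.congr_of_eventuallyEq (h3.mono fun s hs => hs.symm)).unique h2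

theorem axialRadius_add_smul_single {n : ℕ} (y : E (n + 1)) (i : Fin n) (s : ℝ) :
    axialRadius (y + s • EuclideanSpace.single i.castSucc 1) ^ 2 =
      axialRadius y ^ 2 + 2 * (s * y i.castSucc) + s ^ 2 := by
  have h : axialPart (y + s • EuclideanSpace.single i.castSucc 1) =
      axialPart y + s • EuclideanSpace.single i 1 := by
    ext j
    simp [axialPart]
  rw [axialRadius_eq_norm, axialRadius_eq_norm, h, norm_add_sq_real, inner_smul_right,
    EuclideanSpace.inner_single_right, norm_smul]
  simp [axialPart]

theorem axialHeight_add_smul_single {n : ℕ} (y : E (n + 1)) (i : Fin n) (s : ℝ) :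
    axialHeight (y + s • EuclideanSpace.single i.castSucc 1) = axialHeight y := by
  simp [axialHeight, (Fin.castSucc_lt_last i).ne]

theorem axialRadius_add_smul_last {n : ℕ} (y : E (n + 1)) (s : ℝ) :
    axialRadius (y + s • EuclideanSpace.single (Fin.last n) 1) = axialRadius y := by
  simp [axialRadius, (Fin.castSucc_lt_last _).ne]

theorem axialHeight_add_smul_last {n : ℕ} (y : E (n + 1)) (s : ℝ) :
    axialHeight (y + s • EuclideanSpace.single (Fin.last n) 1) = axialHeight y + s := by
  simp [axialHeight]

/-- The Laplacian of an axially symmetric function in cylindrical coordinates. At a point of the half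
plane through the first coordinate axis, the radial and the vertical direction give `w_ρρ` and `w_zz`,
and each of the remaining `k` directions gives `w_ρ / ρ`. -/
theorem lap_lift {k : ℕ} {w : E 3 → ℝ} (hw : ContDiff ℝ (2 : ℕ) w) {y : E (k + 1 + 1)} {ρ z : ℝ}
    (hρ : 0 < ρ) (h0 : y 0 = ρ) (hj : ∀ j : Fin k, y j.succ.castSucc = 0) (hz : axialHeight y = z) :
    lap (lift (k + 1) w) y = pd 0 (pd 0 w) (meridian ρ z) + k * (pd 0 w (meridian ρ z) / ρ)
      + pd 2 (pd 2 w) (meridian ρ z) := by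
  have hrad : axialRadius y = ρ := by
    refine (sq_eq_sq₀ (axialRadius_nonneg _) hρ.le).1 ?_
    rw [axialRadius_sq, Fin.sum_univ_succ, Finset.sum_eq_zero fun j _ => by rw [hj]; norm_num]
    rw [Fin.castSucc_zero, h0, add_zero]
  have hW : ContDiffAt ℝ (2 : ℕ) (lift (k + 1) w) y :=
    contDiffAt_lift (by rw [hrad]; exact hρ) hw.contDiffAt
  have hwd : Differentiable ℝ w := hw.differentiable (by norm_num)
  have hpd : ∀ i, Differentiable ℝ (pd i w) := fun i =>
    (contDiff_pd (k := 1) hw i).differentiable (by norm_num)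
  have hlast : fderiv ℝ (fun x => fderiv ℝ (lift (k + 1) w) x
      (EuclideanSpace.single (Fin.last (k + 1)) 1)) y (EuclideanSpace.single (Fin.last (k + 1)) 1) =
      pd 2 (pd 2 w) (meridian ρ z) := by
    refine fderiv_fderiv_eq_of_line (g := fun s => pd 2 w (meridian ρ (z + s))) hW
      (Eventually.of_forall fun s => ?_) ?_
    · simp only [lift, axialRadius_add_smul_last, axialHeight_add_smul_last, hrad, hz]
      have := hasDerivAt_meridian_vertical (ρ := ρ) (z := z + s) (hwd _)
      simpa using this.comp_const_add z s
    · have := hasDerivAt_meridian_vertical (ρ := ρ) (z := z + 0) (hpd 2 _)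
      simpa using this.comp_const_add z 0
  have hfirst : fderiv ℝ (fun x => fderiv ℝ (lift (k + 1) w) x
      (EuclideanSpace.single (Fin.castSucc 0) 1)) y (EuclideanSpace.single (Fin.castSucc 0) 1) =
      pd 0 (pd 0 w) (meridian ρ z) := by
    have hr : ∀ s : ℝ, -ρ < s →
        axialRadius (y + s • EuclideanSpace.single (Fin.castSucc 0) 1) = ρ + s := by
      intro s hs
      refine (sq_eq_sq₀ (axialRadius_nonneg _) (by linarith)).1 ?_
      rw [axialRadius_add_smul_single, hrad, Fin.castSucc_zero, h0]
      ring
    have hnear : ∀ᶠ s in 𝓝 (0 : ℝ), -ρ < s := eventually_gt_nhds (by linarith)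
    refine fderiv_fderiv_eq_of_line (g := fun s => pd 0 w (meridian (ρ + s) z)) hW ?_ ?_
    · filter_upwards [hnear.eventually_nhds] with s hs
      have := hasDerivAt_meridian_radial (ρ := ρ + s) (z := z) (hwd _)
      refine HasDerivAt.congr_of_eventuallyEq (this.comp_const_add ρ s) ?_
      filter_upwards [hs] with s' hs'
      simp only [lift, hr s' hs', axialHeight_add_smul_single, hz]
    · have := hasDerivAt_meridian_radial (ρ := ρ + 0) (z := z) (hpd 0 _)
      simpa using this.comp_const_add ρ 0
  -- In these directions the axial radius is `√(ρ² + s²)`, which is stationary at `s = 0`.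
  have hinner : ∀ j : Fin k, fderiv ℝ (fun x => fderiv ℝ (lift (k + 1) w) x
      (EuclideanSpace.single (Fin.castSucc j.succ) 1)) y
      (EuclideanSpace.single (Fin.castSucc j.succ) 1) = pd 0 w (meridian ρ z) / ρ := by
    intro j
    have hpos : ∀ s : ℝ, 0 < ρ ^ 2 + s ^ 2 := fun s => by positivity
    have hr : ∀ s : ℝ,
        axialRadius (y + s • EuclideanSpace.single (Fin.castSucc j.succ) 1) = √(ρ ^ 2 + s ^ 2) := by
      intro s
      refine (sq_eq_sq₀ (axialRadius_nonneg _) (Real.sqrt_nonneg _)).1 ?_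
      rw [axialRadius_add_smul_single, hrad, hj, Real.sq_sqrt (hpos s).le]
      ring
    have hsq : ∀ s : ℝ, HasDerivAt (fun s => √(ρ ^ 2 + s ^ 2)) (s / √(ρ ^ 2 + s ^ 2)) s := by
      intro s
      have h1 : HasDerivAt (fun s : ℝ => ρ ^ 2 + s ^ 2) (2 * s) s := by
        simpa using ((hasDerivAt_pow 2 s).const_add (ρ ^ 2))
      convert h1.sqrt (hpos s).ne' using 1
      rw [mul_div_mul_left _ _ two_ne_zero]
    have hsqrt0 : √(ρ ^ 2 + (0 : ℝ) ^ 2) = ρ := by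
      rw [zero_pow two_ne_zero, add_zero, Real.sqrt_sq hρ.le]
    refine fderiv_fderiv_eq_of_line
      (g := fun s => pd 0 w (meridian (√(ρ ^ 2 + s ^ 2)) z) * (s / √(ρ ^ 2 + s ^ 2))) hW
      (Eventually.of_forall fun s => ?_) ?_
    · simp only [lift, hr, axialHeight_add_smul_single, hz]
      exact (hasDerivAt_meridian_radial (hwd _)).comp s (hsq s)
    · have h1 : HasDerivAt (fun s => pd 0 w (meridian (√(ρ ^ 2 + s ^ 2)) z)) _ 0 :=
        HasDerivAt.comp (0 : ℝ) (hasDerivAt_meridian_radial (hpd 0 _)) (hsq 0)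
      have h2 : HasDerivAt (fun s : ℝ => s / √(ρ ^ 2 + s ^ 2)) _ 0 :=
        (hasDerivAt_id (0 : ℝ)).div (hsq 0) (by rw [hsqrt0]; exact hρ.ne')
      refine (h1.mul h2).congr_deriv ?_
      simp only [hsqrt0, id]
      field_simp
      ring
  rw [lap, Fin.sum_univ_castSucc, Fin.sum_univ_succ, hfirst, hlast, Finset.sum_congr rfl
    (fun j _ => hinner j)]
  simp

/-- Poisson's equation on `ℝⁿ⁺¹` for an axially symmetric potential, in cylindrical coordinates. -/
theorem axial_poisson {k m : ℕ} (hkm : m = k) (hm : 0 < m) {A c₀ : ℝ} {q w : E 3 → ℝ}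
    {ι : E 3 →ₗᵢ[ℝ] E (k + 1 + 1)} (hι : IsAxialEmbedding ι) (hq : SourceBound A (lift (k + 1) q))
    (hrep : ∀ x, w x = rieszPot m (lift (k + 1) q) (ι x) + c₀) (hw : ContDiff ℝ (2 : ℕ) w)
    {ρ z : ℝ} (hρ : 0 < ρ) (hcont : ContinuousAt q (meridian ρ z)) :
    pd 0 (pd 0 w) (meridian ρ z) + k * (pd 0 w (meridian ρ z) / ρ)
      + pd 2 (pd 2 w) (meridian ρ z) = -newtonConst (k + 1 + 1) m * q (meridian ρ z) := by
  set y : E (k + 1 + 1) := EuclideanSpace.single (Fin.castSucc 0) ρ +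
    EuclideanSpace.single (Fin.last (k + 1)) z with hy
  have h0 : y 0 = ρ := by simp [hy]
  have hj : ∀ j : Fin k, y j.succ.castSucc = 0 := by
    intro j
    simp [hy, Fin.ext_iff]
    omega
  have hz : axialHeight y = z := by simp [hy, axialHeight]
  have hrad : axialRadius y = ρ := by
    refine (sq_eq_sq₀ (axialRadius_nonneg _) hρ.le).1 ?_
    rw [axialRadius_sq, Fin.sum_univ_succ, Finset.sum_eq_zero fun j _ => by rw [hj]; norm_num]
    rw [Fin.castSucc_zero, h0, add_zero]
  have hpos : ∀ᶠ x in 𝓝 y, 0 < axialRadius x :=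
    continuous_axialRadius.continuousAt.eventually_const_lt (by rw [hrad]; exact hρ)
  have h1 := lap_rieszPot_eq (n := k + 1 + 1) (m := m) (by omega) hm hq
    (lift_eq_of_rieszPot hι hrep) (x₀ := y) (continuousAt_lift (by rwa [hrad, hz]))
    (hpos.mono fun x hx => contDiffAt_lift hx hw.contDiffAt)
  rw [lap_lift hw hρ h0 hj hz] at h1
  rw [h1, lift, hrad, hz]

end laplacian

/-! ### Partial derivatives -/

section partial_derivatives

variable {f g : E 3 → ℝ} {x : E 3}

theorem fderiv_eq_sum (f : E 3 → ℝ) (x v : E 3) : fderiv ℝ f x v = ∑ i, v i * pd i f x := by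
  have h : v = ∑ i, v i • EuclideanSpace.single i (1 : ℝ) := by
    ext j; simp [Fin.sum_univ_three]; fin_cases j <;> simp
  conv_lhs => rw [h]
  simp [pd, map_sum]

theorem abs_pd_le (f : E 3 → ℝ) (x : E 3) (i : Fin 3) : |pd i f x| ≤ ‖fderiv ℝ f x‖ := by
  have h := (fderiv ℝ f x).le_opNorm (EuclideanSpace.single i 1)
  simpa [pd] using h

theorem norm_fderiv_le_of_pd {C : ℝ} (hC : 0 ≤ C) (h : ∀ i, |pd i f x| ≤ C) :
    ‖fderiv ℝ f x‖ ≤ 3 * C := by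
  refine ContinuousLinearMap.opNorm_le_bound _ (by positivity) fun v => ?_
  rw [fderiv_eq_sum]
  refine (Finset.abs_sum_le_sum_abs _ _).trans ?_
  have : ∀ i ∈ Finset.univ, |v i * pd i f x| ≤ ‖v‖ * C := by
    intro i _
    rw [abs_mul]
    exact mul_le_mul (by simpa using PiLp.norm_apply_le v i) (h i) (abs_nonneg _) (norm_nonneg _)
  refine (Finset.sum_le_sum this).trans ?_
  simp
  linarith

theorem pd_const (i : Fin 3) (c : ℝ) : pd i (fun _ => c) = fun _ => 0 := by
  funext x; simp [pd]

theorem pd_add (hf : DifferentiableAt ℝ f x) (hg : DifferentiableAt ℝ g x) (i : Fin 3) :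
    pd i (fun y => f y + g y) x = pd i f x + pd i g x := by
  simp only [pd]
  rw [fderiv_fun_add hf hg]
  rfl

theorem pd_sub (hf : DifferentiableAt ℝ f x) (hg : DifferentiableAt ℝ g x) (i : Fin 3) :
    pd i (fun y => f y - g y) x = pd i f x - pd i g x := by
  simp only [pd]
  rw [fderiv_fun_sub hf hg]
  rfl

theorem pd_sub_const (c : ℝ) (i : Fin 3) (f : E 3 → ℝ) : pd i (fun y => f y - c) = pd i f := by
  funext x
  simp only [pd]
  rw [fderiv_sub_const]

theorem pd_mul (hf : DifferentiableAt ℝ f x) (hg : DifferentiableAt ℝ g x) (i : Fin 3) :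
    pd i (fun y => f y * g y) x = pd i f x * g x + f x * pd i g x := by
  simp only [pd]
  rw [fderiv_fun_mul hf hg]
  simp only [add_apply, smul_apply, smul_eq_mul]
  ring

theorem pd_comp {h : ℝ → ℝ} {h' : ℝ} (hh : HasDerivAt h h' (f x)) (hf : DifferentiableAt ℝ f x)
    (i : Fin 3) : pd i (fun y => h (f y)) x = h' * pd i f x := by
  have := (hh.comp_hasFDerivAt x hf.hasFDerivAt).fderiv
  simp only [pd]
  change fderiv ℝ (h ∘ f) x _ = _
  rw [this]
  rfl

theorem differentiable_coord (j : Fin 3) : Differentiable ℝ fun y : E 3 => y j := by fun_prop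

theorem pd_coord (i j : Fin 3) (x : E 3) : pd i (fun y => y j) x = if i = j then 1 else 0 := by
  have h : (fun y : E 3 => y j) = EuclideanSpace.proj (𝕜 := ℝ) j := rfl
  rw [pd, h, ContinuousLinearMap.fderiv]
  simp [eq_comm]

theorem pd_pd_eq {f : E 3 → ℝ} (hf : ContDiffAt ℝ (2 : ℕ) f x) (i j : Fin 3) :
    pd i (pd j f) x =
      fderiv ℝ (fderiv ℝ f) x (EuclideanSpace.single i 1) (EuclideanSpace.single j 1) := by
  have hd : DifferentiableAt ℝ (fderiv ℝ f) x :=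
    (hf.fderiv_right (m := 1) (by norm_num)).differentiableAt (by norm_num)
  have : fderiv ℝ (fun z => fderiv ℝ f z (EuclideanSpace.single j 1)) x =
      (fderiv ℝ (fderiv ℝ f) x).flip (EuclideanSpace.single j 1) := by
    rw [fderiv_clm_apply hd (by fun_prop)]
    ext v; simp
  change fderiv ℝ (fun z => fderiv ℝ f z (EuclideanSpace.single j 1)) x _ = _
  rw [this]
  rfl

theorem pd_comm {f : E 3 → ℝ} (hf : ContDiffAt ℝ (2 : ℕ) f x) (i j : Fin 3) :
    pd i (pd j f) x = pd j (pd i f) x := by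
  have hs : IsSymmSndFDerivAt ℝ f x := hf.isSymmSndFDerivAt (by simp)
  rw [pd_pd_eq hf, pd_pd_eq hf]
  exact hs _ _

theorem laplacian_eq_sum_pd {f : E 3 → ℝ} (hf : ContDiffAt ℝ (2 : ℕ) f x) :
    Laplacian.laplacian f x = pd 0 (pd 0 f) x + pd 1 (pd 1 f) x + pd 2 (pd 2 f) x := by
  rw [InnerProductSpace.laplacian_eq_iteratedFDeriv_orthonormalBasis f
    (EuclideanSpace.basisFun (Fin 3) ℝ)]
  simp only [iteratedFDeriv_two_apply, Fin.sum_univ_three, pd_pd_eq hf]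
  simp

/-- The iterated partial derivative along the letters of the word `l`. -/
def pds (l : List (Fin 3)) (f : E 3 → ℝ) : E 3 → ℝ := l.foldr pd f

theorem pds_cons (i : Fin 3) (l : List (Fin 3)) (f : E 3 → ℝ) : pds (i :: l) f = pd i (pds l f) :=
  rfl

theorem contDiff_pds {k : ℕ} (l : List (Fin 3)) (hf : ContDiff ℝ (k + l.length : ℕ) f) :
    ContDiff ℝ k (pds l f) := by
  induction l generalizing k with
  | nil => simpa [pds] using hf
  | cons i l ih =>
    refine contDiff_pd (k := k) (ih (k := k + 1) ?_) i
    convert hf using 2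
    rw [List.length_cons]
    ring

theorem pds_perm {l l' : List (Fin 3)} (h : l.Perm l') (hf : ContDiff ℝ (l.length : ℕ) f) :
    pds l f = pds l' f := by
  induction h with
  | nil => rfl
  | cons i h ih =>
    rw [pds_cons, pds_cons, ih (hf.of_le (by norm_cast; simp))]
  | swap i j l =>
    funext x
    exact pd_comm (contDiff_pds (k := 2) l (by convert hf using 2; simp; ring)).contDiffAt _ _
  | trans h1 _ ih1 ih2 => exact (ih1 hf).trans (ih2 (by rwa [← h1.length_eq]))

/-- The sorted word with `σ i` letters `i`. -/
def sortedWord (σ : Fin 3 → ℕ) : List (Fin 3) :=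
  List.replicate (σ 0) 0 ++ List.replicate (σ 1) 1 ++ List.replicate (σ 2) 2

theorem length_sortedWord (σ : Fin 3 → ℕ) : (sortedWord σ).length = ∑ i, σ i := by
  simp [sortedWord, Fin.sum_univ_three, add_assoc]

theorem count_sortedWord (σ : Fin 3 → ℕ) (i : Fin 3) : (sortedWord σ).count i = σ i := by
  fin_cases i <;> simp [sortedWord, List.count_replicate]

theorem pds_replicate (n : ℕ) (i : Fin 3) (f : E 3 → ℝ) :
    pds (List.replicate n i) f = (pd i)^[n] f := by
  induction n with
  | zero => rfl
  | succ n ih => rw [List.replicate_succ, pds_cons, ih, Function.iterate_succ_apply']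

theorem pds_append (l l' : List (Fin 3)) (f : E 3 → ℝ) : pds (l ++ l') f = pds l (pds l' f) := by
  simp [pds]

theorem mpd_eq_pds (σ : Fin 3 → ℕ) (f : E 3 → ℝ) : mpd σ f = pds (sortedWord σ) f := by
  rw [sortedWord, pds_append, pds_append, pds_replicate, pds_replicate, pds_replicate, mpd]

theorem sum_count (l : List (Fin 3)) : ∑ i, l.count i = l.length := by
  induction l with
  | nil => simp
  | cons i l ih => simp [List.count_cons, Finset.sum_add_distrib, ih]

theorem pds_eq_mpd (l : List (Fin 3)) (hf : ContDiff ℝ (l.length : ℕ) f) :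
    pds l f = mpd (fun i => l.count i) f := by
  rw [mpd_eq_pds]
  refine pds_perm (List.perm_iff_count.2 fun i => ?_) hf
  rw [count_sortedWord]

theorem abs_mpd_le_of_pds {p : ℕ} {C : ℝ} (h0 : ∀ x, |f x| ≤ C / (1 + ‖x‖) ^ p)
    (h1 : ∀ x i, |pd i f x| ≤ C / (1 + ‖x‖) ^ (p + 1))
    (h2 : ∀ x i j, |pd i (pd j f) x| ≤ C / (1 + ‖x‖) ^ (p + 2)) (σ : Fin 3 → ℕ) (hσ : ∑ i, σ i ≤ 2)
    (x : E 3) : |mpd σ f x| ≤ C / (1 + ‖x‖) ^ (p + ∑ i, σ i) := by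
  rw [mpd_eq_pds]
  rw [← length_sortedWord] at hσ ⊢
  match sortedWord σ, hσ with
  | [], _ => exact h0 x
  | [i], _ => exact h1 x i
  | [i, j], _ => exact h2 x i j

end partial_derivatives

/-! ### Hölder norms -/

section hoelder

variable {f : E 3 → ℝ} {α : ℝ} {k : ℕ}

theorem abs_le_of_supNorm_le {C : ℝ} (hC : 0 ≤ C) (h : supNorm univ f ≤ ENNReal.ofReal C)
    (x : E 3) : |f x| ≤ C := by
  have h1 : ‖f x‖ₑ ≤ ENNReal.ofReal C := le_trans (le_iSup₂_of_le x (mem_univ x) le_rfl) h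
  rw [Real.enorm_eq_ofReal_abs] at h1
  exact (ENNReal.ofReal_le_ofReal_iff hC).1 h1

theorem abs_sub_le_of_holderSeminorm_le {C : ℝ} (hC : 0 ≤ C) (hα : 0 < α)
    (h : holderSeminorm α univ f ≤ ENNReal.ofReal C) (x y : E 3) :
    |f x - f y| ≤ C * ‖x - y‖ ^ α := by
  by_cases hxy : x = y
  · simp [hxy, Real.zero_rpow hα.ne']
  have hpos : 0 < ‖x - y‖ ^ α := Real.rpow_pos_of_pos (norm_pos_iff.2 (sub_ne_zero.2 hxy)) _
  have h1 : ‖f x - f y‖ₑ / ENNReal.ofReal (‖x - y‖ ^ α) ≤ ENNReal.ofReal C := by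
    refine le_trans ?_ h
    exact le_iSup₂_of_le x (mem_univ x) (le_iSup₂_of_le y (mem_univ y)
      (le_iSup_of_le hxy le_rfl))
  rw [ENNReal.div_le_iff (by simpa using hpos) (by simp), ← ENNReal.ofReal_mul hC,
    Real.enorm_eq_ofReal_abs] at h1
  exact (ENNReal.ofReal_le_ofReal_iff (by positivity)).1 h1

theorem mem_multiIndices_count (l : List (Fin 3)) :
    (fun i => l.count i) ∈ multiIndices l.length := by
  rw [multiIndices, Finset.Nat.mem_antidiagonalTuple, sum_count]

theorem abs_pds_le_of_holderNorm_le {C : ℝ} (hC : 0 ≤ C) (hf : ContDiff ℝ (k : ℕ) f)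
    (h : holderNorm k α univ f ≤ ENNReal.ofReal C) (l : List (Fin 3)) (hl : l.length ≤ k)
    (x : E 3) : |pds l f x| ≤ C := by
  rw [pds_eq_mpd l (hf.of_le (by exact_mod_cast hl))]
  refine abs_le_of_supNorm_le hC (le_trans ?_ h) x
  refine le_trans ?_ (le_add_of_nonneg_right (zero_le))
  refine le_trans ?_ (Finset.single_le_sum (f := fun j => ∑ σ ∈ multiIndices j,
    supNorm univ (mpd σ f)) (fun _ _ => zero_le) (Finset.mem_range.2 (Nat.lt_succ_of_le hl)))
  exact Finset.single_le_sum (f := fun σ => supNorm univ (mpd σ f)) (fun _ _ => zero_le)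
    (mem_multiIndices_count l)

theorem abs_pds_sub_le_of_holderNorm_le {C : ℝ} (hC : 0 ≤ C) (hα : 0 < α)
    (hf : ContDiff ℝ (k : ℕ) f) (h : holderNorm k α univ f ≤ ENNReal.ofReal C)
    (l : List (Fin 3)) (hl : l.length = k) (x y : E 3) :
    |pds l f x - pds l f y| ≤ C * ‖x - y‖ ^ α := by
  rw [pds_eq_mpd l (by rwa [hl])]
  refine abs_sub_le_of_holderSeminorm_le hC hα (le_trans ?_ h) x y
  refine le_trans ?_ (le_add_of_nonneg_left (zero_le))
  refine Finset.single_le_sum (f := fun σ => holderSeminorm α univ (mpd σ f)) (fun _ _ => zero_le)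
    ?_
  rw [← hl]
  exact mem_multiIndices_count l

theorem supNorm_le_of_abs_le {C : ℝ} (h : ∀ x, |f x| ≤ C) :
    supNorm univ f ≤ ENNReal.ofReal C := by
  refine iSup₂_le fun x _ => ?_
  rw [Real.enorm_eq_ofReal_abs]
  exact ENNReal.ofReal_le_ofReal (h x)

theorem memHolder_two {C : ℝ} (hf : ContDiff ℝ (2 : ℕ) f)
    (h0 : ∀ x, |f x| ≤ C) (h1 : ∀ x i, |pd i f x| ≤ C) (h2 : ∀ x i j, |pd i (pd j f) x| ≤ C)
    (h3 : ∀ x y i j, |pd i (pd j f) x - pd i (pd j f) y| ≤ C * ‖x - y‖ ^ α) :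
    MemHolder 2 α univ f := by
  refine ⟨hf.contDiffOn, ENNReal.add_lt_top.2 ⟨?_, ?_⟩⟩
  · refine ENNReal.sum_lt_top.2 fun j hj => ENNReal.sum_lt_top.2 fun σ hσ => ?_
    rw [multiIndices, Finset.Nat.mem_antidiagonalTuple, ← length_sortedWord] at hσ
    rw [Finset.mem_range] at hj
    refine lt_of_le_of_lt (supNorm_le_of_abs_le (C := C) fun x => ?_) ENNReal.ofReal_lt_top
    rw [mpd_eq_pds]
    have hl : (sortedWord σ).length ≤ 2 := by omega
    match sortedWord σ, hl with
    | [], _ => exact h0 x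
    | [i], _ => exact h1 x i
    | [i, j], _ => exact h2 x i j
  · refine ENNReal.sum_lt_top.2 fun σ hσ => ?_
    rw [multiIndices, Finset.Nat.mem_antidiagonalTuple, ← length_sortedWord] at hσ
    refine lt_of_le_of_lt (b := ENNReal.ofReal C) ?_ ENNReal.ofReal_lt_top
    refine iSup₂_le fun x _ => iSup₂_le fun y _ => iSup_le fun hxy => ?_
    have hpos : 0 < ‖x - y‖ ^ α := Real.rpow_pos_of_pos (norm_pos_iff.2 (sub_ne_zero.2 hxy)) _
    have hC : 0 ≤ C := (abs_nonneg _).trans (h0 0)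
    rw [ENNReal.div_le_iff (by simpa using hpos) (by simp), ← ENNReal.ofReal_mul hC,
      Real.enorm_eq_ofReal_abs]
    refine ENNReal.ofReal_le_ofReal ?_
    rw [mpd_eq_pds]
    match sortedWord σ, hσ with
    | [i, j], _ => exact h3 x y i j

end hoelder

/-! ### Derivatives of axially symmetric functions -/

section axially_symmetric

variable {f : E 3 → ℝ}

theorem fderiv_eq_zero_of_reflection {x u : E 3}
    (hf : ∀ y, f ((ℝ ∙ u)ᗮ.reflection y) = f y) (hd : DifferentiableAt ℝ f x)
    (hux : inner ℝ u x = (0 : ℝ)) : fderiv ℝ f x u = 0 := by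
  set T := (ℝ ∙ u)ᗮ.reflection
  have hTx : T x = x := by
    refine Submodule.reflection_mem_subspace_eq_self ?_
    rwa [Submodule.mem_orthogonal_singleton_iff_inner_right]
  have hTu : T u = -u := Submodule.reflection_orthogonalComplement_singleton_eq_neg u
  have hfT : f ∘ T = f := funext hf
  have hd' : DifferentiableAt ℝ f (T x) := by rwa [hTx]
  have h := fderiv_comp x hd' T.toContinuousLinearEquiv.differentiableAt
  have h' : fderiv ℝ (f ∘ T) x u = -fderiv ℝ f x u := by
    have h2 := congrArg (fun A => A u) h
    simp only [ContinuousLinearMap.comp_apply] at h2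
    have h3 : fderiv ℝ T x u = T u := by
      have := ContinuousLinearEquiv.fderiv T.toContinuousLinearEquiv (x := x)
      exact congrArg (fun A => A u) this
    rw [h3, hTx, hTu, map_neg] at h2
    exact h2
  rw [hfT] at h'
  linarith

/-- Derivatives in angular direction vanish, on the axis all horizontal ones. -/
theorem fderiv_eq_zero_of_axial (hf : AxiallySymmetricOn univ f) {x u : E 3}
    (hd : DifferentiableAt ℝ f x) (hu : axialHeight u = 0) (hux : inner ℝ u x = (0 : ℝ)) :
    fderiv ℝ f x u = 0 := by
  refine fderiv_eq_zero_of_reflection (fun y => ?_) hd hux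
  obtain ⟨h1, h2⟩ := axial_reflection hu y
  exact hf _ (mem_univ _) _ (mem_univ _) h2 h1

theorem axial_rotation (hf : AxiallySymmetricOn univ f) {x : E 3} (hd : DifferentiableAt ℝ f x) :
    x 0 * pd 1 f x = x 1 * pd 0 f x := by
  have h := fderiv_eq_zero_of_axial hf hd (u := !₂[-x 1, x 0, 0]) (by simp [axialHeight])
    (by simp [PiLp.inner_apply, Fin.sum_univ_three]; ring)
  rw [fderiv_eq_sum] at h
  simp [Fin.sum_univ_three] at h
  linarith

theorem pd_one_meridian (hf : AxiallySymmetricOn univ f) {ρ z : ℝ}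
    (hd : DifferentiableAt ℝ f (meridian ρ z)) : pd 1 f (meridian ρ z) = 0 :=
  fderiv_eq_zero_of_axial hf hd (by simp [axialHeight, Fin.last])
    (by simp [EuclideanSpace.inner_single_left, meridian])

theorem pd_zero_meridian_zero (hf : AxiallySymmetricOn univ f) {z : ℝ}
    (hd : DifferentiableAt ℝ f (meridian 0 z)) : pd 0 f (meridian 0 z) = 0 :=
  fderiv_eq_zero_of_axial hf hd (by simp [axialHeight, Fin.last])
    (by simp [EuclideanSpace.inner_single_left, meridian])

/-- `ρ ∂_ρ f` in Cartesian coordinates. -/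
def euler (f : E 3 → ℝ) (x : E 3) : ℝ := x 0 * pd 0 f x + x 1 * pd 1 f x

theorem contDiff_euler {k : ℕ} (hf : ContDiff ℝ (k + 1 : ℕ) f) : ContDiff ℝ k (euler f) := by
  unfold euler
  have h0 := contDiff_pd hf 0
  have h1 := contDiff_pd hf 1
  fun_prop

theorem AxiallySymmetricOn.eq_meridian (hf : AxiallySymmetricOn univ f) (x : E 3) :
    f x = f (meridian (axialRadius x) (axialHeight x)) :=
  hf _ (mem_univ _) _ (mem_univ _)
    (by rw [axialRadius_meridian, abs_of_nonneg (axialRadius_nonneg _)]) rfl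

theorem AxiallySymmetricOn.pd_two (hf : AxiallySymmetricOn univ f) (hd : Differentiable ℝ f) :
    AxiallySymmetricOn univ (pd 2 f) := by
  intro x _ y _ hr hz
  have h1 : ∀ w : E 3, HasDerivAt (fun s : ℝ => f (w + s • EuclideanSpace.single 2 1))
      (pd 2 f w) 0 := by
    intro w
    have := hasDerivAt_comp_line w (EuclideanSpace.single 2 1) (s := 0) (hd (w + _))
    simpa [pd] using this
  refine (h1 x).unique ((h1 y).congr_of_eventuallyEq (Eventually.of_forall fun s => ?_))
  refine hf _ (mem_univ _) _ (mem_univ _) ?_ ?_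
  · exact (axialRadius_add_smul_last x s).trans (hr.trans (axialRadius_add_smul_last y s).symm)
  · rw [show (2 : Fin 3) = Fin.last 2 from rfl, axialHeight_add_smul_last,
      axialHeight_add_smul_last, hz]

theorem AxiallySymmetricOn.euler (hf : AxiallySymmetricOn univ f) (hd : Differentiable ℝ f) :
    AxiallySymmetricOn univ (euler f) := by
  intro x _ y _ hr hz
  have h1 : ∀ w : E 3, HasDerivAt (fun s : ℝ => f (w + s • !₂[w 0, w 1, 0]))
      (RotatingEV.euler f w) 0 := by
    intro w
    have := hasDerivAt_comp_line w !₂[w 0, w 1, 0] (s := 0) (hd (w + _))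
    rw [fderiv_eq_sum] at this
    simpa [Fin.sum_univ_three, RotatingEV.euler] using this
  refine (h1 x).unique ((h1 y).congr_of_eventuallyEq (Eventually.of_forall fun s => ?_))
  have hrad : ∀ w : E 3, axialRadius (w + s • !₂[w 0, w 1, 0]) = |1 + s| * axialRadius w := by
    intro w
    rw [axialRadius_three, axialRadius_three, ← Real.sqrt_sq_eq_abs, ← Real.sqrt_mul (sq_nonneg _)]
    congr 1
    simp
    ring
  refine hf _ (mem_univ _) _ (mem_univ _) ?_ ?_
  · rw [hrad, hrad, hr]
  · rw [axialHeight_three, axialHeight_three] at hz ⊢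
    simpa using hz

theorem axialRadius_sq_mul_pd_zero (hf : AxiallySymmetricOn univ f) {x : E 3}
    (hd : DifferentiableAt ℝ f x) : axialRadius x ^ 2 * pd 0 f x = x 0 * euler f x := by
  rw [axialRadius_sq_three, euler]
  linear_combination -x 1 * axial_rotation hf hd

theorem axialRadius_sq_mul_pd_one (hf : AxiallySymmetricOn univ f) {x : E 3}
    (hd : DifferentiableAt ℝ f x) : axialRadius x ^ 2 * pd 1 f x = x 1 * euler f x := by
  rw [axialRadius_sq_three, euler]
  linear_combination x 0 * axial_rotation hf hd

theorem pd_euler (hf : ContDiff ℝ (2 : ℕ) f) (i : Fin 3) (x : E 3) :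
    pd i (euler f) x = (if i = 0 then 1 else 0) * pd 0 f x + x 0 * pd i (pd 0 f) x +
      ((if i = 1 then 1 else 0) * pd 1 f x + x 1 * pd i (pd 1 f) x) := by
  have hd : ∀ j, DifferentiableAt ℝ (pd j f) x := fun j =>
    (contDiff_pd (k := 1) hf j).differentiable (by norm_num) x
  have hc : ∀ j : Fin 3, DifferentiableAt ℝ (fun y : E 3 => y j) x := fun j =>
    differentiable_coord j x
  unfold euler
  rw [pd_add (f := fun y => y 0 * pd 0 f y) (g := fun y => y 1 * pd 1 f y)
    ((hc 0).mul (hd 0)) ((hc 1).mul (hd 1)), pd_mul (hc 0) (hd 0), pd_mul (hc 1) (hd 1),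
    pd_coord, pd_coord]

/-- `ρ²(∂₁∂₁ + ∂₂∂₂) f = (ρ ∂_ρ)² f`. -/
theorem axialRadius_sq_mul_horizontal_laplacian (hf : AxiallySymmetricOn univ f)
    (hc : ContDiff ℝ (2 : ℕ) f) (x : E 3) :
    axialRadius x ^ 2 * (pd 0 (pd 0 f) x + pd 1 (pd 1 f) x) = euler (euler f) x := by
  have hfd : Differentiable ℝ f := hc.differentiable (by norm_num)
  have hd : ∀ j, DifferentiableAt ℝ (pd j f) x := fun j =>
    (contDiff_pd (k := 1) hc j).differentiable (by norm_num) x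
  have hcd : ∀ j : Fin 3, DifferentiableAt ℝ (fun y : E 3 => y j) x := fun j =>
    differentiable_coord j x
  have hrot : (fun y : E 3 => y 0 * pd 1 f y) = fun y => y 1 * pd 0 f y :=
    funext fun y => axial_rotation hf (hfd y)
  have h0 := congrFun (congrArg (pd 0) hrot) x
  have h1 := congrFun (congrArg (pd 1) hrot) x
  rw [pd_mul (hcd 0) (hd 1), pd_mul (hcd 1) (hd 0), pd_coord, pd_coord] at h0 h1
  rw [pd_comm hc.contDiffAt 0 1] at h0
  simp at h0 h1
  rw [euler, pd_euler hc, pd_euler hc, pd_comm hc.contDiffAt 0 1, axialRadius_sq_three]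
  simp
  linear_combination -x 1 * h0 + x 0 * h1

end axially_symmetric

/-! ### The Newtonian potential outside the matter -/

section newton

variable {φ : ℝ → ℝ} {E₀ RN Uinf : ℝ} {U : E 3 → ℝ}

theorem CondPhi2.pos_radius (h1 : CondPhi1 φ E₀) (h2 : CondPhi2 φ E₀ U RN) : 0 < RN := by
  by_contra h
  have h0 := h1.pos_cutoff
  have hU := h2.normalized
  rcases lt_or_eq_of_le (not_lt.1 h) with h | h
  · have := h2.gt_outside 0 (by simpa using h)
    linarith
  · have := h2.eq_at 0 (by simp [h])
    linarith

theorem CondPhi2.newtonDensity_eq_zero (h1 : CondPhi1 φ E₀) (h2 : CondPhi2 φ E₀ U RN) {x : E 3}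
    (hx : RN ≤ ‖x‖) : newtonDensity φ U x = 0 := by
  have hU : E₀ ≤ U x := by
    rcases hx.eq_or_lt with h | h
    · exact (h2.eq_at x h.symm).ge
    · exact (h2.gt_outside x h).le
  unfold newtonDensity
  rw [integral_eq_zero_of_ae]
  refine Eventually.of_forall fun v => h1.eq_zero _ ?_
  have : 0 ≤ ‖v‖ ^ 2 / 2 := by positivity
  linarith

theorem norm_meridian_zero {r : ℝ} (hr : 0 ≤ r) : ‖meridian r 0‖ = r := by
  refine (sq_eq_sq₀ (norm_nonneg _) hr).1 ?_
  rw [norm_sq_meridian]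
  ring

/-- `ΔU = U'' + 2U'/r` for spherically symmetric `U`. -/
theorem mul_laplacian_radial (hU : ContDiff ℝ (2 : ℕ) U) (hrad : ∀ x y, ‖x‖ = ‖y‖ → U x = U y)
    (r : ℝ) : r * Laplacian.laplacian U (meridian r 0) =
      r * pd 0 (pd 0 U) (meridian r 0) + 2 * pd 0 U (meridian r 0) := by
  have hd : Differentiable ℝ U := hU.differentiable (by norm_num)
  have hpd : ∀ i, Differentiable ℝ (pd i U) := fun i =>
    (contDiff_pd (k := 1) hU i).differentiable (by norm_num)
  have h1 : ∀ x : E 3, x 0 * pd 1 U x = x 1 * pd 0 U x := by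
    intro x
    have h := fderiv_eq_zero_of_reflection (f := U) (x := x) (u := !₂[-x 1, x 0, 0])
      (fun y => hrad _ _ (LinearIsometryEquiv.norm_map _ _)) (hd x)
      (by simp [PiLp.inner_apply, Fin.sum_univ_three]; ring)
    rw [fderiv_eq_sum] at h
    simp [Fin.sum_univ_three] at h
    linarith
  have h2 : ∀ x : E 3, x 0 * pd 2 U x = x 2 * pd 0 U x := by
    intro x
    have h := fderiv_eq_zero_of_reflection (f := U) (x := x) (u := !₂[-x 2, 0, x 0])
      (fun y => hrad _ _ (LinearIsometryEquiv.norm_map _ _)) (hd x)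
      (by simp [PiLp.inner_apply, Fin.sum_univ_three]; ring)
    rw [fderiv_eq_sum] at h
    simp [Fin.sum_univ_three] at h
    linarith
  -- Differentiating the two identities gives the second derivatives across the ray.
  have h3 := congrFun (congrArg (pd 1) (funext h1)) (meridian r 0)
  have h4 := congrFun (congrArg (pd 2) (funext h2)) (meridian r 0)
  rw [pd_mul (differentiable_coord _ _) (hpd _ _), pd_mul (differentiable_coord _ _) (hpd _ _),
    pd_coord, pd_coord] at h3 h4
  simp [meridian_zero_coord, meridian_one_coord, meridian_two_coord] at h3 h4
  rw [laplacian_eq_sum_pd hU.contDiffAt]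
  linear_combination h3 + h4

/-- Outside the matter `U` is harmonic, so `(rU)'' = 0`. -/
theorem CondPhi2.exists_exterior (h1 : CondPhi1 φ E₀) (h2 : CondPhi2 φ E₀ U RN) :
    ∃ c d : ℝ, ∀ r, RN ≤ r → r * U (meridian r 0) = c * r + d := by
  have hRN := h2.pos_radius h1
  have hU : ContDiff ℝ (2 : ℕ) U := h2.contDiff
  have hd : Differentiable ℝ U := hU.differentiable (by norm_num)
  have hpd : Differentiable ℝ (pd 0 U) :=
    (contDiff_pd (k := 1) hU 0).differentiable (by norm_num)
  set g : ℝ → ℝ := fun r => U (meridian r 0) + r * pd 0 U (meridian r 0) with hg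
  have hg1 : ∀ r, HasDerivAt (fun r => r * U (meridian r 0)) (g r) r := by
    intro r
    refine ((hasDerivAt_id r).mul (hasDerivAt_meridian_radial (hd _))).congr_deriv ?_
    simp [hg]
  have hg2 : ∀ r, HasDerivAt g (r * Laplacian.laplacian U (meridian r 0)) r := by
    intro r
    refine ((hasDerivAt_meridian_radial (hd _)).add
      ((hasDerivAt_id r).mul (hasDerivAt_meridian_radial (hpd _)))).congr_deriv ?_
    rw [mul_laplacian_radial hU h2.radial]
    simp only [id]
    ring
  have hg3 : ∀ r, RN ≤ r → g r = g RN := by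
    intro r hr
    refine constant_of_has_deriv_right_zero (a := RN) (b := r)
      (fun s _ => (hg2 s).continuousAt.continuousWithinAt) (fun s hs => ?_) r ⟨hr, le_rfl⟩
    have := (hg2 s).hasDerivWithinAt (s := Ici s)
    rwa [h2.poisson, h2.newtonDensity_eq_zero h1
      (by rw [norm_meridian_zero (hRN.le.trans hs.1)]; exact hs.1), mul_zero, mul_zero] at this
  refine ⟨g RN, RN * U (meridian RN 0) - g RN * RN, fun r hr => ?_⟩
  have hk : ∀ s, HasDerivAt (fun s => s * U (meridian s 0) - g RN * s) (g s - g RN) s := by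
    intro s
    refine ((hg1 s).sub ((hasDerivAt_id s).const_mul (g RN))).congr_deriv ?_
    simp
  have := constant_of_has_deriv_right_zero (a := RN) (b := r)
    (fun s _ => (hk s).continuousAt.continuousWithinAt) (fun s hs => ?_) r ⟨hr, le_rfl⟩
  · linarith
  · have h := (hk s).hasDerivWithinAt (s := Ici s)
    rwa [hg3 s hs.1, sub_self] at h

/-- Outside the matter `U = c + d / r`, and `U` grows beyond its value `E₀` at `r = R_N`, so the limit
`c` exceeds `E₀`. -/
theorem CondPhi2.lt_limit (h1 : CondPhi1 φ E₀) (h2 : CondPhi2 φ E₀ U RN)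
    (hlim : Tendsto U (cocompact (E 3)) (𝓝 Uinf)) : E₀ < Uinf := by
  have hRN := h2.pos_radius h1
  obtain ⟨c, d, hcd⟩ := h2.exists_exterior h1
  have hray : Tendsto (fun r : ℝ => meridian r 0) atTop (cocompact (E 3)) := by
    refine tendsto_cocompact_of_tendsto_dist_comp_atTop 0 ?_
    refine tendsto_id.congr' ?_
    filter_upwards [eventually_ge_atTop 0] with r hr
    rw [dist_zero_right, norm_meridian_zero hr, id]
  have hlim2 : Tendsto (fun r : ℝ => c + d / r) atTop (𝓝 (c + 0)) :=
    tendsto_const_nhds.add (tendsto_const_nhds.div_atTop tendsto_id)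
  have hc : Uinf = c := by
    rw [← add_zero c]
    refine tendsto_nhds_unique (hlim.comp hray) (hlim2.congr' ?_)
    filter_upwards [eventually_ge_atTop RN] with r hr
    have hr0 : r ≠ 0 := (hRN.trans_le hr).ne'
    have := hcd r hr
    simp only [Function.comp]
    field_simp
    linarith
  have hR := hcd RN le_rfl
  rw [h2.eq_at _ (norm_meridian_zero hRN.le)] at hR
  have hR2 := hcd (RN + 1) (by linarith)
  have hgt := h2.gt_outside (meridian (RN + 1) 0)
    (by rw [norm_meridian_zero (by linarith)]; linarith)
  have : (RN + 1) * E₀ < c * (RN + 1) + d := by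
    rw [← hR2]; exact mul_lt_mul_of_pos_left hgt (by linarith)
  rw [hc]
  nlinarith

/-- A lower bound on an open exterior region extends to its boundary sphere, along rays. -/
theorem le_of_norm_ge {R a : ℝ} (hR0 : 0 < R) (hU : Continuous U)
    (hR : ∀ x : E 3, R < ‖x‖ → a < U x) {x : E 3} (hx : R ≤ ‖x‖) : a ≤ U x := by
  have hx0 : 0 < ‖x‖ := hR0.trans_le hx
  have hlim : Tendsto (fun s : ℝ => U (s • x)) (𝓝[>] 1) (𝓝 (U x)) := by
    have : Continuous fun s : ℝ => U (s • x) := by fun_prop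
    have h := this.tendsto 1
    rw [one_smul] at h
    exact h.mono_left nhdsWithin_le_nhds
  refine ge_of_tendsto hlim ?_
  filter_upwards [self_mem_nhdsWithin] with s hs
  refine (hR _ ?_).le
  have hs : (1 : ℝ) < s := hs
  rw [norm_smul, Real.norm_of_nonneg (by linarith)]
  nlinarith

end newton

/-! ### The energy function -/

section energy

/-- `m²/B²` as a function of the energy, continued to an increasing `C¹` function on `ℝ`:
the square `(1 + γ e)²` is replaced by `(1 + γ e) |1 + γ e|`. -/
def energyFun (γ ν e : ℝ) : ℝ :=
  if γ = 0 then 2 * (e - ν)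
  else (Real.exp (-4 * γ * ν) * ((1 + γ * e) * |1 + γ * e|) - Real.exp (-2 * γ * ν)) / γ

variable {γ ν : ℝ}

theorem hasDerivAt_mul_abs (t : ℝ) : HasDerivAt (fun t : ℝ => t * |t|) (2 * |t|) t := by
  refine hasDerivAt_of_hasDerivAt_of_ne' (x := 0) (f := fun t : ℝ => t * |t|)
    (g := fun t : ℝ => 2 * |t|) (fun y hy => ?_) (by fun_prop) (by fun_prop) t
  rcases lt_or_gt_of_ne hy with h | h
  · have h1 : HasDerivAt (fun t : ℝ => t * |t|) (1 * |y| + y * -1) y :=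
      (hasDerivAt_id y).mul (hasDerivAt_abs_neg h)
    refine h1.congr_deriv ?_
    rw [abs_of_neg h]; ring
  · have h1 : HasDerivAt (fun t : ℝ => t * |t|) (1 * |y| + y * 1) y :=
      (hasDerivAt_id y).mul (hasDerivAt_abs_pos h)
    refine h1.congr_deriv ?_
    rw [abs_of_pos h]; ring

theorem strictMono_mul_abs : StrictMono fun t : ℝ => t * |t| := by
  intro a b hab
  simp only
  rcases le_total 0 a with ha | ha
  · rw [abs_of_nonneg ha, abs_of_nonneg (ha.trans hab.le)]; nlinarith
  · rcases le_total 0 b with hb | hb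
    · rw [abs_of_nonpos ha, abs_of_nonneg hb]
      rcases ha.eq_or_lt with h | h
      · subst h; nlinarith
      · nlinarith
    · rw [abs_of_nonpos ha, abs_of_nonpos hb]; nlinarith

theorem strictMono_energyFun (hγ : 0 ≤ γ) : StrictMono (energyFun γ ν) := by
  intro a b hab
  unfold energyFun
  split_ifs with h
  · linarith
  · have hγ' : 0 < γ := lt_of_le_of_ne hγ (Ne.symm h)
    refine div_lt_div_of_pos_right ?_ hγ'
    have h1 : 1 + γ * a < 1 + γ * b := by nlinarith
    have h2 := mul_lt_mul_of_pos_left (strictMono_mul_abs h1) (Real.exp_pos (-4 * γ * ν))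
    simp only at h2
    linarith

theorem energyFun_etaMin (γ ν : ℝ) : energyFun γ ν (etaMin γ ν) = 0 := by
  unfold energyFun etaMin
  split_ifs with h
  · ring
  · have h1 : 1 + γ * ((Real.exp (γ * ν) - 1) / γ) = Real.exp (γ * ν) := by field_simp; ring
    rw [h1, abs_of_pos (Real.exp_pos _), ← Real.exp_add, ← Real.exp_add]
    rw [div_eq_zero_iff, sub_eq_zero]
    left
    congr 1
    ring

theorem energyFun_pos_iff (hγ : 0 ≤ γ) {e : ℝ} : 0 < energyFun γ ν e ↔ etaMin γ ν < e := by
  rw [← energyFun_etaMin γ ν]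
  exact (strictMono_energyFun hγ).lt_iff_lt

theorem le_etaMin (hγ : 0 ≤ γ) (ν : ℝ) : ν ≤ etaMin γ ν := by
  unfold etaMin
  split_ifs with h
  · exact le_rfl
  · have hγ' : 0 < γ := lt_of_le_of_ne hγ (Ne.symm h)
    rw [le_div_iff₀ hγ']
    have := Real.add_one_le_exp (γ * ν)
    linarith

theorem one_add_pos_of_etaMin_lt (hγ : 0 ≤ γ) {e : ℝ} (he : etaMin γ ν < e) : 0 < 1 + γ * e := by
  unfold etaMin at he
  split_ifs at he with h
  · rw [h]; norm_num
  · have hγ' : 0 < γ := lt_of_le_of_ne hγ (Ne.symm h)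
    rw [div_lt_iff₀ hγ'] at he
    have := Real.exp_pos (γ * ν)
    linarith

theorem mul_energyFun {e : ℝ} (he : 0 ≤ 1 + γ * e) : γ * energyFun γ ν e =
    Real.exp (-4 * γ * ν) * (1 + γ * e) ^ 2 - Real.exp (-2 * γ * ν) := by
  unfold energyFun
  split_ifs with h
  · simp [h]
  · rw [abs_of_nonneg he]
    field_simp

theorem mBound_eq (hγ : 0 ≤ γ) {e : ℝ} (he : etaMin γ ν < e) (B : ℝ) :
    mBound γ e B ν = B * √(energyFun γ ν e) := by
  have h1 := one_add_pos_of_etaMin_lt hγ he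
  unfold mBound energyFun
  rw [mul_assoc]
  congr 1
  rw [← Real.sqrt_sq (Real.exp_pos (-γ * ν)).le, ← Real.sqrt_mul (sq_nonneg _)]
  congr 1
  split_ifs with h
  · simp [h]
  · rw [abs_of_pos h1]
    have e1 : Real.exp (-γ * ν) ^ 2 = Real.exp (-2 * γ * ν) := by
      rw [← Real.exp_nat_mul]; congr 1; push_cast; ring
    have e2 : Real.exp (-4 * γ * ν) = Real.exp (-2 * γ * ν) * Real.exp (-2 * γ * ν) := by
      rw [← Real.exp_add]; congr 1; ring
    rw [e1, e2]
    ring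

theorem continuous_energyFun (γ : ℝ) : Continuous fun p : ℝ × ℝ => energyFun γ p.1 p.2 := by
  unfold energyFun
  split_ifs with h
  · fun_prop
  · fun_prop

theorem hasDerivAt_energyFun {f g : ℝ → ℝ} {f' g' s : ℝ} (hf : HasDerivAt f f' s)
    (hg : HasDerivAt g g' s) : HasDerivAt (fun s => energyFun γ (f s) (g s))
      (f' * (-4 * Real.exp (-4 * γ * f s) * ((1 + γ * g s) * |1 + γ * g s|)
        + 2 * Real.exp (-2 * γ * f s))
        + g' * (2 * Real.exp (-4 * γ * f s) * |1 + γ * g s|)) s := by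
  unfold energyFun
  split_ifs with h
  · refine ((hg.sub hf).const_mul 2).congr_deriv ?_
    simp [h]; ring
  · have h1 : HasDerivAt (fun s => Real.exp (-4 * γ * f s))
        (Real.exp (-4 * γ * f s) * (-4 * γ * f')) s := (hf.const_mul (-4 * γ)).exp
    have h2 : HasDerivAt (fun s => Real.exp (-2 * γ * f s))
        (Real.exp (-2 * γ * f s) * (-2 * γ * f')) s := (hf.const_mul (-2 * γ)).exp
    have h3 : HasDerivAt (fun s => (1 + γ * g s) * |1 + γ * g s|)
        (2 * |1 + γ * g s| * (γ * g')) s :=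
      (hasDerivAt_mul_abs _).comp s ((hg.const_mul γ).const_add 1)
    refine (((h1.mul h3).sub h2).div_const γ).congr_deriv ?_
    field_simp
    ring

end energy

/-! ### Matter integrals in the variables energy and angular momentum -/

section matter

/-- The condition `0 < matterY` describes the domain of the matter integrals in the variables
`(L, η)`, where `L` is the angular momentum and `W = ρB`. -/
def matterY (γ ν ω W : ℝ) (p : ℝ × ℝ) : ℝ := energyFun γ ν (p.2 - p.1 * ω) - p.1 ^ 2 / W ^ 2

/-- `∫ w φ(η) χ(L)` over `0 < matterY`. -/
def matI (φ χ : ℝ → ℝ) (γ ν ω W : ℝ) (w : ℝ × ℝ → ℝ) : ℝ :=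
  ∫ p, {p | 0 < matterY γ ν ω W p}.indicator (fun p => w p * (φ p.2 * χ p.1)) p

/-- `∫ max(matterY, 0) φ(η) χ(L)`, the potential from which all matter terms derive. -/
def matJ (φ χ : ℝ → ℝ) (γ ν ω W : ℝ) : ℝ :=
  ∫ p : ℝ × ℝ, max (matterY γ ν ω W p) 0 * (φ p.2 * χ p.1)

theorem integrable_indicator_of_compact {U K : Set (ℝ × ℝ)} (hU : IsOpen U) (hK : IsCompact K)
    {g : ℝ × ℝ → ℝ} (hg : Continuous g) (h : ∀ p ∈ U, g p ≠ 0 → p ∈ K) :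
    Integrable (U.indicator g) := by
  have h1 : Integrable (K.indicator g) :=
    (hg.continuousOn.integrableOn_compact hK).integrable_indicator hK.measurableSet
  have h2 : U.indicator g = U.indicator (K.indicator g) := by
    funext p
    by_cases hp : p ∈ U
    · rw [indicator_of_mem hp, indicator_of_mem hp]
      by_cases hpK : p ∈ K
      · rw [indicator_of_mem hpK]
      · rw [indicator_of_notMem hpK]
        by_contra hne
        exact hpK (h p hp hne)
    · rw [indicator_of_notMem hp, indicator_of_notMem hp]
  rw [h2]
  exact h1.indicator hU.measurableSet

variable {φ χ : ℝ → ℝ} {E₀ L₀ γ : ℝ}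

theorem continuous_matterY (γ ν ω W : ℝ) : Continuous (matterY γ ν ω W) := by
  unfold matterY
  have h1 : Continuous fun p : ℝ × ℝ => (ν, p.2 - p.1 * ω) := by fun_prop
  have h2 := (continuous_energyFun γ).comp h1
  exact h2.sub (by fun_prop)

theorem isOpen_matterY_pos (γ ν ω W : ℝ) : IsOpen {p | 0 < matterY γ ν ω W p} :=
  isOpen_lt continuous_const (continuous_matterY _ _ _ _)

theorem etaMin_lt_of_matterY_pos (hγ : 0 ≤ γ) {ν ω W : ℝ} {p : ℝ × ℝ}
    (hp : 0 < matterY γ ν ω W p) : etaMin γ ν < p.2 - p.1 * ω := by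
  rw [← energyFun_pos_iff hγ]
  unfold matterY at hp
  have : 0 ≤ p.1 ^ 2 / W ^ 2 := by positivity
  linarith

/-- The cut-offs of `φ` and `χ` confine the matter integrals to a rectangle. -/
theorem mem_box_of_matterY_pos (hγ : 0 ≤ γ) (hφ : ∀ η, E₀ ≤ η → φ η = 0)
    (hχ : ∀ L, L₀ < |L| → χ L = 0) {ν ω W : ℝ} {p : ℝ × ℝ}
    (hp : 0 < matterY γ ν ω W p) (hne : φ p.2 * χ p.1 ≠ 0) :
    |p.1| ≤ L₀ ∧ ν - L₀ * |ω| ≤ p.2 ∧ p.2 ≤ E₀ := by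
  have h1 : |p.1| ≤ L₀ := by
    by_contra h
    exact hne (by rw [hχ _ (not_le.1 h), mul_zero])
  have h2 : p.2 ≤ E₀ := by
    by_contra h
    exact hne (by rw [hφ _ (not_le.1 h).le, zero_mul])
  refine ⟨h1, ?_, h2⟩
  have h3 := etaMin_lt_of_matterY_pos hγ hp
  have h4 := le_etaMin hγ ν
  have h5 : |p.1 * ω| ≤ L₀ * |ω| := by
    rw [abs_mul]; exact mul_le_mul_of_nonneg_right h1 (abs_nonneg _)
  have h6 := neg_abs_le (p.1 * ω)
  linarith

theorem mem_Icc_prod {L₀ a b : ℝ} {p : ℝ × ℝ} (h : |p.1| ≤ L₀ ∧ a ≤ p.2 ∧ p.2 ≤ b) :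
    p ∈ Icc (-L₀) L₀ ×ˢ Icc a b :=
  ⟨⟨(abs_le.1 h.1).1, (abs_le.1 h.1).2⟩, h.2⟩

theorem integrable_matI (hγ : 0 ≤ γ) (hφc : Continuous φ) (hχc : Continuous χ)
    (hφ : ∀ η, E₀ ≤ η → φ η = 0) (hχ : ∀ L, L₀ < |L| → χ L = 0) (ν ω W : ℝ) {w : ℝ × ℝ → ℝ}
    (hw : Continuous w) :
    Integrable ({p | 0 < matterY γ ν ω W p}.indicator (fun p => w p * (φ p.2 * χ p.1))) := by
  refine integrable_indicator_of_compact (isOpen_matterY_pos _ _ _ _)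
    (K := Icc (-L₀) L₀ ×ˢ Icc (ν - L₀ * |ω|) E₀)
    (isCompact_Icc.prod isCompact_Icc) (by fun_prop) fun p hp hne => ?_
  exact mem_Icc_prod (mem_box_of_matterY_pos hγ hφ hχ hp (right_ne_zero_of_mul hne))

theorem matI_eq_zero (hγ : 0 ≤ γ) (hφ : ∀ η, E₀ ≤ η → φ η = 0)
    (hχ : ∀ L, L₀ < |L| → χ L = 0) {ν ω W : ℝ} (hν : E₀ + L₀ * |ω| ≤ ν) (w : ℝ × ℝ → ℝ) :
    matI φ χ γ ν ω W w = 0 := by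
  unfold matI
  rw [integral_eq_zero_of_ae]
  refine Eventually.of_forall fun p => ?_
  refine indicator_apply_eq_zero.2 fun hp => ?_
  by_contra hne
  obtain ⟨h1, h2, h3⟩ := mem_box_of_matterY_pos hγ hφ hχ hp (right_ne_zero_of_mul hne)
  have : p.2 = E₀ := le_antisymm h3 (by linarith)
  exact right_ne_zero_of_mul hne (by rw [hφ _ this.ge, zero_mul])

theorem max_matterY_eq (γ ν ω W : ℝ) (p : ℝ × ℝ) : max (matterY γ ν ω W p) 0 * (φ p.2 * χ p.1) =
    {p | 0 < matterY γ ν ω W p}.indicator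
      (fun p => matterY γ ν ω W p * (φ p.2 * χ p.1)) p := by
  by_cases hp : 0 < matterY γ ν ω W p
  · rw [indicator_of_mem (show p ∈ {p | 0 < matterY γ ν ω W p} from hp), max_eq_left hp.le]
  · rw [indicator_of_notMem (show p ∉ {p | 0 < matterY γ ν ω W p} from hp),
      max_eq_right (not_lt.1 hp), zero_mul]

theorem matJ_eq_matI (γ ν ω W : ℝ) :
    matJ φ χ γ ν ω W = matI φ χ γ ν ω W (matterY γ ν ω W) :=
  integral_congr_ae (Eventually.of_forall (max_matterY_eq γ ν ω W))

/-- Linearity of the matter integrals in the weight. -/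
theorem matI_add (hγ : 0 ≤ γ) (hφc : Continuous φ) (hχc : Continuous χ)
    (hφ : ∀ η, E₀ ≤ η → φ η = 0) (hχ : ∀ L, L₀ < |L| → χ L = 0) (ν ω W : ℝ) {v w : ℝ × ℝ → ℝ}
    (hv : Continuous v) (hw : Continuous w) :
    matI φ χ γ ν ω W v + matI φ χ γ ν ω W w = matI φ χ γ ν ω W (fun p => v p + w p) := by
  unfold matI
  rw [← integral_add (integrable_matI hγ hφc hχc hφ hχ ν ω W hv)
    (integrable_matI hγ hφc hχc hφ hχ ν ω W hw)]
  congr 1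
  funext p
  simp only [indicator]
  split_ifs
  · ring
  · ring

theorem matI_const_mul (c : ℝ) (ν ω W : ℝ) (w : ℝ × ℝ → ℝ) :
    c * matI φ χ γ ν ω W w = matI φ χ γ ν ω W (fun p => c * w p) := by
  unfold matI
  rw [← integral_const_mul]
  congr 1
  funext p
  simp only [indicator]
  split_ifs
  · ring
  · ring

theorem matI_congr {ν ω W : ℝ} {v w : ℝ × ℝ → ℝ}
    (h : ∀ p, 0 < matterY γ ν ω W p → v p = w p) :
    matI φ χ γ ν ω W v = matI φ χ γ ν ω W w := by
  unfold matI
  congr 1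
  funext p
  by_cases hp : 0 < matterY γ ν ω W p
  · simp [indicator, h p hp]
  · simp [indicator, hp]

/-- The substitution `L = ρs`, `η ↦ η - Lω` in the matter integrals. -/
theorem matterIntegral_eq {ψ : ℝ × ℝ → ℝ} {lam : ℝ} (hγ : 0 ≤ γ) (hφc : Continuous φ)
    (hψc : Continuous ψ) (hφ : ∀ η, E₀ ≤ η → φ η = 0) (hχ : ∀ L, L₀ < |L| → ψ (lam, L) = 0)
    {ν B ω ρ : ℝ} (hB : 0 < B) (hρ : 0 < ρ) {w w' : ℝ → ℝ → ℝ}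
    (hw : Continuous fun p : ℝ × ℝ => w' p.1 p.2)
    (hww' : ∀ η s, etaMin γ ν < η → w η s = w' η s) :
    matterIntegral φ ψ γ lam ν B ω ρ w = 1 / ρ *
      matI φ (fun L => ψ (lam, L)) γ ν ω (ρ * B) (fun p => w' (p.2 - p.1 * ω) (p.1 / ρ)) := by
  set χ : ℝ → ℝ := fun L => ψ (lam, L) with hχdef
  have hχc : Continuous χ := by fun_prop
  set U : Set (ℝ × ℝ) := {p | p.2 ^ 2 < B ^ 2 * energyFun γ ν p.1} with hU
  have hUo : IsOpen U := by
    refine isOpen_lt (by fun_prop) (continuous_const.mul ?_)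
    have h1 : Continuous fun p : ℝ × ℝ => (ν, p.1) := by fun_prop
    exact (continuous_energyFun γ).comp h1
  set g : ℝ × ℝ → ℝ := fun p => w' p.1 p.2 * φ (p.1 + ρ * p.2 * ω) * ψ (lam, ρ * p.2) with hg
  have hgc : Continuous g := by
    simp only [hg]
    fun_prop
  have hUpos : ∀ p ∈ U, etaMin γ ν < p.1 := by
    intro p hp
    rw [← energyFun_pos_iff hγ]
    have hp : p.2 ^ 2 < B ^ 2 * energyFun γ ν p.1 := hp
    by_contra h
    nlinarith [sq_nonneg p.2, sq_nonneg B, mul_nonneg (sq_nonneg B) (neg_nonneg.2 (not_lt.1 h))]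
  have hint : Integrable (U.indicator g) := by
    refine integrable_indicator_of_compact hUo
      (K := Icc ν (E₀ + L₀ * |ω|) ×ˢ Icc (-(L₀ / ρ)) (L₀ / ρ))
      (isCompact_Icc.prod isCompact_Icc) hgc fun p hp hne => ?_
    have h1 : |ρ * p.2| ≤ L₀ := by
      by_contra h
      exact right_ne_zero_of_mul hne (hχ _ (not_le.1 h))
    have h2 : p.1 + ρ * p.2 * ω < E₀ := by
      by_contra h
      exact right_ne_zero_of_mul (left_ne_zero_of_mul hne) (hφ _ (not_lt.1 h))
    have h3 : |ρ * p.2 * ω| ≤ L₀ * |ω| := by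
      rw [abs_mul]; exact mul_le_mul_of_nonneg_right h1 (abs_nonneg _)
    have h4 := neg_abs_le (ρ * p.2 * ω)
    have h5 := hUpos p hp
    have h6 := le_etaMin hγ ν
    rw [abs_mul, abs_of_pos hρ] at h1
    have h7 : |p.2| ≤ L₀ / ρ := by rw [le_div_iff₀ hρ]; linarith
    exact ⟨⟨by linarith, by linarith⟩, abs_le.1 h7⟩
  -- The bounds `η > etaMin` and `|s| < mBound` say that `(η, s)` lies in the open set `U`.
  have hind : matterIntegral φ ψ γ lam ν B ω ρ w = ∫ η, ∫ s, U.indicator g (η, s) := by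
    unfold matterIntegral
    rw [← integral_indicator measurableSet_Ioi]
    congr 1
    funext η
    by_cases hη : etaMin γ ν < η
    · rw [indicator_of_mem (show η ∈ Ioi (etaMin γ ν) from hη)]
      have hpos := (energyFun_pos_iff hγ).2 hη
      have hm := mBound_eq hγ hη B
      have hm0 : 0 ≤ mBound γ η B ν := by rw [hm]; positivity
      rw [intervalIntegral.integral_of_le (by linarith), integral_Ioc_eq_integral_Ioo,
        ← integral_indicator measurableSet_Ioo]
      congr 1
      funext s
      have hiff : s ∈ Ioo (-mBound γ η B ν) (mBound γ η B ν) ↔ (η, s) ∈ U := by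
        rw [mem_Ioo, ← abs_lt, hU, mem_ofPred_eq]
        simp only
        rw [← sq_lt_sq₀ (abs_nonneg s) hm0, sq_abs, hm, mul_pow, Real.sq_sqrt hpos.le]
      by_cases hs : (η, s) ∈ U
      · rw [indicator_of_mem hs, indicator_of_mem (hiff.2 hs), hww' η s hη]
      · rw [indicator_of_notMem hs, indicator_of_notMem fun h => hs (hiff.1 h)]
    · rw [indicator_of_notMem (show η ∉ Ioi (etaMin γ ν) from hη)]
      symm
      rw [integral_eq_zero_of_ae]
      refine Eventually.of_forall fun s => ?_
      exact indicator_of_notMem (fun h => hη (hUpos _ h)) _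
  have hswap : ∫ η, ∫ s, U.indicator g (η, s) = ∫ s, ∫ η, U.indicator g (η, s) :=
    integral_integral_swap (f := fun η s => U.indicator g (η, s)) hint
  set V : Set (ℝ × ℝ) := {p | 0 < matterY γ ν ω (ρ * B) p} with hV
  set k : ℝ × ℝ → ℝ := fun p => w' (p.2 - p.1 * ω) (p.1 / ρ) * (φ p.2 * χ p.1) with hk
  -- The shift of `η` and the scaling `L = ρ s` carry `U` to the domain `V`, which depends on `ρ` and `B`
  -- only through `ρ B`.
  have hshift : ∀ s η, U.indicator g (η - ρ * s * ω, s) = V.indicator k (ρ * s, η) := by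
    intro s η
    have hiff : (η - ρ * s * ω, s) ∈ U ↔ (ρ * s, η) ∈ V := by
      rw [hU, hV, mem_ofPred_eq, mem_ofPred_eq, matterY]
      simp only
      rw [sub_pos, mul_pow, mul_pow, mul_div_mul_left _ _ (by positivity : ρ ^ 2 ≠ 0),
        div_lt_iff₀ (by positivity), mul_comm (B ^ 2)]
    by_cases hs : (η - ρ * s * ω, s) ∈ U
    · rw [indicator_of_mem hs, indicator_of_mem (hiff.1 hs), hg, hk]
      simp only [hχdef]
      rw [mul_div_cancel_left₀ _ hρ.ne', sub_add_cancel]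
      ring
    · rw [indicator_of_notMem hs, indicator_of_notMem fun h => hs (hiff.2 h)]
  have hinner : ∀ s, ∫ η, U.indicator g (η, s) = ∫ η, V.indicator k (ρ * s, η) := by
    intro s
    rw [← integral_sub_right_eq_self (fun η => U.indicator g (η, s)) (ρ * s * ω)]
    simp only [hshift]
  have hintk : Integrable (V.indicator k) := by
    refine integrable_matI hγ hφc hχc hφ hχ ν ω (ρ * B)
      (w := fun p => w' (p.2 - p.1 * ω) (p.1 / ρ)) ?_
    have h1 : Continuous fun p : ℝ × ℝ => (p.2 - p.1 * ω, p.1 / ρ) := by fun_prop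
    exact hw.comp h1
  rw [hind, hswap]
  simp only [hinner]
  rw [Measure.integral_comp_mul_left (fun L => ∫ η, V.indicator k (L, η)) ρ,
    abs_of_pos (inv_pos.2 hρ), smul_eq_mul, one_div, matI, Measure.volume_eq_prod,
    integral_prod _ hintk]

/-- The boundary of the domain of integration is a null set: for fixed `L` it contains at most one
value of `η`, as the energy function is strictly increasing. -/
theorem ae_matterY_ne_zero (hγ : 0 ≤ γ) (ν ω W : ℝ) : ∀ᵐ p : ℝ × ℝ, matterY γ ν ω W p ≠ 0 := by
  have hcl : MeasurableSet {p | matterY γ ν ω W p = 0} :=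
    (isClosed_eq (continuous_matterY _ _ _ _) continuous_const).measurableSet
  rw [ae_iff]
  simp only [not_not]
  rw [Measure.volume_eq_prod, Measure.measure_prod_null hcl]
  refine Eventually.of_forall fun L => Set.Subsingleton.measure_zero (fun a ha b hb => ?_) _
  have ha : matterY γ ν ω W (L, a) = 0 := ha
  have hb : matterY γ ν ω W (L, b) = 0 := hb
  unfold matterY at ha hb
  have := (strictMono_energyFun (ν := ν) hγ).injective
    (show energyFun γ ν (a - L * ω) = energyFun γ ν (b - L * ω) by
      simp only at ha hb; linarith)
  linarith

end matter

/-! ### Regularity and bounds of the matter integrals -/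

section matter_regularity

variable {φ χ : ℝ → ℝ} {E₀ L₀ γ : ℝ}

theorem exists_abs_le_of_compact {X : Type*} [TopologicalSpace X] {K : Set X} (hK : IsCompact K)
    {f : X → ℝ} (hf : ContinuousOn f K) : ∃ C, 0 ≤ C ∧ ∀ x ∈ K, |f x| ≤ C := by
  obtain ⟨C, hC⟩ := hK.exists_bound_of_continuousOn hf
  exact ⟨max C 0, le_max_right _ _, fun x hx => (hC x hx).trans (le_max_left _ _)⟩

theorem continuousAt_indicator_pos {X : Type*} [TopologicalSpace X] {Y F : X → ℝ} {x : X}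
    (hY : ContinuousAt Y x) (hF : ContinuousAt F x) (h0 : Y x ≠ 0) :
    ContinuousAt (fun x => {x | 0 < Y x}.indicator F x) x := by
  rcases lt_or_gt_of_ne h0 with h | h
  · have : (fun _ : X => (0 : ℝ)) =ᶠ[𝓝 x] fun x => {x | 0 < Y x}.indicator F x := by
      filter_upwards [hY.eventually_lt_const h] with y hy
      exact (indicator_of_notMem (s := {x | 0 < Y x}) (fun h' => lt_asymm hy h') F).symm
    exact continuousAt_const.congr this
  · have : F =ᶠ[𝓝 x] fun x => {x | 0 < Y x}.indicator F x := by
      filter_upwards [hY.eventually_const_lt h] with y hy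
      exact (indicator_of_mem (show y ∈ {x | 0 < Y x} from hy) F).symm
    exact hF.congr this

theorem continuousAt_matterY {W₀ : ℝ} (hW : W₀ ≠ 0) (ν₀ ω₀ : ℝ) (p₀ : ℝ × ℝ) :
    ContinuousAt (fun q : (ℝ × ℝ × ℝ) × (ℝ × ℝ) => matterY γ q.1.1 q.1.2.1 q.1.2.2 q.2)
      ((ν₀, ω₀, W₀), p₀) := by
  unfold matterY
  have h1 : Continuous fun q : (ℝ × ℝ × ℝ) × (ℝ × ℝ) => (q.1.1, q.2.2 - q.2.1 * q.1.2.1) := by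
    fun_prop
  refine ((continuous_energyFun γ).comp h1).continuousAt.sub ?_
  refine ContinuousAt.div (by fun_prop) (by fun_prop) ?_
  exact pow_ne_zero 2 hW

/-- Continuity of the matter integrals in the fields: the integrand is discontinuous only on the
boundary of the domain of integration, a null set. -/
theorem continuousAt_matI (hγ : 0 ≤ γ) (hφc : Continuous φ) (hχc : Continuous χ)
    (hφ : ∀ η, E₀ ≤ η → φ η = 0) (hχ : ∀ L, L₀ < |L| → χ L = 0)
    {w : (ℝ × ℝ × ℝ) → (ℝ × ℝ) → ℝ}
    (hw : Continuous fun q : (ℝ × ℝ × ℝ) × (ℝ × ℝ) => w q.1 q.2) {ν₀ ω₀ W₀ : ℝ} (hW : 0 < W₀) :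
    ContinuousAt (fun θ : ℝ × ℝ × ℝ => matI φ χ γ θ.1 θ.2.1 θ.2.2 (w θ)) (ν₀, ω₀, W₀) := by
  set N : Set (ℝ × ℝ × ℝ) := Metric.closedBall (ν₀, ω₀, W₀) 1 with hN
  set K : Set (ℝ × ℝ) := Icc (-L₀) L₀ ×ˢ Icc (ν₀ - 1 - |L₀| * (|ω₀| + 1)) E₀ with hK
  have hNnhds : N ∈ 𝓝 (ν₀, ω₀, W₀) := Metric.closedBall_mem_nhds _ one_pos
  have hKc : IsCompact K := isCompact_Icc.prod isCompact_Icc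
  obtain ⟨C, hC0, hC⟩ := exists_abs_le_of_compact ((isCompact_closedBall (ν₀, ω₀, W₀) 1).prod hKc)
    (f := fun q : (ℝ × ℝ × ℝ) × (ℝ × ℝ) => w q.1 q.2 * (φ q.2.2 * χ q.2.1))
    (Continuous.continuousOn (by fun_prop))
  have hbox : ∀ θ ∈ N, ∀ p, 0 < matterY γ θ.1 θ.2.1 θ.2.2 p → φ p.2 * χ p.1 ≠ 0 → p ∈ K := by
    intro θ hθ p hp hne
    rw [hN, Metric.mem_closedBall, Prod.dist_eq, Prod.dist_eq, max_le_iff, max_le_iff,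
      Real.dist_eq, Real.dist_eq] at hθ
    simp only at hθ
    obtain ⟨h1, h2, h3⟩ := mem_box_of_matterY_pos hγ hφ hχ hp hne
    refine mem_Icc_prod ⟨h1, ?_, h3⟩
    have h4 := abs_le.1 hθ.1
    have h5 : |θ.2.1| ≤ |ω₀| + 1 := by
      have := abs_sub_abs_le_abs_sub θ.2.1 ω₀
      linarith [hθ.2.1]
    have h6 : L₀ * |θ.2.1| ≤ |L₀| * (|ω₀| + 1) :=
      mul_le_mul (le_abs_self _) h5 (abs_nonneg _) (abs_nonneg _)
    linarith
  unfold matI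
  refine continuousAt_of_dominated (bound := K.indicator fun _ => C) ?_ ?_ ?_ ?_
  · refine Eventually.of_forall fun θ => ?_
    refine (integrable_matI hγ hφc hχc hφ hχ θ.1 θ.2.1 θ.2.2 (w := w θ) ?_).aestronglyMeasurable
    exact hw.comp (Continuous.prodMk_right θ)
  · filter_upwards [hNnhds] with θ hθ
    refine Eventually.of_forall fun p => ?_
    by_cases hp : 0 < matterY γ θ.1 θ.2.1 θ.2.2 p ∧ φ p.2 * χ p.1 ≠ 0
    · have hpK := hbox θ hθ p hp.1 hp.2
      rw [indicator_of_mem hpK,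
        indicator_of_mem (show p ∈ {p | 0 < matterY γ θ.1 θ.2.1 θ.2.2 p} from hp.1)]
      exact hC (θ, p) ⟨hθ, hpK⟩
    · have : {p | 0 < matterY γ θ.1 θ.2.1 θ.2.2 p}.indicator
          (fun p => w θ p * (φ p.2 * χ p.1)) p = 0 := by
        refine indicator_apply_eq_zero.2 fun h => ?_
        have : φ p.2 * χ p.1 = 0 := by by_contra h'; exact hp ⟨h, h'⟩
        rw [this, mul_zero]
      rw [this, norm_zero]
      exact indicator_nonneg (fun _ _ => hC0) _
  · exact (integrable_indicator_iff hKc.measurableSet).2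
      (integrableOn_const hKc.measure_lt_top.ne)
  · filter_upwards [ae_matterY_ne_zero hγ ν₀ ω₀ W₀] with p hp
    have hemb : Continuous fun θ : ℝ × ℝ × ℝ => (θ, p) := by fun_prop
    exact continuousAt_indicator_pos (Y := fun θ : ℝ × ℝ × ℝ => matterY γ θ.1 θ.2.1 θ.2.2 p)
      (F := fun θ => w θ p * (φ p.2 * χ p.1))
      (ContinuousAt.comp (f := fun θ : ℝ × ℝ × ℝ => (θ, p))
        (continuousAt_matterY hW.ne' ν₀ ω₀ p) hemb.continuousAt)
      ((hw.comp hemb).mul continuous_const).continuousAt hp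

theorem abs_indicator_eq (U : Set (ℝ × ℝ)) (f : ℝ × ℝ → ℝ) (p : ℝ × ℝ) :
    |U.indicator f p| = U.indicator (fun p => |f p|) p := by
  by_cases hp : p ∈ U
  · simp [hp]
  · simp [hp]

/-- The domain of integration has measure `O(W)`, because `L² < W² T` there, where `T` bounds the energy
function. This compensates the factors `1 / ρ` of the matter terms at the axis. -/
theorem exists_abs_integral_le_mul (hγ : 0 ≤ γ) (hφc : Continuous φ) (hχc : Continuous χ)
    (hφ : ∀ η, E₀ ≤ η → φ η = 0) (hχ : ∀ L, L₀ < |L| → χ L = 0) (N : ℝ)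
    {w : (ℝ × ℝ × ℝ) → (ℝ × ℝ) → ℝ}
    (hw : Continuous fun q : (ℝ × ℝ × ℝ) × (ℝ × ℝ) => w q.1 q.2) :
    ∃ C, 0 ≤ C ∧ ∀ ν ω W, |ν| ≤ N → |ω| ≤ N → 0 < W → W ≤ N → ∀ f : ℝ × ℝ → ℝ,
      (∀ p, |f p| ≤ {p | 0 < matterY γ ν ω W p}.indicator
        (fun p => |w (ν, ω, W) p * (φ p.2 * χ p.1)|) p) → |∫ p, f p| ≤ C * W := by
  set K : Set (ℝ × ℝ) := Icc (-L₀) L₀ ×ˢ Icc (-N - |L₀| * N) E₀ with hK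
  have hKc : IsCompact K := isCompact_Icc.prod isCompact_Icc
  set P : Set (ℝ × ℝ × ℝ) := Icc (-N) N ×ˢ (Icc (-N) N ×ˢ Icc 0 N) with hP
  have hPc : IsCompact P := isCompact_Icc.prod (isCompact_Icc.prod isCompact_Icc)
  obtain ⟨C, hC0, hC⟩ := exists_abs_le_of_compact (hPc.prod hKc)
    (f := fun q : (ℝ × ℝ × ℝ) × (ℝ × ℝ) => w q.1 q.2 * (φ q.2.2 * χ q.2.1))
    (Continuous.continuousOn (by fun_prop))
  have hec : Continuous fun q : (ℝ × ℝ × ℝ) × (ℝ × ℝ) =>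
      energyFun γ q.1.1 (q.2.2 - q.2.1 * q.1.2.1) := by
    have h1 : Continuous fun q : (ℝ × ℝ × ℝ) × (ℝ × ℝ) => (q.1.1, q.2.2 - q.2.1 * q.1.2.1) := by
      fun_prop
    exact (continuous_energyFun γ).comp h1
  obtain ⟨T, hT0, hT⟩ := exists_abs_le_of_compact (hPc.prod hKc) hec.continuousOn
  set ℓ : ℝ := max (E₀ - (-N - |L₀| * N)) 0 with hℓ
  refine ⟨C * (2 * √T * ℓ), by positivity, fun ν ω W hν hω hW hWN f hf => ?_⟩
  set K' : Set (ℝ × ℝ) := Icc (-(W * √T)) (W * √T) ×ˢ Icc (-N - |L₀| * N) E₀ with hK'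
  have hθ : (ν, ω, W) ∈ P := ⟨abs_le.1 hν, abs_le.1 hω, hW.le, hWN⟩
  have hK'm : MeasurableSet K' := measurableSet_Icc.prod measurableSet_Icc
  have hK'c : IsCompact K' := isCompact_Icc.prod isCompact_Icc
  have hpt : ∀ p, ‖f p‖ ≤ K'.indicator (fun _ => C) p := by
    intro p
    refine (hf p).trans ?_
    by_cases hp : 0 < matterY γ ν ω W p ∧ φ p.2 * χ p.1 ≠ 0
    · obtain ⟨h1, h2, h3⟩ := mem_box_of_matterY_pos hγ hφ hχ hp.1 hp.2
      have h6 : L₀ * |ω| ≤ |L₀| * N :=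
        mul_le_mul (le_abs_self _) hω (abs_nonneg _) (abs_nonneg _)
      have h4 : -N - |L₀| * N ≤ p.2 := by linarith [(abs_le.1 hν).1]
      have hpK : p ∈ K := mem_Icc_prod ⟨h1, h4, h3⟩
      have hpT : |energyFun γ ν (p.2 - p.1 * ω)| ≤ T := hT ((ν, ω, W), p) ⟨hθ, hpK⟩
      have hY := hp.1
      unfold matterY at hY
      have h5 : p.1 ^ 2 ≤ (W * √T) ^ 2 := by
        rw [mul_pow, Real.sq_sqrt hT0]
        have h7 : p.1 ^ 2 / W ^ 2 ≤ T := by linarith [(abs_le.1 hpT).2]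
        rw [div_le_iff₀ (by positivity)] at h7
        linarith
      have hpK' : p ∈ K' := mem_Icc_prod ⟨abs_le_of_sq_le_sq h5 (by positivity), h4, h3⟩
      rw [indicator_of_mem hpK',
        indicator_of_mem (show p ∈ {p | 0 < matterY γ ν ω W p} from hp.1)]
      exact hC ((ν, ω, W), p) ⟨hθ, hpK⟩
    · have : {p | 0 < matterY γ ν ω W p}.indicator
          (fun p => |w (ν, ω, W) p * (φ p.2 * χ p.1)|) p = 0 := by
        refine indicator_apply_eq_zero.2 fun h => ?_
        have : φ p.2 * χ p.1 = 0 := by by_contra h'; exact hp ⟨h, h'⟩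
        rw [this, mul_zero, abs_zero]
      rw [this]
      exact indicator_nonneg (fun _ _ => hC0) _
  have hintK : Integrable (K'.indicator fun _ : ℝ × ℝ => C) :=
    (integrable_indicator_iff hK'm).2 (integrableOn_const hK'c.measure_lt_top.ne)
  have h := norm_integral_le_of_norm_le hintK (Eventually.of_forall hpt)
  rw [Real.norm_eq_abs] at h
  refine h.trans (le_of_eq ?_)
  rw [integral_indicator hK'm, setIntegral_const, smul_eq_mul, hK', Measure.volume_eq_prod,
    measureReal_prod_prod, Measure.real, Measure.real, Real.volume_Icc, Real.volume_Icc,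
    ENNReal.toReal_ofReal (by nlinarith [mul_nonneg hW.le (Real.sqrt_nonneg T)]),
    ENNReal.toReal_ofReal']
  rw [hℓ]
  ring

theorem exists_abs_matI_le_mul (hγ : 0 ≤ γ) (hφc : Continuous φ) (hχc : Continuous χ)
    (hφ : ∀ η, E₀ ≤ η → φ η = 0) (hχ : ∀ L, L₀ < |L| → χ L = 0) (N : ℝ)
    {w : (ℝ × ℝ × ℝ) → (ℝ × ℝ) → ℝ}
    (hw : Continuous fun q : (ℝ × ℝ × ℝ) × (ℝ × ℝ) => w q.1 q.2) :
    ∃ C, 0 ≤ C ∧ ∀ ν ω W, |ν| ≤ N → |ω| ≤ N → 0 < W → W ≤ N →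
      |matI φ χ γ ν ω W (w (ν, ω, W))| ≤ C * W := by
  obtain ⟨C, hC0, hC⟩ := exists_abs_integral_le_mul hγ hφc hχc hφ hχ N hw
  refine ⟨C, hC0, fun ν ω W hν hω hW hWN => hC ν ω W hν hω hW hWN _ fun p => ?_⟩
  rw [abs_indicator_eq]

theorem exists_abs_matJ_le_mul (hγ : 0 ≤ γ) (hφc : Continuous φ) (hχc : Continuous χ)
    (hφ : ∀ η, E₀ ≤ η → φ η = 0) (hχ : ∀ L, L₀ < |L| → χ L = 0) (N : ℝ) :
    ∃ C, 0 ≤ C ∧ ∀ ν ω W, |ν| ≤ N → |ω| ≤ N → 0 < W → W ≤ N → |matJ φ χ γ ν ω W| ≤ C * W := by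
  have hec : Continuous fun q : (ℝ × ℝ × ℝ) × (ℝ × ℝ) =>
      energyFun γ q.1.1 (q.2.2 - q.2.1 * q.1.2.1) := by
    have h1 : Continuous fun q : (ℝ × ℝ × ℝ) × (ℝ × ℝ) => (q.1.1, q.2.2 - q.2.1 * q.1.2.1) := by
      fun_prop
    exact (continuous_energyFun γ).comp h1
  obtain ⟨C, hC0, hC⟩ := exists_abs_integral_le_mul hγ hφc hχc hφ hχ N
    (w := fun θ p => energyFun γ θ.1 (p.2 - p.1 * θ.2.1)) hec
  refine ⟨C, hC0, fun ν ω W hν hω hW hWN => hC ν ω W hν hω hW hWN _ fun p => ?_⟩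
  rw [max_matterY_eq, abs_indicator_eq]
  refine indicator_le_indicator' fun hp => ?_
  have hp : 0 < matterY γ ν ω W p := hp
  rw [abs_mul, abs_mul _ (φ p.2 * χ p.1)]
  refine mul_le_mul_of_nonneg_right ?_ (abs_nonneg _)
  rw [abs_of_pos hp]
  refine le_trans ?_ (le_abs_self _)
  unfold matterY
  have : 0 ≤ p.1 ^ 2 / W ^ 2 := by positivity
  linarith

/-- The derivative of `matterY` along a curve of fields. -/
theorem hasDerivAt_matterY {ν ω W : ℝ → ℝ} {ν' ω' W' s : ℝ} (hν : HasDerivAt ν ν' s)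
    (hω : HasDerivAt ω ω' s) (hW : HasDerivAt W W' s) (hW0 : W s ≠ 0) (p : ℝ × ℝ) :
    HasDerivAt (fun s => matterY γ (ν s) (ω s) (W s) p)
      (ν' * (-4 * Real.exp (-4 * γ * ν s) *
          ((1 + γ * (p.2 - p.1 * ω s)) * |1 + γ * (p.2 - p.1 * ω s)|)
        + 2 * Real.exp (-2 * γ * ν s))
        - ω' * (2 * Real.exp (-4 * γ * ν s) * |1 + γ * (p.2 - p.1 * ω s)| * p.1)
        + W' * (2 * p.1 ^ 2 / W s ^ 3)) s := by
  unfold matterY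
  have h1 := hasDerivAt_energyFun (γ := γ) hν ((hω.const_mul p.1).const_sub p.2)
  have h2 : HasDerivAt (fun s => p.1 ^ 2 / W s ^ 2) _ s :=
    (hasDerivAt_const s (p.1 ^ 2)).div (hW.pow 2) (pow_ne_zero 2 hW0)
  refine (h1.sub h2).congr_deriv ?_
  field_simp
  push_cast
  ring

/-- The derivative of `matJ` along a curve of fields. No boundary term appears, as the integrand
`max(matterY, 0)` is Lipschitz in the fields. -/
theorem hasDerivAt_matJ (hγ : 0 ≤ γ) (hφc : Continuous φ) (hχc : Continuous χ)
    (hφ : ∀ η, E₀ ≤ η → φ η = 0) (hχ : ∀ L, L₀ < |L| → χ L = 0)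
    {ν ω W ν' ω' W' : ℝ → ℝ} (hν : ∀ s, HasDerivAt ν (ν' s) s) (hω : ∀ s, HasDerivAt ω (ω' s) s)
    (hW : ∀ s, HasDerivAt W (W' s) s) (hν' : Continuous ν') (hω' : Continuous ω')
    (hW' : Continuous W') {s₀ : ℝ} (hW0 : 0 < W s₀) :
    HasDerivAt (fun s => matJ φ χ γ (ν s) (ω s) (W s))
      (-2 * ν' s₀ * matI φ χ γ (ν s₀) (ω s₀) (W s₀)
          (fun p => 2 * Real.exp (-4 * γ * ν s₀) * (1 + γ * (p.2 - p.1 * ω s₀)) ^ 2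
            - Real.exp (-2 * γ * ν s₀))
        - 2 * ω' s₀ * Real.exp (-4 * γ * ν s₀) * matI φ χ γ (ν s₀) (ω s₀) (W s₀)
          (fun p => (1 + γ * (p.2 - p.1 * ω s₀)) * p.1)
        + W' s₀ * (2 / W s₀ ^ 3 * matI φ χ γ (ν s₀) (ω s₀) (W s₀) (fun p => p.1 ^ 2))) s₀ := by
  have hνc : Continuous ν := continuous_iff_continuousAt.2 fun s => (hν s).continuousAt
  have hωc : Continuous ω := continuous_iff_continuousAt.2 fun s => (hω s).continuousAt
  have hWc : Continuous W := continuous_iff_continuousAt.2 fun s => (hW s).continuousAt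
  set D : ℝ → ℝ × ℝ → ℝ := fun s p =>
    ν' s * (-4 * Real.exp (-4 * γ * ν s) *
          ((1 + γ * (p.2 - p.1 * ω s)) * |1 + γ * (p.2 - p.1 * ω s)|)
        + 2 * Real.exp (-2 * γ * ν s))
        - ω' s * (2 * Real.exp (-4 * γ * ν s) * |1 + γ * (p.2 - p.1 * ω s)| * p.1)
        + W' s * (2 * p.1 ^ 2 / W s ^ 3) with hD
  obtain ⟨ε, hε, hεW⟩ : ∃ ε > 0, ∀ s ∈ Metric.closedBall s₀ ε, 0 < W s := by
    obtain ⟨ε, hε, h⟩ := Metric.nhds_basis_closedBall.eventually_iff.1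
      (hWc.continuousAt.eventually_const_lt hW0)
    exact ⟨ε, hε, fun s hs => h hs⟩
  set I : Set ℝ := Metric.closedBall s₀ ε with hI
  have hInhds : I ∈ 𝓝 s₀ := Metric.closedBall_mem_nhds _ hε
  have hIc : IsCompact I := isCompact_closedBall s₀ ε
  obtain ⟨N, hN0, hN⟩ := exists_abs_le_of_compact hIc
    (f := fun s => ν s - L₀ * |ω s|) (Continuous.continuousOn (by fun_prop))
  set K : Set (ℝ × ℝ) := Icc (-L₀) L₀ ×ˢ Icc (-N) E₀ with hK
  have hKc : IsCompact K := isCompact_Icc.prod isCompact_Icc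
  have hDc : ContinuousOn (fun q : ℝ × (ℝ × ℝ) => D q.1 q.2) (I ×ˢ K) := by
    have h2 : ContinuousOn (fun q : ℝ × (ℝ × ℝ) => 2 * q.2.1 ^ 2 / W q.1 ^ 3) (I ×ˢ K) := by
      refine ContinuousOn.div (Continuous.continuousOn (by fun_prop))
        (Continuous.continuousOn (by fun_prop)) fun q hq => ?_
      exact pow_ne_zero 3 (hεW q.1 hq.1).ne'
    simp only [hD]
    refine ContinuousOn.add (Continuous.continuousOn (by fun_prop)) (ContinuousOn.mul ?_ h2)
    exact Continuous.continuousOn (by fun_prop)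
  obtain ⟨C, hC0, hC⟩ := exists_abs_le_of_compact (hIc.prod hKc) hDc
  obtain ⟨C₂, hC₂0, hC₂⟩ := exists_abs_le_of_compact hKc
    (f := fun p : ℝ × ℝ => φ p.2 * χ p.1) (Continuous.continuousOn (by fun_prop))
  have hbox : ∀ s ∈ I, ∀ p, p ∉ K → max (matterY γ (ν s) (ω s) (W s) p) 0 * (φ p.2 * χ p.1) = 0 := by
    intro s hs p hp
    rw [max_matterY_eq]
    refine indicator_apply_eq_zero.2 fun hY => ?_
    by_contra hne
    obtain ⟨h1, h2, h3⟩ := mem_box_of_matterY_pos hγ hφ hχ hY (right_ne_zero_of_mul hne)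
    refine hp (mem_Icc_prod ⟨h1, ?_, h3⟩)
    have h4 := hN s hs
    linarith [(abs_le.1 h4).1]
  have hmeas : ∀ s, AEStronglyMeasurable (fun p : ℝ × ℝ =>
      max (matterY γ (ν s) (ω s) (W s) p) 0 * (φ p.2 * χ p.1)) volume := by
    intro s
    refine Continuous.aestronglyMeasurable ?_
    have := continuous_matterY γ (ν s) (ω s) (W s)
    fun_prop
  set F' : ℝ × ℝ → ℝ := {p | 0 < matterY γ (ν s₀) (ω s₀) (W s₀) p}.indicator
    (fun p => D s₀ p * (φ p.2 * χ p.1)) with hF'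
  have hF'int : Integrable F' := by
    refine integrable_matI hγ hφc hχc hφ hχ _ _ _ ?_
    simp only [hD]
    fun_prop
  have hYder : ∀ s ∈ I, ∀ p, HasDerivAt (fun s => matterY γ (ν s) (ω s) (W s) p) (D s p) s :=
    fun s hs p => hasDerivAt_matterY (hν s) (hω s) (hW s) (hεW s hs).ne' p
  have key := hasDerivAt_integral_of_dominated_loc_of_lip (μ := volume)
    (F := fun s (p : ℝ × ℝ) => max (matterY γ (ν s) (ω s) (W s) p) 0 * (φ p.2 * χ p.1))
    (F' := F') (x₀ := s₀) (s := I) (bound := K.indicator fun _ => C * C₂) hInhds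
    (Eventually.of_forall hmeas) ?_ hF'int.aestronglyMeasurable ?_ ?_ ?_
  · have h := key.2
    have heq : ∫ p, F' p = -2 * ν' s₀ * matI φ χ γ (ν s₀) (ω s₀) (W s₀)
          (fun p => 2 * Real.exp (-4 * γ * ν s₀) * (1 + γ * (p.2 - p.1 * ω s₀)) ^ 2
            - Real.exp (-2 * γ * ν s₀))
        - 2 * ω' s₀ * Real.exp (-4 * γ * ν s₀) * matI φ χ γ (ν s₀) (ω s₀) (W s₀)
          (fun p => (1 + γ * (p.2 - p.1 * ω s₀)) * p.1)
        + W' s₀ * (2 / W s₀ ^ 3 * matI φ χ γ (ν s₀) (ω s₀) (W s₀) (fun p => p.1 ^ 2)) := by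
      rw [sub_eq_add_neg, ← neg_mul, ← mul_assoc (W' s₀), matI_const_mul, matI_const_mul,
        matI_const_mul, matI_add hγ hφc hχc hφ hχ _ _ _ (by fun_prop) (by fun_prop),
        matI_add hγ hφc hχc hφ hχ _ _ _ (by fun_prop) (by fun_prop)]
      refine matI_congr fun p hp => ?_
      -- On the domain of integration the absolute value of the energy function can be dropped.
      have ha := one_add_pos_of_etaMin_lt hγ (etaMin_lt_of_matterY_pos hγ hp)
      simp only [hD]
      rw [abs_of_pos ha]
      ring
    rw [heq] at h
    exact h
  · have := integrable_matI hγ hφc hχc hφ hχ (ν s₀) (ω s₀) (W s₀)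
      (continuous_matterY γ (ν s₀) (ω s₀) (W s₀))
    exact this.congr (Eventually.of_forall fun p => (max_matterY_eq _ _ _ _ p).symm)
  · refine Eventually.of_forall fun p => ?_
    by_cases hp : p ∈ K
    · rw [indicator_of_mem hp]
      refine LipschitzOnWith.of_dist_le_mul fun s hs t ht => ?_
      have h1 : |matterY γ (ν s) (ω s) (W s) p - matterY γ (ν t) (ω t) (W t) p| ≤ C * |s - t| := by
        have := Convex.norm_image_sub_le_of_norm_hasDerivWithin_le (s := I)
          (f := fun s => matterY γ (ν s) (ω s) (W s) p) (f' := fun s => D s p) (C := C)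
          (fun r hr => (hYder r hr p).hasDerivWithinAt) (fun r hr => hC (r, p) ⟨hr, hp⟩)
          (convex_closedBall _ _) ht hs
        exact this
      have h2 := abs_max_sub_max_le_abs (matterY γ (ν s) (ω s) (W s) p)
        (matterY γ (ν t) (ω t) (W t) p) 0
      have h3 : |C * C₂| = C * C₂ := abs_of_nonneg (mul_nonneg hC0 hC₂0)
      rw [Real.dist_eq, Real.dist_eq, ← sub_mul, abs_mul, Real.coe_nnabs, h3]
      calc _ ≤ C * |s - t| * C₂ := mul_le_mul (h2.trans h1) (hC₂ p hp) (abs_nonneg _) (by positivity)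
        _ = _ := by ring
    · refine LipschitzOnWith.of_dist_le_mul fun s hs t ht => ?_
      rw [hbox s hs p hp, hbox t ht p hp, dist_self]
      positivity
  · exact (integrable_indicator_iff hKc.measurableSet).2
      (integrableOn_const hKc.measure_lt_top.ne)
  · filter_upwards [ae_matterY_ne_zero hγ (ν s₀) (ω s₀) (W s₀)] with p hp
    have hd := hYder s₀ (mem_of_mem_nhds hInhds) p
    rcases lt_or_gt_of_ne hp with h | h
    · rw [hF', indicator_of_notMem (show p ∉ {p | 0 < matterY γ (ν s₀) (ω s₀) (W s₀) p} from
        fun h' => lt_asymm h h')]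
      refine (hasDerivAt_const s₀ (0 : ℝ)).congr_of_eventuallyEq ?_
      filter_upwards [hd.continuousAt.eventually_lt_const h] with s hs
      rw [max_eq_right hs.le, zero_mul]
    · rw [hF', indicator_of_mem (show p ∈ {p | 0 < matterY γ (ν s₀) (ω s₀) (W s₀) p} from h)]
      refine (hd.mul_const _).congr_of_eventuallyEq ?_
      filter_upwards [hd.continuousAt.eventually_const_lt h] with s hs
      rw [max_eq_left hs.le]

end matter_regularity

/-! ### The matter terms as functions of the fields -/

section matter_terms

/-- Smoothness and cut-offs of the ansatz functions. -/
structure Ansatz (φ : ℝ → ℝ) (ψ : ℝ × ℝ → ℝ) (E₀ L₀ : ℝ) : Prop where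
  contDiff_φ : ContDiff ℝ 1 φ
  contDiff_ψ : ContDiff ℝ 1 ψ
  φ_eq_zero : ∀ η, E₀ ≤ η → φ η = 0
  ψ_eq_zero : ∀ lam L, L₀ < |L| → ψ (lam, L) = 0

variable {φ : ℝ → ℝ} {ψ : ℝ × ℝ → ℝ} {E₀ L₀ γ lam : ℝ}

theorem Ansatz.continuous_φ (h : Ansatz φ ψ E₀ L₀) : Continuous φ := h.contDiff_φ.continuous
theorem Ansatz.continuous_ψ (h : Ansatz φ ψ E₀ L₀) : Continuous ψ := h.contDiff_ψ.continuous
theorem Ansatz.continuous_χ (h : Ansatz φ ψ E₀ L₀) (lam : ℝ) :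
    Continuous fun L => ψ (lam, L) := by
  have := h.continuous_ψ
  fun_prop

/-- The weight of the integral `M₁`. -/
def weightOne (γ : ℝ) (θ : ℝ × ℝ × ℝ) (p : ℝ × ℝ) : ℝ :=
  2 * Real.exp (-4 * γ * θ.1) * (1 + γ * (p.2 - p.1 * θ.2.1)) ^ 2 - Real.exp (-2 * γ * θ.1)

/-- The weight of the integral `M₃`. -/
def weightThree (γ : ℝ) (θ : ℝ × ℝ × ℝ) (p : ℝ × ℝ) : ℝ := (1 + γ * (p.2 - p.1 * θ.2.1)) * p.1

theorem continuous_weightOne (γ : ℝ) :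
    Continuous fun q : (ℝ × ℝ × ℝ) × (ℝ × ℝ) => weightOne γ q.1 q.2 := by
  unfold weightOne; fun_prop

theorem continuous_weightThree (γ : ℝ) :
    Continuous fun q : (ℝ × ℝ × ℝ) × (ℝ × ℝ) => weightThree γ q.1 q.2 := by
  unfold weightThree; fun_prop

/-- The four components in `M₁` combine into one matter integral, by the relation
`γ · energyFun = e^{-4γν} (1 + γη)² - e^{-2γν}`. -/
theorem M1_eq (hA : Ansatz φ ψ E₀ L₀) (hγ : 0 ≤ γ) {u : Fields} {x : E 3}
    (hρ : 0 < axialRadius x) (hB : 0 < 1 + u.b x) :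
    M1 φ ψ γ lam u x = 2 * Real.pi * Real.exp (2 * u.ξ x) / (axialRadius x * (1 + u.b x)) *
      matI φ (fun L => ψ (lam, L)) γ (u.ν x) (u.ω x) (axialRadius x * (1 + u.b x))
        (weightOne γ (u.ν x, u.ω x, axialRadius x * (1 + u.b x))) := by
  unfold M1 Phi00 Phi11 Phi03 Phi33
  simp only
  set ρ := axialRadius x
  set B := 1 + u.b x
  set ν := u.ν x
  set ω := u.ω x
  have hφc := hA.continuous_φ
  have hχc := hA.continuous_χ lam
  have hχ := hA.ψ_eq_zero lam
  have hΘ : Continuous fun e => energyFun γ ν e := by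
    have h1 : Continuous fun e : ℝ => (ν, e) := by fun_prop
    exact (continuous_energyFun γ).comp h1
  have hΘ1 : Continuous fun p : ℝ × ℝ => energyFun γ ν p.1 := hΘ.comp continuous_fst
  have hΘ2 : Continuous fun p : ℝ × ℝ => energyFun γ ν (p.2 - p.1 * ω) :=
    hΘ.comp (by fun_prop)
  have hconv : ∀ w w' : ℝ → ℝ → ℝ, (Continuous fun p : ℝ × ℝ => w' p.1 p.2) →
      (∀ η s, etaMin γ ν < η → w η s = w' η s) → matterIntegral φ ψ γ lam ν B ω ρ w = 1 / ρ *
        matI φ (fun L => ψ (lam, L)) γ ν ω (ρ * B) (fun p => w' (p.2 - p.1 * ω) (p.1 / ρ)) :=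
    fun w w' hw hww' => matterIntegral_eq hγ hφc hA.continuous_ψ hA.φ_eq_zero hχ hB hρ hw hww'
  rw [hconv (fun η s => (1 + γ * η + γ * ρ * s * ω) ^ 2) _ (by fun_prop) (fun _ _ _ => rfl),
    hconv (fun η s => mBound γ η B ν ^ 2 - s ^ 2) (fun η s => B ^ 2 * energyFun γ ν η - s ^ 2)
      (by fun_prop) (fun η s hη => by
        rw [mBound_eq hγ hη, mul_pow, Real.sq_sqrt ((energyFun_pos_iff hγ).2 hη).le]),
    hconv (fun η s => s * (1 + γ * η + γ * ρ * s * ω)) _ (by fun_prop) (fun _ _ _ => rfl),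
    hconv (fun _ s => s ^ 2) _ (by fun_prop) (fun _ _ _ => rfl)]
  set e4 := Real.exp (-4 * γ * ν) with he4
  have hexp : Real.exp (2 * u.ξ x - 4 * γ * ν) = Real.exp (2 * u.ξ x) * e4 := by
    rw [he4, ← Real.exp_add]; congr 1; ring
  rw [hexp]
  set X0 := matI φ (fun L => ψ (lam, L)) γ ν ω (ρ * B)
    (fun p => (1 + γ * (p.2 - p.1 * ω) + γ * ρ * (p.1 / ρ) * ω) ^ 2) with hX0
  set X1 := matI φ (fun L => ψ (lam, L)) γ ν ω (ρ * B)
    (fun p => B ^ 2 * energyFun γ ν (p.2 - p.1 * ω) - (p.1 / ρ) ^ 2) with hX1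
  set X2 := matI φ (fun L => ψ (lam, L)) γ ν ω (ρ * B) (fun p => (p.1 / ρ) ^ 2) with hX2
  set X3 := matI φ (fun L => ψ (lam, L)) γ ν ω (ρ * B)
    (fun p => p.1 / ρ * (1 + γ * (p.2 - p.1 * ω) + γ * ρ * (p.1 / ρ) * ω)) with hX3
  have key : matI φ (fun L => ψ (lam, L)) γ ν ω (ρ * B) (weightOne γ (ν, ω, ρ * B)) =
      e4 * X0 + γ / B ^ 2 * X1 + -(2 * γ * ω * e4 * ρ) * X3
        + (γ / B ^ 2 + γ ^ 2 * ω ^ 2 * e4 * ρ ^ 2) * X2 := by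
    rw [hX0, hX1, hX2, hX3, matI_const_mul, matI_const_mul, matI_const_mul, matI_const_mul,
      matI_add hγ hφc hχc hA.φ_eq_zero hχ _ _ _ (by fun_prop) (by fun_prop),
      matI_add hγ hφc hχc hA.φ_eq_zero hχ _ _ _ (by fun_prop) (by fun_prop),
      matI_add hγ hφc hχc hA.φ_eq_zero hχ _ _ _ (by fun_prop) (by fun_prop)]
    refine matI_congr fun p hp => ?_
    have ha := one_add_pos_of_etaMin_lt hγ (etaMin_lt_of_matterY_pos hγ hp)
    -- `X1` contains the energy function; eliminating it produces the second half of the weight.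
    have hm := mul_energyFun (ν := ν) ha.le
    unfold weightOne
    simp only [← he4] at hm ⊢
    have hL : γ * ρ * (p.1 / ρ) * ω = γ * p.1 * ω := by field_simp
    rw [hL]
    have h2 : γ / B ^ 2 * (B ^ 2 * energyFun γ ν (p.2 - p.1 * ω) - (p.1 / ρ) ^ 2) =
        γ * energyFun γ ν (p.2 - p.1 * ω) - γ / B ^ 2 * (p.1 / ρ) ^ 2 := by field_simp
    rw [h2, hm]
    field_simp
    ring
  rw [key]
  field_simp

theorem M2_eq (hA : Ansatz φ ψ E₀ L₀) (hγ : 0 ≤ γ) {u : Fields} {x : E 3}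
    (hρ : 0 < axialRadius x) (hB : 0 < 1 + u.b x) :
    M2 φ ψ γ lam u x = 2 * Real.pi * γ ^ 2 * Real.exp (2 * u.ξ x) / axialRadius x *
      matJ φ (fun L => ψ (lam, L)) γ (u.ν x) (u.ω x) (axialRadius x * (1 + u.b x)) := by
  unfold M2 Phi11
  set ρ := axialRadius x
  set B := 1 + u.b x
  set ν := u.ν x
  set ω := u.ω x
  have hΘ1 : Continuous fun p : ℝ × ℝ => energyFun γ ν p.1 := by
    have h1 : Continuous fun p : ℝ × ℝ => (ν, p.1) := by fun_prop
    exact (continuous_energyFun γ).comp h1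
  rw [matterIntegral_eq hγ hA.continuous_φ hA.continuous_ψ hA.φ_eq_zero (hA.ψ_eq_zero lam) hB hρ
    (w' := fun η s => B ^ 2 * energyFun γ ν η - s ^ 2) (by fun_prop) (fun η s hη => by
        rw [mBound_eq hγ hη, mul_pow, Real.sq_sqrt ((energyFun_pos_iff hγ).2 hη).le]),
    matJ_eq_matI]
  have key : matI φ (fun L => ψ (lam, L)) γ ν ω (ρ * B)
      (fun p => B ^ 2 * energyFun γ ν (p.2 - p.1 * ω) - (p.1 / ρ) ^ 2) =
      B ^ 2 * matI φ (fun L => ψ (lam, L)) γ ν ω (ρ * B) (matterY γ ν ω (ρ * B)) := by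
    rw [matI_const_mul]
    refine matI_congr fun p _ => ?_
    unfold matterY
    field_simp
  rw [key]
  field_simp

/-- Two forms of `M₃`: the first keeps the variables `(η, s)`, in which the weight is odd in `s`; the second
uses energy and angular momentum. -/
theorem M3_eq_matterIntegral (hA : Ansatz φ ψ E₀ L₀) (hγ : 0 ≤ γ) {u : Fields} {x : E 3}
    (hρ : 0 < axialRadius x) (hB : 0 < 1 + u.b x) :
    M3 φ ψ γ lam u x = -(32 * Real.pi ^ 2 * γ * Real.exp (2 * u.ξ x) /
      (axialRadius x * (1 + u.b x) ^ 3)) * matterIntegral φ ψ γ lam (u.ν x) (1 + u.b x) (u.ω x)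
        (axialRadius x) (fun η s => s * (1 + γ * η)) ∧
    M3 φ ψ γ lam u x = -(32 * Real.pi ^ 2 * γ * Real.exp (2 * u.ξ x) /
      (axialRadius x * (1 + u.b x)) ^ 3) *
      matI φ (fun L => ψ (lam, L)) γ (u.ν x) (u.ω x) (axialRadius x * (1 + u.b x))
        (weightThree γ (u.ν x, u.ω x, axialRadius x * (1 + u.b x))) := by
  unfold M3 Phi33 Phi03
  simp only
  set ρ := axialRadius x
  set B := 1 + u.b x
  set ν := u.ν x
  set ω := u.ω x
  have hφc := hA.continuous_φ
  have hχc := hA.continuous_χ lam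
  have hχ := hA.ψ_eq_zero lam
  have hconv : ∀ w : ℝ → ℝ → ℝ, (Continuous fun p : ℝ × ℝ => w p.1 p.2) →
      matterIntegral φ ψ γ lam ν B ω ρ w = 1 / ρ *
        matI φ (fun L => ψ (lam, L)) γ ν ω (ρ * B) (fun p => w (p.2 - p.1 * ω) (p.1 / ρ)) :=
    fun w hw => matterIntegral_eq hγ hφc hA.continuous_ψ hA.φ_eq_zero hχ hB hρ hw (fun _ _ _ => rfl)
  rw [hconv (fun η s => s * (1 + γ * η + γ * ρ * s * ω)) (by fun_prop),
    hconv (fun _ s => s ^ 2) (by fun_prop), hconv (fun η s => s * (1 + γ * η)) (by fun_prop)]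
  set X := matI φ (fun L => ψ (lam, L)) γ ν ω (ρ * B) (weightThree γ (ν, ω, ρ * B)) with hX
  set X2 := matI φ (fun L => ψ (lam, L)) γ ν ω (ρ * B) (fun p => (p.1 / ρ) ^ 2) with hX2
  have h1 : matI φ (fun L => ψ (lam, L)) γ ν ω (ρ * B)
      (fun p => p.1 / ρ * (1 + γ * (p.2 - p.1 * ω))) = 1 / ρ * X := by
    rw [hX, matI_const_mul]
    refine matI_congr fun p _ => ?_
    unfold weightThree
    ring
  have h3 : matI φ (fun L => ψ (lam, L)) γ ν ω (ρ * B)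
      (fun p => p.1 / ρ * (1 + γ * (p.2 - p.1 * ω) + γ * ρ * (p.1 / ρ) * ω)) =
      1 / ρ * X + γ * ρ * ω * X2 := by
    rw [hX, hX2, matI_const_mul, matI_const_mul,
      matI_add hγ hφc hχc hA.φ_eq_zero hχ _ _ _ (by unfold weightThree; fun_prop) (by fun_prop)]
    refine matI_congr fun p _ => ?_
    unfold weightThree
    ring
  rw [h1, h3]
  constructor
  · field_simp
    ring
  · field_simp
    ring

theorem M3_eq (hA : Ansatz φ ψ E₀ L₀) (hγ : 0 ≤ γ) {u : Fields} {x : E 3}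
    (hρ : 0 < axialRadius x) (hB : 0 < 1 + u.b x) :
    M3 φ ψ γ lam u x = -(32 * Real.pi ^ 2 * γ * Real.exp (2 * u.ξ x) /
      (axialRadius x * (1 + u.b x)) ^ 3) *
      matI φ (fun L => ψ (lam, L)) γ (u.ν x) (u.ω x) (axialRadius x * (1 + u.b x))
        (weightThree γ (u.ν x, u.ω x, axialRadius x * (1 + u.b x))) :=
  (M3_eq_matterIntegral hA hγ hρ hB).2

/-- There is no matter where `ν` is large: particles have `η ≥ ν`, while `φ` and `ψ` cut off at
`η + Lω ≥ E₀` and `|L| > L₀`. -/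
theorem matter_eq_zero (hA : Ansatz φ ψ E₀ L₀) (hγ : 0 ≤ γ) {u : Fields} {x : E 3}
    (hρ : 0 < axialRadius x) (hB : 0 < 1 + u.b x) (hν : E₀ + L₀ * |u.ω x| ≤ u.ν x) :
    M1 φ ψ γ lam u x = 0 ∧ M2 φ ψ γ lam u x = 0 ∧ M3 φ ψ γ lam u x = 0 := by
  rw [M1_eq hA hγ hρ hB, M2_eq hA hγ hρ hB, M3_eq hA hγ hρ hB, matJ_eq_matI]
  simp only [matI_eq_zero hγ hA.φ_eq_zero (hA.ψ_eq_zero lam) hν, mul_zero, and_self]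

theorem continuousAt_matter (hA : Ansatz φ ψ E₀ L₀) (hγ : 0 ≤ γ) {u : Fields} {x : E 3}
    (hρ : 0 < axialRadius x) (hB : 0 < 1 + u.b x) (hν : ContinuousAt u.ν x)
    (hb : ContinuousAt u.b x) (hξ : ContinuousAt u.ξ x) (hω : ContinuousAt u.ω x) :
    ContinuousAt (M1 φ ψ γ lam u) x ∧ ContinuousAt (M2 φ ψ γ lam u) x ∧
      ContinuousAt (M3 φ ψ γ lam u) x := by
  have hr : ContinuousAt (axialRadius : E 3 → ℝ) x := continuous_axialRadius.continuousAt
  have hev : ∀ᶠ y in 𝓝 x, 0 < axialRadius y ∧ 0 < 1 + u.b y :=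
    (hr.eventually_const_lt hρ).and ((continuousAt_const.add hb).eventually_const_lt hB)
  have hW : 0 < axialRadius x * (1 + u.b x) := mul_pos hρ hB
  have hΘ : ContinuousAt (fun y => (u.ν y, u.ω y, axialRadius y * (1 + u.b y))) x :=
    hν.prodMk (hω.prodMk (hr.mul (continuousAt_const.add hb)))
  have hmat : ∀ w : (ℝ × ℝ × ℝ) → (ℝ × ℝ) → ℝ,
      (Continuous fun q : (ℝ × ℝ × ℝ) × (ℝ × ℝ) => w q.1 q.2) →
      ContinuousAt (fun y => matI φ (fun L => ψ (lam, L)) γ (u.ν y) (u.ω y)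
        (axialRadius y * (1 + u.b y)) (w (u.ν y, u.ω y, axialRadius y * (1 + u.b y)))) x := by
    intro w hw
    exact ContinuousAt.comp (f := fun y => (u.ν y, u.ω y, axialRadius y * (1 + u.b y)))
      (g := fun θ : ℝ × ℝ × ℝ => matI φ (fun L => ψ (lam, L)) γ θ.1 θ.2.1 θ.2.2 (w θ))
      (continuousAt_matI hγ hA.continuous_φ (hA.continuous_χ lam) hA.φ_eq_zero
        (hA.ψ_eq_zero lam) hw hW) hΘ
  have hexp : ContinuousAt (fun y => Real.exp (2 * u.ξ y)) x :=
    (continuousAt_const.mul hξ).rexp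
  have hWc : ContinuousAt (fun y => axialRadius y * (1 + u.b y)) x :=
    hr.mul (continuousAt_const.add hb)
  refine ⟨?_, ?_, ?_⟩
  · refine ContinuousAt.congr (f := fun y => 2 * Real.pi * Real.exp (2 * u.ξ y) /
      (axialRadius y * (1 + u.b y)) * matI φ (fun L => ψ (lam, L)) γ (u.ν y) (u.ω y)
        (axialRadius y * (1 + u.b y)) (weightOne γ (u.ν y, u.ω y, axialRadius y * (1 + u.b y)))) ?_
      (hev.mono fun y hy => (M1_eq hA hγ hy.1 hy.2).symm)
    exact ((continuousAt_const.mul hexp).div hWc hW.ne').mul (hmat _ (continuous_weightOne γ))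
  · refine ContinuousAt.congr (f := fun y => 2 * Real.pi * γ ^ 2 * Real.exp (2 * u.ξ y) /
      axialRadius y * (matI φ (fun L => ψ (lam, L)) γ (u.ν y) (u.ω y)
        (axialRadius y * (1 + u.b y)) (fun p => energyFun γ (u.ν y) (p.2 - p.1 * u.ω y)) +
        -(1 / (axialRadius y * (1 + u.b y)) ^ 2) * matI φ (fun L => ψ (lam, L)) γ (u.ν y) (u.ω y)
        (axialRadius y * (1 + u.b y)) (fun p => p.1 ^ 2))) ?_ (hev.mono fun y hy => ?_)
    · refine ((continuousAt_const.mul hexp).div hr hρ.ne').mul (ContinuousAt.add ?_ ?_)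
      · refine hmat (fun θ p => energyFun γ θ.1 (p.2 - p.1 * θ.2.1)) ?_
        have h1 : Continuous fun q : (ℝ × ℝ × ℝ) × (ℝ × ℝ) =>
            (q.1.1, q.2.2 - q.2.1 * q.1.2.1) := by fun_prop
        exact (continuous_energyFun γ).comp h1
      · refine ContinuousAt.mul ?_ (hmat (fun _ p => p.1 ^ 2) (by fun_prop))
        exact (continuousAt_const.div (hWc.pow 2) (pow_ne_zero 2 hW.ne')).neg
    · have h1 : Continuous fun p : ℝ × ℝ => energyFun γ (u.ν y) (p.2 - p.1 * u.ω y) := by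
        have h1 : Continuous fun p : ℝ × ℝ => (u.ν y, p.2 - p.1 * u.ω y) := by fun_prop
        exact (continuous_energyFun γ).comp h1
      rw [M2_eq hA hγ hy.1 hy.2, matJ_eq_matI]
      refine congrArg (fun t => 2 * Real.pi * γ ^ 2 * Real.exp (2 * u.ξ y) / axialRadius y * t) ?_
      rw [matI_const_mul,
        matI_add hγ hA.continuous_φ (hA.continuous_χ lam) hA.φ_eq_zero (hA.ψ_eq_zero lam) _ _ _
          h1 (by fun_prop)]
      refine matI_congr fun p _ => ?_
      unfold matterY
      ring
  · refine ContinuousAt.congr (f := fun y => -(32 * Real.pi ^ 2 * γ * Real.exp (2 * u.ξ y) /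
      (axialRadius y * (1 + u.b y)) ^ 3) * matI φ (fun L => ψ (lam, L)) γ (u.ν y) (u.ω y)
        (axialRadius y * (1 + u.b y))
        (weightThree γ (u.ν y, u.ω y, axialRadius y * (1 + u.b y)))) ?_
      (hev.mono fun y hy => (M3_eq hA hγ hy.1 hy.2).symm)
    exact ((continuousAt_const.mul hexp).div (hWc.pow 3) (pow_ne_zero 3 hW.ne')).neg.mul
      (hmat _ (continuous_weightThree γ))

/-- Bound for the odd moment in `M₃`: the odd factor `s` gains a factor `ρ`. -/
theorem exists_abs_matterIntegral_odd_le (hA : Ansatz φ ψ E₀ L₀) (hγ : 0 ≤ γ) (N : ℝ) :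
    ∃ C, 0 ≤ C ∧ ∀ ν B ω ρ, |ν| ≤ N → 0 < B → B ≤ N → |ω| ≤ N → 0 < ρ → ρ ≤ N →
      |matterIntegral φ ψ γ lam ν B ω ρ (fun η s => s * (1 + γ * η))| ≤ C * ρ := by
  set χ : ℝ → ℝ := fun L => ψ (lam, L) with hχdef
  have hχd : ContDiff ℝ 1 χ := hA.contDiff_ψ.comp (contDiff_const.prodMk contDiff_id)
  set e₁ := E₀ + |L₀| * N with he₁
  set Iη : Set ℝ := Icc (-N) e₁ with hIη
  obtain ⟨T, hT0, hT⟩ := exists_abs_le_of_compact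
    ((isCompact_Icc (a := -N) (b := N)).prod (isCompact_Icc (a := -N) (b := e₁)))
    (f := fun p : ℝ × ℝ => energyFun γ p.1 p.2) (continuous_energyFun γ).continuousOn
  set mb := |N| * √T with hmb
  have hmb0 : 0 ≤ mb := by positivity
  obtain ⟨Q, hQ0, hQ⟩ := exists_abs_le_of_compact
    ((isCompact_Icc (a := -N) (b := e₁)).prod ((isCompact_Icc (a := -N) (b := N)).prod
      (isCompact_Icc (a := -(|N| * mb)) (b := |N| * mb))))
    (f := fun q : ℝ × ℝ × ℝ => deriv φ (q.1 + q.2.2 * q.2.1) * q.2.1 * χ q.2.2 +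
      φ (q.1 + q.2.2 * q.2.1) * deriv χ q.2.2) (by
      have h1 := hA.contDiff_φ.continuous_deriv le_rfl
      have h2 := hχd.continuous_deriv le_rfl
      have h3 := hA.continuous_φ
      have h4 := hχd.continuous
      exact Continuous.continuousOn (by fun_prop))
  obtain ⟨A, hA0, hAb⟩ := exists_abs_le_of_compact (isCompact_Icc (a := -N) (b := e₁))
    (f := fun η => 1 + γ * η) (Continuous.continuousOn (by fun_prop))
  set D := mb * A * (Q * mb) * (2 * mb) with hD
  refine ⟨D * max (e₁ + N) 0, by positivity, fun ν B ω ρ hν hB hBN hω hρ hρN => ?_⟩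
  have hN0 : 0 < N := hB.trans_le hBN
  have hinner : ∀ η, etaMin γ ν < η → ‖∫ s in (-mBound γ η B ν)..(mBound γ η B ν),
      s * (1 + γ * η) * φ (η + ρ * s * ω) * ψ (lam, ρ * s)‖ ≤
        (Icc (-N) e₁).indicator (fun _ => D * ρ) η := by
    intro η hη
    have hνη : -N < η := lt_of_le_of_lt ((abs_le.1 hν).1.trans (le_etaMin hγ ν)) hη
    have hm := mBound_eq hγ hη B
    have hm0 : 0 ≤ mBound γ η B ν := by rw [hm]; positivity
    by_cases he : η ≤ e₁
    · rw [indicator_of_mem (show η ∈ Icc (-N) e₁ from ⟨hνη.le, he⟩)]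
      have hmle : mBound γ η B ν ≤ mb := by
        rw [hm, hmb]
        refine mul_le_mul (hBN.trans (le_abs_self _)) (Real.sqrt_le_sqrt ?_) (Real.sqrt_nonneg _)
          (abs_nonneg _)
        exact (le_abs_self _).trans (hT (ν, η) ⟨abs_le.1 hν, hνη.le, he⟩)
      set k : ℝ → ℝ := fun L => φ (η + L * ω) * χ L with hk
      have hkd : ∀ L, HasDerivAt k (deriv φ (η + L * ω) * ω * χ L + φ (η + L * ω) * deriv χ L) L := by
        intro L
        have h1 : HasDerivAt (fun L => η + L * ω) ω L := by
          simpa using ((hasDerivAt_id L).mul_const ω).const_add η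
        have h2 : HasDerivAt φ (deriv φ (η + L * ω)) (η + L * ω) :=
          (hA.contDiff_φ.differentiable (by norm_num) _).hasDerivAt
        have h3 : HasDerivAt χ (deriv χ L) L :=
          (hχd.differentiable (by norm_num) _).hasDerivAt
        exact (h2.comp L h1).mul h3
      have hklip : ∀ s, |s| ≤ mBound γ η B ν → |k (ρ * s) - k 0| ≤ Q * (ρ * |s|) := by
        intro s hs
        have hs2 : |ρ * s| ≤ |N| * mb := by
          rw [abs_mul]
          exact mul_le_mul (abs_le_abs_of_nonneg hρ.le hρN) (hs.trans hmle) (abs_nonneg _)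
            (abs_nonneg _)
        have := Convex.norm_image_sub_le_of_norm_hasDerivWithin_le
          (s := Icc (-(|N| * mb)) (|N| * mb)) (C := Q) (x := 0) (y := ρ * s)
          (fun L _ => (hkd L).hasDerivWithinAt)
          (fun L hL => hQ (η, ω, L) ⟨⟨hνη.le, he⟩, abs_le.1 hω, hL⟩) (convex_Icc _ _)
          ⟨by linarith [mul_nonneg (abs_nonneg N) hmb0], mul_nonneg (abs_nonneg N) hmb0⟩
          (abs_le.1 hs2)
        rw [sub_zero, Real.norm_eq_abs, Real.norm_eq_abs, abs_mul, abs_of_pos hρ] at this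
        exact this
      have hkc : Continuous k := continuous_iff_continuousAt.2 fun L => (hkd L).continuousAt
      -- The constant term of `k` integrates to zero against the odd factor `s`.
      have hzero : ∫ s in (-mBound γ η B ν)..(mBound γ η B ν), s * ((1 + γ * η) * k 0) = 0 := by
        rw [intervalIntegral.integral_mul_const, integral_id]
        ring
      have heq : ∫ s in (-mBound γ η B ν)..(mBound γ η B ν),
          s * (1 + γ * η) * φ (η + ρ * s * ω) * ψ (lam, ρ * s) =
          ∫ s in (-mBound γ η B ν)..(mBound γ η B ν), s * (1 + γ * η) * (k (ρ * s) - k 0) := by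
        have h3 := hA.continuous_φ
        have h4 := hA.continuous_ψ
        have hs := intervalIntegral.integral_sub (μ := volume) (a := -mBound γ η B ν)
          (b := mBound γ η B ν)
          (f := fun s => s * (1 + γ * η) * φ (η + ρ * s * ω) * ψ (lam, ρ * s))
          (g := fun s => s * ((1 + γ * η) * k 0))
          (Continuous.intervalIntegrable (by fun_prop) _ _)
          (Continuous.intervalIntegrable (by fun_prop) _ _)
        rw [hzero, sub_zero] at hs
        rw [← hs]
        congr 1
        funext s
        simp only [hk, hχdef]
        ring
      rw [heq]
      have hb := intervalIntegral.norm_integral_le_of_norm_le_const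
        (a := -mBound γ η B ν) (b := mBound γ η B ν) (C := mb * A * (Q * (ρ * mb)))
        (f := fun s => s * (1 + γ * η) * (k (ρ * s) - k 0)) (fun s hs => by
          rw [uIoc_of_le (by linarith)] at hs
          have hs' : |s| ≤ mBound γ η B ν := abs_le.2 ⟨hs.1.le, hs.2⟩
          rw [Real.norm_eq_abs, abs_mul, abs_mul]
          refine mul_le_mul (mul_le_mul (hs'.trans hmle) (hAb η ⟨hνη.le, he⟩) (abs_nonneg _) hmb0)
            ((hklip s hs').trans ?_) (abs_nonneg _) (by positivity)
          exact mul_le_mul_of_nonneg_left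
            (mul_le_mul_of_nonneg_left (hs'.trans hmle) hρ.le) hQ0)
      refine hb.trans ?_
      have h2m : |mBound γ η B ν - -mBound γ η B ν| ≤ 2 * mb := by
        rw [sub_neg_eq_add, abs_of_nonneg (by linarith)]; linarith
      calc _ ≤ mb * A * (Q * (ρ * mb)) * (2 * mb) := mul_le_mul_of_nonneg_left h2m (by positivity)
        _ = D * ρ := by rw [hD]; ring
    · have h0 : ∀ s, s * (1 + γ * η) * φ (η + ρ * s * ω) * ψ (lam, ρ * s) = 0 := by
        intro s
        by_cases hs : L₀ < |ρ * s|
        · rw [hA.ψ_eq_zero lam _ hs, mul_zero]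
        · have h1 : |ρ * s * ω| ≤ |L₀| * N := by
            rw [abs_mul]
            exact mul_le_mul ((not_lt.1 hs).trans (le_abs_self _)) hω (abs_nonneg _) (abs_nonneg _)
          rw [hA.φ_eq_zero _ (by linarith [neg_abs_le (ρ * s * ω), not_le.1 he]), mul_zero, zero_mul]
      simp only [h0, intervalIntegral.integral_zero, norm_zero]
      exact indicator_nonneg (fun _ _ => by positivity) _
  unfold matterIntegral
  have hint : Integrable ((Icc (-N) e₁).indicator fun _ : ℝ => D * ρ)
      (volume.restrict (Ioi (etaMin γ ν))) :=
    ((integrable_indicator_iff measurableSet_Icc).2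
      (integrableOn_const isCompact_Icc.measure_lt_top.ne)).restrict
  have h := norm_integral_le_of_norm_le hint
    ((ae_restrict_mem measurableSet_Ioi).mono fun η hη => hinner η hη)
  rw [Real.norm_eq_abs] at h
  refine h.trans ?_
  have h5 : ∫ η in Ioi (etaMin γ ν), (Icc (-N) e₁).indicator (fun _ : ℝ => D * ρ) η ≤
      ∫ η, (Icc (-N) e₁).indicator (fun _ : ℝ => D * ρ) η := by
    refine setIntegral_le_integral ((integrable_indicator_iff measurableSet_Icc).2
      (integrableOn_const isCompact_Icc.measure_lt_top.ne)) (Eventually.of_forall fun η => ?_)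
    exact indicator_nonneg (fun _ _ => by positivity) _
  refine h5.trans (le_of_eq ?_)
  rw [integral_indicator measurableSet_Icc, setIntegral_const, smul_eq_mul, Measure.real,
    Real.volume_Icc, ENNReal.toReal_ofReal']
  ring_nf

end matter_terms

/-! ### A calculus of decaying functions -/

section decay

/-- `f = O((1 + |x|)^{-p})`. -/
def Decays (p : ℤ) (f : E 3 → ℝ) : Prop := ∃ C, ∀ x, |f x| ≤ C * (1 + ‖x‖) ^ (-p)

/-- The local Hölder constants of `f` are `O((1 + |x|)^{-q})`. -/
def Hol (α : ℝ) (q : ℤ) (f : E 3 → ℝ) : Prop :=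
  ∃ C, ∀ x y, ‖x - y‖ ≤ 1 → |f x - f y| ≤ C * (1 + ‖x‖) ^ (-q) * ‖x - y‖ ^ α

/-- A `C¹` function of order `-p` with first derivatives of order `-q`. -/
structure GradDecays (p q : ℤ) (f : E 3 → ℝ) : Prop where
  contDiff : ContDiff ℝ (1 : ℕ) f
  size : Decays p f
  grad : ∀ i, Decays q (pd i f)

/-- A `C¹` function of order `-p` with first derivatives of order `-p - 1`, whose local Hölder
constants are of order `-q`. -/
structure Reg (α : ℝ) (p q : ℤ) (f : E 3 → ℝ) : Prop where
  toGradDecays : GradDecays p (p + 1) f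
  hol : ∀ i, Hol α q (pd i f)

variable {f g : E 3 → ℝ} {p q r p₁ p₂ q₁ q₂ : ℤ} {α : ℝ}

theorem weight_pos (x : E 3) : 0 < 1 + ‖x‖ := by positivity

theorem one_le_weight (x : E 3) : 1 ≤ 1 + ‖x‖ := by linarith [norm_nonneg x]

theorem Decays.exists_nonneg (h : Decays p f) : ∃ C, 0 ≤ C ∧ ∀ x, |f x| ≤ C * (1 + ‖x‖) ^ (-p) := by
  obtain ⟨C, hC⟩ := h
  refine ⟨|C|, abs_nonneg _, fun x => (hC x).trans ?_⟩
  have := zpow_pos (weight_pos x) (-p)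
  exact mul_le_mul_of_nonneg_right (le_abs_self C) this.le

theorem zpow_weight_le (h : q ≤ p) (x : E 3) : (1 + ‖x‖) ^ (-p) ≤ (1 + ‖x‖) ^ (-q) :=
  zpow_le_zpow_right₀ (one_le_weight x) (by omega)

theorem Decays.mono (h : Decays p f) (hq : q ≤ p) : Decays q f := by
  obtain ⟨C, hC0, hC⟩ := h.exists_nonneg
  exact ⟨C, fun x => (hC x).trans (mul_le_mul_of_nonneg_left (zpow_weight_le hq x) hC0)⟩

theorem Decays.add (hf : Decays p f) (hg : Decays p g) : Decays p (fun x => f x + g x) := by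
  obtain ⟨C, hC⟩ := hf
  obtain ⟨D, hD⟩ := hg
  refine ⟨C + D, fun x => (abs_add_le _ _).trans ?_⟩
  rw [add_mul]
  exact add_le_add (hC x) (hD x)

theorem Decays.neg (hf : Decays p f) : Decays p (fun x => -f x) := by
  obtain ⟨C, hC⟩ := hf
  exact ⟨C, fun x => by rw [abs_neg]; exact hC x⟩

theorem Decays.sub (hf : Decays p f) (hg : Decays p g) : Decays p (fun x => f x - g x) := by
  simpa only [sub_eq_add_neg] using hf.add hg.neg

theorem Decays.mul (hf : Decays p₁ f) (hg : Decays p₂ g) (h : p ≤ p₁ + p₂) :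
    Decays p (fun x => f x * g x) := by
  refine Decays.mono (p := p₁ + p₂) ?_ h
  obtain ⟨C, hC0, hC⟩ := hf.exists_nonneg
  obtain ⟨D, hD0, hD⟩ := hg.exists_nonneg
  refine ⟨C * D, fun x => ?_⟩
  rw [abs_mul]
  have hw := weight_pos x
  calc |f x| * |g x| ≤ (C * (1 + ‖x‖) ^ (-p₁)) * (D * (1 + ‖x‖) ^ (-p₂)) :=
        mul_le_mul (hC x) (hD x) (abs_nonneg _) (by positivity)
    _ = C * D * (1 + ‖x‖) ^ (-(p₁ + p₂)) := by
        rw [neg_add, zpow_add₀ hw.ne']; ring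

theorem decays_of_abs_le {C : ℝ} (h : ∀ x, |f x| ≤ C) : Decays 0 f :=
  ⟨C, fun x => by simpa using h x⟩

theorem decays_const (c : ℝ) : Decays 0 (fun _ => c) := decays_of_abs_le fun _ => le_rfl

theorem Decays.const_mul (hf : Decays p f) (c : ℝ) : Decays p (fun x => c * f x) :=
  (decays_const c).mul hf (by omega)

theorem decays_zero : Decays p (fun _ => (0 : ℝ)) := ⟨0, fun x => by simp⟩

theorem decays_natCast {C : ℝ} {n : ℕ} (h : ∀ x, |f x| ≤ C * ((1 + ‖x‖) ^ n)⁻¹) : Decays n f :=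
  ⟨C, fun x => by rw [zpow_neg, zpow_natCast]; exact h x⟩

theorem Decays.exists_natCast {n : ℕ} (h : Decays n f) :
    ∃ C, 0 ≤ C ∧ ∀ x, |f x| ≤ C * ((1 + ‖x‖) ^ n)⁻¹ := by
  obtain ⟨C, hC0, hC⟩ := h.exists_nonneg
  exact ⟨C, hC0, fun x => by have := hC x; rwa [zpow_neg, zpow_natCast] at this⟩

theorem decays_coord (i : Fin 3) : Decays (-1) (fun x : E 3 => x i) :=
  ⟨1, fun x => by
    have := PiLp.norm_apply_le x i
    rw [Real.norm_eq_abs] at this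
    simp only [neg_neg, zpow_one, one_mul]
    linarith⟩

/-- For continuous functions only the behaviour outside a ball matters. -/
theorem Decays.of_exterior {C r : ℝ} {n : ℕ} (hf : Continuous f)
    (h : ∀ x, r < ‖x‖ → |f x| ≤ C * ((1 + ‖x‖) ^ n)⁻¹) : Decays n f := by
  obtain ⟨D, hD0, hD⟩ := exists_abs_le_of_compact (isCompact_closedBall (0 : E 3) r) hf.continuousOn
  refine decays_natCast (C := max C (D * (1 + |r|) ^ n)) fun x => ?_
  have hw : 0 < ((1 + ‖x‖) ^ n)⁻¹ := inv_pos.2 (pow_pos (weight_pos x) n)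
  by_cases hx : r < ‖x‖
  · exact (h x hx).trans (mul_le_mul_of_nonneg_right (le_max_left _ _) hw.le)
  · refine le_trans ?_ (mul_le_mul_of_nonneg_right (le_max_right _ _) hw.le)
    refine (hD x (by simpa using hx)).trans ?_
    rw [mul_assoc]
    refine le_mul_of_one_le_right hD0 ?_
    rw [← div_eq_mul_inv, one_le_div (pow_pos (weight_pos x) n)]
    exact pow_le_pow_left₀ (weight_pos x).le (by linarith [le_abs_self r]) n

/-- Weights at points of distance at most `1` are comparable. -/
theorem zpow_weight_comparable (p : ℤ) {x y : E 3} (h : ‖x - y‖ ≤ 1) :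
    (1 + ‖y‖) ^ p ≤ 2 ^ |p| * (1 + ‖x‖) ^ p := by
  have hx := weight_pos x
  have hy := weight_pos y
  have h1 := norm_sub_norm_le x y
  have h2 := norm_sub_norm_le y x
  rw [norm_sub_rev] at h2
  have hxy : 1 + ‖y‖ ≤ 2 * (1 + ‖x‖) := by linarith [norm_nonneg x]
  have hyx : 1 + ‖x‖ ≤ 2 * (1 + ‖y‖) := by linarith [norm_nonneg y]
  rcases le_total 0 p with hp | hp
  · rw [abs_of_nonneg hp, ← mul_zpow]
    exact zpow_le_zpow_left₀ hp hy.le hxy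
  · rw [abs_of_nonpos hp]
    obtain ⟨n, hn⟩ := Int.eq_ofNat_of_zero_le (neg_nonneg.2 hp)
    have hp' : p = -(n : ℤ) := by omega
    rw [hp', neg_neg, zpow_neg, zpow_neg, zpow_natCast, zpow_natCast, zpow_natCast,
      ← div_eq_mul_inv, inv_eq_one_div, div_le_div_iff₀ (by positivity) (by positivity), one_mul,
      ← mul_pow]
    exact pow_le_pow_left₀ hx.le hyx n

theorem Hol.exists_nonneg (h : Hol α q f) : ∃ C, 0 ≤ C ∧
    ∀ x y, ‖x - y‖ ≤ 1 → |f x - f y| ≤ C * (1 + ‖x‖) ^ (-q) * ‖x - y‖ ^ α := by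
  obtain ⟨C, hC⟩ := h
  refine ⟨|C|, abs_nonneg _, fun x y hxy => (hC x y hxy).trans ?_⟩
  have := zpow_pos (weight_pos x) (-q)
  exact mul_le_mul_of_nonneg_right (mul_le_mul_of_nonneg_right (le_abs_self C) this.le)
    (Real.rpow_nonneg (norm_nonneg _) _)

theorem Hol.mono (h : Hol α p f) (hq : q ≤ p) : Hol α q f := by
  obtain ⟨C, hC0, hC⟩ := h.exists_nonneg
  refine ⟨C, fun x y hxy => (hC x y hxy).trans ?_⟩
  exact mul_le_mul_of_nonneg_right (mul_le_mul_of_nonneg_left (zpow_weight_le hq x) hC0)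
    (Real.rpow_nonneg (norm_nonneg _) _)

theorem Hol.add (hf : Hol α q f) (hg : Hol α q g) : Hol α q (fun x => f x + g x) := by
  obtain ⟨C, hC⟩ := hf
  obtain ⟨D, hD⟩ := hg
  refine ⟨C + D, fun x y hxy => ?_⟩
  have h : f x + g x - (f y + g y) = (f x - f y) + (g x - g y) := by ring
  rw [h, add_mul, add_mul]
  exact (abs_add_le _ _).trans (add_le_add (hC x y hxy) (hD x y hxy))

theorem Hol.neg (hf : Hol α q f) : Hol α q (fun x => -f x) := by
  obtain ⟨C, hC⟩ := hf
  refine ⟨C, fun x y hxy => ?_⟩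
  have h : -f x - -f y = -(f x - f y) := by ring
  rw [h, abs_neg]
  exact hC x y hxy

theorem hol_const (c : ℝ) : Hol α q (fun _ => c) := ⟨0, fun x y _ => by simp⟩

theorem Hol.mul (hf : Decays p₁ f) (hf' : Hol α q₁ f) (hg : Decays p₂ g) (hg' : Hol α q₂ g)
    (h1 : q ≤ q₁ + p₂) (h2 : q ≤ p₁ + q₂) : Hol α q (fun x => f x * g x) := by
  obtain ⟨A, hA0, hA⟩ := hf.exists_nonneg
  obtain ⟨A', hA'0, hA'⟩ := hf'.exists_nonneg
  obtain ⟨B, hB0, hB⟩ := hg.exists_nonneg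
  obtain ⟨B', hB'0, hB'⟩ := hg'.exists_nonneg
  refine ⟨A * B' + 2 ^ |(-p₂)| * (A' * B), fun x y hxy => ?_⟩
  have hw := weight_pos x
  set δ := ‖x - y‖ ^ α with hδ
  have hδ0 : 0 ≤ δ := Real.rpow_nonneg (norm_nonneg _) _
  have hgy : |g y| ≤ B * (2 ^ |(-p₂)| * (1 + ‖x‖) ^ (-p₂)) :=
    (hB y).trans (mul_le_mul_of_nonneg_left (zpow_weight_comparable (-p₂) hxy) hB0)
  have hsplit : f x * g x - f y * g y = f x * (g x - g y) + (f x - f y) * g y := by ring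
  have e1 : (1 + ‖x‖) ^ (-p₁) * (1 + ‖x‖) ^ (-q₂) ≤ (1 + ‖x‖) ^ (-q) := by
    rw [← zpow_add₀ hw.ne', ← neg_add]; exact zpow_weight_le h2 x
  have e2 : (1 + ‖x‖) ^ (-q₁) * (1 + ‖x‖) ^ (-p₂) ≤ (1 + ‖x‖) ^ (-q) := by
    rw [← zpow_add₀ hw.ne', ← neg_add]; exact zpow_weight_le h1 x
  have t1 : |f x * (g x - g y)| ≤ A * B' * (1 + ‖x‖) ^ (-q) * δ := by
    rw [abs_mul]
    calc _ ≤ (A * (1 + ‖x‖) ^ (-p₁)) * (B' * (1 + ‖x‖) ^ (-q₂) * δ) :=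
          mul_le_mul (hA x) (hB' x y hxy) (abs_nonneg _) (by positivity)
      _ = A * B' * ((1 + ‖x‖) ^ (-p₁) * (1 + ‖x‖) ^ (-q₂)) * δ := by ring
      _ ≤ _ := mul_le_mul_of_nonneg_right (mul_le_mul_of_nonneg_left e1 (by positivity)) hδ0
  have t2 : |(f x - f y) * g y| ≤ 2 ^ |(-p₂)| * (A' * B) * (1 + ‖x‖) ^ (-q) * δ := by
    rw [abs_mul]
    calc _ ≤ (A' * (1 + ‖x‖) ^ (-q₁) * δ) * (B * (2 ^ |(-p₂)| * (1 + ‖x‖) ^ (-p₂))) :=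
          mul_le_mul (hA' x y hxy) hgy (abs_nonneg _) (by positivity)
      _ = 2 ^ |(-p₂)| * (A' * B) * ((1 + ‖x‖) ^ (-q₁) * (1 + ‖x‖) ^ (-p₂)) * δ := by ring
      _ ≤ _ := mul_le_mul_of_nonneg_right (mul_le_mul_of_nonneg_left e2 (by positivity)) hδ0
  rw [hsplit, add_mul, add_mul]
  exact (abs_add_le _ _).trans (add_le_add t1 t2)

theorem hol_of_global {C : ℝ} (h : ∀ x y, |f x - f y| ≤ C * ‖x - y‖ ^ α) : Hol α 0 f :=
  ⟨C, fun x y _ => by simpa using h x y⟩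

theorem abs_sub_le_of_pd_le (hα0 : 0 < α) (hα : α ≤ 1) {x y : E 3} {D : ℝ} (hxy : ‖x - y‖ ≤ 1)
    (hf : ∀ z, ‖x - z‖ ≤ 1 → DifferentiableAt ℝ f z) (hD : 0 ≤ D)
    (h : ∀ z, ‖x - z‖ ≤ 1 → ∀ i, |pd i f z| ≤ D) : |f x - f y| ≤ 3 * D * ‖x - y‖ ^ α := by
  have hseg : ∀ z ∈ segment ℝ y x, ‖x - z‖ ≤ 1 := by
    intro z hz
    have hb : segment ℝ y x ⊆ Metric.closedBall x 1 :=
      (convex_closedBall x 1).segment_subset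
        (by rw [Metric.mem_closedBall, dist_eq_norm, norm_sub_rev]; exact hxy)
        (Metric.mem_closedBall_self zero_le_one)
    have := hb hz
    rwa [Metric.mem_closedBall, dist_eq_norm, norm_sub_rev] at this
  have hmv := Convex.norm_image_sub_le_of_norm_fderiv_le (𝕜 := ℝ)
    (fun z hz => hf z (hseg z hz)) (fun z hz => norm_fderiv_le_of_pd hD (h z (hseg z hz)))
    (convex_segment y x) (left_mem_segment ℝ y x) (right_mem_segment ℝ y x)
  rw [Real.norm_eq_abs] at hmv
  refine hmv.trans (mul_le_mul_of_nonneg_left ?_ (by positivity))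
  rcases (norm_nonneg (x - y)).eq_or_lt with h0 | h0
  · rw [← h0, Real.zero_rpow hα0.ne']
  · conv_lhs => rw [← Real.rpow_one ‖x - y‖]
    exact Real.rpow_le_rpow_of_exponent_ge h0 hxy hα

/-- On the unit scale a gradient bound controls every Hölder quotient with exponent `α ≤ 1`. -/
theorem hol_of_grad (hα0 : 0 < α) (hα : α ≤ 1) (hf : ContDiff ℝ (1 : ℕ) f)
    (h : ∀ i, Decays q (pd i f)) : Hol α q f := by
  choose C hC0 hC using fun i => (h i).exists_nonneg
  set D := ∑ i, C i with hD
  have hD0 : 0 ≤ D := Finset.sum_nonneg fun i _ => hC0 i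
  refine ⟨3 * (D * 2 ^ |(-q)|), fun x y hxy => ?_⟩
  have hw := zpow_pos (weight_pos x) (-q)
  refine (abs_sub_le_of_pd_le (D := D * (2 ^ |(-q)| * (1 + ‖x‖) ^ (-q))) hα0 hα hxy
    (fun z _ => hf.differentiable (by norm_num) z) (by positivity) fun z hz i =>
    (hC i z).trans (mul_le_mul (Finset.single_le_sum (fun i _ => hC0 i) (Finset.mem_univ i))
      (zpow_weight_comparable (-q) hz) (zpow_pos (weight_pos z) _).le hD0)).trans
    (le_of_eq (by ring))

theorem Hol.of_exterior (hα0 : 0 < α) (hα : α ≤ 1) {C r : ℝ} {n : ℕ} (h0 : Hol α 0 f)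
    (hf : ∀ x, r < ‖x‖ → DifferentiableAt ℝ f x)
    (h : ∀ x, r < ‖x‖ → ∀ i, |pd i f x| ≤ C * ((1 + ‖x‖) ^ n)⁻¹) : Hol α n f := by
  obtain ⟨D, hD0, hD⟩ := h0.exists_nonneg
  refine ⟨max (3 * (|C| * 2 ^ |(-n : ℤ)|)) (D * (1 + (|r| + 1)) ^ n), fun x y hxy => ?_⟩
  have hw := zpow_pos (weight_pos x) (-n)
  have hp := Real.rpow_nonneg (norm_nonneg (x - y)) α
  by_cases hx : |r| + 1 < ‖x‖
  · have hz : ∀ z : E 3, ‖x - z‖ ≤ 1 → r < ‖z‖ := fun z hz => by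
      linarith [norm_sub_norm_le x z, le_abs_self r]
    refine (abs_sub_le_of_pd_le (D := |C| * (2 ^ |(-n : ℤ)| * (1 + ‖x‖) ^ (-n : ℤ))) hα0 hα hxy
      (fun z h1 => hf z (hz z h1)) (by positivity) fun z h1 i => (h z (hz z h1) i).trans ?_).trans ?_
    · have := zpow_weight_comparable (-n) h1
      have hwz := weight_pos z
      rw [zpow_neg, zpow_natCast] at this
      exact (mul_le_mul_of_nonneg_right (le_abs_self C) (by positivity)).trans
        (mul_le_mul_of_nonneg_left this (abs_nonneg C))
    · refine le_trans (le_of_eq ?_) (mul_le_mul_of_nonneg_right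
        (mul_le_mul_of_nonneg_right (le_max_left _ _) hw.le) hp)
      ring
  · refine le_trans ?_ (mul_le_mul_of_nonneg_right
      (mul_le_mul_of_nonneg_right (le_max_right _ _) hw.le) hp)
    refine (hD x y hxy).trans (mul_le_mul_of_nonneg_right ?_ hp)
    rw [neg_zero, zpow_zero, mul_assoc]
    refine mul_le_mul_of_nonneg_left ?_ hD0
    rw [zpow_neg, zpow_natCast, ← div_eq_mul_inv, one_le_div (pow_pos (weight_pos x) n)]
    exact pow_le_pow_left₀ (weight_pos x).le (by linarith) n

/-! ### Functions with decaying gradient -/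

theorem GradDecays.differentiable (h : GradDecays p q f) : Differentiable ℝ f :=
  h.contDiff.differentiable (by norm_num)

theorem GradDecays.mono (h : GradDecays p₁ q₁ f) (hp : p ≤ p₁) (hq : q ≤ q₁) : GradDecays p q f :=
  ⟨h.contDiff, h.size.mono hp, fun i => (h.grad i).mono hq⟩

theorem pd_add_fun (hf : Differentiable ℝ f) (hg : Differentiable ℝ g) (i : Fin 3) :
    pd i (fun y => f y + g y) = fun x => pd i f x + pd i g x :=
  funext fun x => pd_add (hf x) (hg x) i

theorem pd_mul_fun (hf : Differentiable ℝ f) (hg : Differentiable ℝ g) (i : Fin 3) :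
    pd i (fun y => f y * g y) = fun x => pd i f x * g x + f x * pd i g x :=
  funext fun x => pd_mul (hf x) (hg x) i

theorem pd_neg_fun (i : Fin 3) (f : E 3 → ℝ) : pd i (fun y => -f y) = fun x => -pd i f x := by
  funext x
  simp only [pd]
  rw [fderiv_fun_neg]
  rfl

theorem GradDecays.add (hf : GradDecays p q f) (hg : GradDecays p q g) :
    GradDecays p q (fun x => f x + g x) := by
  refine ⟨hf.contDiff.add hg.contDiff, hf.size.add hg.size, fun i => ?_⟩
  rw [pd_add_fun hf.differentiable hg.differentiable]
  exact (hf.grad i).add (hg.grad i)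

theorem GradDecays.neg (hf : GradDecays p q f) : GradDecays p q (fun x => -f x) := by
  refine ⟨hf.contDiff.neg, hf.size.neg, fun i => ?_⟩
  rw [pd_neg_fun]
  exact (hf.grad i).neg

theorem GradDecays.sub (hf : GradDecays p q f) (hg : GradDecays p q g) :
    GradDecays p q (fun x => f x - g x) := by
  simpa only [sub_eq_add_neg] using hf.add hg.neg

theorem GradDecays.mul (hf : GradDecays p₁ q₁ f) (hg : GradDecays p₂ q₂ g) (hp : p ≤ p₁ + p₂)
    (hq1 : q ≤ q₁ + p₂) (hq2 : q ≤ p₁ + q₂) : GradDecays p q (fun x => f x * g x) := by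
  refine ⟨hf.contDiff.mul hg.contDiff, hf.size.mul hg.size hp, fun i => ?_⟩
  rw [pd_mul_fun hf.differentiable hg.differentiable]
  exact ((hf.grad i).mul hg.size hq1).add (hf.size.mul (hg.grad i) hq2)

theorem gradDecays_const (c : ℝ) : GradDecays 0 q (fun _ => c) :=
  ⟨contDiff_const, decays_const c, fun i => by rw [pd_const]; exact decays_zero⟩

theorem GradDecays.const_mul (hf : GradDecays p q f) (c : ℝ) : GradDecays p q (fun x => c * f x) :=
  (gradDecays_const (q := q - p) c).mul hf (by omega) (by omega) (by omega)

theorem gradDecays_coord (i : Fin 3) : GradDecays (-1) 0 (fun x : E 3 => x i) :=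
  ⟨by fun_prop, decays_coord i, fun j => by
    have : pd j (fun y : E 3 => y i) = fun _ => if j = i then (1 : ℝ) else 0 :=
      funext fun x => pd_coord j i x
    rw [this]; exact decays_const _⟩

theorem GradDecays.inv {c : ℝ} (hf : GradDecays 0 q f) (hc : 0 < c) (h : ∀ x, c ≤ f x) :
    GradDecays 0 q (fun x => (f x)⁻¹) ∧
      ∀ i, pd i (fun x => (f x)⁻¹) = fun x => -pd i f x * ((f x)⁻¹ * (f x)⁻¹) := by
  have hne : ∀ x, f x ≠ 0 := fun x => (hc.trans_le (h x)).ne'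
  have hsize : Decays 0 (fun x => (f x)⁻¹) := by
    refine decays_of_abs_le (C := c⁻¹) fun x => ?_
    rw [abs_inv, abs_of_pos (hc.trans_le (h x))]
    exact inv_anti₀ hc (h x)
  have hpd : ∀ i, pd i (fun x => (f x)⁻¹) = fun x => -pd i f x * ((f x)⁻¹ * (f x)⁻¹) := by
    intro i
    funext x
    rw [pd_comp (h := fun t => t⁻¹) (hasDerivAt_inv (hne x)) (hf.differentiable x)]
    field_simp
  refine ⟨⟨hf.contDiff.inv hne, hsize, fun i => ?_⟩, hpd⟩
  rw [hpd]
  exact (hf.grad i).neg.mul (hsize.mul hsize (p := 0) (by omega)) (by omega)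

theorem GradDecays.exp {N : ℝ} (hf : GradDecays 0 q f) (hN : ∀ x, |f x| ≤ N) :
    GradDecays 0 q (fun x => Real.exp (f x)) ∧
      ∀ i, pd i (fun x => Real.exp (f x)) = fun x => Real.exp (f x) * pd i f x := by
  have hsize : Decays 0 (fun x => Real.exp (f x)) := by
    refine decays_of_abs_le (C := Real.exp N) fun x => ?_
    rw [abs_of_pos (Real.exp_pos _)]
    exact Real.exp_le_exp.2 ((le_abs_self _).trans (hN x))
  have hpd : ∀ i, pd i (fun x => Real.exp (f x)) = fun x => Real.exp (f x) * pd i f x := by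
    intro i
    funext x
    exact pd_comp (Real.hasDerivAt_exp _) (hf.differentiable x) i
  refine ⟨⟨hf.contDiff.exp, hsize, fun i => ?_⟩, hpd⟩
  rw [hpd]
  exact hsize.mul (hf.grad i) (by omega)

/-! ### Functions with Hölder continuous gradient -/

section reg

theorem Reg.size (h : Reg α p q f) : Decays p f := h.toGradDecays.size

theorem Reg.mono (h : Reg α p₁ q₁ f) (hp : p ≤ p₁) (hq : q ≤ q₁) : Reg α p q f :=
  ⟨h.toGradDecays.mono hp (by omega), fun i => (h.hol i).mono hq⟩

theorem Reg.add (hf : Reg α p q f) (hg : Reg α p q g) : Reg α p q (fun x => f x + g x) := by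
  refine ⟨hf.toGradDecays.add hg.toGradDecays, fun i => ?_⟩
  rw [pd_add_fun hf.toGradDecays.differentiable hg.toGradDecays.differentiable]
  exact (hf.hol i).add (hg.hol i)

theorem Reg.neg (hf : Reg α p q f) : Reg α p q (fun x => -f x) := by
  refine ⟨hf.toGradDecays.neg, fun i => ?_⟩
  rw [pd_neg_fun]
  exact (hf.hol i).neg

theorem Reg.sub (hf : Reg α p q f) (hg : Reg α p q g) : Reg α p q (fun x => f x - g x) := by
  simpa only [sub_eq_add_neg] using hf.add hg.neg

theorem Reg.mul (hα0 : 0 < α) (hα : α ≤ 1) (hf : Reg α p₁ q₁ f) (hg : Reg α p₂ q₂ g) (hp : p ≤ p₁ + p₂)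
    (hq1 : q ≤ q₁ + p₂) (hq2 : q ≤ p₁ + q₂) (hq : q ≤ p₁ + p₂ + 2) :
    Reg α p q (fun x => f x * g x) := by
  refine ⟨hf.toGradDecays.mul hg.toGradDecays hp (by omega) (by omega), fun i => ?_⟩
  rw [pd_mul_fun hf.toGradDecays.differentiable hg.toGradDecays.differentiable]
  have hf1 := hol_of_grad hα0 hα hf.toGradDecays.contDiff hf.toGradDecays.grad
  have hg1 := hol_of_grad hα0 hα hg.toGradDecays.contDiff hg.toGradDecays.grad
  exact (Hol.mul (hf.toGradDecays.grad i) (hf.hol i) hg.size hg1 hq1 (by omega)).add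
    (Hol.mul hf.size hf1 (hg.toGradDecays.grad i) (hg.hol i) (by omega) hq2)

theorem reg_const (c : ℝ) : Reg α 0 q (fun _ => c) :=
  ⟨gradDecays_const c, fun i => by rw [pd_const]; exact hol_const 0⟩

theorem reg_coord (i : Fin 3) : Reg α (-1) q (fun x : E 3 => x i) :=
  ⟨gradDecays_coord i, fun j => by
    have : pd j (fun y : E 3 => y i) = fun _ => if j = i then (1 : ℝ) else 0 :=
      funext fun x => pd_coord j i x
    rw [this]; exact hol_const _⟩

theorem Reg.const_mul (hα0 : 0 < α) (hα : α ≤ 1) (hf : Reg α p q f) (c : ℝ) (hq : q ≤ p + 2) :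
    Reg α p q (fun x => c * f x) :=
  (reg_const (q := q - p) c).mul hα0 hα hf (by omega) (by omega) (by omega) (by omega)

theorem Reg.inv (hα0 : 0 < α) (hα : α ≤ 1) {c : ℝ} (hf : Reg α 0 q f) (hq : q ≤ 2) (hc : 0 < c) (h : ∀ x, c ≤ f x) :
    Reg α 0 q (fun x => (f x)⁻¹) := by
  obtain ⟨h1, h2⟩ := hf.toGradDecays.inv hc h
  refine ⟨h1, fun i => ?_⟩
  rw [h2]
  have hg1 := hol_of_grad hα0 hα h1.contDiff h1.grad
  have hsq : Decays 0 (fun x => (f x)⁻¹ * (f x)⁻¹) := h1.size.mul h1.size (by omega)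
  have hsq' : Hol α (0 + 1) (fun x => (f x)⁻¹ * (f x)⁻¹) :=
    Hol.mul h1.size hg1 h1.size hg1 (by omega) (by omega)
  exact Hol.mul (hf.toGradDecays.grad i).neg (hf.hol i).neg hsq hsq' (by omega) (by omega)

theorem Reg.exp (hα0 : 0 < α) (hα : α ≤ 1) {N : ℝ} (hf : Reg α 0 q f) (hq : q ≤ 2) (hN : ∀ x, |f x| ≤ N) :
    Reg α 0 q (fun x => Real.exp (f x)) := by
  obtain ⟨h1, h2⟩ := hf.toGradDecays.exp hN
  refine ⟨h1, fun i => ?_⟩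
  rw [h2]
  have hg1 := hol_of_grad hα0 hα h1.contDiff h1.grad
  exact Hol.mul h1.size hg1 (hf.toGradDecays.grad i) (hf.hol i) (by omega) (by omega)

theorem reg_of_second (hα0 : 0 < α) (hα : α ≤ 1) (hf : ContDiff ℝ (2 : ℕ) f) (h0 : Decays p f)
    (h1 : ∀ i, Decays (p + 1) (pd i f)) (h2 : ∀ i j, Decays q (pd j (pd i f))) : Reg α p q f :=
  ⟨⟨hf.of_le (by norm_num), h0, h1⟩, fun i => hol_of_grad hα0 hα (contDiff_pd (k := 1) hf i) (h2 i)⟩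

end reg

end decay

/-! ### Solutions and the candidate for the gradient of `ξ` -/

section solution

/-- What is used of a zero of the solution operators. The third field has been replaced by its
extension `G3` to the whole space. -/
structure IsSolution (α : ℝ) (φ : ℝ → ℝ) (ψ : ℝ × ℝ → ℝ) (E₀ L₀ γ lam R : ℝ) (u : Fields) :
    Prop where
  α_pos : 0 < α
  α_le : α ≤ 1
  ansatz : Ansatz φ ψ E₀ L₀
  γ_nonneg : 0 ≤ γ
  one_le_R : 1 ≤ R
  contDiff_ν : ContDiff ℝ (2 : ℕ) u.ν
  contDiff_b : ContDiff ℝ (3 : ℕ) u.b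
  contDiff_ω : ContDiff ℝ (2 : ℕ) u.ω
  axial_ν : AxiallySymmetricOn univ u.ν
  axial_b : AxiallySymmetricOn univ u.b
  axial_ω : AxiallySymmetricOn univ u.ω
  eq_ν : ∀ x, u.ν x = G1 φ ψ γ lam u x
  eq_b : ∀ x, u.b x = G2 φ ψ γ lam u x
  eq_ξ : ∀ x, u.ξ x = G3 γ u x
  eq_ω : ∀ x, u.ω x = G4 φ ψ γ lam u x
  b_small : ∀ x, |u.b x| ≤ 1 / 8
  grad_b_small : ∀ x, (1 + ‖x‖) * ‖fderiv ℝ u.b x‖ ≤ 1 / 8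
  no_matter : ∀ x, R ≤ ‖x‖ → E₀ + L₀ * |u.ω x| ≤ u.ν x
  ν_size : Decays 0 u.ν
  ν_grad : ∀ i, Decays 1 (pd i u.ν)
  ν_second : ∀ i j, Decays 0 (pd i (pd j u.ν))
  ν_hol : ∀ i j, Hol α 0 (pd i (pd j u.ν))
  b_grad : ∀ i, Decays 3 (pd i u.b)
  b_second : ∀ i j, Decays 0 (pd i (pd j u.b))
  b_hol : ∀ i j k, Hol α 0 (pd i (pd j (pd k u.b)))
  ω_size : Decays 0 u.ω
  ω_grad : ∀ i, Decays 4 (pd i u.ω)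
  ω_second : ∀ i j, Decays 0 (pd i (pd j u.ω))
  ω_hol : ∀ i j, Hol α 0 (pd i (pd j u.ω))

/-- `∂_ρ (ρB)`. -/
def gradBeta (u : Fields) (x : E 3) : ℝ := 1 + u.b x + euler u.b x

/-- `|∇(ρB)|²`. -/
def gradDen (u : Fields) (x : E 3) : ℝ :=
  gradBeta u x * gradBeta u x + (x 0 * x 0 + x 1 * x 1) * (pd 2 u.b x * pd 2 u.b x)

/-- `B³ e^{-4γν}`. -/
def gradWeight (γ : ℝ) (u : Fields) (x : E 3) : ℝ :=
  (1 + u.b x) * (1 + u.b x) * (1 + u.b x) * Real.exp (-4 * γ * u.ν x)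

/-- The right hand side `A` of the equation `W_z ξ_ρ + W_ρ ξ_z = A`, where `W = ρB`. -/
def gradA (γ : ℝ) (u : Fields) (x : E 3) : ℝ :=
  pd 2 u.b x + euler (pd 2 u.b) x + 2 * γ ^ 2 * ((1 + u.b x) * (euler u.ν x * pd 2 u.ν x))
    - 1 / 2 * γ * ((x 0 * x 0 + x 1 * x 1) * gradWeight γ u x * (euler u.ω x * pd 2 u.ω x))

/-- The components of the right hand side `C` of `W_ρ ξ_ρ - W_z ξ_z = C`, with `C` as a radial
vector. -/
def gradC (γ : ℝ) (u : Fields) (i : Fin 3) (x : E 3) : ℝ :=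
  1 / 2 * (x i * (pd 0 (pd 0 u.b) x + pd 1 (pd 1 u.b) x) + pd i u.b x - x i * pd 2 (pd 2 u.b) x)
    + γ ^ 2 * ((1 + u.b x) * (pd i u.ν x * euler u.ν x - x i * (pd 2 u.ν x * pd 2 u.ν x)))
    - 1 / 4 * γ * ((x 0 * x 0 + x 1 * x 1) * gradWeight γ u x *
        (pd i u.ω x * euler u.ω x - x i * (pd 2 u.ω x * pd 2 u.ω x)))

/-- The horizontal components of the gradient of `ξ`. -/
def gradG (γ : ℝ) (u : Fields) (i : Fin 3) (x : E 3) : ℝ :=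
  (pd 2 u.b x * (x i * gradA γ u x) + gradBeta u x * gradC γ u i x) * (gradDen u x)⁻¹

/-- The vertical component of the gradient of `ξ`. -/
def gradH (γ : ℝ) (u : Fields) (x : E 3) : ℝ :=
  (gradBeta u x * gradA γ u x - pd 2 u.b x * (x 0 * gradC γ u 0 x + x 1 * gradC γ u 1 x)) *
    (gradDen u x)⁻¹

variable {α : ℝ} {φ : ℝ → ℝ} {ψ : ℝ × ℝ → ℝ} {E₀ L₀ γ lam R : ℝ} {u : Fields}

namespace IsSolution

theorem B_bounds (S : IsSolution α φ ψ E₀ L₀ γ lam R u) (x : E 3) :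
    7 / 8 ≤ 1 + u.b x ∧ 1 + u.b x ≤ 9 / 8 := by
  have := abs_le.1 (S.b_small x)
  constructor <;> linarith

theorem B_pos (S : IsSolution α φ ψ E₀ L₀ γ lam R u) (x : E 3) : 0 < 1 + u.b x := by
  linarith [(S.B_bounds x).1]

theorem beta_lower (S : IsSolution α φ ψ E₀ L₀ γ lam R u) (x : E 3) : 3 / 4 ≤ gradBeta u x := by
  have h1 : euler u.b x = fderiv ℝ u.b x !₂[x 0, x 1, 0] := by
    rw [fderiv_eq_sum]; simp [Fin.sum_univ_three, euler]
  have h2 : ‖(!₂[x 0, x 1, 0] : E 3)‖ ≤ ‖x‖ := by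
    rw [EuclideanSpace.norm_eq, EuclideanSpace.norm_eq]
    refine Real.sqrt_le_sqrt ?_
    simp [Fin.sum_univ_three]
    positivity
  have h3 : |euler u.b x| ≤ 1 / 8 := by
    rw [h1]
    refine ((fderiv ℝ u.b x).le_opNorm _).trans (le_trans ?_ (S.grad_b_small x))
    rw [mul_comm]
    exact mul_le_mul_of_nonneg_right (h2.trans (by linarith)) (norm_nonneg _)
  have := (S.B_bounds x).1
  unfold gradBeta
  linarith [neg_abs_le (euler u.b x)]

theorem den_lower (S : IsSolution α φ ψ E₀ L₀ γ lam R u) (x : E 3) : 1 / 2 ≤ gradDen u x := by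
  have := S.beta_lower x
  unfold gradDen
  nlinarith [mul_nonneg (add_nonneg (mul_self_nonneg (x 0)) (mul_self_nonneg (x 1)))
    (mul_self_nonneg (pd 2 u.b x))]

theorem contDiff_ν_one (S : IsSolution α φ ψ E₀ L₀ γ lam R u) : ContDiff ℝ (1 : ℕ) u.ν :=
  S.contDiff_ν.of_le (by norm_num)

theorem contDiff_ω_one (S : IsSolution α φ ψ E₀ L₀ γ lam R u) : ContDiff ℝ (1 : ℕ) u.ω :=
  S.contDiff_ω.of_le (by norm_num)

theorem contDiff_b_two (S : IsSolution α φ ψ E₀ L₀ γ lam R u) : ContDiff ℝ (2 : ℕ) u.b :=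
  S.contDiff_b.of_le (by norm_num)

theorem contDiff_b_one (S : IsSolution α φ ψ E₀ L₀ γ lam R u) : ContDiff ℝ (1 : ℕ) u.b :=
  S.contDiff_b.of_le (by norm_num)

theorem contDiff_pd_b (S : IsSolution α φ ψ E₀ L₀ γ lam R u) (i : Fin 3) :
    ContDiff ℝ (2 : ℕ) (pd i u.b) := contDiff_pd (k := 2) S.contDiff_b i

theorem contDiff_pd_pd_b (S : IsSolution α φ ψ E₀ L₀ γ lam R u) (i j : Fin 3) :
    ContDiff ℝ (1 : ℕ) (pd i (pd j u.b)) := contDiff_pd (k := 1) (S.contDiff_pd_b j) i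

theorem contDiff_gradBeta (S : IsSolution α φ ψ E₀ L₀ γ lam R u) :
    ContDiff ℝ (1 : ℕ) (gradBeta u) := by
  have h1 := S.contDiff_b_one
  have h2 := contDiff_euler (k := 1) S.contDiff_b_two
  unfold gradBeta
  fun_prop

theorem contDiff_gradWeight (S : IsSolution α φ ψ E₀ L₀ γ lam R u) :
    ContDiff ℝ (1 : ℕ) (gradWeight γ u) := by
  have h1 := S.contDiff_b_one
  have h2 := S.contDiff_ν_one
  unfold gradWeight
  fun_prop

theorem contDiff_gradA (S : IsSolution α φ ψ E₀ L₀ γ lam R u) : ContDiff ℝ (1 : ℕ) (gradA γ u) := by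
  have h1 := S.contDiff_b_one
  have h2 := contDiff_euler (k := 1) (S.contDiff_pd_b 2)
  have h3 := (S.contDiff_pd_b 2).of_le (m := (1 : ℕ)) (by norm_num)
  have h4 := contDiff_euler (k := 1) S.contDiff_ν
  have h5 := contDiff_euler (k := 1) S.contDiff_ω
  have h6 := contDiff_pd (k := 1) S.contDiff_ν 2
  have h7 := contDiff_pd (k := 1) S.contDiff_ω 2
  have h8 := S.contDiff_gradWeight
  unfold gradA
  fun_prop

theorem contDiff_gradC (S : IsSolution α φ ψ E₀ L₀ γ lam R u) (i : Fin 3) :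
    ContDiff ℝ (1 : ℕ) (gradC γ u i) := by
  have h1 := S.contDiff_b_one
  have h2 := (S.contDiff_pd_b i).of_le (m := (1 : ℕ)) (by norm_num)
  have h3 := S.contDiff_pd_pd_b
  have h30 := h3 0 0
  have h31 := h3 1 1
  have h32 := h3 2 2
  have h4 := contDiff_euler (k := 1) S.contDiff_ν
  have h5 := contDiff_euler (k := 1) S.contDiff_ω
  have h6 := contDiff_pd (k := 1) S.contDiff_ν 2
  have h7 := contDiff_pd (k := 1) S.contDiff_ω 2
  have h6i := contDiff_pd (k := 1) S.contDiff_ν i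
  have h7i := contDiff_pd (k := 1) S.contDiff_ω i
  have h8 := S.contDiff_gradWeight
  unfold gradC
  fun_prop

theorem contDiff_gradDen (S : IsSolution α φ ψ E₀ L₀ γ lam R u) :
    ContDiff ℝ (1 : ℕ) (gradDen u) := by
  have h1 := S.contDiff_gradBeta
  have h2 := (S.contDiff_pd_b 2).of_le (m := (1 : ℕ)) (by norm_num)
  unfold gradDen
  fun_prop

theorem contDiff_gradG (S : IsSolution α φ ψ E₀ L₀ γ lam R u) (i : Fin 3) :
    ContDiff ℝ (1 : ℕ) (gradG γ u i) := by
  have h1 := S.contDiff_gradBeta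
  have h2 := (S.contDiff_pd_b 2).of_le (m := (1 : ℕ)) (by norm_num)
  have h3 := S.contDiff_gradA
  have h4 := S.contDiff_gradC i
  have h5 := S.contDiff_gradDen.inv fun x => (lt_of_lt_of_le (by norm_num) (S.den_lower x)).ne'
  unfold gradG
  exact ContDiff.mul (by fun_prop) h5

theorem contDiff_gradH (S : IsSolution α φ ψ E₀ L₀ γ lam R u) : ContDiff ℝ (1 : ℕ) (gradH γ u) := by
  have h1 := S.contDiff_gradBeta
  have h2 := (S.contDiff_pd_b 2).of_le (m := (1 : ℕ)) (by norm_num)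
  have h3 := S.contDiff_gradA
  have h4 := S.contDiff_gradC 0
  have h4' := S.contDiff_gradC 1
  have h5 := S.contDiff_gradDen.inv fun x => (lt_of_lt_of_le (by norm_num) (S.den_lower x)).ne'
  unfold gradH
  exact ContDiff.mul (by fun_prop) h5

theorem euler_meridian (f : E 3 → ℝ) (s z : ℝ) :
    euler f (meridian s z) = s * pd 0 f (meridian s z) := by
  simp [euler, meridian_zero_coord, meridian_one_coord]

/-- `ρ ∂₂∂₂ b = ∂_ρ b` on the meridian plane. -/
theorem mul_pd_one_pd_one_meridian {f : E 3 → ℝ} (hf : ContDiff ℝ (2 : ℕ) f)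
    (hax : AxiallySymmetricOn univ f) (s z : ℝ) :
    s * pd 1 (pd 1 f) (meridian s z) = pd 0 f (meridian s z) := by
  have hfd : Differentiable ℝ f := hf.differentiable (by norm_num)
  have hd : ∀ j, Differentiable ℝ (pd j f) := fun j =>
    (contDiff_pd (k := 1) hf j).differentiable (by norm_num)
  have hrot : (fun y : E 3 => y 0 * pd 1 f y) = fun y => y 1 * pd 0 f y :=
    funext fun y => axial_rotation hax (hfd y)
  have h := congrFun (congrArg (pd 1) hrot) (meridian s z)
  rw [pd_mul (differentiable_coord 0 _) (hd 1 _), pd_mul (differentiable_coord 1 _) (hd 0 _),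
    pd_coord, pd_coord] at h
  simpa [meridian_zero_coord, meridian_one_coord] using h

/-- The radial derivative prescribed by `G3` is a `C¹` function on `ℝ³`. Writing `∂_ρ b / ρ` as a second
derivative across the meridian plane removes the singularity at the axis; at `s = 0` the convention
`2 / 0 = 0` does no harm, because the term carries the factor `s`. -/
theorem gRhs_eq (S : IsSolution α φ ψ E₀ L₀ γ lam R u) (s z : ℝ) :
    gRhs γ u s z = gradG γ u 0 (meridian s z) := by
  have h1 := mul_pd_one_pd_one_meridian S.contDiff_b_two S.axial_b s z
  have hcomm := pd_comm (S.contDiff_b_two.contDiffAt (x := meridian s z)) 2 0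
  have hs : s / 2 * (pd 0 (pd 0 u.b) (meridian s z) + 2 / s * pd 0 u.b (meridian s z)
      - pd 2 (pd 2 u.b) (meridian s z)) = 1 / 2 * (s * pd 0 (pd 0 u.b) (meridian s z)
      + 2 * pd 0 u.b (meridian s z) - s * pd 2 (pd 2 u.b) (meridian s z)) := by
    by_cases h0 : s = 0
    · subst h0
      rw [pd_zero_meridian_zero S.axial_b (S.contDiff_b_one.differentiable (by norm_num) _)]
      ring
    · field_simp
  unfold gRhs gradG gradC gradA gradDen gradBeta gradWeight
  simp only [euler_meridian, meridian_zero_coord, meridian_one_coord, hs, hcomm]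
  have h2 : (1 + u.b (meridian s z) + s * pd 0 u.b (meridian s z)) ^ 2 +
      (s * pd 2 u.b (meridian s z)) ^ 2 =
      (1 + u.b (meridian s z) + s * pd 0 u.b (meridian s z)) *
        (1 + u.b (meridian s z) + s * pd 0 u.b (meridian s z)) +
      (s * s + 0 * 0) * (pd 2 u.b (meridian s z) * pd 2 u.b (meridian s z)) := by ring
  rw [h2, mul_comm]
  congr 1
  linear_combination (-1 / 2 * (1 + u.b (meridian s z) + s * pd 0 u.b (meridian s z))) * h1

theorem ξ_eq (S : IsSolution α φ ψ E₀ L₀ γ lam R u) (x : E 3) :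
    u.ξ x = Real.log (1 + u.b (meridian 0 (axialHeight x))) +
      ∫ s in (0 : ℝ)..(axialRadius x), gradG γ u 0 (meridian s (axialHeight x)) := by
  rw [S.eq_ξ, G3]
  simp only [S.gRhs_eq]

theorem continuous_ξ (S : IsSolution α φ ψ E₀ L₀ γ lam R u) : Continuous u.ξ := by
  have h : u.ξ = fun x => _ := funext S.ξ_eq
  rw [h]
  refine Continuous.add ?_ ?_
  · refine Continuous.log ?_ fun x => (S.B_pos _).ne'
    refine continuous_const.add (S.contDiff_b.continuous.comp ?_)
    exact continuous_meridian.comp (continuous_const.prodMk continuous_axialHeight)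
  · refine intervalIntegral.continuous_parametric_intervalIntegral_of_continuous
      (f := fun x s => gradG γ u 0 (meridian s (axialHeight x))) ?_ continuous_axialRadius
    have hm : Continuous fun a : E 3 × ℝ => meridian a.2 (axialHeight a.1) :=
      continuous_meridian.comp
        (continuous_snd.prodMk (continuous_axialHeight.comp continuous_fst))
    exact (S.contDiff_gradG 0).continuous.comp hm

theorem axial_ξ (S : IsSolution α φ ψ E₀ L₀ γ lam R u) : AxiallySymmetricOn univ u.ξ := by
  intro x _ y _ hr hz
  rw [S.ξ_eq, S.ξ_eq, hr, hz]

end IsSolution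

end solution

/-! ### Sources of the integral equations -/

section sources

/-- `q` away from the axis of symmetry, and zero on it. The matter terms are quotients by powers of `ρ`,
so their values on the axis, a null set, carry no information. -/
def offAxis (q : E 3 → ℝ) (x : E 3) : ℝ := if axialRadius x = 0 then 0 else q x

theorem offAxis_eq {q : E 3 → ℝ} {x : E 3} (h : 0 < axialRadius x) : offAxis q x = q x :=
  if_neg h.ne'

theorem isOpen_offAxis : IsOpen {x : E 3 | 0 < axialRadius x} :=
  isOpen_lt continuous_const continuous_axialRadius

theorem continuousAt_offAxis {q : E 3 → ℝ} {x : E 3} (h : 0 < axialRadius x)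
    (hq : ContinuousAt q x) : ContinuousAt (offAxis q) x :=
  hq.congr (eventually_of_mem (isOpen_offAxis.mem_nhds h) fun _ hy => (offAxis_eq hy).symm)

theorem lift_offAxis_ae (n : ℕ) (q : E 3 → ℝ) :
    lift (n + 1) (offAxis q) =ᵐ[volume] lift (n + 1) q := by
  have h := volume_axialRadius_eq_zero n
  rw [← compl_compl {y : E (n + 1 + 1) | axialRadius y = 0}] at h
  filter_upwards [mem_ae_iff.2 h] with y hy
  refine offAxis_eq ?_
  rw [axialRadius_meridian, abs_of_nonneg (axialRadius_nonneg _)]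
  exact lt_of_le_of_ne (axialRadius_nonneg _) (Ne.symm hy)

theorem lift_two_eq {q : E 3 → ℝ} (hq : AxiallySymmetricOn univ q) : lift 2 q = q :=
  funext fun x => (hq.eq_meridian x).symm

theorem exists_sourceBound_lift {k : ℕ} {q : E 3 → ℝ}
    (hc : ∀ x, 0 < axialRadius x → ContinuousAt q x) (hd : Decays (k + 3 : ℕ) q) :
    ∃ A, SourceBound A (lift (k + 1) q) := by
  obtain ⟨A, -, hA⟩ := hd.exists_natCast
  refine ⟨A, aestronglyMeasurable_lift fun x hx => (hc x hx).continuousWithinAt, fun y => ?_⟩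
  have := hA (meridian (axialRadius y) (axialHeight y))
  rwa [norm_meridian_axial] at this

theorem decays_of_ball {f : E 3 → ℝ} {C R : ℝ} (h : ∀ x, |f x| ≤ C)
    (h0 : ∀ x, R ≤ ‖x‖ → f x = 0) (n : ℕ) : Decays n f := by
  refine decays_natCast (C := C * (1 + |R|) ^ n) fun x => ?_
  have hC : 0 ≤ C := (abs_nonneg _).trans (h 0)
  have hx := weight_pos x
  rcases le_or_gt R ‖x‖ with h1 | h1
  · rw [h0 x h1, abs_zero]; positivity
  · refine (h x).trans ?_
    rw [mul_assoc, ← div_eq_mul_inv]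
    refine le_mul_of_one_le_right hC ((one_le_div (pow_pos hx n)).2 ?_)
    exact pow_le_pow_left₀ hx.le (by linarith [le_abs_self R]) n

theorem AxiallySymmetricOn.gradDot {f h : E 3 → ℝ} (hf : AxiallySymmetricOn univ f)
    (hfd : Differentiable ℝ f) (hh : AxiallySymmetricOn univ h) (hhd : Differentiable ℝ h) :
    AxiallySymmetricOn univ (gradDot f h) := by
  -- `ρ² ∇f·∇h` is an expression in the axially symmetric functions `ρ ∂_ρ` and `∂_z`, which settles all
  -- points off the axis.
  have key : ∀ x : E 3, axialRadius x ^ 2 * RotatingEV.gradDot f h x =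
      RotatingEV.euler f x * RotatingEV.euler h x +
        axialRadius x ^ 2 * (pd 2 f x * pd 2 h x) := by
    intro x
    rw [RotatingEV.gradDot, Fin.sum_univ_three, axialRadius_sq_three, RotatingEV.euler,
      RotatingEV.euler]
    linear_combination (x 0 * pd 1 h x - x 1 * pd 0 h x) * axial_rotation hf (hfd x)
  intro x _ y _ hr hz
  rcases eq_or_ne (axialRadius x) 0 with h0 | h0
  -- Two points of the axis with the same height coincide.
  · have hxy : ∀ w : E 3, axialRadius w = 0 → w = meridian 0 (axialHeight w) := by
      intro w hw
      have h1 := axialRadius_sq_three w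
      rw [hw] at h1
      have h2 : w 0 = 0 := by nlinarith [sq_nonneg (w 0), sq_nonneg (w 1)]
      have h3 : w 1 = 0 := by nlinarith [sq_nonneg (w 0), sq_nonneg (w 1)]
      ext i
      fin_cases i
      · simpa [meridian] using h2
      · simpa [meridian] using h3
      · simp [meridian, axialHeight_three]
    rw [hxy x h0, hxy y (hr ▸ h0), hz]
  · have h1 := key x
    have h2 := key y
    rw [hf.euler hfd x trivial y trivial hr hz, hh.euler hhd x trivial y trivial hr hz,
      hf.pd_two hfd x trivial y trivial hr hz, hh.pd_two hhd x trivial y trivial hr hz, hr] at h1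
    exact mul_left_cancel₀ (pow_ne_zero 2 (hr ▸ h0)) (h1.trans h2.symm)

theorem gradDecays_gradDot {f h : E 3 → ℝ} {p p₁ p₂ q q₁ q₂ : ℤ}
    (hf : ∀ i, GradDecays p₁ q₁ (pd i f)) (hh : ∀ i, GradDecays p₂ q₂ (pd i h))
    (hp : p ≤ p₁ + p₂) (hq1 : q ≤ q₁ + p₂) (hq2 : q ≤ p₁ + q₂) :
    GradDecays p q (gradDot f h) := by
  have h1 : gradDot f h =
      fun x => pd 0 f x * pd 0 h x + pd 1 f x * pd 1 h x + pd 2 f x * pd 2 h x :=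
    funext fun x => Fin.sum_univ_three _
  rw [h1]
  exact (((hf 0).mul (hh 0) hp hq1 hq2).add ((hf 1).mul (hh 1) hp hq1 hq2)).add
    ((hf 2).mul (hh 2) hp hq1 hq2)

/-- The quadratic term in the equation for `ν`. -/
def nonlinOne (γ : ℝ) (u : Fields) (y : E 3) : ℝ :=
  gradDot u.b u.ν y / (1 + u.b y)
    - 1 / 2 * axialRadius y ^ 2 * (1 + u.b y) ^ 2 * Real.exp (-4 * γ * u.ν y)
      * gradDot u.ω u.ω y

/-- The quadratic term in the equation for `ω`. -/
def nonlinFour (γ : ℝ) (u : Fields) (p : E 3) : ℝ :=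
  3 * gradDot u.b u.ω p / (1 + u.b p) - 4 * γ * gradDot u.ν u.ω p

variable {α : ℝ} {φ : ℝ → ℝ} {ψ : ℝ × ℝ → ℝ} {E₀ L₀ γ lam R : ℝ} {u : Fields}

namespace IsSolution

theorem gradDecays_inv_B (S : IsSolution α φ ψ E₀ L₀ γ lam R u) :
    GradDecays 0 3 (fun x => (1 + u.b x)⁻¹) ∧ GradDecays 0 3 (fun x => 1 + u.b x) := by
  have hb : GradDecays 0 3 u.b := ⟨S.contDiff_b_one, decays_of_abs_le S.b_small, S.b_grad⟩
  have h1 := (gradDecays_const (q := 3) 1).add hb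
  exact ⟨(h1.inv (c := 7 / 8) (by norm_num) fun x => (S.B_bounds x).1).1, h1⟩

theorem gradDecays_exp (S : IsSolution α φ ψ E₀ L₀ γ lam R u) {p : ℤ}
    (hν : ∀ i, Decays p (pd i u.ν)) : GradDecays 0 p (fun x => Real.exp (-4 * γ * u.ν x)) := by
  obtain ⟨N, -, hN⟩ := S.ν_size.exists_natCast (n := 0)
  refine (GradDecays.exp (N := |-4 * γ| * N)
    ((GradDecays.mk S.contDiff_ν_one S.ν_size hν).const_mul (-4 * γ)) fun x => ?_).1
  rw [abs_mul]
  exact mul_le_mul_of_nonneg_left (by simpa using hN x) (abs_nonneg _)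

theorem gradDecays_nonlinOne (S : IsSolution α φ ψ E₀ L₀ γ lam R u) {pν rν rb rω q : ℤ}
    (hν : ∀ i, GradDecays pν rν (pd i u.ν)) (hb : ∀ i, GradDecays 3 rb (pd i u.b))
    (hω : ∀ i, GradDecays 4 rω (pd i u.ω)) (hp : 1 ≤ pν) (h1 : q ≤ rb + pν) (h2 : q ≤ 3 + rν)
    (h3 : q ≤ rω + 2) (h4 : q ≤ 6) : GradDecays 4 q (nonlinOne γ u) := by
  have hbν := gradDecays_gradDot (p := 4) (q := q) hb hν (by omega) (by omega) (by omega)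
  have hωω := gradDecays_gradDot (p := 8) (q := rω + 4) hω hω (by omega) (by omega) (by omega)
  have hB := S.gradDecays_inv_B
  have he := S.gradDecays_exp fun i => (hν i).size
  have hr : GradDecays (-2) (-1) (fun x : E 3 => x 0 * x 0 + x 1 * x 1) :=
    ((gradDecays_coord 0).mul (gradDecays_coord 0) (by omega) (by omega) (by omega)).add
      ((gradDecays_coord 1).mul (gradDecays_coord 1) (by omega) (by omega) (by omega))
  have hBe := (hB.2.mul hB.2 (p := 0) (q := 3) (by omega) (by omega) (by omega)).mul he
    (p := 0) (q := 1) (by omega) (by omega) (by omega)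
  have hfirst := hbν.mul hB.1 (p := 4) (q := q) (by omega) (by omega) (by omega)
  have hsecond := ((hr.mul (hBe.mul hωω (p := 8) (q := min (rω + 4) 9) (by omega) (by omega)
    (by omega)) (p := 4) (q := q) (by omega) (by omega) (by omega)).const_mul (1 / 2))
  have h : nonlinOne γ u = fun x => gradDot u.b u.ν x * (1 + u.b x)⁻¹ -
      1 / 2 * ((x 0 * x 0 + x 1 * x 1) * ((1 + u.b x) * (1 + u.b x) *
        Real.exp (-4 * γ * u.ν x) * gradDot u.ω u.ω x)) := by
    funext x
    rw [nonlinOne, axialRadius_sq_three]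
    ring
  rw [h]
  exact hfirst.sub hsecond

theorem gradDecays_nonlinFour (S : IsSolution α φ ψ E₀ L₀ γ lam R u) {rν rb rω q : ℤ}
    (hν : ∀ i, GradDecays 2 rν (pd i u.ν)) (hb : ∀ i, GradDecays 3 rb (pd i u.b))
    (hω : ∀ i, GradDecays 4 rω (pd i u.ω)) (h1 : q ≤ rb + 4) (h2 : q ≤ 2 + rω)
    (h3 : q ≤ rν + 4) (h4 : q ≤ 6) : GradDecays 6 q (nonlinFour γ u) := by
  have hbω := gradDecays_gradDot (p := 6) (q := q) hb hω (by omega) (by omega) (by omega)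
  have hνω := gradDecays_gradDot (p := 6) (q := q) hν hω (by omega) (by omega) (by omega)
  have hB := S.gradDecays_inv_B
  have h : nonlinFour γ u = fun x => 3 * (gradDot u.b u.ω x * (1 + u.b x)⁻¹) -
      4 * γ * gradDot u.ν u.ω x := by
    funext x
    rw [nonlinFour]
    ring
  rw [h]
  exact ((hbω.mul hB.1 (p := 6) (q := q) (by omega) (by omega) (by omega)).const_mul 3).sub
    (hνω.const_mul (4 * γ))

theorem axial_nonlinOne (S : IsSolution α φ ψ E₀ L₀ γ lam R u) :
    AxiallySymmetricOn univ (nonlinOne γ u) := by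
  have hb := S.contDiff_b_one.differentiable (by norm_num)
  have hν := S.contDiff_ν_one.differentiable (by norm_num)
  have hω := S.contDiff_ω_one.differentiable (by norm_num)
  intro x _ y _ hr hz
  simp only [nonlinOne, S.axial_b.gradDot hb S.axial_ν hν x trivial y trivial hr hz,
    S.axial_ω.gradDot hω S.axial_ω hω x trivial y trivial hr hz, hr,
    S.axial_b x trivial y trivial hr hz, S.axial_ν x trivial y trivial hr hz]

theorem axial_M1 (S : IsSolution α φ ψ E₀ L₀ γ lam R u) :
    AxiallySymmetricOn univ (M1 φ ψ γ lam u) := by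
  intro x _ y _ hr hz
  simp only [M1, hr, S.axial_b x trivial y trivial hr hz, S.axial_ν x trivial y trivial hr hz,
    S.axial_ω x trivial y trivial hr hz, S.axial_ξ x trivial y trivial hr hz]

theorem continuousAt_M (S : IsSolution α φ ψ E₀ L₀ γ lam R u) {x : E 3} (hx : 0 < axialRadius x) :
    ContinuousAt (M1 φ ψ γ lam u) x ∧ ContinuousAt (M2 φ ψ γ lam u) x ∧
      ContinuousAt (M3 φ ψ γ lam u) x :=
  continuousAt_matter S.ansatz S.γ_nonneg hx (S.B_pos x) S.contDiff_ν.continuous.continuousAt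
    S.contDiff_b.continuous.continuousAt S.continuous_ξ.continuousAt
    S.contDiff_ω.continuous.continuousAt

theorem offAxis_M_eq_zero (S : IsSolution α φ ψ E₀ L₀ γ lam R u) {x : E 3} (hx : R ≤ ‖x‖) :
    offAxis (M1 φ ψ γ lam u) x = 0 ∧ offAxis (M2 φ ψ γ lam u) x = 0 ∧
      offAxis (M3 φ ψ γ lam u) x = 0 := by
  rcases (axialRadius_nonneg x).eq_or_lt with h | h
  · simp [offAxis, ← h]
  · have := matter_eq_zero (lam := lam) S.ansatz S.γ_nonneg h (S.B_pos x) (S.no_matter x hx)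
    simpa only [offAxis_eq h] using this

/-- The matter terms are bounded up to the axis and compactly supported. The factors `1 / ρ` are
compensated by the measure of the domain of integration, and in `M₃` by the oddness of the weight. -/
theorem decays_matter (S : IsSolution α φ ψ E₀ L₀ γ lam R u) (n : ℕ) :
    Decays n (offAxis (M1 φ ψ γ lam u)) ∧ Decays n (offAxis (M2 φ ψ γ lam u)) ∧
      Decays n (offAxis (M3 φ ψ γ lam u)) := by
  obtain ⟨N₁, -, hN₁⟩ := S.ν_size.exists_natCast (n := 0)
  obtain ⟨N₂, -, hN₂⟩ := S.ω_size.exists_natCast (n := 0)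
  simp only [pow_zero, inv_one, mul_one] at hN₁ hN₂
  obtain ⟨X, -, hX⟩ := exists_abs_le_of_compact (isCompact_closedBall (0 : E 3) R)
    S.continuous_ξ.continuousOn
  have hR := S.one_le_R
  set N : ℝ := max (max N₁ N₂) (2 * R) with hN
  have hA := S.ansatz
  obtain ⟨C₁, hC₁0, hC₁⟩ := exists_abs_matI_le_mul S.γ_nonneg hA.continuous_φ (hA.continuous_χ lam)
    hA.φ_eq_zero (hA.ψ_eq_zero lam) N (continuous_weightOne γ)
  obtain ⟨C₂, hC₂0, hC₂⟩ := exists_abs_matJ_le_mul S.γ_nonneg hA.continuous_φ (hA.continuous_χ lam)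
    hA.φ_eq_zero (hA.ψ_eq_zero lam) N
  obtain ⟨C₃, hC₃0, hC₃⟩ := exists_abs_matterIntegral_odd_le (lam := lam) hA S.γ_nonneg N
  set D : ℝ := max (max (2 * Real.pi * Real.exp (2 * X) * C₁)
    (2 * Real.pi * γ ^ 2 * Real.exp (2 * X) * (2 * C₂)))
    (32 * Real.pi ^ 2 * γ * Real.exp (2 * X) * (2 * C₃)) with hD
  have hD0 : 0 ≤ D := le_max_of_le_left (le_max_of_le_left (by positivity))
  have hγ := S.γ_nonneg
  have key : ∀ x, |offAxis (M1 φ ψ γ lam u) x| ≤ D ∧ |offAxis (M2 φ ψ γ lam u) x| ≤ D ∧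
      |offAxis (M3 φ ψ γ lam u) x| ≤ D := by
    intro x
    rcases le_or_gt R ‖x‖ with hx | hx
    · obtain ⟨h1, h2, h3⟩ := S.offAxis_M_eq_zero hx
      simp only [h1, h2, h3, abs_zero, hD0, and_self]
    rcases (axialRadius_nonneg x).eq_or_lt with h | h
    · simp [offAxis, ← h, hD0]
    obtain ⟨hB1, hB2⟩ := S.B_bounds x
    have hB := S.B_pos x
    have hW : 0 < axialRadius x * (1 + u.b x) := mul_pos h hB
    have hrR : axialRadius x ≤ R := (axialRadius_le_norm x).trans hx.le
    have hN1 : |u.ν x| ≤ N := (hN₁ x).trans ((le_max_left _ _).trans (le_max_left _ _))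
    have hN2 : |u.ω x| ≤ N := (hN₂ x).trans ((le_max_right _ _).trans (le_max_left _ _))
    have hN3 : 2 * R ≤ N := le_max_right _ _
    have hWN : axialRadius x * (1 + u.b x) ≤ N := by nlinarith
    have hexp : Real.exp (2 * u.ξ x) ≤ Real.exp (2 * X) :=
      Real.exp_le_exp.2 (by linarith [le_of_abs_le (hX x (by simpa using hx.le))])
    rw [offAxis_eq h, offAxis_eq h, offAxis_eq h]
    refine ⟨?_, ?_, ?_⟩
    · refine le_trans ?_ ((le_max_left _ _).trans (le_max_left _ _))
      have hm := hC₁ _ _ _ hN1 hN2 hW hWN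
      rw [M1_eq hA hγ h hB, abs_mul, abs_of_nonneg (by positivity)]
      calc _ ≤ 2 * Real.pi * Real.exp (2 * X) / (axialRadius x * (1 + u.b x)) *
            (C₁ * (axialRadius x * (1 + u.b x))) := by gcongr
        _ = _ := by field_simp
    · refine le_trans ?_ ((le_max_right _ _).trans (le_max_left _ _))
      have hm := hC₂ _ _ _ hN1 hN2 hW hWN
      rw [M2_eq hA hγ h hB, abs_mul, abs_of_nonneg (by positivity)]
      calc _ ≤ 2 * Real.pi * γ ^ 2 * Real.exp (2 * X) / axialRadius x *
            (C₂ * (axialRadius x * 2)) := by gcongr; exact hm.trans (by gcongr; linarith)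
        _ = _ := by field_simp
    · refine le_trans ?_ (le_max_right _ _)
      have hm := hC₃ _ _ _ _ hN1 hB (by linarith) hN2 h (by linarith)
      rw [(M3_eq_matterIntegral hA hγ h hB).1, abs_mul, abs_neg, abs_of_nonneg (by positivity)]
      have hB3 : 1 / 2 ≤ (1 + u.b x) ^ 3 :=
        le_trans (by norm_num) (pow_le_pow_left₀ (by norm_num) hB1 3)
      calc _ ≤ 32 * Real.pi ^ 2 * γ * Real.exp (2 * X) / (axialRadius x * (1 / 2)) *
            (C₃ * axialRadius x) := by gcongr
        _ = _ := by field_simp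
  exact ⟨decays_of_ball (fun x => (key x).1) (fun x hx => (S.offAxis_M_eq_zero hx).1) n,
    decays_of_ball (fun x => (key x).2.1) (fun x hx => (S.offAxis_M_eq_zero hx).2.1) n,
    decays_of_ball (fun x => (key x).2.2) (fun x hx => (S.offAxis_M_eq_zero hx).2.2) n⟩

end IsSolution

end sources

section representation

variable {α : ℝ} {φ : ℝ → ℝ} {ψ : ℝ × ℝ → ℝ} {E₀ L₀ γ lam R : ℝ} {u : Fields}

/-- The source of the Newtonian potential `ν`. -/
def srcOne (φ : ℝ → ℝ) (ψ : ℝ × ℝ → ℝ) (γ lam : ℝ) (u : Fields) (x : E 3) : ℝ :=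
  -offAxis (M1 φ ψ γ lam u) x + 1 / (4 * Real.pi) * nonlinOne γ u x

/-- The source of the potential `b` on `ℝ⁴`. -/
def srcTwo (φ : ℝ → ℝ) (ψ : ℝ × ℝ → ℝ) (γ lam : ℝ) (u : Fields) (x : E 3) : ℝ :=
  -(2 / Real.pi) * offAxis (M2 φ ψ γ lam u) x

/-- The source of the potential `ω` on `ℝ⁵`. -/
def srcFour (φ : ℝ → ℝ) (ψ : ℝ × ℝ → ℝ) (γ lam : ℝ) (u : Fields) (x : E 3) : ℝ :=
  1 / (8 * Real.pi ^ 2) * (nonlinFour γ u x - offAxis (M3 φ ψ γ lam u) x)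

theorem rieszPot_const_mul {n m : ℕ} (c : ℝ) (f : E n → ℝ) (x : E n) :
    rieszPot m (fun y => c * f y) x = c * rieszPot m f x := by
  simp only [rieszPot, mul_assoc, integral_const_mul]

theorem rieszPot_congr {n m : ℕ} {f g : E n → ℝ} (h : f =ᵐ[volume] g) (x : E n) :
    rieszPot m f x = rieszPot m g x := by
  refine integral_congr_ae ?_
  filter_upwards [h] with y hy
  rw [hy]

theorem integral_lift_div {n m : ℕ} (q : E 3 → ℝ) (x : E (n + 1)) :
    ∫ y, lift n q y / ‖x - y‖ ^ m = rieszPot m (lift n q) x := by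
  simp only [rieszPot, div_eq_mul_inv]

namespace IsSolution

theorem continuousAt_src (S : IsSolution α φ ψ E₀ L₀ γ lam R u) (hK : Continuous (nonlinOne γ u))
    {x : E 3} (hx : 0 < axialRadius x) : ContinuousAt (srcOne φ ψ γ lam u) x :=
  (continuousAt_offAxis hx (S.continuousAt_M hx).1).neg.add
    (continuousAt_const.mul hK.continuousAt)

theorem sourceBound_srcOne (S : IsSolution α φ ψ E₀ L₀ γ lam R u)
    (hK : GradDecays 4 0 (nonlinOne γ u)) : ∃ A, SourceBound A (lift 2 (srcOne φ ψ γ lam u)) :=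
  exists_sourceBound_lift (k := 1) (fun _ hx => S.continuousAt_src hK.contDiff.continuous hx)
    ((S.decays_matter 4).1.neg.add (hK.size.const_mul _))

/-- The constant is the value at the origin of the potential of the matter term, which converges because
the source decays. -/
theorem exists_ν_eq (S : IsSolution α φ ψ E₀ L₀ γ lam R u) (hK : GradDecays 4 0 (nonlinOne γ u)) :
    ∃ c₀, ∀ x, u.ν x = rieszPot 1 (lift 2 (srcOne φ ψ γ lam u))
      ((LinearIsometry.id : E 3 →ₗᵢ[ℝ] E 3) x) + c₀ := by
  obtain ⟨A, hA⟩ := exists_sourceBound_lift (k := 1)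
    (fun x hx => continuousAt_offAxis hx (S.continuousAt_M hx).1) (S.decays_matter 4).1
  obtain ⟨A', hA'⟩ := exists_sourceBound_lift (k := 1) (q := nonlinOne γ u)
    (fun x hx => hK.contDiff.continuous.continuousAt) hK.size
  refine ⟨rieszPot 1 (lift 2 (offAxis (M1 φ ψ γ lam u))) 0, fun x => ?_⟩
  have hM : lift 2 (offAxis (M1 φ ψ γ lam u)) =ᵐ[volume] M1 φ ψ γ lam u := by
    conv_rhs => rw [← lift_two_eq S.axial_M1]
    exact lift_offAxis_ae 1 _
  have h1 : ∫ y : E 3, (1 / ‖x - y‖ - 1 / ‖y‖) * M1 φ ψ γ lam u y =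
      rieszPot 1 (lift 2 (offAxis (M1 φ ψ γ lam u))) x -
        rieszPot 1 (lift 2 (offAxis (M1 φ ψ γ lam u))) 0 := by
    rw [rieszPot, rieszPot, ← integral_sub (hA.integrable_mul_kernel (by norm_num) x)
      (hA.integrable_mul_kernel (by norm_num) 0)]
    refine integral_congr_ae ?_
    filter_upwards [hM] with y hy
    rw [hy, zero_sub, norm_neg, pow_one, pow_one]
    ring
  have h2 : ∫ y : E 3, (gradDot u.b u.ν y / (1 + u.b y)
        - 1 / 2 * axialRadius y ^ 2 * (1 + u.b y) ^ 2 * Real.exp (-4 * γ * u.ν y)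
          * gradDot u.ω u.ω y) / ‖x - y‖ = rieszPot 1 (lift 2 (nonlinOne γ u)) x := by
    rw [lift_two_eq S.axial_nonlinOne]
    simp only [rieszPot, pow_one, div_eq_mul_inv, nonlinOne]
  have h3 : rieszPot 1 (lift 2 (srcOne φ ψ γ lam u)) x =
      -rieszPot 1 (lift 2 (offAxis (M1 φ ψ γ lam u))) x +
        1 / (4 * Real.pi) * rieszPot 1 (lift 2 (nonlinOne γ u)) x := by
    simp only [rieszPot]
    have hi : Integrable fun y => -(lift 2 (offAxis (M1 φ ψ γ lam u)) y * (‖x - y‖ ^ 1)⁻¹) :=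
      (hA.integrable_mul_kernel (by norm_num) x).neg
    rw [← integral_neg, ← integral_const_mul, ← integral_add hi
      ((hA'.integrable_mul_kernel (k := 1) (by norm_num) x).const_mul _)]
    refine integral_congr_ae (Eventually.of_forall fun y => ?_)
    simp only [lift, srcOne]
    ring
  rw [S.eq_ν, G1, h1, h2, LinearIsometry.id_apply, h3]
  ring

theorem sourceBound_srcTwo (S : IsSolution α φ ψ E₀ L₀ γ lam R u) :
    ∃ A, SourceBound A (lift 3 (srcTwo φ ψ γ lam u)) :=
  exists_sourceBound_lift (k := 2) (fun _ hx => continuousAt_const.mul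
    (continuousAt_offAxis hx (S.continuousAt_M hx).2.1)) ((S.decays_matter 5).2.1.const_mul _)

theorem b_eq (S : IsSolution α φ ψ E₀ L₀ γ lam R u) (x : E 3) :
    u.b x = rieszPot 2 (lift 3 (srcTwo φ ψ γ lam u)) (embFour x) := by
  have h1 : lift 3 (srcTwo φ ψ γ lam u) =
      fun y => -(2 / Real.pi) * lift 3 (offAxis (M2 φ ψ γ lam u)) y := rfl
  have hr : axialRadius (!₂[axialRadius x, 0, 0, axialHeight x] : E (3 + 1)) =
      axialRadius (embFour x) := by
    rw [isAxialEmbedding_embFour.axialRadius, axialRadius]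
    simp [Fin.sum_univ_three, Real.sqrt_sq (axialRadius_nonneg x)]
  rw [S.eq_b, G2, h1, rieszPot_const_mul, rieszPot_congr (lift_offAxis_ae 2 _),
    integral_lift_div (n := 3) (m := 2)]
  congr 1
  exact rieszPot_lift_eq hr rfl

theorem sourceBound_srcFour (S : IsSolution α φ ψ E₀ L₀ γ lam R u)
    (hK : GradDecays 6 0 (nonlinFour γ u)) : ∃ A, SourceBound A (lift 4 (srcFour φ ψ γ lam u)) :=
  exists_sourceBound_lift (k := 3) (fun _ hx => continuousAt_const.mul
    (hK.contDiff.continuous.continuousAt.sub (continuousAt_offAxis hx (S.continuousAt_M hx).2.2)))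
    ((hK.size.sub (S.decays_matter 6).2.2).const_mul _)

theorem ω_eq (S : IsSolution α φ ψ E₀ L₀ γ lam R u) (x : E 3) :
    u.ω x = rieszPot 3 (lift 4 (srcFour φ ψ γ lam u)) (embFive x) := by
  have h1 : lift 4 (srcFour φ ψ γ lam u) = fun y => 1 / (8 * Real.pi ^ 2) *
      lift 4 (fun p => nonlinFour γ u p - offAxis (M3 φ ψ γ lam u) p) y := rfl
  have h2 : lift 4 (fun p => nonlinFour γ u p - offAxis (M3 φ ψ γ lam u) p) =ᵐ[volume]
      lift 4 (fun p => nonlinFour γ u p - M3 φ ψ γ lam u p) := by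
    filter_upwards [lift_offAxis_ae 3 (M3 φ ψ γ lam u)] with y hy
    simp only [lift] at hy ⊢
    rw [hy]
  have hr : axialRadius (!₂[axialRadius x, 0, 0, 0, axialHeight x] : E (4 + 1)) =
      axialRadius (embFive x) := by
    rw [isAxialEmbedding_embFive.axialRadius, axialRadius]
    simp [Fin.sum_univ_four, Real.sqrt_sq (axialRadius_nonneg x)]
  rw [S.eq_ω, G4, h1, rieszPot_const_mul, rieszPot_congr h2,
    integral_lift_div (n := 4) (m := 3)]
  congr 1
  exact rieszPot_lift_eq hr rfl

/-- The field equations in cylindrical coordinates. -/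
theorem field_equations (S : IsSolution α φ ψ E₀ L₀ γ lam R u)
    (hK1 : GradDecays 4 0 (nonlinOne γ u)) (hK4 : GradDecays 6 0 (nonlinFour γ u)) {ρ z : ℝ}
    (hρ : 0 < ρ) :
    pd 0 (pd 0 u.ν) (meridian ρ z) + pd 0 u.ν (meridian ρ z) / ρ +
        pd 2 (pd 2 u.ν) (meridian ρ z) =
      4 * Real.pi * M1 φ ψ γ lam u (meridian ρ z) - nonlinOne γ u (meridian ρ z) ∧
    pd 0 (pd 0 u.b) (meridian ρ z) + 2 * (pd 0 u.b (meridian ρ z) / ρ) +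
        pd 2 (pd 2 u.b) (meridian ρ z) = 8 * Real.pi * M2 φ ψ γ lam u (meridian ρ z) ∧
    pd 0 (pd 0 u.ω) (meridian ρ z) + 3 * (pd 0 u.ω (meridian ρ z) / ρ) +
        pd 2 (pd 2 u.ω) (meridian ρ z) =
      M3 φ ψ γ lam u (meridian ρ z) - nonlinFour γ u (meridian ρ z) := by
  have hr : 0 < axialRadius (meridian ρ z) := by rw [axialRadius_meridian, abs_of_pos hρ]; exact hρ
  have hM := S.continuousAt_M hr
  have hπ := Real.pi_ne_zero
  obtain ⟨A₁, hA₁⟩ := S.sourceBound_srcOne hK1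
  obtain ⟨A₂, hA₂⟩ := S.sourceBound_srcTwo
  obtain ⟨A₄, hA₄⟩ := S.sourceBound_srcFour hK4
  obtain ⟨c₀, hc₀⟩ := S.exists_ν_eq hK1
  have h1 := axial_poisson (k := 1) (m := 1) rfl one_pos isAxialEmbedding_id hA₁ hc₀ S.contDiff_ν
    (z := z) hρ (S.continuousAt_src hK1.contDiff.continuous hr)
  have h2 := axial_poisson (k := 2) (m := 2) (c₀ := 0) rfl two_pos isAxialEmbedding_embFour hA₂
    (fun x => by rw [add_zero]; exact S.b_eq x) S.contDiff_b_two (z := z) hρ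
    (continuousAt_const.mul (continuousAt_offAxis hr hM.2.1))
  have h3 := axial_poisson (k := 3) (m := 3) (c₀ := 0) rfl three_pos isAxialEmbedding_embFive hA₄
    (fun x => by rw [add_zero]; exact S.ω_eq x) S.contDiff_ω (z := z) hρ
    (continuousAt_const.mul (hK4.contDiff.continuous.continuousAt.sub
      (continuousAt_offAxis hr hM.2.2)))
  simp only [srcOne, srcTwo, srcFour, offAxis_eq hr] at h1 h2 h3
  norm_num only [newtonConst_three, newtonConst_four, newtonConst_five, Nat.cast_one, one_mul,
    Nat.cast_ofNat] at h1 h2 h3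
  refine ⟨h1.trans ?_, h2.trans ?_, h3.trans ?_⟩ <;> field_simp <;> ring

end IsSolution

end representation

/-! ### Decay of the solution -/

section decay

variable {f : E 3 → ℝ}

theorem fderiv_fderiv_apply (hf : ContDiff ℝ (2 : ℕ) f) (x e : E 3) :
    fderiv ℝ (fun z => fderiv ℝ f z e) x e = fderiv ℝ (fderiv ℝ f) x e e := by
  have hd : DifferentiableAt ℝ (fderiv ℝ f) x :=
    (hf.contDiffAt.fderiv_right (m := 1) (by norm_num)).differentiableAt (by norm_num)
  rw [fderiv_clm_apply hd (by fun_prop)]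
  simp

/-- The mixed second derivatives, by polarization. -/
theorem pd_pd_eq_polarization (hf : ContDiff ℝ (2 : ℕ) f) (i j : Fin 3) (x : E 3) :
    pd i (pd j f) x = 1 / 2 *
      (fderiv ℝ (fun z => fderiv ℝ f z (EuclideanSpace.single i 1 + EuclideanSpace.single j 1)) x
        (EuclideanSpace.single i 1 + EuclideanSpace.single j 1)
      - fderiv ℝ (fun z => fderiv ℝ f z (EuclideanSpace.single i 1)) x (EuclideanSpace.single i 1)
      - fderiv ℝ (fun z => fderiv ℝ f z (EuclideanSpace.single j 1)) x
        (EuclideanSpace.single j 1)) := by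
  have h1 := pd_pd_eq hf.contDiffAt (x := x) i j
  have h2 := pd_pd_eq hf.contDiffAt (x := x) j i
  rw [pd_comm hf.contDiffAt] at h2
  rw [fderiv_fderiv_apply hf, fderiv_fderiv_apply hf, fderiv_fderiv_apply hf]
  simp only [map_add, add_apply]
  linarith

/-- Second derivatives of a potential whose source is smooth outside a ball. The near and far parts
of the source are separated at distance `(1 + ‖x‖)⁻ˢ`. -/
theorem decays_pd_pd_of_rieszPot {m : ℕ} (hm : 0 < m) {ι : E 3 →ₗᵢ[ℝ] E (m + 1 + 1)}
    {A R : ℝ} {src F w : E 3 → ℝ} (hA : SourceBound A (lift (m + 1) src))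
    (hw : ∀ x, w x = rieszPot m (lift (m + 1) src) (ι x)) (hwc : ContDiff ℝ (2 : ℕ) w) {p q s : ℕ}
    (hF : GradDecays 0 q F) (hsrc : ∀ x, R ≤ ‖x‖ → src x = F x) (h1 : p ≤ q + s)
    (h2 : p + s ≤ m + 2) (i j : Fin 3) : Decays p (pd i (pd j w)) := by
  obtain ⟨H, hH0, hH⟩ := (hol_of_grad one_pos le_rfl hF.contDiff hF.grad).exists_nonneg
  have key : ∀ e : E 3, ∃ C, ∀ x, |R| + 5 < ‖x‖ →
      |fderiv ℝ (fun z => fderiv ℝ w z e) x e| ≤ C * ((1 + ‖x‖) ^ p)⁻¹ := by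
    intro e
    obtain ⟨C, hC0, hC⟩ := exists_abs_snd_fderiv_rieszPot_le (n := m + 1 + 1) rfl hm ι e
    refine ⟨C * (H * 2 ^ q + A), fun x hx => ?_⟩
    have hx0 := weight_pos x
    have hx1 := one_le_weight x
    -- Since `|R| + 5 < ‖x‖`, within distance `4` of `ι x` the source is the smooth function `F`, whose
    -- gradient is of order `(1 + ‖x‖)⁻q` there.
    have hlip : ∀ y y' : E (m + 1 + 1), ‖y - ι x‖ ≤ 3 → ‖y - y'‖ ≤ 1 →
        |lift (m + 1) src y - lift (m + 1) src y'| ≤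
          H * 2 ^ q * ((1 + ‖x‖) ^ q)⁻¹ * ‖y - y'‖ := by
      intro y y' hy hyy
      have hyn : ‖x‖ - 3 ≤ ‖y‖ := by
        have := norm_sub_norm_le (ι x) y
        rw [norm_sub_rev, ι.norm_map] at this
        linarith
      have hyn' : ‖x‖ - 4 ≤ ‖y'‖ := by linarith [norm_sub_norm_le y y']
      have hle := norm_meridian_sub_le y y'
      have hH' := hH _ _ (hle.trans hyy)
      rw [lift, lift, hsrc _ (by rw [norm_meridian_axial]; linarith [le_abs_self R]),
        hsrc _ (by rw [norm_meridian_axial]; linarith [le_abs_self R])]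
      refine hH'.trans ?_
      rw [norm_meridian_axial, Real.rpow_one, zpow_neg, zpow_natCast]
      refine mul_le_mul ?_ hle (norm_nonneg _) (by positivity)
      rw [mul_assoc]
      refine mul_le_mul_of_nonneg_left ?_ hH0
      have h : (1 + ‖x‖) / 2 ≤ 1 + ‖y‖ := by linarith [abs_nonneg R]
      calc ((1 + ‖y‖) ^ q)⁻¹ ≤ (((1 + ‖x‖) / 2) ^ q)⁻¹ :=
            inv_anti₀ (by positivity) (pow_le_pow_left₀ (by positivity) h q)
        _ = _ := by rw [div_pow, inv_div, div_eq_mul_inv]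
    have hA0 := hA.nonneg
    refine (hC A _ hA w hw (by exact_mod_cast hwc) x (H * 2 ^ q * ((1 + ‖x‖) ^ q)⁻¹)
      (((1 + ‖x‖) ^ s)⁻¹) (by positivity) (inv_le_one_of_one_le₀ (one_le_pow₀ hx1))
      (by positivity) hlip).trans ?_
    rw [mul_assoc C]
    refine mul_le_mul_of_nonneg_left ?_ hC0.le
    rw [add_mul]
    refine add_le_add ?_ ?_
    · rw [mul_left_comm, ← mul_inv, ← pow_add]
      refine mul_le_mul_of_nonneg_left (inv_anti₀ (by positivity) ?_) (by positivity)
      exact pow_le_pow_right₀ hx1 (by omega)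
    · rw [inv_inv, mul_assoc]
      refine mul_le_mul_of_nonneg_left ?_ hA0
      rw [← div_eq_mul_inv, div_le_iff₀ (by positivity), ← div_eq_inv_mul,
        le_div_iff₀ (by positivity), ← pow_add]
      exact pow_le_pow_right₀ hx1 (by omega)
  obtain ⟨C₁, h1⟩ := key (EuclideanSpace.single i 1 + EuclideanSpace.single j 1)
  obtain ⟨C₂, h2⟩ := key (EuclideanSpace.single i 1)
  obtain ⟨C₃, h3⟩ := key (EuclideanSpace.single j 1)
  refine Decays.of_exterior (C := 1 / 2 * (C₁ + C₂ + C₃)) (r := |R| + 5)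
    (contDiff_pd (k := 0) (contDiff_pd (k := 1) hwc j) i).continuous fun x hx => ?_
  rw [pd_pd_eq_polarization hwc, abs_mul, abs_of_pos (by norm_num : (0 : ℝ) < 1 / 2), mul_assoc,
    add_mul, add_mul]
  refine mul_le_mul_of_nonneg_left ?_ (by norm_num)
  refine (abs_sub _ _).trans (add_le_add ((abs_sub _ _).trans (add_le_add (h1 x hx) (h2 x hx)))
    (h3 x hx))

variable {α : ℝ} {φ : ℝ → ℝ} {ψ : ℝ × ℝ → ℝ} {E₀ L₀ γ lam R : ℝ} {u : Fields}

namespace IsSolution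

theorem gradDecays_pd_ν (S : IsSolution α φ ψ E₀ L₀ γ lam R u) (i : Fin 3) :
    GradDecays 1 0 (pd i u.ν) :=
  ⟨contDiff_pd (k := 1) S.contDiff_ν i, S.ν_grad i, fun j => S.ν_second j i⟩

theorem gradDecays_pd_b (S : IsSolution α φ ψ E₀ L₀ γ lam R u) (i : Fin 3) :
    GradDecays 3 0 (pd i u.b) :=
  ⟨contDiff_pd (k := 1) S.contDiff_b_two i, S.b_grad i, fun j => S.b_second j i⟩

theorem gradDecays_pd_ω (S : IsSolution α φ ψ E₀ L₀ γ lam R u) (i : Fin 3) :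
    GradDecays 4 0 (pd i u.ω) :=
  ⟨contDiff_pd (k := 1) S.contDiff_ω i, S.ω_grad i, fun j => S.ω_second j i⟩

theorem nonlinOne_decay (S : IsSolution α φ ψ E₀ L₀ γ lam R u) : GradDecays 4 0 (nonlinOne γ u) :=
  S.gradDecays_nonlinOne S.gradDecays_pd_ν S.gradDecays_pd_b S.gradDecays_pd_ω le_rfl (by norm_num)
    (by norm_num) (by norm_num) (by norm_num)

theorem decays_ν_first (S : IsSolution α φ ψ E₀ L₀ γ lam R u) :
    (∃ c₀, Decays 1 fun x => u.ν x - c₀) ∧ ∀ i, Decays 2 (pd i u.ν) := by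
  obtain ⟨c₀, hc₀⟩ := S.exists_ν_eq S.nonlinOne_decay
  obtain ⟨A, hA⟩ := S.sourceBound_srcOne S.nonlinOne_decay
  have hrep : ∀ x, u.ν x - c₀ = rieszPot 1 (lift 2 (srcOne φ ψ γ lam u))
      ((LinearIsometry.id : E 3 →ₗᵢ[ℝ] E 3) x) := fun x => by rw [hc₀ x, add_sub_cancel_right]
  obtain ⟨C₀, -, h0⟩ := exists_abs_rieszPot_le (n := 3) (m := 1) (by norm_num)
  obtain ⟨C₁, -, h1⟩ := exists_norm_fderiv_rieszPot_le (n := 3) (m := 1) (by norm_num) (by norm_num)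
  refine ⟨⟨c₀, decays_natCast (n := 1) (C := C₀ * A) fun x => ?_⟩,
    fun i => decays_natCast (n := 2) (C := C₁ * A) fun x => ?_⟩
  · rw [hrep]
    exact h0 A _ hA x
  · rw [← pd_sub_const c₀]
    exact (abs_pd_le _ _ _).trans (h1 A _ hA _ _ hrep x
      ((S.contDiff_ν_one.differentiable (by norm_num) x).sub_const _))

theorem gradDecays_pd_ν_two (S : IsSolution α φ ψ E₀ L₀ γ lam R u) (i : Fin 3) :
    GradDecays 2 0 (pd i u.ν) :=
  ⟨contDiff_pd (k := 1) S.contDiff_ν i, S.decays_ν_first.2 i, fun j => S.ν_second j i⟩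

theorem nonlinFour_decay (S : IsSolution α φ ψ E₀ L₀ γ lam R u) :
    GradDecays 6 2 (nonlinFour γ u) :=
  S.gradDecays_nonlinFour S.gradDecays_pd_ν_two S.gradDecays_pd_b S.gradDecays_pd_ω (by norm_num)
    (by norm_num) (by norm_num) (by norm_num)

theorem lift_srcTwo_eq_zero (S : IsSolution α φ ψ E₀ L₀ γ lam R u) (y : E 4) (hy : R < ‖y‖) :
    lift 3 (srcTwo φ ψ γ lam u) y = 0 := by
  rw [lift, srcTwo, (S.offAxis_M_eq_zero (by rw [norm_meridian_axial]; exact hy.le)).2.1, mul_zero]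

/-- The source of `b` is compactly supported, so `b` and all its derivatives decay like those of
the fundamental solution. -/
theorem b_decay (S : IsSolution α φ ψ E₀ L₀ γ lam R u) :
    Decays 2 u.b ∧ (∀ i j, Decays 4 (pd i (pd j u.b))) ∧
      (∀ i j k, Decays 5 (pd i (pd j (pd k u.b)))) ∧
      ∀ i j k, Hol α 6 (pd i (pd j (pd k u.b))) := by
  obtain ⟨A, hA⟩ := S.sourceBound_srcTwo
  have hR0 : 0 < R := by linarith [S.one_le_R]
  have hz := S.lift_srcTwo_eq_zero
  have h0 : IsExterior embFour (lift 3 (srcTwo φ ψ γ lam u)) R 2 u.b :=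
    ⟨_, isKernel_inv_norm_pow 2, fun x _ => S.b_eq x⟩
  have h2 := fun i j => (h0.pd hR0 hA hz j).pd hR0 hA hz i
  have h3 := fun i j k => (h2 j k).pd hR0 hA hz i
  have hc2 := fun i j => (contDiff_pd (k := 1) (S.contDiff_pd_b j) i)
  refine ⟨?_, fun i j => ?_, fun i j k => ?_, fun i j k => ?_⟩
  · obtain ⟨C, -, hC⟩ := h0.exists_abs_le S.one_le_R hA hz
    exact Decays.of_exterior (n := 2) S.contDiff_b.continuous hC
  · obtain ⟨C, -, hC⟩ := (h2 i j).exists_abs_le S.one_le_R hA hz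
    exact Decays.of_exterior (n := 4) (hc2 i j).continuous hC
  · obtain ⟨C, -, hC⟩ := (h3 i j k).exists_abs_le S.one_le_R hA hz
    exact Decays.of_exterior (n := 5) (contDiff_pd (k := 0) (hc2 j k) i).continuous hC
  · choose C hC0 hC using fun l => ((h3 i j k).pd hR0 hA hz l).exists_abs_le S.one_le_R hA hz
    refine Hol.of_exterior (n := 6) (r := 2 * R) (C := ∑ l, C l) S.α_pos S.α_le (S.b_hol i j k)
      (fun x hx => (h3 i j k).differentiableAt hR0 hA hz hx) fun x hx l => (hC l x hx).trans ?_
    exact mul_le_mul_of_nonneg_right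
      (Finset.single_le_sum (fun l _ => (hC0 l).le) (Finset.mem_univ l))
      (inv_nonneg.2 (pow_nonneg (weight_pos x).le _))

/-- If the gradient of the nonlinearity is of order `-q`, the near part of the source, of size
`(1 + ‖x‖)⁻ˢ`, contributes a term of order `-(q + s)` to the second derivatives of `ω`, and the far
part a term of order `s - 5`. -/
theorem decays_pd_pd_ω (S : IsSolution α φ ψ E₀ L₀ γ lam R u) {p q s : ℕ}
    (hK : GradDecays 6 q (nonlinFour γ u)) (h1 : p ≤ q + s) (h2 : p + s ≤ 5) (i j : Fin 3) :
    Decays p (pd i (pd j u.ω)) := by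
  obtain ⟨A, hA⟩ := S.sourceBound_srcFour (S.nonlinFour_decay.mono le_rfl (by norm_num))
  refine decays_pd_pd_of_rieszPot (m := 3) (R := R) (by norm_num) hA S.ω_eq S.contDiff_ω
    ((hK.const_mul (1 / (8 * Real.pi ^ 2))).mono (by norm_num) le_rfl) (fun x hx => ?_) h1 h2 i j
  rw [srcFour, (S.offAxis_M_eq_zero hx).2.2, sub_zero]

/-- The second derivatives of `ν` are controlled by those of `ω`, which enter the gradient of
`nonlinOne`. A first, suboptimal bound for the latter, using only that the second derivatives of
`ν` are bounded, is enough. -/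
theorem ν_decay (S : IsSolution α φ ψ E₀ L₀ γ lam R u) (i j : Fin 3) :
    Decays 3 (pd i (pd j u.ν)) := by
  have hω : ∀ i, GradDecays 4 3 (pd i u.ω) := fun i =>
    ⟨contDiff_pd (k := 1) S.contDiff_ω i, S.ω_grad i, fun j =>
      S.decays_pd_pd_ω (p := 3) (q := 2) (s := 1) S.nonlinFour_decay le_rfl (by norm_num) j i⟩
  have hb : ∀ i, GradDecays 3 4 (pd i u.b) := fun i =>
    ⟨contDiff_pd (k := 1) S.contDiff_b_two i, S.b_grad i, fun j => S.b_decay.2.1 j i⟩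
  have hK : GradDecays 4 3 (nonlinOne γ u) :=
    S.gradDecays_nonlinOne S.gradDecays_pd_ν_two hb hω (by norm_num) (by norm_num) (by norm_num)
      (by norm_num) (by norm_num)
  obtain ⟨c₀, hc₀⟩ := S.exists_ν_eq S.nonlinOne_decay
  obtain ⟨A, hA⟩ := S.sourceBound_srcOne S.nonlinOne_decay
  have hpd : pd j (fun x => u.ν x - c₀) = pd j u.ν := pd_sub_const _ _ _
  rw [← hpd]
  refine decays_pd_pd_of_rieszPot (m := 1) (R := R) (w := fun x => u.ν x - c₀) (p := 3) (q := 3)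
    (s := 0) (by norm_num) (ι := LinearIsometry.id) hA
    (fun x => by rw [hc₀ x, add_sub_cancel_right]) (S.contDiff_ν.sub contDiff_const)
    ((hK.const_mul (1 / (4 * Real.pi))).mono (by norm_num) le_rfl) (fun x hx => ?_) le_rfl le_rfl
    i j
  rw [srcOne, (S.offAxis_M_eq_zero hx).1, neg_zero, zero_add]

/-- With the optimal bound for the second derivatives of `ν` the gradient of `nonlinFour` is of order
`-5`, and the potential estimate can be repeated with the optimal exponent. -/
theorem ω_decay (S : IsSolution α φ ψ E₀ L₀ γ lam R u) :
    Decays 3 u.ω ∧ ∀ i j, Decays 5 (pd i (pd j u.ω)) := by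
  obtain ⟨A, hA⟩ := S.sourceBound_srcFour (S.nonlinFour_decay.mono le_rfl (by norm_num))
  obtain ⟨C, -, hC⟩ := exists_abs_rieszPot_le (n := 5) (m := 3) (by norm_num)
  refine ⟨decays_natCast (n := 3) (C := C * A) fun x => ?_, ?_⟩
  · have := hC A _ hA (embFive x)
    rwa [← S.ω_eq, embFive.norm_map] at this
  have hω : ∀ i, GradDecays 4 3 (pd i u.ω) := fun i =>
    ⟨contDiff_pd (k := 1) S.contDiff_ω i, S.ω_grad i, fun j =>
      S.decays_pd_pd_ω (p := 3) (q := 2) (s := 1) S.nonlinFour_decay le_rfl (by norm_num) j i⟩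
  have hb : ∀ i, GradDecays 3 4 (pd i u.b) := fun i =>
    ⟨contDiff_pd (k := 1) S.contDiff_b_two i, S.b_grad i, fun j => S.b_decay.2.1 j i⟩
  have hν : ∀ i, GradDecays 2 3 (pd i u.ν) := fun i =>
    ⟨contDiff_pd (k := 1) S.contDiff_ν i, S.decays_ν_first.2 i, fun j => S.ν_decay j i⟩
  have hK : GradDecays 6 5 (nonlinFour γ u) :=
    S.gradDecays_nonlinFour hν hb hω (by norm_num) (by norm_num) (by norm_num) (by norm_num)
  exact fun i j => S.decays_pd_pd_ω (p := 5) (q := 5) (s := 0) hK le_rfl le_rfl i j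

end IsSolution

end decay

/-! ### Integrability of the equations for `ξ` -/

section integrability

/-- The computation behind the integrability of the system `W_ρ P - W_z Q = C`,
`W_z P + W_ρ Q = A` for the gradient `(P, Q)`. The first four hypotheses are the derivatives of the
two equations with respect to `ρ` and `z`, where `β = W_ρ`, `w = W_z`, `S = ΔW` and `V = W³e^{-4γν}`;
then come the field equations for `ν` and `ω`, the relation between the gradients of `V`, `W` and
`ν`, and the equation for `b` differentiated with respect to `ρ` and `z`. -/
theorem integrability_algebra {γ β w W V m₁ m₃ P Q Ps Pz Qs Qz Xz T S Ss Sz βs βz wz : ℝ}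
    {νs νz νss νsz νzz ωs ωz ωss ωsz ωzz Vs Vz cs cz as az : ℝ}
    (e1s : βs * P + β * Ps - (βz * Q + w * Qs) = cs + γ ^ 2 * (β * (νs ^ 2 - νz ^ 2) +
      W * (2 * νs * νss - 2 * νz * νsz)) - 1 / 4 * γ * (Vs * (ωs ^ 2 - ωz ^ 2) +
      V * (2 * ωs * ωss - 2 * ωz * ωsz)))
    (e1z : βz * P + β * Pz - (wz * Q + w * Qz) = cz + γ ^ 2 * (w * (νs ^ 2 - νz ^ 2) +
      W * (2 * νs * νsz - 2 * νz * νzz)) - 1 / 4 * γ * (Vz * (ωs ^ 2 - ωz ^ 2) +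
      V * (2 * ωs * ωsz - 2 * ωz * ωzz)))
    (e2s : βz * P + w * Ps + (βs * Q + β * Qs) = as + 2 * γ ^ 2 * (β * (νs * νz) +
      W * (νss * νz + νs * νsz)) - 1 / 2 * γ * (Vs * (ωs * ωz) + V * (ωss * ωz + ωs * ωsz)))
    (e2z : wz * P + w * Pz + (βz * Q + β * Qz) = az + 2 * γ ^ 2 * (w * (νs * νz) +
      W * (νsz * νz + νs * νzz)) - 1 / 2 * γ * (Vz * (ωs * ωz) + V * (ωsz * ωz + ωs * ωzz)))
    (hcz : cz - as = -(1 / 2) * Sz) (hcs : cs + az = 1 / 2 * Ss) (hS : S = βs + wz)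
    (hν : W * (νss + νzz) = -β * νs - w * νz + 4 * Real.pi * W * m₁ +
      1 / 2 * V * (ωs ^ 2 + ωz ^ 2))
    (hω : V * (ωss + ωzz) + Vs * ωs + Vz * ωz = V * m₃)
    (hV : β * Vz - w * Vs = 4 * γ * V * (w * νs - β * νz))
    (hXs : 1 / 2 * Ss + 8 * Real.pi * γ ^ 2 * W * m₁ * νs - 1 / 2 * γ * V * m₃ * ωs = S * P + β * T)
    (hXz : 1 / 2 * Sz + 8 * Real.pi * γ ^ 2 * W * m₁ * νz - 1 / 2 * γ * V * m₃ * ωz =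
      S * Xz + w * T) :
    (β * β + w * w) * (Pz - Qs) = -(β * S) * (Xz - Q) := by
  linear_combination β * e1z - β * e2s + w * e1s + w * e2z + β * hcz + w * hcs +
    (-β * Q + w * P) * hS + 2 * γ ^ 2 * (w * νs - β * νz) * hν -
    1 / 2 * γ * (w * ωs - β * ωz) * hω - 1 / 4 * γ * (ωs ^ 2 + ωz ^ 2) * hV + w * hXs - β * hXz

/-- Cramer's rule for the system `β P - s v Q = C`, `s v P + β Q = A`. The right-hand sides have the
form of `gradG` and `gradH` on the meridian plane. -/
theorem solve_rotation_system {β v s A C D : ℝ} (hD : D ≠ 0) (h : D = β ^ 2 + (s * v) ^ 2) :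
    β * ((v * (s * A) + β * C) * D⁻¹) - s * v * ((β * A - v * (s * C)) * D⁻¹) = C ∧
      s * v * ((v * (s * A) + β * C) * D⁻¹) + β * ((β * A - v * (s * C)) * D⁻¹) = A := by
  constructor <;> field_simp <;> rw [h] <;> ring

variable {f g : E 3 → ℝ}

theorem pd_congr_meridian (hf : Differentiable ℝ f) (hg : Differentiable ℝ g)
    (h : ∀ s z, f (meridian s z) = g (meridian s z)) {i : Fin 3} (hi : i = 0 ∨ i = 2) (s z : ℝ) :
    pd i f (meridian s z) = pd i g (meridian s z) := by
  rcases hi with rfl | rfl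
  · have h0 := hasDerivAt_meridian_radial (hf (meridian s z))
    simp only [h] at h0
    exact h0.unique (hasDerivAt_meridian_radial (hg _))
  · have h2 := hasDerivAt_meridian_vertical (hf (meridian s z))
    simp only [h] at h2
    exact h2.unique (hasDerivAt_meridian_vertical (hg _))

theorem pd_system_form {k W V p q : E 3 → ℝ} (hk : Differentiable ℝ k)
    (hW : Differentiable ℝ W) (hV : Differentiable ℝ V) (hp : Differentiable ℝ p)
    (hq : Differentiable ℝ q) (c d : ℝ) (i : Fin 3) (x : E 3) :
    pd i (fun y => k y + c * (W y * p y) - d * (V y * q y)) x =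
      pd i k x + c * (pd i W x * p x + W x * pd i p x) -
        d * (pd i V x * q x + V x * pd i q x) := by
  have h (e : ℝ) {a : E 3 → ℝ} (ha : Differentiable ℝ a) :
      pd i (fun y => e * a y) x = e * pd i a x := by
    rw [pd_mul (differentiableAt_const e) (ha x), pd_const]
    ring
  have hWp : Differentiable ℝ fun y => W y * p y := hW.mul hp
  have hVq : Differentiable ℝ fun y => V y * q y := hV.mul hq
  have h1 : Differentiable ℝ fun y => c * (W y * p y) := hWp.const_mul c
  have h2 : Differentiable ℝ fun y => d * (V y * q y) := hVq.const_mul d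
  have h3 : Differentiable ℝ fun y => k y + c * (W y * p y) := hk.add h1
  rw [pd_sub (h3 x) (h2 x), pd_add (hk x) (h1 x), h c hWp, h d hVq,
    pd_mul (hW x) (hp x), pd_mul (hV x) (hq x)]

theorem pd_sub_sq (hf : Differentiable ℝ f) (hg : Differentiable ℝ g) (i : Fin 3) (x : E 3) :
    pd i (fun y => f y * f y - g y * g y) x =
      2 * f x * pd i f x - 2 * g x * pd i g x := by
  have h1 : Differentiable ℝ fun y => f y * f y := hf.mul hf
  have h2 : Differentiable ℝ fun y => g y * g y := hg.mul hg
  rw [pd_sub (h1 x) (h2 x), pd_mul (hf x) (hf x), pd_mul (hg x) (hg x)]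
  ring

/-- `W = ρB` on the meridian plane. -/
def potW (u : Fields) (x : E 3) : ℝ := x 0 * (1 + u.b x)

/-- `W³ e^{-4γν}` on the meridian plane. -/
def potV (γ : ℝ) (u : Fields) (x : E 3) : ℝ := potW u x ^ 3 * Real.exp (-4 * γ * u.ν x)

/-- `ΔW` on the meridian plane. -/
def potS (u : Fields) (x : E 3) : ℝ :=
  2 * pd 0 u.b x + x 0 * (pd 0 (pd 0 u.b) x + pd 2 (pd 2 u.b) x)

variable {α : ℝ} {φ : ℝ → ℝ} {ψ : ℝ × ℝ → ℝ} {E₀ L₀ γ lam R : ℝ} {u : Fields}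

namespace IsSolution

theorem differentiable_potW (S : IsSolution α φ ψ E₀ L₀ γ lam R u) : Differentiable ℝ (potW u) := by
  have := S.contDiff_b_one.differentiable (by norm_num)
  have := differentiable_coord 0
  unfold potW
  fun_prop

theorem differentiable_pd_b (S : IsSolution α φ ψ E₀ L₀ γ lam R u) (i : Fin 3) :
    Differentiable ℝ (pd i u.b) := (S.contDiff_pd_b i).differentiable (by norm_num)

theorem differentiable_pd_pd_b (S : IsSolution α φ ψ E₀ L₀ γ lam R u) (i j : Fin 3) :
    Differentiable ℝ (pd i (pd j u.b)) := (S.contDiff_pd_pd_b i j).differentiable (by norm_num)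

theorem differentiable_potV (S : IsSolution α φ ψ E₀ L₀ γ lam R u) :
    Differentiable ℝ (potV γ u) := by
  have := S.differentiable_potW
  have := S.contDiff_ν_one.differentiable (by norm_num)
  unfold potV
  fun_prop

theorem pd_potW (S : IsSolution α φ ψ E₀ L₀ γ lam R u) (i : Fin 3) (x : E 3) :
    pd i (potW u) x = (if i = 0 then 1 else 0) * (1 + u.b x) + x 0 * pd i u.b x := by
  have hb := S.contDiff_b_one.differentiable (by norm_num) x
  unfold potW
  rw [pd_mul (differentiable_coord 0 x) (hb.const_add 1), pd_coord,
    pd_add (differentiableAt_const 1) hb, pd_const, zero_add]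

theorem pd_potV (S : IsSolution α φ ψ E₀ L₀ γ lam R u) (i : Fin 3) (x : E 3) :
    pd i (potV γ u) x = 3 * potW u x ^ 2 * pd i (potW u) x * Real.exp (-4 * γ * u.ν x) -
      4 * γ * potV γ u x * pd i u.ν x := by
  have hν := S.contDiff_ν_one.differentiable (by norm_num) x
  have hW := S.differentiable_potW x
  have h1 : HasDerivAt (fun t : ℝ => Real.exp (-4 * γ * t))
      (Real.exp (-4 * γ * u.ν x) * (-4 * γ)) (u.ν x) := by
    simpa using ((hasDerivAt_id (u.ν x)).const_mul (-4 * γ)).exp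
  have h2 : HasDerivAt (fun t : ℝ => t ^ 3) (3 * potW u x ^ 2) (potW u x) := by
    simpa using hasDerivAt_pow 3 (potW u x)
  have h3 : DifferentiableAt ℝ (fun x => potW u x ^ 3) x := hW.pow 3
  have h4 : DifferentiableAt ℝ (fun x => Real.exp (-4 * γ * u.ν x)) x := (hν.const_mul _).exp
  unfold potV
  rw [pd_mul h3 h4, pd_comp h1 hν, pd_comp h2 hW]
  ring

/-- The two equations for the gradient of `ξ`, differentiated along the meridian plane. -/
theorem pd_system (S : IsSolution α φ ψ E₀ L₀ γ lam R u) {i : Fin 3} (hi : i = 0 ∨ i = 2)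
    (s z : ℝ) : let x := meridian s z
    pd i (fun y => 1 + u.b y + y 0 * pd 0 u.b y) x * gradG γ u 0 x +
      (1 + u.b x + s * pd 0 u.b x) * pd i (gradG γ u 0) x -
      (pd i (fun y => y 0 * pd 2 u.b y) x * gradH γ u x + s * pd 2 u.b x * pd i (gradH γ u) x) =
      pd i (fun y => 1 / 2 * (y 0 * pd 0 (pd 0 u.b) y + 2 * pd 0 u.b y
        - y 0 * pd 2 (pd 2 u.b) y)) x +
      γ ^ 2 * (pd i (potW u) x * (pd 0 u.ν x ^ 2 - pd 2 u.ν x ^ 2) + potW u x *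
        (2 * pd 0 u.ν x * pd i (pd 0 u.ν) x - 2 * pd 2 u.ν x * pd i (pd 2 u.ν) x)) -
      1 / 4 * γ * (pd i (potV γ u) x * (pd 0 u.ω x ^ 2 - pd 2 u.ω x ^ 2) + potV γ u x *
        (2 * pd 0 u.ω x * pd i (pd 0 u.ω) x - 2 * pd 2 u.ω x * pd i (pd 2 u.ω) x)) ∧
    pd i (fun y => y 0 * pd 2 u.b y) x * gradG γ u 0 x +
      s * pd 2 u.b x * pd i (gradG γ u 0) x +
      (pd i (fun y => 1 + u.b y + y 0 * pd 0 u.b y) x * gradH γ u x +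
        (1 + u.b x + s * pd 0 u.b x) * pd i (gradH γ u) x) =
      pd i (fun y => pd 2 u.b y + y 0 * pd 0 (pd 2 u.b) y) x +
      2 * γ ^ 2 * (pd i (potW u) x * (pd 0 u.ν x * pd 2 u.ν x) + potW u x *
        (pd i (pd 0 u.ν) x * pd 2 u.ν x + pd 0 u.ν x * pd i (pd 2 u.ν) x)) -
      1 / 2 * γ * (pd i (potV γ u) x * (pd 0 u.ω x * pd 2 u.ω x) + potV γ u x *
        (pd i (pd 0 u.ω) x * pd 2 u.ω x + pd 0 u.ω x * pd i (pd 2 u.ω) x)) := by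
  intro x
  have hb := S.contDiff_b_one.differentiable (by norm_num)
  have hb1 := S.differentiable_pd_b
  have hb2 := S.differentiable_pd_pd_b
  have hx := differentiable_coord 0
  have hG := (S.contDiff_gradG 0).differentiable (by norm_num)
  have hH := S.contDiff_gradH.differentiable (by norm_num)
  have hν1 := fun j => (contDiff_pd (k := 1) S.contDiff_ν j).differentiable (by norm_num)
  have hω1 := fun j => (contDiff_pd (k := 1) S.contDiff_ω j).differentiable (by norm_num)
  have hW := S.differentiable_potW
  have hV := S.differentiable_potV
  have hβ : Differentiable ℝ fun y => 1 + u.b y + y 0 * pd 0 u.b y :=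
    (hb.const_add 1).add (hx.mul (hb1 0))
  have hw : Differentiable ℝ fun y => y 0 * pd 2 u.b y := hx.mul (hb1 2)
  have hkC : Differentiable ℝ fun y => 1 / 2 * (y 0 * pd 0 (pd 0 u.b) y + 2 * pd 0 u.b y
      - y 0 * pd 2 (pd 2 u.b) y) :=
    (((hx.mul (hb2 0 0)).add ((hb1 0).const_mul 2)).sub (hx.mul (hb2 2 2))).const_mul _
  have hkA : Differentiable ℝ fun y => pd 2 u.b y + y 0 * pd 0 (pd 2 u.b) y :=
    (hb1 2).add (hx.mul (hb2 0 2))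
  have hνC : Differentiable ℝ fun y => pd 0 u.ν y * pd 0 u.ν y - pd 2 u.ν y * pd 2 u.ν y :=
    ((hν1 0).mul (hν1 0)).sub ((hν1 2).mul (hν1 2))
  have hωC : Differentiable ℝ fun y => pd 0 u.ω y * pd 0 u.ω y - pd 2 u.ω y * pd 2 u.ω y :=
    ((hω1 0).mul (hω1 0)).sub ((hω1 2).mul (hω1 2))
  have hνA : Differentiable ℝ fun y => pd 0 u.ν y * pd 2 u.ν y := (hν1 0).mul (hν1 2)
  have hωA : Differentiable ℝ fun y => pd 0 u.ω y * pd 2 u.ω y := (hω1 0).mul (hω1 2)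
  have hD : ∀ y, gradDen u y ≠ 0 := fun y => (lt_of_lt_of_le (by norm_num) (S.den_lower y)).ne'
  have hden : ∀ s z : ℝ, gradDen u (meridian s z) =
      (1 + u.b (meridian s z) + s * pd 0 u.b (meridian s z)) ^ 2 +
        (s * pd 2 u.b (meridian s z)) ^ 2 := by
    intro s z
    rw [gradDen, gradBeta, euler_meridian, meridian_zero_coord, meridian_one_coord]
    ring
  -- On the meridian plane the definitions of `gradG` and `gradH` say that they solve the linear system;
  -- it is differentiated only afterwards, so that no quotient has to be differentiated.
  have key1 : ∀ s z, (fun y => (1 + u.b y + y 0 * pd 0 u.b y) * gradG γ u 0 y -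
      y 0 * pd 2 u.b y * gradH γ u y) (meridian s z) = (fun y => 1 / 2 * (y 0 * pd 0 (pd 0 u.b) y +
        2 * pd 0 u.b y - y 0 * pd 2 (pd 2 u.b) y) + γ ^ 2 * (potW u y *
        (pd 0 u.ν y * pd 0 u.ν y - pd 2 u.ν y * pd 2 u.ν y)) - 1 / 4 * γ * (potV γ u y *
        (pd 0 u.ω y * pd 0 u.ω y - pd 2 u.ω y * pd 2 u.ω y))) (meridian s z) := by
    intro s z
    have h11 := mul_pd_one_pd_one_meridian S.contDiff_b_two S.axial_b s z
    refine Eq.trans ?_ ((solve_rotation_system (A := gradA γ u (meridian s z))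
      (C := gradC γ u 0 (meridian s z)) (hD _) (hden s z)).1.trans ?_)
    · simp only [gradG, gradH, gradBeta, euler_meridian, meridian_zero_coord, meridian_one_coord,
        zero_mul, add_zero]
    · simp only [gradC, gradWeight, euler_meridian, meridian_zero_coord, meridian_one_coord, potV,
        potW]
      linear_combination (1 / 2) * h11
  have key2 : ∀ s z, (fun y => y 0 * pd 2 u.b y * gradG γ u 0 y +
      (1 + u.b y + y 0 * pd 0 u.b y) * gradH γ u y) (meridian s z) = (fun y => pd 2 u.b y +
        y 0 * pd 0 (pd 2 u.b) y + 2 * γ ^ 2 * (potW u y * (pd 0 u.ν y * pd 2 u.ν y)) -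
        1 / 2 * γ * (potV γ u y * (pd 0 u.ω y * pd 2 u.ω y))) (meridian s z) := by
    intro s z
    refine Eq.trans ?_ ((solve_rotation_system (A := gradA γ u (meridian s z))
      (C := gradC γ u 0 (meridian s z)) (hD _) (hden s z)).2.trans ?_)
    · simp only [gradG, gradH, gradBeta, euler_meridian, meridian_zero_coord, meridian_one_coord,
        zero_mul, add_zero]
    · simp only [gradA, gradWeight, euler_meridian, meridian_zero_coord, meridian_one_coord, potV,
        potW]
      ring
  have e1 := pd_congr_meridian ((hβ.mul hG).sub (hw.mul hH))
    ((hkC.add ((hW.mul hνC).const_mul (γ ^ 2))).sub ((hV.mul hωC).const_mul (1 / 4 * γ))) key1 hi s z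
  have e2 := pd_congr_meridian ((hw.mul hG).add (hβ.mul hH))
    ((hkA.add ((hW.mul hνA).const_mul (2 * γ ^ 2))).sub ((hV.mul hωA).const_mul (1 / 2 * γ)))
    key2 hi s z
  have hβG : Differentiable ℝ fun y => (1 + u.b y + y 0 * pd 0 u.b y) * gradG γ u 0 y := hβ.mul hG
  have hβH : Differentiable ℝ fun y => (1 + u.b y + y 0 * pd 0 u.b y) * gradH γ u y := hβ.mul hH
  have hwG : Differentiable ℝ fun y => y 0 * pd 2 u.b y * gradG γ u 0 y := hw.mul hG
  have hwH : Differentiable ℝ fun y => y 0 * pd 2 u.b y * gradH γ u y := hw.mul hH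
  refine ⟨?_, ?_⟩
  · refine Eq.trans ?_ ((pd_sub (hβG x) (hwH x) i).symm.trans (e1.trans ?_))
    · rw [pd_mul (hβ x) (hG x), pd_mul (hw x) (hH x)]
      simp only [x, meridian_zero_coord]
    · refine (pd_system_form hkC hW hV hνC hωC _ _ i x).trans ?_
      rw [pd_sub_sq (hν1 0) (hν1 2), pd_sub_sq (hω1 0) (hω1 2)]
      ring
  · refine Eq.trans ?_ ((pd_add (hwG x) (hβH x) i).symm.trans (e2.trans ?_))
    · rw [pd_mul (hβ x) (hH x), pd_mul (hw x) (hG x)]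
      simp only [x, meridian_zero_coord]
    · refine (pd_system_form hkA hW hV hνA hωA _ _ i x).trans ?_
      rw [pd_mul (hν1 0 x) (hν1 2 x), pd_mul (hω1 0 x) (hω1 2 x)]

end IsSolution

end integrability

/-! ### The defect of the vertical derivative of `ξ` -/

section transport

variable {α : ℝ} {φ : ℝ → ℝ} {ψ : ℝ × ℝ → ℝ} {E₀ L₀ γ lam R : ℝ} {u : Fields}

namespace IsSolution

theorem contDiff_potW (S : IsSolution α φ ψ E₀ L₀ γ lam R u) : ContDiff ℝ (1 : ℕ) (potW u) := by
  have := S.contDiff_b_one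
  unfold potW
  fun_prop

theorem differentiable_potS (S : IsSolution α φ ψ E₀ L₀ γ lam R u) : Differentiable ℝ (potS u) := by
  have := S.differentiable_pd_b 0
  have := S.differentiable_pd_pd_b 0 0
  have := S.differentiable_pd_pd_b 2 2
  have := differentiable_coord 0
  unfold potS
  fun_prop

/-- The equation for `b` expresses `ΔW` through the potential `matJ` of the matter terms. -/
theorem potS_eq (S : IsSolution α φ ψ E₀ L₀ γ lam R u) {s z : ℝ} (hs : 0 < s) :
    potS u (meridian s z) = 16 * Real.pi ^ 2 * γ ^ 2 * (Real.exp (2 * u.ξ (meridian s z)) *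
      matJ φ (fun L => ψ (lam, L)) γ (u.ν (meridian s z)) (u.ω (meridian s z))
        (potW u (meridian s z))) := by
  have hr : axialRadius (meridian s z) = s := by rw [axialRadius_meridian, abs_of_pos hs]
  have h := (S.field_equations S.nonlinOne_decay (S.nonlinFour_decay.mono le_rfl (by norm_num))
    (z := z) hs).2.1
  rw [M2_eq S.ansatz S.γ_nonneg (hr.symm ▸ hs) (S.B_pos _), hr] at h
  rw [potS, potW, meridian_zero_coord]
  field_simp at h
  linear_combination h

/-- Conservation of energy and momentum for the matter, in the form needed for the integrability of
the equations for `ξ`. The source of the equation for `b` is the potential `matJ`, and its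
derivatives with respect to `ν` and `ω` are the sources of the other two equations. So along a curve
`c` which runs through `meridian s z` in the direction of the coordinate `i` the combination of matter
terms on the left is the derivative of the potential, up to a term along the gradient of `W` with a
coefficient `T` that does not depend on the direction. As `ξ` enters the potential through the factor
`e^{2ξ}`, its derivative `ξ'` along the curve appears; `ξ` is not known to have any further
regularity. -/
theorem exists_source_identity (S : IsSolution α φ ψ E₀ L₀ γ lam R u) {s z : ℝ} (hs : 0 < s) :
    ∃ T : ℝ, ∀ (i : Fin 3) (c : ℝ → E 3) (t₀ ξ' : ℝ), c t₀ = meridian s z →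
      (∀ t, c t = meridian (c t 0) (c t 2)) → Continuous c →
      (∀ f : E 3 → ℝ, Differentiable ℝ f → ∀ t, HasDerivAt (fun t => f (c t)) (pd i f (c t)) t) →
      HasDerivAt (fun t => u.ξ (c t)) ξ' t₀ →
      1 / 2 * pd i (potS u) (meridian s z) + 8 * Real.pi * γ ^ 2 * potW u (meridian s z) *
        M1 φ ψ γ lam u (meridian s z) * pd i u.ν (meridian s z) - 1 / 2 * γ *
        potV γ u (meridian s z) * M3 φ ψ γ lam u (meridian s z) * pd i u.ω (meridian s z) =
      potS u (meridian s z) * ξ' + pd i (potW u) (meridian s z) * T := by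
  set x := meridian s z with hx
  refine ⟨8 * Real.pi ^ 2 * γ ^ 2 * Real.exp (2 * u.ξ x) * (2 / potW u x ^ 3 *
    matI φ (fun L => ψ (lam, L)) γ (u.ν x) (u.ω x) (potW u x) (fun p => p.1 ^ 2)),
    fun i c t₀ ξ' hct hcm hcc hc hξ => ?_⟩
  have hr : axialRadius x = s := by rw [hx, axialRadius_meridian, abs_of_pos hs]
  have hWx : potW u x = s * (1 + u.b x) := by rw [potW, hx, meridian_zero_coord]
  have hW0 : 0 < potW u x := hWx ▸ mul_pos hs (S.B_pos x)
  have hA := S.ansatz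
  have hJ := hasDerivAt_matJ S.γ_nonneg hA.continuous_φ (hA.continuous_χ lam) hA.φ_eq_zero
    (hA.ψ_eq_zero lam) (hc u.ν (S.contDiff_ν_one.differentiable (by norm_num)))
    (hc u.ω (S.contDiff_ω_one.differentiable (by norm_num))) (hc _ S.differentiable_potW)
    ((contDiff_pd (k := 1) S.contDiff_ν i).continuous.comp hcc)
    ((contDiff_pd (k := 1) S.contDiff_ω i).continuous.comp hcc)
    ((contDiff_pd (k := 0) S.contDiff_potW i).continuous.comp hcc) (s₀ := t₀) (by rwa [hct])
  have h1 := (((hξ.const_mul 2).exp).mul hJ).const_mul (16 * Real.pi ^ 2 * γ ^ 2)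
  have hpos : ∀ᶠ t in 𝓝 t₀, 0 < c t 0 := by
    have h : Continuous fun t => c t 0 := by fun_prop
    refine h.continuousAt.eventually_const_lt ?_
    change 0 < c t₀ 0
    rw [hct, hx, meridian_zero_coord]
    exact hs
  have h2 : (fun t => potS u (c t)) =ᶠ[𝓝 t₀] fun t => 16 * Real.pi ^ 2 * γ ^ 2 *
      (Real.exp (2 * u.ξ (c t)) * matJ φ (fun L => ψ (lam, L)) γ (u.ν (c t)) (u.ω (c t))
        (potW u (c t))) := by
    filter_upwards [hpos] with t ht
    rw [hcm t]
    exact S.potS_eq ht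
  have h3 := (hc _ S.differentiable_potS t₀).unique (h1.congr_of_eventuallyEq h2)
  have h4 : potS u x = _ := S.potS_eq hs
  rw [hct] at h3
  have hM1 := M1_eq (lam := lam) hA S.γ_nonneg (u := u) (x := x) (by rwa [hr]) (S.B_pos x)
  have hM3 := M3_eq (lam := lam) hA S.γ_nonneg (u := u) (x := x) (by rwa [hr]) (S.B_pos x)
  rw [hr, ← hWx] at hM1 hM3
  have hw1 : (fun p : ℝ × ℝ => 2 * Real.exp (-4 * γ * u.ν x) *
      (1 + γ * (p.2 - p.1 * u.ω x)) ^ 2 - Real.exp (-2 * γ * u.ν x)) =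
      weightOne γ (u.ν x, u.ω x, potW u x) := rfl
  have hw3 : (fun p : ℝ × ℝ => (1 + γ * (p.2 - p.1 * u.ω x)) * p.1) =
      weightThree γ (u.ν x, u.ω x, potW u x) := rfl
  rw [hw1, hw3] at h3
  rw [h3, h4, hM1, hM3, potV, ← hx]
  -- Only the linear dependence on the matter integrals matters from here on.
  generalize matI φ (fun L => ψ (lam, L)) γ (u.ν x) (u.ω x) (potW u x)
    (weightOne γ (u.ν x, u.ω x, potW u x)) = I₁
  generalize matI φ (fun L => ψ (lam, L)) γ (u.ν x) (u.ω x) (potW u x)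
    (weightThree γ (u.ν x, u.ω x, potW u x)) = I₃
  generalize matI φ (fun L => ψ (lam, L)) γ (u.ν x) (u.ω x) (potW u x) (fun p => p.1 ^ 2) = I₂
  generalize matJ φ (fun L => ψ (lam, L)) γ (u.ν x) (u.ω x) (potW u x) = J
  field_simp
  ring

/-- The defect `ξ_z - Q` of the second equation satisfies a linear ordinary differential equation in
the radial variable. -/
theorem transport (S : IsSolution α φ ψ E₀ L₀ γ lam R u) {s z ξz : ℝ} (hs : 0 < s)
    (hξs : HasDerivAt (fun t => u.ξ (meridian t z)) (gradG γ u 0 (meridian s z)) s)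
    (hξz : HasDerivAt (fun t => u.ξ (meridian s t)) ξz z) :
    gradDen u (meridian s z) * (pd 2 (gradG γ u 0) (meridian s z) - pd 0 (gradH γ u) (meridian s z))
      = -(gradBeta u (meridian s z) * potS u (meridian s z)) * (ξz - gradH γ u (meridian s z)) := by
  set x := meridian s z with hx
  have hx0 : x 0 = s := meridian_zero_coord s z
  have hr : axialRadius x = s := by rw [hx, axialRadius_meridian, abs_of_pos hs]
  obtain ⟨T, hT⟩ := S.exists_source_identity (z := z) hs
  have hXs := hT 0 (fun t => meridian t z) s _ rfl
    (fun t => by simp only [meridian_zero_coord, meridian_two_coord])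
    (continuous_meridian.comp (continuous_id.prodMk continuous_const))
    (fun f hf t => hasDerivAt_meridian_radial (hf _)) hξs
  have hXz := hT 2 (fun t => meridian s t) z _ rfl
    (fun t => by simp only [meridian_zero_coord, meridian_two_coord])
    (continuous_meridian.comp (continuous_const.prodMk continuous_id))
    (fun f hf t => hasDerivAt_meridian_vertical (hf _)) hξz
  obtain ⟨e1s, e2s⟩ := S.pd_system (Or.inl rfl) s z
  obtain ⟨e1z, e2z⟩ := S.pd_system (Or.inr rfl) s z
  obtain ⟨fν, -, fω⟩ := S.field_equations S.nonlinOne_decay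
    (S.nonlinFour_decay.mono le_rfl (by norm_num)) (z := z) hs
  rw [← hx] at hXs hXz e1s e2s e1z e2z fν fω
  have hb := S.contDiff_b_one.differentiable (by norm_num)
  have hνd := S.contDiff_ν_one.differentiable (by norm_num)
  have hωd := S.contDiff_ω_one.differentiable (by norm_num)
  have hb1 := S.differentiable_pd_b
  have hb2 := S.differentiable_pd_pd_b
  have hc0 := differentiable_coord 0
  have b1 : pd 1 u.b x = 0 := pd_one_meridian S.axial_b (hb _)
  have ν1 : pd 1 u.ν x = 0 := pd_one_meridian S.axial_ν (hνd _)
  have ω1 : pd 1 u.ω x = 0 := pd_one_meridian S.axial_ω (hωd _)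
  have hcν : pd 2 (pd 0 u.ν) x = pd 0 (pd 2 u.ν) x := pd_comm S.contDiff_ν.contDiffAt 2 0
  have hcω : pd 2 (pd 0 u.ω) x = pd 0 (pd 2 u.ω) x := pd_comm S.contDiff_ω.contDiffAt 2 0
  have hcb : pd 2 (pd 0 u.b) = pd 0 (pd 2 u.b) :=
    funext fun y => pd_comm S.contDiff_b_two.contDiffAt 2 0
  have hcb0 : pd 2 (pd 0 (pd 0 u.b)) x = pd 0 (pd 0 (pd 2 u.b)) x := by
    rw [pd_comm (S.contDiff_pd_b 0).contDiffAt 2 0, hcb]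
  have hcb2 : pd 2 (pd 0 (pd 2 u.b)) x = pd 0 (pd 2 (pd 2 u.b)) x :=
    pd_comm (S.contDiff_pd_b 2).contDiffAt 2 0
  have hdm : ∀ f : E 3 → ℝ, Differentiable ℝ f → Differentiable ℝ fun y : E 3 => y 0 * f y :=
    fun f hf => hc0.mul hf
  have hxmul : ∀ (f : E 3 → ℝ), Differentiable ℝ f → ∀ i : Fin 3,
      pd i (fun y => y 0 * f y) x = (if i = 0 then 1 else 0) * f x + s * pd i f x := by
    intro f hf i
    rw [pd_mul (hc0 x) (hf x), pd_coord, hx0]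
  have hβ : ∀ i, pd i (fun y => 1 + u.b y + y 0 * pd 0 u.b y) x =
      pd i u.b x + ((if i = 0 then 1 else 0) * pd 0 u.b x + s * pd i (pd 0 u.b) x) := by
    intro i
    rw [pd_add ((hb x).const_add 1) (hdm _ (hb1 0) x), pd_add (differentiableAt_const 1) (hb x),
      pd_const, zero_add, hxmul _ (hb1 0)]
  have hkA : ∀ i, pd i (fun y => pd 2 u.b y + y 0 * pd 0 (pd 2 u.b) y) x =
      pd i (pd 2 u.b) x + ((if i = 0 then 1 else 0) * pd 0 (pd 2 u.b) x +
        s * pd i (pd 0 (pd 2 u.b)) x) := by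
    intro i
    rw [pd_add (hb1 2 x) (hdm _ (hb2 0 2) x), hxmul _ (hb2 0 2)]
  have hm2 : ∀ i, pd i (fun y => 2 * pd 0 u.b y) x = 2 * pd i (pd 0 u.b) x := by
    intro i
    rw [pd_mul (differentiableAt_const 2) (hb1 0 x), pd_const]
    ring
  have hkC : ∀ i, pd i (fun y => 1 / 2 * (y 0 * pd 0 (pd 0 u.b) y + 2 * pd 0 u.b y
        - y 0 * pd 2 (pd 2 u.b) y)) x =
      1 / 2 * ((if i = 0 then 1 else 0) * pd 0 (pd 0 u.b) x + s * pd i (pd 0 (pd 0 u.b)) x +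
        2 * pd i (pd 0 u.b) x - ((if i = 0 then 1 else 0) * pd 2 (pd 2 u.b) x +
        s * pd i (pd 2 (pd 2 u.b)) x)) := by
    intro i
    have h1 : Differentiable ℝ fun y : E 3 => y 0 * pd 0 (pd 0 u.b) y := hdm _ (hb2 0 0)
    have h2 : Differentiable ℝ fun y : E 3 => y 0 * pd 2 (pd 2 u.b) y := hdm _ (hb2 2 2)
    have h3 : Differentiable ℝ fun y : E 3 => 2 * pd 0 u.b y := (hb1 0).const_mul 2
    have h4 : Differentiable ℝ fun y : E 3 => y 0 * pd 0 (pd 0 u.b) y + 2 * pd 0 u.b y := h1.add h3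
    have h5 : Differentiable ℝ fun y : E 3 => y 0 * pd 0 (pd 0 u.b) y + 2 * pd 0 u.b y -
      y 0 * pd 2 (pd 2 u.b) y := h4.sub h2
    rw [pd_mul (differentiableAt_const _) (h5 x), pd_const, pd_sub (h4 x) (h2 x),
      pd_add (h1 x) (h3 x), hxmul _ (hb2 0 0), hxmul _ (hb2 2 2), hm2]
    ring
  have hpS : ∀ i, pd i (potS u) x = 2 * pd i (pd 0 u.b) x +
      ((if i = 0 then 1 else 0) * (pd 0 (pd 0 u.b) x + pd 2 (pd 2 u.b) x) +
        s * (pd i (pd 0 (pd 0 u.b)) x + pd i (pd 2 (pd 2 u.b)) x)) := by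
    intro i
    have h1 : Differentiable ℝ fun y : E 3 => pd 0 (pd 0 u.b) y + pd 2 (pd 2 u.b) y :=
      (hb2 0 0).add (hb2 2 2)
    unfold potS
    rw [pd_add ((hb1 0).const_mul 2 x) (hdm _ h1 x), hxmul _ h1, hm2,
      pd_add (hb2 0 0 x) (hb2 2 2 x)]
  have hW : potW u x = s * (1 + u.b x) := by rw [potW, hx0]
  have hB := (S.B_pos x).ne'
  have hβx : gradBeta u x = 1 + u.b x + s * pd 0 u.b x := by
    rw [gradBeta, hx, euler_meridian]
  have hDx : gradDen u x = (1 + u.b x + s * pd 0 u.b x) * (1 + u.b x + s * pd 0 u.b x) +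
      s * pd 2 u.b x * (s * pd 2 u.b x) := by
    rw [gradDen, hβx, hx, meridian_zero_coord, meridian_one_coord]
    ring
  rw [hDx, hβx]
  have hVW : potV γ u x = potW u x ^ 3 * Real.exp (-4 * γ * u.ν x) := rfl
  have hV0 := S.pd_potV 0 x
  have hV2 := S.pd_potV 2 x
  have hW0 := S.pd_potW 0 x
  have hW2 := S.pd_potW 2 x
  simp only [nonlinOne, nonlinFour, gradDot, Fin.sum_univ_three, b1, ν1, ω1, hr] at fν fω
  simp only [hβ, hkA, hkC, hxmul _ (hb1 2), hcν, hcω, hcb0, hcb2, hcb] at e1s e2s e1z e2z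
  simp only [hpS, hcb0, hcb] at hXs hXz
  simp only [Fin.isValue, if_true, if_false, one_mul, zero_mul, zero_add,
    show ((2 : Fin 3) = 0) = False by simp] at e1s e2s e1z e2z hXs hXz hW0 hW2
  rw [hx0] at hW0 hW2
  rw [hW0] at e1s e2s hXs
  rw [hW2] at e1z e2z hXz
  have hS : potS u x = 2 * pd 0 u.b x + s * (pd 0 (pd 0 u.b) x + pd 2 (pd 2 u.b) x) := by
    rw [potS, hx0]
  refine integrability_algebra (Xz := ξz) e1s e1z e2s e2z ?_ ?_ ?_ ?_ ?_ ?_ hXs hXz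
  · ring
  · ring
  · rw [hS]
    ring
  · have h : pd 0 (pd 0 u.ν) x + pd 2 (pd 2 u.ν) x = 4 * Real.pi * M1 φ ψ γ lam u x -
        ((pd 0 u.b x * pd 0 u.ν x + pd 2 u.b x * pd 2 u.ν x) / (1 + u.b x) - 1 / 2 * s ^ 2 *
          (1 + u.b x) ^ 2 * Real.exp (-4 * γ * u.ν x) * (pd 0 u.ω x ^ 2 + pd 2 u.ω x ^ 2)) -
        pd 0 u.ν x / s := by
      linear_combination fν
    rw [h, hVW, hW]
    field_simp
    ring
  · have h : pd 0 (pd 0 u.ω) x + pd 2 (pd 2 u.ω) x = M3 φ ψ γ lam u x -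
        (3 * (pd 0 u.b x * pd 0 u.ω x + pd 2 u.b x * pd 2 u.ω x) / (1 + u.b x) -
          4 * γ * (pd 0 u.ν x * pd 0 u.ω x + pd 2 u.ν x * pd 2 u.ω x)) -
        3 * (pd 0 u.ω x / s) := by
      linear_combination fω
    rw [hV0, hV2, hW0, hW2, h, hVW, hW]
    field_simp
    ring
  · rw [hV0, hV2, hW0, hW2, hVW]
    ring

end IsSolution

end transport

/-! ### The gradient of `ξ` -/

section gradient

/-- Differentiation under the integral sign for an integrand of class `C¹`. -/
theorem hasFDerivAt_integral_of_contDiff {H : Type*} [NormedAddCommGroup H] [NormedSpace ℝ H]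
    [ProperSpace H] {Φ : H × ℝ → ℝ} (h : ContDiff ℝ (1 : ℕ) Φ) (a b : ℝ) (x : H) :
    HasFDerivAt (fun x => ∫ t in a..b, Φ (x, t))
      (∫ t in a..b, (fderiv ℝ Φ (x, t)).comp (ContinuousLinearMap.inl ℝ H ℝ)) x := by
  have hc : Continuous fun p => (fderiv ℝ Φ p).comp (ContinuousLinearMap.inl ℝ H ℝ) :=
    (h.continuous_fderiv (by norm_num)).clm_comp continuous_const
  obtain ⟨C, hC⟩ := ((isCompact_closedBall x 1).prod (isCompact_uIcc (a := a) (b := b))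
    ).exists_bound_of_continuousOn hc.continuousOn
  have hx (y : H) : Continuous fun t : ℝ => (y, t) := by fun_prop
  refine (intervalIntegral.hasFDerivAt_integral_of_dominated_of_fderiv_le (bound := fun _ => C)
    (F' := fun x t => (fderiv ℝ Φ (x, t)).comp (ContinuousLinearMap.inl ℝ H ℝ))
    (Metric.closedBall_mem_nhds x one_pos)
    (Eventually.of_forall fun y => (h.continuous.comp (hx y)).aestronglyMeasurable)
    ((h.continuous.comp (hx x)).intervalIntegrable _ _) (hc.comp (hx x)).aestronglyMeasurable
    (Eventually.of_forall fun t ht y hy => hC (y, t) ⟨hy, uIoc_subset_uIcc ht⟩)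
    intervalIntegrable_const (Eventually.of_forall fun t _ y _ => ?_))
  have h1 : HasFDerivAt Φ (fderiv ℝ Φ (y, t)) (y, t) :=
    (h.differentiable (by norm_num) _).hasFDerivAt
  exact h1.comp y (hasFDerivAt_prodMk_left y t)

theorem hasDerivAt_integral_meridian {f : E 3 → ℝ} (hf : ContDiff ℝ (1 : ℕ) f) (s z : ℝ) :
    HasDerivAt (fun z => ∫ t in (0 : ℝ)..s, f (meridian t z))
      (∫ t in (0 : ℝ)..s, pd 2 f (meridian t z)) z := by
  have hΦ : ContDiff ℝ (1 : ℕ) fun p : ℝ × ℝ => f (meridian p.2 p.1) := by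
    have : ContDiff ℝ (1 : ℕ) fun p : ℝ × ℝ => meridian p.1 p.2 :=
      contDiff_meridian.of_le (by exact_mod_cast le_top)
    exact hf.comp (this.comp (contDiff_snd.prodMk contDiff_fst))
  have h1 := (hasFDerivAt_integral_of_contDiff hΦ 0 s z).hasDerivAt
  refine h1.congr_deriv ?_
  have hc : Continuous fun t : ℝ => (fderiv ℝ (fun p : ℝ × ℝ => f (meridian p.2 p.1)) (z, t)).comp
      (ContinuousLinearMap.inl ℝ ℝ ℝ) :=
    ((hΦ.continuous_fderiv (by norm_num)).clm_comp continuous_const).comp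
      (continuous_const.prodMk continuous_id)
  rw [ContinuousLinearMap.intervalIntegral_apply (hc.intervalIntegrable _ _)]
  refine intervalIntegral.integral_congr fun t _ => ?_
  have h2 : HasFDerivAt (fun p : ℝ × ℝ => f (meridian p.2 p.1)) _ (z, t) :=
    (hΦ.differentiable (by norm_num) _).hasFDerivAt
  have h3 := (h2.comp z (hasFDerivAt_prodMk_left z t)).hasDerivAt
  exact h3.unique (hasDerivAt_meridian_vertical (hf.differentiable (by norm_num) _))

variable {α : ℝ} {φ : ℝ → ℝ} {ψ : ℝ × ℝ → ℝ} {E₀ L₀ γ lam R : ℝ} {u : Fields}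

namespace IsSolution

theorem ξ_meridian (S : IsSolution α φ ψ E₀ L₀ γ lam R u) {s : ℝ} (hs : 0 ≤ s) (z : ℝ) :
    u.ξ (meridian s z) = Real.log (1 + u.b (meridian 0 z)) +
      ∫ t in (0 : ℝ)..s, gradG γ u 0 (meridian t z) := by
  rw [S.ξ_eq, axialRadius_meridian, abs_of_nonneg hs, axialHeight_meridian]

theorem hasDerivAt_ξ_radial (S : IsSolution α φ ψ E₀ L₀ γ lam R u) {s : ℝ} (hs : 0 < s) (z : ℝ) :
    HasDerivAt (fun t => u.ξ (meridian t z)) (gradG γ u 0 (meridian s z)) s := by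
  have hc : Continuous fun t => gradG γ u 0 (meridian t z) :=
    (S.contDiff_gradG 0).continuous.comp
      (continuous_meridian.comp (continuous_id.prodMk continuous_const))
  have h1 := ((hc.integral_hasStrictDerivAt 0 s).hasDerivAt).const_add
    (Real.log (1 + u.b (meridian 0 z)))
  refine h1.congr_of_eventuallyEq ?_
  filter_upwards [lt_mem_nhds hs] with t ht using S.ξ_meridian ht.le z

theorem hasDerivAt_ξ_vertical_integral (S : IsSolution α φ ψ E₀ L₀ γ lam R u) {s : ℝ} (hs : 0 ≤ s)
    (z : ℝ) : HasDerivAt (fun t => u.ξ (meridian s t))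
      (pd 2 u.b (meridian 0 z) / (1 + u.b (meridian 0 z)) +
        ∫ t in (0 : ℝ)..s, pd 2 (gradG γ u 0) (meridian t z)) z := by
  simp only [S.ξ_meridian hs]
  refine HasDerivAt.add ?_ (hasDerivAt_integral_meridian (S.contDiff_gradG 0) s z)
  exact ((hasDerivAt_meridian_vertical
    (S.contDiff_b_one.differentiable (by norm_num) _)).const_add 1).log (S.B_pos _).ne'

theorem continuous_potS (S : IsSolution α φ ψ E₀ L₀ γ lam R u) : Continuous (potS u) :=
  S.differentiable_potS.continuous

/-- The defect of the vertical derivative vanishes on the axis and solves a linear homogeneous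
equation, so it vanishes. -/
theorem hasDerivAt_ξ_vertical (S : IsSolution α φ ψ E₀ L₀ γ lam R u) {s : ℝ} (hs : 0 ≤ s) (z : ℝ) :
    HasDerivAt (fun t => u.ξ (meridian s t)) (gradH γ u (meridian s z)) z := by
  have hm : Continuous fun t => meridian t z :=
    continuous_meridian.comp (continuous_id.prodMk continuous_const)
  set d : ℝ → ℝ := fun t => pd 2 u.b (meridian 0 z) / (1 + u.b (meridian 0 z)) +
    (∫ t in (0 : ℝ)..t, pd 2 (gradG γ u 0) (meridian t z)) - gradH γ u (meridian t z) with hd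
  set d' : ℝ → ℝ := fun t => pd 2 (gradG γ u 0) (meridian t z) - pd 0 (gradH γ u) (meridian t z)
    with hd'
  have hG2 : Continuous fun t => pd 2 (gradG γ u 0) (meridian t z) :=
    (contDiff_pd (k := 0) (S.contDiff_gradG 0) 2).continuous.comp hm
  have hH0 : Continuous fun t => pd 0 (gradH γ u) (meridian t z) :=
    (contDiff_pd (k := 0) S.contDiff_gradH 0).continuous.comp hm
  have hder : ∀ t, HasDerivAt d (d' t) t := fun t =>
    (((hG2.integral_hasStrictDerivAt 0 t).hasDerivAt).const_add _).sub
      (hasDerivAt_meridian_radial (S.contDiff_gradH.differentiable (by norm_num) _))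
  have hdc : Continuous d := continuous_iff_continuousAt.2 fun t => (hder t).continuousAt
  have hDpos : ∀ x, 0 < gradDen u x := fun x => lt_of_lt_of_le (by norm_num) (S.den_lower x)
  have hD : Continuous fun t => gradDen u (meridian t z) := S.contDiff_gradDen.continuous.comp hm
  have hq : Continuous fun t => gradBeta u (meridian t z) * potS u (meridian t z) :=
    (S.contDiff_gradBeta.continuous.comp hm).mul (S.continuous_potS.comp hm)
  -- The transport equation holds off the axis, and on the axis by continuity.
  have hode : ∀ t ∈ Ici (0 : ℝ), gradDen u (meridian t z) * d' t =
      -(gradBeta u (meridian t z) * potS u (meridian t z)) * d t := by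
    have hcl : IsClosed {t : ℝ | gradDen u (meridian t z) * d' t =
        -(gradBeta u (meridian t z) * potS u (meridian t z)) * d t} :=
      isClosed_eq (hD.mul (hG2.sub hH0)) (hq.neg.mul hdc)
    have hsub : Ioi (0 : ℝ) ⊆ {t : ℝ | gradDen u (meridian t z) * d' t =
        -(gradBeta u (meridian t z) * potS u (meridian t z)) * d t} := fun t ht =>
      S.transport ht (S.hasDerivAt_ξ_radial ht z) (S.hasDerivAt_ξ_vertical_integral (le_of_lt ht) z)
    rw [← closure_Ioi]
    exact hcl.closure_subset_iff.2 hsub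
  obtain ⟨K, hK0, hK⟩ := exists_abs_le_of_compact (isCompact_Icc (a := (0 : ℝ)) (b := s))
    (hq.div hD fun t => (hDpos _).ne').continuousOn
  -- On the axis `gradH` is `∂_z b / (1 + b)`, the derivative of the initial value `log (1 + b)`.
  have hzero : d 0 = 0 := by
    have hB := (S.B_pos (meridian 0 z)).ne'
    simp only [hd, intervalIntegral.integral_same, gradH, gradDen, gradBeta, gradA, euler_meridian,
      meridian_zero_coord, meridian_one_coord]
    field_simp
    ring
  have hall := eq_zero_of_abs_deriv_le_mul_abs_self_of_eq_zero_right (f := d) (f' := d') (K := K)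
    (a := 0) (b := s) hdc.continuousOn (fun t _ => (hder t).hasDerivWithinAt) hzero fun t ht => by
      have h1 := hode t ht.1
      have h2 : d' t = -((gradBeta u (meridian t z) * potS u (meridian t z)) /
          gradDen u (meridian t z)) * d t := by
        have := (hDpos (meridian t z)).ne'
        field_simp
        linear_combination h1
      rw [h2, norm_mul, norm_neg]
      exact mul_le_mul_of_nonneg_right (hK t (Ico_subset_Icc_self ht)) (norm_nonneg _)
  refine (S.hasDerivAt_ξ_vertical_integral hs z).congr_deriv ?_
  exact sub_eq_zero.1 (hall s ⟨hs, le_rfl⟩)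

end IsSolution

end gradient

section cartesian

variable {α : ℝ} {φ : ℝ → ℝ} {ψ : ℝ × ℝ → ℝ} {E₀ L₀ γ lam R : ℝ} {u : Fields}

/-- `ρ C` for the radial vector `C`. -/
theorem radial_gradC (γ : ℝ) (u : Fields) (x : E 3) :
    x 0 * gradC γ u 0 x + x 1 * gradC γ u 1 x =
      1 / 2 * ((x 0 * x 0 + x 1 * x 1) * (pd 0 (pd 0 u.b) x + pd 1 (pd 1 u.b) x) + euler u.b x -
        (x 0 * x 0 + x 1 * x 1) * pd 2 (pd 2 u.b) x) +
      γ ^ 2 * ((1 + u.b x) * (euler u.ν x * euler u.ν x -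
        (x 0 * x 0 + x 1 * x 1) * (pd 2 u.ν x * pd 2 u.ν x))) -
      1 / 4 * γ * ((x 0 * x 0 + x 1 * x 1) * gradWeight γ u x * (euler u.ω x * euler u.ω x -
        (x 0 * x 0 + x 1 * x 1) * (pd 2 u.ω x * pd 2 u.ω x))) := by
  unfold gradC
  have hν : euler u.ν x = x 0 * pd 0 u.ν x + x 1 * pd 1 u.ν x := rfl
  have hω : euler u.ω x = x 0 * pd 0 u.ω x + x 1 * pd 1 u.ω x := rfl
  have hb : euler u.b x = x 0 * pd 0 u.b x + x 1 * pd 1 u.b x := rfl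
  rw [hν, hω, hb]
  ring

theorem coord_sq_add (x : E 3) : x 0 * x 0 + x 1 * x 1 = axialRadius x ^ 2 := by
  rw [axialRadius_sq_three]; ring

namespace IsSolution

/-- The individual derivatives `∂₀`, `∂₁` of axially symmetric functions are not axially symmetric;
they enter here only through `ρ∂_ρ`, `∂_z` and `ρ²` times the horizontal Laplacian. -/
theorem axial_grad (S : IsSolution α φ ψ E₀ L₀ γ lam R u) :
    AxiallySymmetricOn univ (gradH γ u) ∧
      AxiallySymmetricOn univ (fun x => x 0 * gradG γ u 0 x + x 1 * gradG γ u 1 x) := by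
  have hb := S.contDiff_b_one.differentiable (by norm_num)
  have hν := S.contDiff_ν_one.differentiable (by norm_num)
  have hω := S.contDiff_ω_one.differentiable (by norm_num)
  have he := (contDiff_euler (k := 1) S.contDiff_b_two).differentiable (by norm_num)
  have hlap : AxiallySymmetricOn univ fun x =>
      axialRadius x ^ 2 * (pd 0 (pd 0 u.b) x + pd 1 (pd 1 u.b) x) := by
    simp only [axialRadius_sq_mul_horizontal_laplacian S.axial_b S.contDiff_b_two]
    exact (S.axial_b.euler hb).euler he
  have key : ∀ x y, axialRadius x = axialRadius y → axialHeight x = axialHeight y →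
      gradBeta u x = gradBeta u y ∧ gradDen u x = gradDen u y ∧ gradA γ u x = gradA γ u y ∧
      x 0 * gradC γ u 0 x + x 1 * gradC γ u 1 x = y 0 * gradC γ u 0 y + y 1 * gradC γ u 1 y := by
    intro x y hr hz
    have e1 := S.axial_b x trivial y trivial hr hz
    have e2 := S.axial_ν x trivial y trivial hr hz
    have e3 := S.axial_b.euler hb x trivial y trivial hr hz
    have e4 := S.axial_ν.euler hν x trivial y trivial hr hz
    have e5 := S.axial_ω.euler hω x trivial y trivial hr hz
    have e6 := S.axial_b.pd_two hb x trivial y trivial hr hz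
    have e7 := S.axial_ν.pd_two hν x trivial y trivial hr hz
    have e8 := S.axial_ω.pd_two hω x trivial y trivial hr hz
    have e9 := (S.axial_b.pd_two hb).pd_two (S.differentiable_pd_b 2) x trivial y trivial hr hz
    have e10 := (S.axial_b.pd_two hb).euler (S.differentiable_pd_b 2) x trivial y trivial hr hz
    have e11 := hlap x trivial y trivial hr hz
    have e12 : gradWeight γ u x = gradWeight γ u y := by simp only [gradWeight, e1, e2]
    have e13 : gradBeta u x = gradBeta u y := by simp only [gradBeta, e1, e3]
    refine ⟨e13, ?_, ?_, ?_⟩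
    · simp only [gradDen, coord_sq_add, hr, e13, e6]
    · simp only [gradA, coord_sq_add, hr, e1, e4, e5, e6, e7, e8, e10, e12]
    · simp only [radial_gradC, coord_sq_add, e11, e1, e3, e4, e5, e7, e8, e9, e12]
      simp only [hr]
  refine ⟨fun x _ y _ hr hz => ?_, fun x _ y _ hr hz => ?_⟩
  · obtain ⟨k1, k2, k3, k4⟩ := key x y hr hz
    simp only [gradH, k1, k2, k3, k4, S.axial_b.pd_two hb x trivial y trivial hr hz]
  · obtain ⟨k1, k2, k3, k4⟩ := key x y hr hz
    have h : ∀ x : E 3, x 0 * gradG γ u 0 x + x 1 * gradG γ u 1 x =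
        (pd 2 u.b x * (axialRadius x ^ 2 * gradA γ u x) +
          gradBeta u x * (x 0 * gradC γ u 0 x + x 1 * gradC γ u 1 x)) * (gradDen u x)⁻¹ := by
      intro x
      rw [← coord_sq_add]
      unfold gradG
      ring
    simp only [h, k1, k2, k3, k4, hr, S.axial_b.pd_two hb x trivial y trivial hr hz]

/-- The field `(gradG 0, gradG 1)` is radial. -/
theorem axialRadius_sq_mul_gradG (S : IsSolution α φ ψ E₀ L₀ γ lam R u) {i : Fin 3}
    (hi : i = 0 ∨ i = 1) (x : E 3) : axialRadius x ^ 2 * gradG γ u i x =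
      x i * (x 0 * gradG γ u 0 x + x 1 * gradG γ u 1 x) := by
  have rot : ∀ f : E 3 → ℝ, AxiallySymmetricOn univ f → ContDiff ℝ (1 : ℕ) f →
      axialRadius x ^ 2 * pd i f x = x i * euler f x := by
    intro f hf hfc
    have hfd := hfc.differentiable (by norm_num) x
    rcases hi with rfl | rfl
    exacts [axialRadius_sq_mul_pd_zero hf hfd, axialRadius_sq_mul_pd_one hf hfd]
  have hb := rot u.b S.axial_b S.contDiff_b_one
  have hν := rot u.ν S.axial_ν S.contDiff_ν_one
  have hω := rot u.ω S.axial_ω S.contDiff_ω_one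
  have hC : axialRadius x ^ 2 * gradC γ u i x =
      x i * (x 0 * gradC γ u 0 x + x 1 * gradC γ u 1 x) := by
    rw [radial_gradC, coord_sq_add]
    unfold gradC
    rw [coord_sq_add]
    linear_combination (1 / 2) * hb + γ ^ 2 * (1 + u.b x) * euler u.ν x * hν -
      1 / 4 * γ * axialRadius x ^ 2 * gradWeight γ u x * euler u.ω x * hω
  have h := coord_sq_add x
  unfold gradG
  linear_combination (gradBeta u x * (gradDen u x)⁻¹) * hC -
    (x i * pd 2 u.b x * gradA γ u x * (gradDen u x)⁻¹) * h

/-- `ξ` as an integral over rays orthogonal to the axis, whose integrand is `C¹` in the Cartesian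
variable. -/
theorem ξ_eq_ray (S : IsSolution α φ ψ E₀ L₀ γ lam R u) (x : E 3) :
    u.ξ x = Real.log (1 + u.b (meridian 0 (x 2))) +
      ∫ t in (0 : ℝ)..1, (x 0 * gradG γ u 0 !₂[t * x 0, t * x 1, x 2] +
        x 1 * gradG γ u 1 !₂[t * x 0, t * x 1, x 2]) := by
  rw [S.ξ_eq, axialHeight_three]
  congr 1
  have h1 := intervalIntegral.mul_integral_comp_mul_right (a := 0) (b := 1)
    (f := fun s => gradG γ u 0 (meridian s (x 2))) (axialRadius x)
  rw [zero_mul, one_mul] at h1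
  rw [← h1, ← intervalIntegral.integral_const_mul]
  refine intervalIntegral.integral_congr_ae (Eventually.of_forall fun t ht => ?_)
  rw [uIoc_of_le zero_le_one] at ht
  have hy : axialRadius (!₂[t * x 0, t * x 1, x 2] : E 3) = t * axialRadius x := by
    refine (sq_eq_sq₀ (axialRadius_nonneg _) (mul_nonneg ht.1.le (axialRadius_nonneg _))).1 ?_
    rw [mul_pow, axialRadius_sq_three, axialRadius_sq_three]
    simp
    ring
  have h2 : t * x 0 * gradG γ u 0 !₂[t * x 0, t * x 1, x 2] +
      t * x 1 * gradG γ u 1 !₂[t * x 0, t * x 1, x 2] =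
      t * axialRadius x * gradG γ u 0 (meridian (t * axialRadius x) (x 2)) := by
    have := S.axial_grad.2.eq_meridian (!₂[t * x 0, t * x 1, x 2] : E 3)
    rw [hy, axialHeight_three] at this
    simp only [meridian_zero_coord, meridian_one_coord, zero_mul, add_zero] at this
    exact this
  refine mul_left_cancel₀ ht.1.ne' ?_
  linear_combination -h2

theorem differentiable_ξ (S : IsSolution α φ ψ E₀ L₀ γ lam R u) : Differentiable ℝ u.ξ := by
  have hΦ : ContDiff ℝ (1 : ℕ) fun p : E 3 × ℝ =>
      p.1 0 * gradG γ u 0 !₂[p.2 * p.1 0, p.2 * p.1 1, p.1 2] +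
        p.1 1 * gradG γ u 1 !₂[p.2 * p.1 0, p.2 * p.1 1, p.1 2] := by
    have hm : ContDiff ℝ (1 : ℕ) fun p : E 3 × ℝ =>
        (!₂[p.2 * p.1 0, p.2 * p.1 1, p.1 2] : E 3) := by
      rw [contDiff_euclidean]
      intro i
      fin_cases i <;> simp <;> fun_prop
    have h0 := (S.contDiff_gradG 0).comp hm
    have h1 := (S.contDiff_gradG 1).comp hm
    exact (ContDiff.mul (by fun_prop) h0).add (ContDiff.mul (by fun_prop) h1)
  have hlog : Differentiable ℝ fun x : E 3 => Real.log (1 + u.b (meridian 0 (x 2))) := by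
    intro x
    refine DifferentiableAt.log ?_ (S.B_pos _).ne'
    have hm : DifferentiableAt ℝ (fun x : E 3 => meridian 0 (x 2)) x :=
      DifferentiableAt.comp (g := fun p : ℝ × ℝ => meridian p.1 p.2)
        (f := fun x : E 3 => ((0 : ℝ), x 2)) x (contDiff_meridian.differentiable (by simp) _)
        ((differentiableAt_const _).prodMk (differentiable_coord 2 x))
    exact ((S.contDiff_b_one.differentiable (by norm_num) _).comp x hm).const_add 1
  have h : u.ξ = fun x => _ := funext S.ξ_eq_ray
  rw [h]
  exact hlog.add fun x => (hasFDerivAt_integral_of_contDiff hΦ 0 1 x).differentiableAt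

theorem pd_two_ξ (S : IsSolution α φ ψ E₀ L₀ γ lam R u) : pd 2 u.ξ = gradH γ u := by
  funext x
  rw [(S.axial_ξ.pd_two S.differentiable_ξ).eq_meridian, S.axial_grad.1.eq_meridian]
  exact (hasDerivAt_meridian_vertical (S.differentiable_ξ _)).unique
    (S.hasDerivAt_ξ_vertical (axialRadius_nonneg x) _)

theorem pd_horizontal_ξ (S : IsSolution α φ ψ E₀ L₀ γ lam R u) {i : Fin 3} (hi : i = 0 ∨ i = 1) :
    pd i u.ξ = gradG γ u i := by
  funext x
  rcases (axialRadius_nonneg x).eq_or_lt with h | h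
    -- On the axis both sides vanish, because there the gradient of an axially symmetric function is
    -- vertical.
  · have hx := axialRadius_sq_three x
    rw [← h] at hx
    have h0 : x 0 = 0 := by nlinarith [sq_nonneg (x 0), sq_nonneg (x 1)]
    have h1 : x 1 = 0 := by nlinarith [sq_nonneg (x 0), sq_nonneg (x 1)]
    have hxi : x i = 0 := by rcases hi with rfl | rfl <;> assumption
    have hz : ∀ f : E 3 → ℝ, AxiallySymmetricOn univ f → DifferentiableAt ℝ f x → pd i f x = 0 := by
      intro f hf hfd
      refine fderiv_eq_zero_of_axial hf hfd ?_ ?_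
      · change (EuclideanSpace.single i (1 : ℝ) : E 3) 2 = 0
        rcases hi with rfl | rfl <;> simp
      · have h2 : inner ℝ (EuclideanSpace.single i (1 : ℝ) : E 3) x = x i := by
          rw [EuclideanSpace.inner_single_left]; simp
        exact h2.trans hxi
    rw [hz u.ξ S.axial_ξ (S.differentiable_ξ x)]
    simp only [gradG, gradC, hxi, hz u.b S.axial_b (S.contDiff_b_one.differentiable (by norm_num) x),
      hz u.ν S.axial_ν (S.contDiff_ν_one.differentiable (by norm_num) x),
      hz u.ω S.axial_ω (S.contDiff_ω_one.differentiable (by norm_num) x)]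
    ring
  · have h1 : axialRadius x ^ 2 * pd i u.ξ x = x i * euler u.ξ x := by
      rcases hi with rfl | rfl
      exacts [axialRadius_sq_mul_pd_zero S.axial_ξ (S.differentiable_ξ x),
        axialRadius_sq_mul_pd_one S.axial_ξ (S.differentiable_ξ x)]
    refine mul_left_cancel₀ (pow_ne_zero 2 h.ne') (h1.trans ?_)
    rw [S.axialRadius_sq_mul_gradG hi, (S.axial_ξ.euler S.differentiable_ξ).eq_meridian,
      S.axial_grad.2.eq_meridian x, euler_meridian, meridian_zero_coord, meridian_one_coord,
      zero_mul, add_zero, (hasDerivAt_meridian_radial (S.differentiable_ξ _)).unique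
        (S.hasDerivAt_ξ_radial h _)]

end IsSolution

end cartesian

/-! ### Regularity and decay of `ξ` -/

section regularity

variable {α : ℝ} {φ : ℝ → ℝ} {ψ : ℝ × ℝ → ℝ} {E₀ L₀ γ lam R : ℝ} {u : Fields}

/-- A function with gradient of order `-3` which tends to zero in the vertical directions is of
order `-2`. -/
theorem decays_two_of_vertical {f : E 3 → ℝ} (hf : Differentiable ℝ f) (h2 : Decays 3 (pd 2 f))
    (h0 : ∀ (x : E 3) (σ : ℝ), |σ| = 1 →
      Tendsto (fun τ : ℝ => f (x + (σ * τ) • EuclideanSpace.single 2 1)) atTop (𝓝 0)) :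
    Decays 2 f := by
  obtain ⟨C, hC0, hC⟩ := h2.exists_natCast (n := 3)
  refine decays_natCast (n := 2) (C := 4 * C) fun x => ?_
  -- The vertical ray from `x` that leads away from the plane `z = 0`: along it the norm is at least
  -- `(‖x‖ + τ) / 2`, so that the bound of order `-3` for the derivative can be integrated.
  obtain ⟨σ, hσ, hσx⟩ : ∃ σ : ℝ, |σ| = 1 ∧ 0 ≤ σ * x 2 := by
    rcases le_total 0 (x 2) with h | h
    · exact ⟨1, by simp, by simpa using h⟩
    · exact ⟨-1, by simp, by linarith⟩
  have hσ2 : σ * σ = 1 := by rw [← abs_mul_abs_self, hσ, one_mul]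
  set a := 1 + ‖x‖ with ha
  have ha0 : 0 < a := weight_pos x
  set g : ℝ → ℝ := fun τ => f (x + (σ * τ) • EuclideanSpace.single 2 1) with hg
  have hder : ∀ τ, HasDerivAt g
      (σ * pd 2 f (x + (σ * τ) • EuclideanSpace.single 2 1)) τ := by
    intro τ
    have h1 : HasDerivAt (fun τ : ℝ => x + (σ * τ) • (EuclideanSpace.single 2 1 : E 3))
        ((σ * 1) • EuclideanSpace.single 2 1) τ :=
      (((hasDerivAt_id τ).const_mul σ).smul_const _).const_add x
    refine ((hf _).hasFDerivAt.comp_hasDerivAt τ h1).congr_deriv ?_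
    rw [mul_one, map_smul, smul_eq_mul]
    rfl
  have hnorm : ∀ τ, 0 ≤ τ →
      (a + τ) / 2 ≤ 1 + ‖x + (σ * τ) • (EuclideanSpace.single 2 1 : E 3)‖ := by
    intro τ hτ
    have h1 : ‖x‖ ^ 2 + τ ^ 2 ≤ ‖x + (σ * τ) • (EuclideanSpace.single 2 1 : E 3)‖ ^ 2 := by
      rw [EuclideanSpace.norm_sq_eq, EuclideanSpace.norm_sq_eq]
      simp [Fin.sum_univ_three]
      nlinarith [mul_nonneg hσx hτ]
    have h2 : ‖x‖ ≤ ‖x + (σ * τ) • (EuclideanSpace.single 2 1 : E 3)‖ :=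
      le_of_sq_le_sq (by nlinarith [sq_nonneg τ]) (norm_nonneg _)
    have h3 : τ ≤ ‖x + (σ * τ) • (EuclideanSpace.single 2 1 : E 3)‖ :=
      le_of_sq_le_sq (by nlinarith [sq_nonneg ‖x‖]) (norm_nonneg _)
    linarith
  have hB : ∀ τ, 0 ≤ τ → HasDerivAt (fun τ => 4 * C * ((a ^ 2)⁻¹ - ((a + τ) ^ 2)⁻¹))
      (C * (((a + τ) / 2) ^ 3)⁻¹) τ := by
    intro τ hτ
    have hpos : 0 < a + τ := by linarith
    have h1 : HasDerivAt (fun τ : ℝ => (a + τ) ^ 2) (2 * (a + τ)) τ := by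
      exact (((hasDerivAt_id τ).const_add a).pow 2).congr_deriv (by simp)
    refine (((h1.inv (by positivity)).const_sub (a ^ 2)⁻¹).const_mul (4 * C)).congr_deriv ?_
    field_simp
    ring
  have hbound : ∀ T, 0 ≤ T → |g T - g 0| ≤ 4 * C * (a ^ 2)⁻¹ := by
    intro T hT
    have h1 := image_norm_le_of_norm_deriv_right_le_deriv_boundary' (a := 0) (b := T)
      (f := fun τ => g τ - g 0) (f' := fun τ => σ * pd 2 f (x + (σ * τ) • EuclideanSpace.single 2 1))
      (B := fun τ => 4 * C * ((a ^ 2)⁻¹ - ((a + τ) ^ 2)⁻¹)) (B' := fun τ => C * (((a + τ) / 2) ^ 3)⁻¹)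
      (fun τ _ => ((hder τ).sub_const _).continuousAt.continuousWithinAt)
      (fun τ _ => ((hder τ).sub_const _).hasDerivWithinAt) (by simp)
      (fun τ hτ => (hB τ hτ.1).continuousAt.continuousWithinAt)
      (fun τ hτ => (hB τ hτ.1).hasDerivWithinAt) (fun τ hτ => ?_) ⟨hT, le_rfl⟩
    · refine h1.trans (mul_le_mul_of_nonneg_left ?_ (by positivity))
      have : 0 < a + T := by linarith
      exact sub_le_self _ (by positivity)
    · rw [norm_mul, Real.norm_eq_abs σ, hσ, one_mul]
      have hpos : 0 < a + τ := by linarith [hτ.1]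
      exact (hC _).trans (mul_le_mul_of_nonneg_left (inv_anti₀ (by positivity)
        (pow_le_pow_left₀ (by positivity) (hnorm τ hτ.1) 3)) hC0)
  have hlim : Tendsto (fun T => |g T - g 0|) atTop (𝓝 |0 - g 0|) := ((h0 x σ hσ).sub_const _).abs
  have := le_of_tendsto hlim (eventually_atTop.2 ⟨0, fun T hT => hbound T hT⟩)
  simpa [hg] using this

namespace IsSolution

/-- The orders of decay are read off from the explicit formulas. The Hölder constants of the second
derivatives of `ν` and `ω` are only known to be bounded; as these derivatives are multiplied by
functions of order `-1`, the order `-1` remains. -/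
theorem reg_grad (S : IsSolution α φ ψ E₀ L₀ γ lam R u) :
    (∀ i, Reg α 3 1 (gradG γ u i)) ∧ Reg α 3 1 (gradH γ u) := by
  have a0 := S.α_pos
  have a1 := S.α_le
  obtain ⟨hb0, hb2, hb3, hb4⟩ := S.b_decay
  have b : Reg α 2 4 u.b := reg_of_second a0 a1 S.contDiff_b_two hb0 S.b_grad fun i j => hb2 j i
  have B : Reg α 0 2 (fun x => 1 + u.b x) :=
    (reg_const (q := 2) 1).add (b.mono (by norm_num) (by norm_num))
  have b1 : ∀ i, Reg α 3 5 (pd i u.b) := fun i =>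
    reg_of_second a0 a1 (S.contDiff_pd_b i) (S.b_grad i) (fun j => hb2 j i) fun j k => hb3 k j i
  have b2 : ∀ i j, Reg α 4 6 (pd i (pd j u.b)) := fun i j =>
    ⟨⟨S.contDiff_pd_pd_b i j, hb2 i j, fun k => hb3 k i j⟩, fun k => hb4 k i j⟩
  have ν1 : ∀ i, Reg α 2 0 (pd i u.ν) := fun i =>
    ⟨⟨contDiff_pd (k := 1) S.contDiff_ν i, S.decays_ν_first.2 i, fun j => S.ν_decay j i⟩,
      fun j => S.ν_hol j i⟩
  have ω1 : ∀ i, Reg α 4 0 (pd i u.ω) := fun i =>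
    ⟨⟨contDiff_pd (k := 1) S.contDiff_ω i, S.ω_grad i, fun j => S.ω_decay.2 j i⟩,
      fun j => S.ω_hol j i⟩
  have ν0 : Reg α 0 2 u.ν := reg_of_second a0 a1 S.contDiff_ν S.ν_size S.ν_grad
    fun i j => (S.ν_decay j i).mono (by norm_num)
  have eul : ∀ {f : E 3 → ℝ} {p q : ℤ}, (∀ i, Reg α p q (pd i f)) → q ≤ p + 2 →
      Reg α (p - 1) (q - 1) (euler f) := fun {f p q} h hq =>
    (Reg.mul a0 a1 (reg_coord (q := 1) 0) (h 0) (by omega) (by omega) (by omega) (by omega)).add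
      (Reg.mul a0 a1 (reg_coord (q := 1) 1) (h 1) (by omega) (by omega) (by omega) (by omega))
  have eν : Reg α 1 (-1) (euler u.ν) := eul ν1 (by norm_num)
  have eω : Reg α 3 (-1) (euler u.ω) := eul ω1 (by norm_num)
  have eb : Reg α 2 4 (euler u.b) := eul b1 (by norm_num)
  have eb2 : Reg α 3 5 (euler (pd 2 u.b)) := eul (fun i => b2 i 2) (by norm_num)
  have β : Reg α 0 2 (gradBeta u) := B.add (eb.mono (by norm_num) (by norm_num))
  have rr : Reg α (-2) 0 (fun x : E 3 => x 0 * x 0 + x 1 * x 1) :=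
    (Reg.mul a0 a1 (reg_coord (q := 1) 0) (reg_coord (q := 1) 0) (by omega) (by omega) (by omega)
      (by omega)).add (Reg.mul a0 a1 (reg_coord (q := 1) 1) (reg_coord (q := 1) 1) (by omega)
      (by omega) (by omega) (by omega))
  have bb : Reg α 6 8 (fun x => pd 2 u.b x * pd 2 u.b x) :=
    Reg.mul a0 a1 (b1 2) (b1 2) (by omega) (by omega) (by omega) (by omega)
  have D : Reg α 0 2 (gradDen u) :=
    (Reg.mul a0 a1 β β (by omega) (by omega) (by omega) (by omega)).add
      (Reg.mul a0 a1 rr bb (by omega) (by omega) (by omega) (by omega))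
  have D' : Reg α 0 2 (fun x => (gradDen u x)⁻¹) :=
    Reg.inv a0 a1 D le_rfl (by norm_num : (0 : ℝ) < 1 / 2) S.den_lower
  obtain ⟨N, -, hN⟩ := S.ν_size.exists_natCast (n := 0)
  have ex : Reg α 0 2 (fun x => Real.exp (-4 * γ * u.ν x)) := by
    refine Reg.exp (N := |-4 * γ| * N) a0 a1 (Reg.const_mul a0 a1 ν0 (-4 * γ) (by omega)) le_rfl
      fun x => ?_
    rw [abs_mul]
    exact mul_le_mul_of_nonneg_left (by simpa using hN x) (abs_nonneg _)
  have BB : Reg α 0 2 (fun x => (1 + u.b x) * (1 + u.b x)) :=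
    Reg.mul a0 a1 B B (by omega) (by omega) (by omega) (by omega)
  have BBB : Reg α 0 2 (fun x => (1 + u.b x) * (1 + u.b x) * (1 + u.b x)) :=
    Reg.mul a0 a1 BB B (by omega) (by omega) (by omega) (by omega)
  have w : Reg α 0 2 (gradWeight γ u) :=
    Reg.mul a0 a1 BBB ex (by omega) (by omega) (by omega) (by omega)
  have rrw : Reg α (-2) 0 (fun x => (x 0 * x 0 + x 1 * x 1) * gradWeight γ u x) :=
    Reg.mul a0 a1 rr w (by omega) (by omega) (by omega) (by omega)
  have A : Reg α 3 1 (gradA γ u) := by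
    have h1 : Reg α 3 1 (fun x => euler u.ν x * pd 2 u.ν x) :=
      Reg.mul a0 a1 eν (ν1 2) (by omega) (by omega) (by omega) (by omega)
    have h2 : Reg α 3 1 (fun x => (1 + u.b x) * (euler u.ν x * pd 2 u.ν x)) :=
      Reg.mul a0 a1 B h1 (by omega) (by omega) (by omega) (by omega)
    have h3 : Reg α 7 3 (fun x => euler u.ω x * pd 2 u.ω x) :=
      Reg.mul a0 a1 eω (ω1 2) (by omega) (by omega) (by omega) (by omega)
    have h4 : Reg α 3 1 (fun x => (x 0 * x 0 + x 1 * x 1) * gradWeight γ u x *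
        (euler u.ω x * pd 2 u.ω x)) :=
      Reg.mul a0 a1 rrw h3 (by omega) (by omega) (by omega) (by omega)
    exact ((((b1 2).add eb2).mono le_rfl (by norm_num)).add
      (Reg.const_mul a0 a1 h2 (2 * γ ^ 2) (by omega))).sub
      (Reg.const_mul a0 a1 h4 (1 / 2 * γ) (by omega))
  have C : ∀ i, Reg α 3 1 (gradC γ u i) := by
    intro i
    have x2 : Reg α (-1) 6 (fun x : E 3 => x i) := reg_coord i
    have k : ∀ {f : E 3 → ℝ}, Reg α 4 6 f → Reg α 3 5 (fun x => x i * f x) := fun hf =>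
      Reg.mul a0 a1 x2 hf (by omega) (by omega) (by omega) (by omega)
    have h0 := Reg.const_mul a0 a1 (((k ((b2 0 0).add (b2 1 1))).add (b1 i)).sub (k (b2 2 2)))
      (1 / 2) (by omega)
    have hν2 : Reg α 4 2 (fun x => pd 2 u.ν x * pd 2 u.ν x) :=
      Reg.mul a0 a1 (ν1 2) (ν1 2) (by omega) (by omega) (by omega) (by omega)
    have hν3 : Reg α 3 1 (fun x => x i * (pd 2 u.ν x * pd 2 u.ν x)) :=
      Reg.mul a0 a1 x2 hν2 (by omega) (by omega) (by omega) (by omega)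
    have hν4 : Reg α 3 1 (fun x => pd i u.ν x * euler u.ν x) :=
      Reg.mul a0 a1 (ν1 i) eν (by omega) (by omega) (by omega) (by omega)
    have h1 : Reg α 3 1 (fun x => (1 + u.b x) *
        (pd i u.ν x * euler u.ν x - x i * (pd 2 u.ν x * pd 2 u.ν x))) :=
      Reg.mul a0 a1 B (hν4.sub hν3) (by omega) (by omega) (by omega) (by omega)
    have hω2 : Reg α 8 4 (fun x => pd 2 u.ω x * pd 2 u.ω x) :=
      Reg.mul a0 a1 (ω1 2) (ω1 2) (by omega) (by omega) (by omega) (by omega)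
    have hω3 : Reg α 7 3 (fun x => x i * (pd 2 u.ω x * pd 2 u.ω x)) :=
      Reg.mul a0 a1 x2 hω2 (by omega) (by omega) (by omega) (by omega)
    have hω4 : Reg α 7 3 (fun x => pd i u.ω x * euler u.ω x) :=
      Reg.mul a0 a1 (ω1 i) eω (by omega) (by omega) (by omega) (by omega)
    have h2 : Reg α 3 1 (fun x => (x 0 * x 0 + x 1 * x 1) * gradWeight γ u x *
        (pd i u.ω x * euler u.ω x - x i * (pd 2 u.ω x * pd 2 u.ω x))) :=
      Reg.mul a0 a1 rrw (hω4.sub hω3) (by omega) (by omega) (by omega) (by omega)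
    exact ((h0.mono le_rfl (by norm_num)).add (Reg.const_mul a0 a1 h1 (γ ^ 2) (by omega))).sub
      (Reg.const_mul a0 a1 h2 (1 / 4 * γ) (by omega))
  have xf : ∀ (i : Fin 3) {f : E 3 → ℝ}, Reg α 3 1 f → Reg α 2 0 (fun x => x i * f x) :=
    fun i f hf => Reg.mul a0 a1 (reg_coord (q := 1) i) hf (by omega) (by omega) (by omega) (by omega)
  have bx : ∀ {f : E 3 → ℝ}, Reg α 2 0 f → Reg α 3 1 (fun x => pd 2 u.b x * f x) := fun hf =>
    Reg.mul a0 a1 (b1 2) hf (by omega) (by omega) (by omega) (by omega)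
  have βx : ∀ {f : E 3 → ℝ}, Reg α 3 1 f → Reg α 3 1 (fun x => gradBeta u x * f x) := fun hf =>
    Reg.mul a0 a1 β hf (by omega) (by omega) (by omega) (by omega)
  exact ⟨fun i => Reg.mul a0 a1 ((bx (xf i A)).add (βx (C i))) D' (by omega) (by omega) (by omega)
    (by omega), Reg.mul a0 a1 ((βx A).sub (bx ((xf 0 (C 0)).add (xf 1 (C 1))))) D' (by omega)
    (by omega) (by omega) (by omega)⟩

theorem reg_pd_ξ (S : IsSolution α φ ψ E₀ L₀ γ lam R u) (i : Fin 3) : Reg α 3 1 (pd i u.ξ) := by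
  fin_cases i
  · exact S.pd_horizontal_ξ (Or.inl rfl) ▸ S.reg_grad.1 0
  · exact S.pd_horizontal_ξ (Or.inr rfl) ▸ S.reg_grad.1 1
  · exact S.pd_two_ξ ▸ S.reg_grad.2

theorem contDiff_ξ (S : IsSolution α φ ψ E₀ L₀ γ lam R u) : ContDiff ℝ (2 : ℕ) u.ξ := by
  have h : ∀ i, ContDiff ℝ (1 : ℕ) (pd i u.ξ) := fun i => (S.reg_pd_ξ i).toGradDecays.contDiff
  have h2 : ((2 : ℕ) : WithTop ℕ∞) = ((1 : ℕ) : WithTop ℕ∞) + 1 := by norm_num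
  rw [h2, contDiff_succ_iff_fderiv]
  refine ⟨S.differentiable_ξ, fun h => absurd h (by simp), ?_⟩
  have h3 : fderiv ℝ u.ξ = fun x => ∑ i : Fin 3, pd i u.ξ x •
      (EuclideanSpace.proj i : E 3 →L[ℝ] ℝ) := by
    funext x
    ext v
    rw [fderiv_eq_sum]
    simp [mul_comm]
  rw [h3]
  exact ContDiff.sum fun i _ => (h i).smul contDiff_const

/-- Along a vertical line the value of `ξ` on the axis and the integral over the bounded radial
interval tend to zero, while integration from the axis alone would give no decay in `ρ`. -/
theorem decays_ξ (S : IsSolution α φ ψ E₀ L₀ γ lam R u) : Decays 2 u.ξ := by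
  refine decays_two_of_vertical S.differentiable_ξ (S.reg_pd_ξ 2).size fun x σ hσ => ?_
  obtain ⟨C, hC0, hC⟩ := (S.reg_grad.1 0).size.exists_natCast (n := 3)
  obtain ⟨C', hC'0, hC'⟩ := S.b_decay.1.exists_natCast (n := 2)
  have hw : Tendsto (fun τ : ℝ => 1 + |x 2 + σ * τ|) atTop atTop := by
    refine tendsto_atTop_mono (f := fun τ : ℝ => τ - |x 2|) (fun τ => ?_)
      (tendsto_atTop_add_const_right _ _ tendsto_id)
    have h1 : |σ * τ| ≤ |x 2 + σ * τ| + |x 2| := by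
      have := abs_sub (x 2 + σ * τ) (x 2)
      rwa [add_sub_cancel_left] at this
    rw [abs_mul, hσ, one_mul] at h1
    linarith [le_abs_self τ]
  have hinv : ∀ (n : ℕ), n ≠ 0 → ∀ K : ℝ,
      Tendsto (fun τ : ℝ => K * ((1 + |x 2 + σ * τ|) ^ n)⁻¹) atTop (𝓝 0) := by
    intro n hn K
    simpa using (((tendsto_pow_atTop hn).comp hw).inv_tendsto_atTop).const_mul K
  have hz : ∀ ρ z : ℝ, |z| ≤ ‖meridian ρ z‖ := fun ρ z => by
    have := abs_axialHeight_le_norm (meridian ρ z)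
    rwa [axialHeight_meridian] at this
  have hmono : ∀ (n : ℕ) (ρ z : ℝ), ((1 + ‖meridian ρ z‖) ^ n)⁻¹ ≤ ((1 + |z|) ^ n)⁻¹ :=
    fun n ρ z => inv_anti₀ (by positivity)
      (pow_le_pow_left₀ (by positivity) (by linarith [hz ρ z]) n)
  have hb : Tendsto (fun τ : ℝ => u.b (meridian 0 (x 2 + σ * τ))) atTop (𝓝 0) :=
    squeeze_zero_norm (fun τ => (hC' _).trans (mul_le_mul_of_nonneg_left (hmono 2 _ _) hC'0))
      (hinv 2 two_ne_zero C')
  have hlog : Tendsto (fun τ : ℝ => Real.log (1 + u.b (meridian 0 (x 2 + σ * τ)))) atTop (𝓝 0) := by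
    have h1 : Tendsto (fun τ : ℝ => 1 + u.b (meridian 0 (x 2 + σ * τ))) atTop (𝓝 1) := by
      simpa using hb.const_add 1
    simpa using h1.log one_ne_zero
  have hint : Tendsto (fun τ : ℝ => ∫ s in (0 : ℝ)..(axialRadius x),
      gradG γ u 0 (meridian s (x 2 + σ * τ))) atTop (𝓝 0) := by
    refine squeeze_zero_norm (fun τ => ?_) (hinv 3 three_ne_zero (C * |axialRadius x - 0|))
    refine (intervalIntegral.norm_integral_le_of_norm_le_const (fun s _ => (hC _).trans
      (mul_le_mul_of_nonneg_left (hmono 3 s (x 2 + σ * τ)) hC0))).trans (le_of_eq (by ring))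
  have h := hlog.add hint
  rw [add_zero] at h
  refine h.congr fun τ => ?_
  have h1 : axialHeight (x + (σ * τ) • EuclideanSpace.single 2 1) = x 2 + σ * τ := by
    rw [axialHeight_three]; simp
  have h2 : axialRadius (x + (σ * τ) • EuclideanSpace.single 2 1) = axialRadius x :=
    axialRadius_add_smul_last x (σ * τ)
  rw [S.ξ_eq, h1, h2]

end IsSolution

end regularity

/-! ### Conclusions for a solution -/

section conclusion

variable {f : E 3 → ℝ} {p : ℕ} {α : ℝ}

theorem exists_abs_mpd_le (h0 : Decays p f) (h1 : ∀ i, Decays (p + 1 : ℕ) (pd i f))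
    (h2 : ∀ i j, Decays (p + 2 : ℕ) (pd i (pd j f))) :
    ∃ C : ℝ, ∀ σ : Fin 3 → ℕ, ∑ i, σ i ≤ 2 → ∀ x : E 3,
      |mpd σ f x| ≤ C / (1 + ‖x‖) ^ (p + ∑ i, σ i) := by
  obtain ⟨C₀, hC₀, h0⟩ := h0.exists_natCast
  choose C₁ hC₁ h1 using fun i => (h1 i).exists_natCast
  choose C₂ hC₂ h2 using fun i j => (h2 i j).exists_natCast
  have n1 : 0 ≤ ∑ i, C₁ i := Finset.sum_nonneg fun i _ => hC₁ i
  have n2 : 0 ≤ ∑ i, ∑ j, C₂ i j := Finset.sum_nonneg fun i _ => Finset.sum_nonneg fun j _ => hC₂ i j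
  refine ⟨C₀ + ∑ i, C₁ i + ∑ i, ∑ j, C₂ i j, abs_mpd_le_of_pds (fun x => ?_) (fun x i => ?_)
    fun x i j => ?_⟩
  all_goals
    have hx := weight_pos x
    rw [div_eq_mul_inv]
  · exact (h0 x).trans (mul_le_mul_of_nonneg_right (by linarith) (by positivity))
  · have := Finset.single_le_sum (f := C₁) (fun i _ => hC₁ i) (Finset.mem_univ i)
    exact (h1 i x).trans (mul_le_mul_of_nonneg_right (by linarith) (by positivity))
  · have e1 := Finset.single_le_sum (f := C₂ i) (fun j _ => hC₂ i j) (Finset.mem_univ j)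
    have e2 := Finset.single_le_sum (f := fun i => ∑ j, C₂ i j)
      (fun i _ => Finset.sum_nonneg fun j _ => hC₂ i j) (Finset.mem_univ i)
    exact (h2 i j x).trans (mul_le_mul_of_nonneg_right (by linarith) (by positivity))

theorem Decays.tendsto_zero (h : Decays p f) (hp : p ≠ 0) :
    Tendsto f (cocompact (E 3)) (𝓝 0) := by
  obtain ⟨C, -, hC⟩ := h.exists_natCast
  refine squeeze_zero_norm hC ?_
  have h1 : Tendsto (fun x : E 3 => (1 + ‖x‖) ^ p) (cocompact (E 3)) atTop :=
    (tendsto_pow_atTop hp).comp (tendsto_atTop_add_const_left _ 1 (tendsto_norm_cocompact_atTop))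
  simpa using h1.inv_tendsto_atTop.const_mul C

theorem memHolder_two_of_reg (hα : 0 < α) (hf : ContDiff ℝ (2 : ℕ) f) (h0 : Decays 0 f)
    (h1 : ∀ i, Reg α 0 0 (pd i f)) : MemHolder 2 α univ f := by
  obtain ⟨C₀, hC₀, h0⟩ := h0.exists_natCast (n := 0)
  choose C₁ hC₁ k1 using fun i => (h1 i).size.exists_natCast (n := 0)
  choose C₂ hC₂ k2 using fun i j => (((h1 j).toGradDecays.grad i).mono (q := 0)
    (by norm_num)).exists_natCast (n := 0)
  choose C₃ hC₃ k3 using fun i j => ((h1 j).hol i).exists_nonneg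
  simp only [pow_zero, inv_one, mul_one] at h0 k1 k2
  simp only [neg_zero, zpow_zero, mul_one] at k3
  have s1 : ∀ i, C₁ i ≤ ∑ i, C₁ i := fun i =>
    Finset.single_le_sum (f := C₁) (fun i _ => hC₁ i) (Finset.mem_univ i)
  have s2 : ∀ {D : Fin 3 → Fin 3 → ℝ}, (∀ i j, 0 ≤ D i j) → ∀ i j, D i j ≤ ∑ i, ∑ j, D i j :=
    fun {D} hD i j => (Finset.single_le_sum (f := D i) (fun j _ => hD i j) (Finset.mem_univ j)).trans
      (Finset.single_le_sum (f := fun i => ∑ j, D i j)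
        (fun i _ => Finset.sum_nonneg fun j _ => hD i j) (Finset.mem_univ i))
  have n1 : 0 ≤ ∑ i, C₁ i := Finset.sum_nonneg fun i _ => hC₁ i
  have n2 : 0 ≤ ∑ i, ∑ j, C₂ i j := (hC₂ 0 0).trans (s2 hC₂ 0 0)
  have n3 : 0 ≤ ∑ i, ∑ j, C₃ i j := (hC₃ 0 0).trans (s2 hC₃ 0 0)
  refine memHolder_two (C := C₀ + ∑ i, C₁ i + 2 * ∑ i, ∑ j, C₂ i j + ∑ i, ∑ j, C₃ i j) hf
    (fun x => ?_) (fun x i => ?_) (fun x i j => ?_) fun x y i j => ?_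
  · linarith [h0 x]
  · linarith [k1 i x, s1 i]
  · linarith [k2 i j x, s2 hC₂ i j]
  · rcases le_or_gt ‖x - y‖ 1 with h | h
    · refine (k3 i j x y h).trans (mul_le_mul_of_nonneg_right ?_
        (Real.rpow_nonneg (norm_nonneg _) _))
      linarith [s2 hC₃ i j]
    · refine (abs_sub _ _).trans (le_trans ?_ (le_mul_of_one_le_right ?_
        (Real.one_le_rpow h.le hα.le)))
      · linarith [k2 i j x, k2 i j y, s2 hC₂ i j]
      · linarith

variable {φ : ℝ → ℝ} {ψ : ℝ × ℝ → ℝ} {E₀ L₀ γ lam R : ℝ} {u : Fields}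

namespace IsSolution

theorem memHolder_ξ (S : IsSolution α φ ψ E₀ L₀ γ lam R u) : MemHolder 2 α univ u.ξ :=
  memHolder_two_of_reg S.α_pos S.contDiff_ξ (S.decays_ξ.mono (by norm_num)) fun i =>
    (S.reg_pd_ξ i).mono (by norm_num) (by norm_num)

theorem exists_decay (S : IsSolution α φ ψ E₀ L₀ γ lam R u) :
    ∃ νinf : ℝ, Decays 1 (fun x => u.ν x - νinf) ∧
      ∃ C : ℝ, ∀ σ : Fin 3 → ℕ, ∑ i, σ i ≤ 2 → ∀ x : E 3,
        |mpd σ (fun y => u.ν y - νinf) x| ≤ C / (1 + ‖x‖) ^ (1 + ∑ i, σ i) ∧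
        |mpd σ u.b x| ≤ C / (1 + ‖x‖) ^ (2 + ∑ i, σ i) ∧
        |mpd σ u.ξ x| ≤ C / (1 + ‖x‖) ^ (2 + ∑ i, σ i) ∧
        |mpd σ u.ω x| ≤ C / (1 + ‖x‖) ^ (3 + ∑ i, σ i) := by
  obtain ⟨⟨νinf, hν0⟩, hν1⟩ := S.decays_ν_first
  have hpd : ∀ i, pd i (fun y => u.ν y - νinf) = pd i u.ν := fun i => pd_sub_const _ _ _
  obtain ⟨C₁, h1⟩ := exists_abs_mpd_le (p := 1) hν0 (fun i => by rw [hpd]; exact hν1 i)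
    fun i j => by rw [hpd]; exact S.ν_decay i j
  obtain ⟨C₂, h2⟩ := exists_abs_mpd_le (p := 2) S.b_decay.1 S.b_grad S.b_decay.2.1
  obtain ⟨C₃, h3⟩ := exists_abs_mpd_le (p := 2) S.decays_ξ (fun i => (S.reg_pd_ξ i).size)
    fun i j => (S.reg_pd_ξ j).toGradDecays.grad i
  obtain ⟨C₄, h4⟩ := exists_abs_mpd_le (p := 3) S.ω_decay.1 S.ω_grad S.ω_decay.2
  refine ⟨νinf, hν0, max (max C₁ C₂) (max C₃ C₄), fun σ hσ x => ?_⟩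
  have hx := weight_pos x
  have hle : ∀ {C D : ℝ} (n : ℕ), C ≤ D → C / (1 + ‖x‖) ^ n ≤ D / (1 + ‖x‖) ^ n := fun n h =>
    div_le_div_of_nonneg_right h (by positivity)
  exact ⟨(h1 σ hσ x).trans (hle _ (by simp)), (h2 σ hσ x).trans (hle _ (by simp)),
    (h3 σ hσ x).trans (hle _ (by simp)), (h4 σ hσ x).trans (hle _ (by simp))⟩

end IsSolution

theorem axialRadius_smul {c : ℝ} (hc : 0 < c) (x : E 3) :
    axialRadius (c • x) = c * axialRadius x := by
  refine (sq_eq_sq₀ (axialRadius_nonneg _) (mul_nonneg hc.le (axialRadius_nonneg _))).1 ?_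
  rw [mul_pow, axialRadius_sq_three, axialRadius_sq_three]
  simp only [PiLp.smul_apply, smul_eq_mul]
  ring

theorem tendsto_smul_cocompact {c : ℝ} (hc : c ≠ 0) :
    Tendsto (fun x : E 3 => c • x) (cocompact (E 3)) (cocompact (E 3)) :=
  (Homeomorph.smulOfNeZero c hc).isClosedEmbedding.tendsto_cocompact

/-- The metric in rescaled coordinates. -/
theorem metric_rescale (γ ν₀ : ℝ) (ν B μ ω : E 3 → ℝ) (x : E 3) :
    metric γ ν B μ ω x =
      Matrix.diagonal ![Real.exp (γ * ν₀), Real.exp (-(γ * ν₀)), Real.exp (-(γ * ν₀)), 1] *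
        metric γ (fun x => ν ((Real.exp (-(γ * ν₀)))⁻¹ • x) - ν₀)
          (fun x => B ((Real.exp (-(γ * ν₀)))⁻¹ • x))
          (fun x => μ ((Real.exp (-(γ * ν₀)))⁻¹ • x) + γ * ν₀)
          (fun x => ω ((Real.exp (-(γ * ν₀)))⁻¹ • x) * Real.exp (-(γ * ν₀)))
          (Real.exp (-(γ * ν₀)) • x) *
        Matrix.diagonal ![Real.exp (γ * ν₀), Real.exp (-(γ * ν₀)), Real.exp (-(γ * ν₀)), 1] := by
  set a := Real.exp (γ * ν₀) with ha
  have ha0 : 0 < a := Real.exp_pos _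
  have hc : Real.exp (-(γ * ν₀)) = a⁻¹ := Real.exp_neg _
  have h1 : Real.exp (-2 * γ * (ν x - ν₀)) = Real.exp (-2 * γ * ν x) * a ^ 2 := by
    rw [ha, ← Real.exp_nat_mul, ← Real.exp_add]; congr 1; push_cast; ring
  have h2 : Real.exp (2 * γ * (ν x - ν₀)) = Real.exp (2 * γ * ν x) * (a ^ 2)⁻¹ := by
    rw [ha, ← Real.exp_nat_mul, ← Real.exp_neg, ← Real.exp_add]; congr 1; push_cast; ring
  have h3 : Real.exp (2 * (μ x + γ * ν₀)) = Real.exp (2 * μ x) * a ^ 2 := by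
    rw [ha, ← Real.exp_nat_mul, ← Real.exp_add]; congr 1; push_cast; ring
  simp only [metric, hc, inv_inv, smul_smul, mul_inv_cancel₀ ha0.ne', one_smul,
    axialRadius_smul (inv_pos.2 ha0), h1, h2, h3]
  ext i j
  rw [Matrix.mul_diagonal, Matrix.diagonal_mul]
  fin_cases i <;> fin_cases j <;> simp <;> field_simp

end conclusion

/-! ### From the smallness of the norm to the hypotheses on solutions -/

section entry

variable {α β R C γ lam δ₀ E₀ E₁ L₀ : ℝ} {u : Fields} {φ : ℝ → ℝ} {ψ : ℝ × ℝ → ℝ} {UN : E 3 → ℝ}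

theorem norms_le_normX (α β R : ℝ) (u : Fields) :
    holderNorm 2 α univ u.ν ≤ normX α β R u ∧
    supNorm univ (fun x => (1 + ‖x‖) ^ (1 + β) * ‖fderiv ℝ u.ν x‖) ≤ normX α β R u ∧
    holderNorm 3 α univ u.b ≤ normX α β R u ∧
    supNorm univ (fun x => (1 + ‖x‖) ^ 3 * ‖fderiv ℝ u.b x‖) ≤ normX α β R u ∧
    holderNorm 2 α univ u.ω ≤ normX α β R u ∧
    supNorm univ (fun x => (1 + ‖x‖) ^ 4 * ‖fderiv ℝ u.ω x‖) ≤ normX α β R u := by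
  have h1 : normX1 α β u.ν ≤ normX α β R u := le_self_add.trans (le_self_add.trans le_self_add)
  have h2 : normX2 α u.b ≤ normX α β R u := le_add_self.trans (le_self_add.trans le_self_add)
  have h4 : normX4 α u.ω ≤ normX α β R u := le_add_self
  exact ⟨le_self_add.trans h1, le_add_self.trans h1, le_self_add.trans h2, le_add_self.trans h2,
    le_self_add.trans h4, le_add_self.trans h4⟩

theorem decays_pd_of_weight_mul_le {n : ℕ} {f : E 3 → ℝ}
    (h : ∀ x, (1 + ‖x‖) ^ n * ‖fderiv ℝ f x‖ ≤ C) (i : Fin 3) : Decays n (pd i f) :=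
  decays_natCast (C := C) fun x => by
    have hx := pow_pos (weight_pos x) n
    rw [← div_eq_mul_inv, le_div_iff₀ hx]
    exact (mul_le_mul_of_nonneg_right (abs_pd_le f x i) hx.le).trans (by linarith [h x])

theorem weight_mul_le_of_supNorm_le (hC : 0 ≤ C) {w : E 3 → ℝ} {f : E 3 → ℝ}
    (h : supNorm univ (fun x => w x * ‖fderiv ℝ f x‖) ≤ ENNReal.ofReal C) (x : E 3) :
    w x * ‖fderiv ℝ f x‖ ≤ C :=
  (le_abs_self _).trans (abs_le_of_supNorm_le hC h x)

/-- The number `L₀` bounds the angular momenta on the support of `ψ`. -/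
theorem exists_ansatz (hφ : CondPhi1 φ E₀) (hψ : CondPsi φ UN ψ) :
    ∃ L₀, 0 ≤ L₀ ∧ Ansatz φ ψ E₀ L₀ := by
  obtain ⟨L, hL⟩ := hψ.compact.isBounded.subset_closedBall (0 : ℝ × ℝ)
  refine ⟨max L 0, le_max_right _ _, hφ.contDiff, hψ.contDiff.of_le (by exact_mod_cast le_top),
    hφ.eq_zero, fun lam x hx => ?_⟩
  by_contra h
  have h1 := hL (subset_tsupport ψ h)
  rw [mem_closedBall_zero_iff] at h1
  have h2 : |x| ≤ ‖((lam, x) : ℝ × ℝ)‖ := norm_snd_le (lam, x)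
  linarith [le_max_left L 0]

/-- The matter terms involve `ξ`, but outside `Z_R` they vanish whatever the value of `ξ` is; so they
do not change if `ξ` is replaced by its extension. -/
theorem matter_congr (hA : Ansatz φ ψ E₀ L₀) (hγ : 0 ≤ γ) (hR : 0 < R) {ξ : E 3 → ℝ}
    (hξ : ∀ x ∈ cylinder R, u.ξ x = ξ x) (hb : ∀ x, 0 < 1 + u.b x)
    (hν : ∀ x, R ≤ ‖x‖ → E₀ + L₀ * |u.ω x| ≤ u.ν x) :
    M1 φ ψ γ lam u = M1 φ ψ γ lam { u with ξ := ξ } ∧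
    M2 φ ψ γ lam u = M2 φ ψ γ lam { u with ξ := ξ } ∧
    M3 φ ψ γ lam u = M3 φ ψ γ lam { u with ξ := ξ } := by
  have key : ∀ x, M1 φ ψ γ lam u x = M1 φ ψ γ lam { u with ξ := ξ } x ∧
      M2 φ ψ γ lam u x = M2 φ ψ γ lam { u with ξ := ξ } x ∧
      M3 φ ψ γ lam u x = M3 φ ψ γ lam { u with ξ := ξ } x := by
    intro x
    rcases lt_or_ge (axialRadius x) R with h | h
    · simp only [M1, M2, M3, hξ x h, and_self]
    · have hx := hν x (h.trans (axialRadius_le_norm x))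
      obtain ⟨a1, a2, a3⟩ := matter_eq_zero (lam := lam) hA hγ (hR.trans_le h) (hb x) hx
      obtain ⟨b1, b2, b3⟩ := matter_eq_zero (lam := lam) (u := { u with ξ := ξ }) hA hγ
        (hR.trans_le h) (hb x) hx
      rw [a1, a2, a3, b1, b2, b3]
      exact ⟨rfl, rfl, rfl⟩
  exact ⟨funext fun x => (key x).1, funext fun x => (key x).2.1, funext fun x => (key x).2.2⟩

/-- The norm enters twice: it is finite, which gives the regularity and a first decay of the fields,
and its distance to the Newtonian state is small, which bounds `b` and `ρ∂_ρ b` and keeps the matter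
inside the ball of radius `R`. -/
theorem isSolution_of_memU (hα : 0 < α) (hα1 : α ≤ 1) (hβ : 0 < β) (hA : Ansatz φ ψ E₀ L₀)
    (hL₀ : 0 ≤ L₀) (hUN : ContDiff ℝ (2 : ℕ) UN) (hR : 0 < R) (hE : ∀ x, R ≤ ‖x‖ → E₁ ≤ UN x)
    (hδ0 : 0 ≤ δ₀) (hδ : δ₀ ≤ 1 / 8) (hδE : E₀ + (1 + L₀) * δ₀ ≤ E₁)
    (hu : MemU α β R UN δ₀ u γ lam) (hz : IsZeroX R (mapF φ ψ u γ lam)) :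
    IsSolution α φ ψ E₀ L₀ γ lam (max R 1) { u with ξ := G3 γ u } := by
  obtain ⟨hX, hγ, -, hsmall⟩ := hu
  obtain ⟨z1, z2, z3, z4⟩ := hz
  obtain ⟨s1, -, s3, s4, s5, -⟩ :=
    norms_le_normX α β R ⟨fun x => u.ν x - UN x, u.b, u.ξ, u.ω⟩
  have cν : ContDiff ℝ (2 : ℕ) u.ν := hX.contDiff_ν
  have cb : ContDiff ℝ (3 : ℕ) u.b := hX.contDiff_b
  have cω : ContDiff ℝ (2 : ℕ) u.ω := hX.contDiff_ω
  have small_ν : ∀ x, |u.ν x - UN x| ≤ δ₀ :=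
    abs_pds_le_of_holderNorm_le hδ0 (cν.sub hUN) (s1.trans hsmall.le) [] (by simp)
  have small_b : ∀ x, |u.b x| ≤ δ₀ :=
    abs_pds_le_of_holderNorm_le hδ0 cb (s3.trans hsmall.le) [] (by simp)
  have small_ω : ∀ x, |u.ω x| ≤ δ₀ :=
    abs_pds_le_of_holderNorm_le hδ0 cω (s5.trans hsmall.le) [] (by simp)
  have hB : ∀ x, 0 < 1 + u.b x := fun x => by linarith [neg_abs_le (u.b x), small_b x]
  have hout : ∀ x, R ≤ ‖x‖ → E₀ + L₀ * |u.ω x| ≤ u.ν x := fun x hx => by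
    have h1 := mul_le_mul_of_nonneg_left (small_ω x) hL₀
    linarith [hE x hx, neg_abs_le (u.ν x - UN x), small_ν x]
  obtain ⟨m1, m2, m3⟩ := matter_congr (lam := lam) (ξ := G3 γ u) hA hγ.1 hR
    (fun x hx => sub_eq_zero.1 (z3 x hx)) hB hout
  set C := (normX α β R u).toReal with hCdef
  have hC : 0 ≤ C := ENNReal.toReal_nonneg
  have hCeq : normX α β R u = ENNReal.ofReal C := (ENNReal.ofReal_toReal hX.norm_lt_top.ne).symm
  obtain ⟨n1, n2, n3, n4, n5, n6⟩ := norms_le_normX α β R u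
  rw [hCeq] at n1 n2 n3 n4 n5 n6
  refine { α_pos := hα, α_le := hα1, ansatz := hA, γ_nonneg := hγ.1, one_le_R := le_max_right _ _,
           contDiff_ν := cν, contDiff_b := cb, contDiff_ω := cω, axial_ν := hX.axial_ν,
           axial_b := hX.axial_b, axial_ω := hX.axial_ω,
           eq_ν := fun x => (sub_eq_zero.1 (z1 x)).trans ?_
           eq_b := fun x => (sub_eq_zero.1 (z2 x)).trans ?_
           eq_ξ := fun x => rfl
           eq_ω := fun x => (sub_eq_zero.1 (z4 x)).trans ?_
           b_small := fun x => (small_b x).trans hδ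
           grad_b_small := fun x => ?_
           no_matter := fun x hx => hout x ((le_max_left _ _).trans hx)
           ν_size := decays_of_abs_le (abs_pds_le_of_holderNorm_le hC cν n1 [] (by simp))
           ν_grad := ?_
           ν_second := fun i j =>
             decays_of_abs_le (abs_pds_le_of_holderNorm_le hC cν n1 [i, j] (by simp))
           ν_hol := fun i j =>
             hol_of_global (abs_pds_sub_le_of_holderNorm_le hC hα cν n1 [i, j] rfl)
           b_grad := decays_pd_of_weight_mul_le (n := 3) (weight_mul_le_of_supNorm_le hC n4)
           b_second := fun i j =>
             decays_of_abs_le (abs_pds_le_of_holderNorm_le hC cb n3 [i, j] (by simp))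
           b_hol := fun i j k =>
             hol_of_global (abs_pds_sub_le_of_holderNorm_le hC hα cb n3 [i, j, k] rfl)
           ω_size := decays_of_abs_le (abs_pds_le_of_holderNorm_le hC cω n5 [] (by simp))
           ω_grad := decays_pd_of_weight_mul_le (n := 4) (weight_mul_le_of_supNorm_le hC n6)
           ω_second := fun i j =>
             decays_of_abs_le (abs_pds_le_of_holderNorm_le hC cω n5 [i, j] (by simp))
           ω_hol := fun i j =>
             hol_of_global (abs_pds_sub_le_of_holderNorm_le hC hα cω n5 [i, j] rfl) }
  · simp only [G1, m1]
  · simp only [G2, m2]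
  · simp only [G4, m3]
  · refine le_trans ?_ ((weight_mul_le_of_supNorm_le hδ0 (s4.trans hsmall.le) x).trans hδ)
    exact mul_le_mul_of_nonneg_right (le_self_pow₀ (one_le_weight x) (by norm_num))
      (norm_nonneg _)
  · refine decays_pd_of_weight_mul_le (n := 1) (C := C) fun x => ?_
    refine le_trans ?_ (weight_mul_le_of_supNorm_le hC n2 x)
    rw [← Real.rpow_natCast]
    exact mul_le_mul_of_nonneg_right
      (Real.rpow_le_rpow_of_exponent_le (one_le_weight x) (by push_cast; linarith))
      (norm_nonneg _)

theorem vanishAtInfinity_rescale {c ν₀ e₀ d : ℝ} (hc : c ≠ 0) {ν B μ ω : E 3 → ℝ}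
    (hν : Tendsto ν (cocompact (E 3)) (𝓝 ν₀)) (hB : Tendsto B (cocompact (E 3)) (𝓝 1))
    (hμ : Tendsto μ (cocompact (E 3)) (𝓝 (-e₀))) (hω : Tendsto ω (cocompact (E 3)) (𝓝 0)) :
    VanishAtInfinity (fun x => ν (c • x) - ν₀) (fun x => B (c • x))
      (fun x => μ (c • x) + e₀) (fun x => ω (c • x) * d) := by
  have hs := tendsto_smul_cocompact hc
  have h1 := ((hν.comp hs).sub_const ν₀).abs
  have h2 := ((hμ.comp hs).add_const e₀).abs
  have h3 := ((hω.comp hs).mul_const d).abs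
  have h4 := ((hB.comp hs).sub_const 1).abs
  simpa [VanishAtInfinity, Function.comp_def] using ((h1.add h2).add h3).add h4

end entry

end RotatingEV

end


open RotatingEV in
theorem proposition3p2
    (α β : ℝ) (hα : α ∈ Set.Ioo (0 : ℝ) (1 / 2)) (hβ : β ∈ Set.Ioo (0 : ℝ) 1)
    (φ : ℝ → ℝ) (ψ : ℝ × ℝ → ℝ) (E₀ RN : ℝ) (UN : E 3 → ℝ)
    (hφ1 : CondPhi1 φ E₀) (hφ2 : CondPhi2 φ E₀ UN RN) (hφ3 : CondPhi3 φ UN)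
    (hψ : CondPsi φ UN ψ)
    (Uinf : ℝ) (hUinf : Tendsto UN (cocompact (E 3)) (𝓝 Uinf))
    (R : ℝ) (hRN : RN < R) (hR : ∀ x : E 3, R < ‖x‖ → (E₀ + Uinf) / 2 < UN x) :
    ∃ δ₀ > 0, ∀ (u : Fields) (γ lam : ℝ),
      MemU α β R UN δ₀ u γ lam → IsZeroX R (mapF φ ψ u γ lam) →
      -- the extension of the third component to the whole space, and the function `μ`
      let ξ : E 3 → ℝ := G3 γ u
      let μ : E 3 → ℝ := fun x => ξ x - γ * u.ν x
      let B : E 3 → ℝ := fun x => 1 + u.b x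
      MemHolder 2 α Set.univ ξ ∧
      ∃ νinf : ℝ, Tendsto u.ν (cocompact (E 3)) (𝓝 νinf) ∧
        (∃ C : ℝ, ∀ σ : Fin 3 → ℕ, ∑ i, σ i ≤ 2 → ∀ x : E 3,
          |mpd σ (fun y => u.ν y - νinf) x| ≤ C / (1 + ‖x‖) ^ (1 + ∑ i, σ i) ∧
          |mpd σ (fun y => B y - 1) x| ≤ C / (1 + ‖x‖) ^ (2 + ∑ i, σ i) ∧
          |mpd σ ξ x| ≤ C / (1 + ‖x‖) ^ (2 + ∑ i, σ i) ∧
          |mpd σ u.ω x| ≤ C / (1 + ‖x‖) ^ (3 + ∑ i, σ i)) ∧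
        Tendsto μ (cocompact (E 3)) (𝓝 (-(γ * νinf))) ∧
        -- After the change of units `(t, ρ, z, ϕ) ↦ (c₁ t, c₂ ρ, c₂ z, ϕ)` the metric has the
        -- same form, with metric functions that satisfy the boundary condition at infinity.
        (let c₁ : ℝ := Real.exp (γ * νinf)
         let c₂ : ℝ := Real.exp (-(γ * νinf))
         let ν' : E 3 → ℝ := fun x => u.ν (c₂⁻¹ • x) - νinf
         let B' : E 3 → ℝ := fun x => B (c₂⁻¹ • x)
         let μ' : E 3 → ℝ := fun x => μ (c₂⁻¹ • x) + γ * νinf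
         let ω' : E 3 → ℝ := fun x => u.ω (c₂⁻¹ • x) * Real.exp (-(γ * νinf))
         VanishAtInfinity ν' B' μ' ω' ∧
         (0 < γ → ∀ x : E 3,
           metric γ u.ν B μ u.ω x =
             Matrix.diagonal ![c₁, c₂, c₂, 1] * metric γ ν' B' μ' ω' (c₂ • x) *
               Matrix.diagonal ![c₁, c₂, c₂, 1])) := by
  obtain ⟨L₀, hL₀, hA⟩ := exists_ansatz hφ1 hψ
  have hlt := hφ2.lt_limit hφ1 hUinf
  have hR0 : 0 < R := (hφ2.pos_radius hφ1).trans hRN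
  have hE : ∀ x : E 3, R ≤ ‖x‖ → (E₀ + Uinf) / 2 ≤ UN x := fun x hx =>
    le_of_norm_ge hR0 hφ2.contDiff.continuous hR hx
  have hgap : 0 < ((E₀ + Uinf) / 2 - E₀) / (1 + L₀) := div_pos (by linarith) (by linarith)
  -- The bound `1 / 8` keeps `B` and `∂_ρ (ρB)` away from zero. The other bound turns
  -- `(E₀ + U_N(∞)) / 2 ≤ U_N` into `E₀ + L₀ |ω| ≤ ν` outside the ball of radius `R`, where therefore
  -- no matter is present; it is positive because `E₀ < U_N(∞)`.
  refine ⟨min (1 / 8) (((E₀ + Uinf) / 2 - E₀) / (1 + L₀)), lt_min (by norm_num) hgap,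
    fun u γ lam hu hz => ?_⟩
  have hδE : E₀ + (1 + L₀) * min (1 / 8) (((E₀ + Uinf) / 2 - E₀) / (1 + L₀)) ≤
      (E₀ + Uinf) / 2 := by
    have h := mul_le_mul_of_nonneg_left
      (min_le_right (1 / 8) (((E₀ + Uinf) / 2 - E₀) / (1 + L₀))) (by linarith : 0 ≤ 1 + L₀)
    rw [mul_div_cancel₀ _ (by linarith : 1 + L₀ ≠ 0)] at h
    linarith
  have S := isSolution_of_memU hα.1 (by linarith [hα.2]) hβ.1 hA hL₀ hφ2.contDiff hR0 hE
    (lt_min (by norm_num) hgap).le (min_le_left _ _) hδE hu hz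
  obtain ⟨νinf, hν, hdecay⟩ := S.exists_decay
  have tν : Tendsto u.ν (cocompact (E 3)) (𝓝 νinf) := by
    simpa using (hν.tendsto_zero (p := 1) one_ne_zero).add_const νinf
  have tξ : Tendsto (G3 γ u) (cocompact (E 3)) (𝓝 0) :=
    S.decays_ξ.tendsto_zero (p := 2) two_ne_zero
  have tB : Tendsto (fun x => 1 + u.b x) (cocompact (E 3)) (𝓝 1) := by
    simpa using (S.b_decay.1.tendsto_zero (p := 2) two_ne_zero).const_add 1
  have tω : Tendsto u.ω (cocompact (E 3)) (𝓝 0) :=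
    S.ω_decay.1.tendsto_zero (p := 3) three_ne_zero
  have tμ : Tendsto (fun x => G3 γ u x - γ * u.ν x) (cocompact (E 3)) (𝓝 (-(γ * νinf))) := by
    simpa using tξ.sub (tν.const_mul γ)
  have hV := vanishAtInfinity_rescale (c := (Real.exp (-(γ * νinf)))⁻¹) (e₀ := γ * νinf)
    (d := Real.exp (-(γ * νinf))) (inv_ne_zero (Real.exp_pos _).ne') tν tB tμ tω
  refine ⟨S.memHolder_ξ, νinf, tν, ?_, tμ, hV,
    fun _ x => metric_rescale _ _ _ _ _ _ _⟩
  simpa only [add_sub_cancel_left] using hdecay
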